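/- **Setting.** Let $G$ be a connected semisimple Lie group with Lie algebra $\mathfrak g$, and let $K\subseteq G$ be a maximal compact subgroup with Lie algebra $\mathfrak k$, of the same rank as $G$. Let $\langle\cdot,\cdot\rangle$ be an $\mathrm{Ad}(G)$-invariant symmetric bilinear form on $\mathfrak g$ such that, with $\mathfrak p=\mathfrak k^{\perp}$, $\mathfrak g=\mathfrak k\oplus\mathfrak p$ is a Cartan decomposition and $\langle\cdot,\cdot\rangle$ is positive definite on $\mathfrak k$ and negative definite on $\mathfrak p$ (for instance the Killing form normalized so that it is positive definite on $\mathfrak k$). Manifolds are smooth, Hausdorff, second countable and of pure dimension. Let $\theta^L,\theta^R$ be the left- and right-invariant Maurer–Cartan forms and $\eta_G=\frac1{12}\langle\theta^L,[\theta^L,\theta^L]\rangle$. A *q-Hamiltonian $G$-manifold* is a triple $(M,\omega_M,\mu_M)$ of a manifold $M$ with a smooth $G$-action, a smooth $G$-invariant $2$-form $\omega_M$ and a smooth map $\mu_M:M\to G$ that is equivariant for conjugation on $G$, such that 1. $d\omega_M=-\mu_M^*\eta_G$; 2. $\iota_{X_\xi}\omega_M=\frac12\mu_M^*\langle\theta^L+\theta^R,\xi\rangle$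 for all $\xi\in\mathfrak g$, where $X_\xi(x)=\frac{d}{dt}\big|_{t=0}\exp(t\xi)\cdot x$; 3. $\ker(\omega_M)_x=\{X_\xi(x)\mid \mathrm{Ad}_{\mu_M(x)}\xi=-\xi\}$ for all $x\in M$. q-Hamiltonian $K$-manifolds are defined likewise, with $\langle\cdot,\cdot\rangle$ restricted to $\mathfrak k$. An element of $G$ is *strongly stable* if its centralizer in $G$ is compact; $\mathcal D\subseteq G$ is the set of these elements. For a $K$-manifold $N$ with a $2$-form $\omega_N$ and an equivariant map $\mu_N:N\to K$, the *induction* is $\mathrm{Ind}(N)=G\times_K N=(G\times N)/\big((g,n)\sim(gk^{-1},k\cdot n)\big)$, with the smooth structure for which $G\times N\to\mathrm{Ind}(N)$ is a submersion, the action $h\cdot[g,n]=[hg,n]$, the map $[g,n]\mapsto g\,\mu_N(n)\,g^{-1}$, and the $G$-invariant $2$-form $\omega$ that is given at $[e,n]$, where the tangent space is $T_nN\oplus\mathfrak p$ through the differential of $n'\mapsto[e,n']$ and through $\xi\mapsto X_\xi$, by $$\omega(v+\xi,w+\zeta)=\omega_N(v,w)+\tfrac12\big(\langle\mathrm{Ad}_{\mu_N(n)}\xi,\zeta\rangle-\langle\xi,\mathrm{Ad}_{\mu_N(n)}\zeta\rangle\big).$$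 **Proposition B.6 (q-Hamiltonian cross-section).** (a) Let $(M,\omega_M,\mu_M)$ be a q-Hamiltonian $G$-manifold with proper $G$-action and $\mu_M(M)\subseteq\mathcal D$, such that $eK$ is a regular value of the composite $M\xrightarrow{\mu_M}G\to G/K$. Then $N=\mu_M^{-1}(K)$ is an embedded submanifold of $M$, and with its inclusion $i:N\to M$, $(N,i^*\omega_M,\mu_M\circ i)$ is a q-Hamiltonian $K$-manifold. Moreover $[g,n]\mapsto g\cdot n$ is a $G$-equivariant diffeomorphism $\mathrm{Ind}(N)\to M$ that identifies the induced $2$-form and the induced map with $\omega_M$ and $\mu_M$. (b) Conversely, let $(N,\omega_N,\mu_N)$ be a q-Hamiltonian $K$-manifold with $\mu_N(N)\subseteq\mathcal D\cap K$. Then $\mathrm{Ind}(N)$, with the induced form and map, is a q-Hamiltonian $G$-manifold that satisfies all the hypotheses of (a), and $n\mapsto[e,n]$ is a $K$-equivariant diffeomorphism of $N$ onto the cross-section of $\mathrm{Ind}(N)$ that identifies $\omega_N$ and $\mu_N$ with the restricted form and map. Thus induction and cross-section are mutually inverse. -/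

import Mathlib

open scoped Manifold ContDiff

/-- A smooth Lie group is regular enough for its tangent space at `1` to be a Lie algebra. -/
instance instLieGroupMinSmoothness {n : ℕ} {G : Type*} [TopologicalSpace G]
    [ChartedSpace (EuclideanSpace ℝ (Fin n)) G] [Group G] [LieGroup (𝓡 n) ∞ G] :
    LieGroup (𝓡 n) (minSmoothness ℝ 3) G := by
  rw [minSmoothness_of_isRCLikeNormedField]
  exact LieGroup.of_le (n := ∞) (WithTop.coe_le_coe.mpr (le_top : (3 : ℕ∞) ≤ ⊤))

/-- The Lie algebra of a Lie group modelled on Euclidean space is finite-dimensional. -/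
instance instFiniteGroupLieAlgebra {n : ℕ} {G : Type*} [TopologicalSpace G]
    [ChartedSpace (EuclideanSpace ℝ (Fin n)) G] [Group G] :
    Module.Finite ℝ (GroupLieAlgebra (𝓡 n) G) :=
  inferInstanceAs (Module.Finite ℝ (EuclideanSpace ℝ (Fin n)))

noncomputable section

namespace QHam

/-! ### Differential forms on manifolds -/

section Forms

variable {m : ℕ} {M : Type*} [TopologicalSpace M] [ChartedSpace (EuclideanSpace ℝ (Fin m)) M]
  {m' : ℕ} {M' : Type*} [TopologicalSpace M'] [ChartedSpace (EuclideanSpace ℝ (Fin m')) M']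
  {r : ℕ}

/-- Differential `r`-forms (no regularity yet) on an `m`-dimensional manifold `M`. -/
abbrev DiffForm (m : ℕ) (M : Type*) [TopologicalSpace M]
    [ChartedSpace (EuclideanSpace ℝ (Fin m)) M] (r : ℕ) : Type _ :=
  (x : M) → TangentSpace (𝓡 m) x [⋀^Fin r]→L[ℝ] ℝ

variable (m m') in
/-- The pullback `f^* α` of a form along a map `f`. -/
def pullback (f : M → M') (α : DiffForm m' M' r) : DiffForm m M r := fun x =>
  (α (f x)).compContinuousLinearMap (mfderiv (𝓡 m) (𝓡 m') f x)

/-- The form `α` written in the preferred chart at `x₀`, i.e. pulled back to Euclidean space along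
the inverse of that chart (meaningful on the target of the chart). -/
def chartForm (α : DiffForm m M r) (x₀ : M) :
    EuclideanSpace ℝ (Fin m) → EuclideanSpace ℝ (Fin m) [⋀^Fin r]→L[ℝ] ℝ := fun y =>
  (α ((extChartAt (𝓡 m) x₀).symm y)).compContinuousLinearMap
    (mfderiv (𝓡 m) (𝓡 m) (extChartAt (𝓡 m) x₀).symm y)

/-- A form is smooth if it is smooth in charts. -/
def IsSmoothForm (α : DiffForm m M r) : Prop :=
  ∀ x₀ : M, ContDiffOn ℝ ∞ (chartForm α x₀) (extChartAt (𝓡 m) x₀).target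

/-- The exterior derivative of a form, computed at `x` in the chart at `x`. -/
def extDerivForm (α : DiffForm m M r) : DiffForm m M (r + 1) := fun x =>
  (extDeriv (chartForm α x) (extChartAt (𝓡 m) x x)).compContinuousLinearMap
    (mfderiv (𝓡 m) (𝓡 m) (extChartAt (𝓡 m) x) x)

variable (m m') in
/-- `q` is a regular value of `f`: the differential of `f` is onto at every point over `q`. -/
def IsRegularValue (f : M → M') (q : M') : Prop :=
  ∀ x, f x = q → Function.Surjective (mfderiv (𝓡 m) (𝓡 m') f x)

end Forms

/-! ### Lie groups and their actions -/

section Group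

variable {n : ℕ} {G : Type*} [TopologicalSpace G] [ChartedSpace (EuclideanSpace ℝ (Fin n)) G]
  [Group G]

variable (n) in
/-- The adjoint action `Ad g` on the Lie algebra: the differential at `1` of conjugation by `g`. -/
def Ad (g : G) : GroupLieAlgebra (𝓡 n) G →L[ℝ] GroupLieAlgebra (𝓡 n) G :=
  mfderiv (𝓡 n) (𝓡 n) (fun x : G => g * x * g⁻¹) 1

/-- The left-invariant Maurer-Cartan form `θ^L = g⁻¹ dg`. -/
def thetaL (g : G) : TangentSpace (𝓡 n) g →L[ℝ] GroupLieAlgebra (𝓡 n) G :=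
  mfderiv (𝓡 n) (𝓡 n) (fun x : G => g⁻¹ * x) g

/-- The right-invariant Maurer-Cartan form `θ^R = dg g⁻¹`. -/
def thetaR (g : G) : TangentSpace (𝓡 n) g →L[ℝ] GroupLieAlgebra (𝓡 n) G :=
  mfderiv (𝓡 n) (𝓡 n) (fun x : G => x * g⁻¹) g

/-- The vector field `X_ξ` generated by `ξ` through an action: `X_ξ(x) = d/dt (exp(tξ) • x)` at
`t = 0`, i.e. the differential at `1` of the orbit map `g ↦ g • x` applied to `ξ`. -/
def generator {m : ℕ} {M : Type*} [TopologicalSpace M] [ChartedSpace (EuclideanSpace ℝ (Fin m)) M]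
    [MulAction G M] (ξ : GroupLieAlgebra (𝓡 n) G) (x : M) : TangentSpace (𝓡 m) x :=
  (mfderiv (𝓡 n) (𝓡 m) (fun g : G => g • x) 1 :
    GroupLieAlgebra (𝓡 n) G →L[ℝ] TangentSpace (𝓡 m) ((1 : G) • x)) ξ

variable [LieGroup (𝓡 n) ∞ G]

/-- The Cartan 3-form `η = (1/12) ⟨θ^L, [θ^L, θ^L]⟩`, where
`[θ^L, θ^L](v, w) = 2 [θ^L v, θ^L w]` and the wedge of a 1-form with a 2-form is the cyclic sum. -/
def cartanForm (B : LinearMap.BilinForm ℝ (GroupLieAlgebra (𝓡 n) G)) (g : G)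
    (u v w : TangentSpace (𝓡 n) g) : ℝ :=
  (1 / 12) * (B (thetaL g u) ((2 : ℝ) • ⁅thetaL g v, thetaL g w⁆)
    + B (thetaL g v) ((2 : ℝ) • ⁅thetaL g w, thetaL g u⁆)
    + B (thetaL g w) ((2 : ℝ) • ⁅thetaL g u, thetaL g v⁆))

/-- `(M, ωM, μ)` is a q-Hamiltonian `G`-manifold, with respect to the bilinear form `B` on the Lie
algebra of `G`. -/
structure IsQHamiltonian (B : LinearMap.BilinForm ℝ (GroupLieAlgebra (𝓡 n) G))
    (m : ℕ) {M : Type*} [TopologicalSpace M] [ChartedSpace (EuclideanSpace ℝ (Fin m)) M]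
    [MulAction G M] (ωM : DiffForm m M 2) (μ : M → G) : Prop where
  /-- the action is smooth -/
  contMDiff_smul : ContMDiff ((𝓡 n).prod (𝓡 m)) (𝓡 m) ∞ (fun p : G × M => p.1 • p.2)
  /-- `ωM` is smooth -/
  smooth_form : IsSmoothForm ωM
  /-- `μ` is smooth -/
  smooth_moment : ContMDiff (𝓡 m) (𝓡 n) ∞ μ
  /-- `ωM` is invariant -/
  invariant : ∀ g : G, pullback m m (fun x : M => g • x) ωM = ωM
  /-- `μ` is equivariant for conjugation -/
  equivariant : ∀ (g : G) (x : M), μ (g • x) = g * μ x * g⁻¹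
  /-- `dωM = - μ^* η` -/
  extDeriv_eq : ∀ (x : M) (u v w : TangentSpace (𝓡 m) x),
    extDerivForm ωM x ![u, v, w] =
      - cartanForm B (μ x) (mfderiv (𝓡 m) (𝓡 n) μ x u) (mfderiv (𝓡 m) (𝓡 n) μ x v)
          (mfderiv (𝓡 m) (𝓡 n) μ x w)
  /-- `ι(X_ξ) ωM = (1/2) μ^* ⟨θ^L + θ^R, ξ⟩` -/
  contraction_eq : ∀ (ξ : GroupLieAlgebra (𝓡 n) G) (x : M) (v : TangentSpace (𝓡 m) x),
    ωM x ![generator ξ x, v] =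
      (1 / 2) * B (thetaL (μ x) (mfderiv (𝓡 m) (𝓡 n) μ x v)
        + thetaR (μ x) (mfderiv (𝓡 m) (𝓡 n) μ x v)) ξ
  /-- `ker ωM_x = {X_ξ(x) | ξ ∈ ker (Ad_{μ(x)} + 1)}` -/
  ker_eq : ∀ (x : M) (v : TangentSpace (𝓡 m) x),
    (∀ w : TangentSpace (𝓡 m) x, ωM x ![v, w] = 0) ↔
      ∃ ξ : GroupLieAlgebra (𝓡 n) G, Ad n (μ x) ξ + ξ = 0 ∧ generator ξ x = v

end Group

/-- The set of strongly stable elements of `G`: those with compact centralizer. -/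
def stronglyStable (G : Type*) [TopologicalSpace G] [Group G] : Set G :=
  {g | IsCompact (Subgroup.centralizer {g} : Set G)}

/-! ### The subgroup `K` and the Cartan decomposition -/

section Subgroup

/-- `𝔤 = 𝔨 ⊕ 𝔭` is a Cartan decomposition of the real Lie algebra `𝔤`. -/
structure IsCartanDecomposition {𝔤 : Type*} [LieRing 𝔤] [LieAlgebra ℝ 𝔤]
    (𝔨 𝔭 : Submodule ℝ 𝔤) : Prop where
  isCompl : IsCompl 𝔨 𝔭
  lie_kk : ∀ x ∈ 𝔨, ∀ y ∈ 𝔨, ⁅x, y⁆ ∈ 𝔨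
  lie_kp : ∀ x ∈ 𝔨, ∀ y ∈ 𝔭, ⁅x, y⁆ ∈ 𝔭
  lie_pp : ∀ x ∈ 𝔭, ∀ y ∈ 𝔭, ⁅x, y⁆ ∈ 𝔨
  killing_neg : ∀ x ∈ 𝔨, x ≠ 0 → killingForm ℝ 𝔤 x x < 0
  killing_pos : ∀ x ∈ 𝔭, x ≠ 0 → 0 < killingForm ℝ 𝔤 x x

variable {n : ℕ} {G : Type*} [TopologicalSpace G] [ChartedSpace (EuclideanSpace ℝ (Fin n)) G]
  [Group G] {k : ℕ} (K : Subgroup G) [ChartedSpace (EuclideanSpace ℝ (Fin k)) K]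

variable (n k) in
/-- The inclusion of Lie algebras `Lie K → Lie G`: the differential at `1` of `K → G`. -/
def lieIncl : GroupLieAlgebra (𝓡 k) K →L[ℝ] GroupLieAlgebra (𝓡 n) G :=
  mfderiv (𝓡 k) (𝓡 n) (Subtype.val : K → G) 1

variable (n k) in
/-- The Lie algebra `𝔨` of `K`, as a subspace of the Lie algebra of `G`. -/
def lieSub : Submodule ℝ (GroupLieAlgebra (𝓡 n) G) :=
  LinearMap.range (lieIncl n k K).toLinearMap

variable (k) in
/-- The orthogonal complement `𝔭 = 𝔨^⊥` with respect to `B`. -/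
def lieOrth (B : LinearMap.BilinForm ℝ (GroupLieAlgebra (𝓡 n) G)) :
    Submodule ℝ (GroupLieAlgebra (𝓡 n) G) :=
  B.orthogonal (lieSub n k K)

variable (k) in
/-- The restriction of `B` to the Lie algebra of `K`. -/
def restrictForm (B : LinearMap.BilinForm ℝ (GroupLieAlgebra (𝓡 n) G)) :
    LinearMap.BilinForm ℝ (GroupLieAlgebra (𝓡 k) K) :=
  B.compl₁₂ (lieIncl n k K).toLinearMap (lieIncl n k K).toLinearMap

variable (k) in
/-- `B` is a normalized form for `(G, K)`: an `Ad`-invariant symmetric bilinear form on `𝔤`, such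
that `𝔤 = 𝔨 ⊕ 𝔭` with `𝔭 = 𝔨^⊥` is a Cartan decomposition, and `B` is positive definite on `𝔨` and
negative definite on `𝔭`. Every multiple of the Killing form by a negative constant (more
generally: by one negative constant on each simple ideal) is of this kind. -/
structure IsNormalizedForm [LieGroup (𝓡 n) ∞ G]
    (B : LinearMap.BilinForm ℝ (GroupLieAlgebra (𝓡 n) G)) : Prop where
  symm : ∀ x y, B x y = B y x
  ad_invariant : ∀ (g : G) (x y : GroupLieAlgebra (𝓡 n) G), B (Ad n g x) (Ad n g y) = B x y
  cartan : IsCartanDecomposition (lieSub n k K) (lieOrth k K B)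
  pos : ∀ x ∈ lieSub n k K, x ≠ 0 → 0 < B x x
  neg : ∀ x ∈ lieOrth k K B, x ≠ 0 → B x x < 0

end Subgroup

/-! ### Cross-section and induction -/

section CrossSection

variable {G : Type*} [Group G] (K : Subgroup G) {M : Type*} [MulAction G M]

/-- The cross-section `μ⁻¹(K)`, a `K`-invariant subset of `M`. -/
def crossSection (μ : M → G) (hμ : ∀ (g : G) (x : M), μ (g • x) = g * μ x * g⁻¹) :
    SubMulAction K M where
  carrier := {x | μ x ∈ K}
  smul_mem' := fun c x hx => by
    change μ ((c : G) • x) ∈ K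
    rw [hμ]
    exact K.mul_mem (K.mul_mem c.2 hx) (K.inv_mem c.2)

/-- The restricted moment map `μ⁻¹(K) → K`. -/
def crossMoment (μ : M → G) (hμ : ∀ (g : G) (x : M), μ (g • x) = g * μ x * g⁻¹) :
    crossSection K μ hμ → K := fun x => ⟨μ x.1, x.2⟩

end CrossSection

section Induction

variable {G : Type*} [Group G] (K : Subgroup G) (N : Type*) [MulAction K N]

/-- The relation `(g, n) ∼ (g k⁻¹, k • n)`, `k ∈ K`, on `G × N`. -/
def inductionSetoid : Setoid (G × N) where
  r a b := ∃ c : K, b = (a.1 * (c : G)⁻¹, c • a.2)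
  iseqv :=
    { refl := fun a => ⟨1, by simp⟩
      symm := by
        rintro a _ ⟨c, rfl⟩
        exact ⟨c⁻¹, by simp⟩
      trans := by
        rintro a _ _ ⟨c, rfl⟩ ⟨c', rfl⟩
        exact ⟨c' * c, by simp [mul_smul, mul_assoc]⟩ }

/-- The induction `G ×_K N`. -/
def Induction : Type _ := Quotient (inductionSetoid K N)

variable {N}

/-- The class `[g, n]`, i.e. the projection `G × N → G ×_K N`. -/
def Induction.mk (p : G × N) : Induction K N := Quotient.mk (inductionSetoid K N) p

variable (N) in
/-- `G ×_K N` carries the quotient topology. -/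
instance [TopologicalSpace G] [TopologicalSpace N] : TopologicalSpace (Induction K N) :=
  inferInstanceAs (TopologicalSpace (Quotient (inductionSetoid K N)))

variable (N) in
/-- The `G`-action `h • [g, n] = [h g, n]`. -/
instance : MulAction G (Induction K N) where
  smul h := Quotient.map (fun p : G × N => (h * p.1, p.2)) (by
    rintro a _ ⟨c, rfl⟩
    exact ⟨c, by simp [mul_assoc]⟩)
  one_smul := by
    rintro ⟨a⟩
    change Induction.mk K (1 * a.1, a.2) = Induction.mk K a
    simp
  mul_smul := by
    rintro g h ⟨a⟩
    change Induction.mk K (g * h * a.1, a.2) = Induction.mk K (g * (h * a.1), a.2)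
    rw [mul_assoc]

/-- The induced moment map `[g, n] ↦ g μ(n) g⁻¹`. -/
def inducedMoment (μ : N → K) (hμ : ∀ (c : K) (x : N), μ (c • x) = c * μ x * c⁻¹) :
    Induction K N → G :=
  Quotient.lift (fun p : G × N => p.1 * (μ p.2 : G) * p.1⁻¹) (by
    rintro a _ ⟨c, rfl⟩
    simp [hμ, mul_assoc])

/-- `Ω` is the 2-form on `G ×_K N` induced by `(ωN, μ)`: it is `G`-invariant, and at `[1, x]`, where
the tangent space is `T_x N ⊕ 𝔭` through the differential of `y ↦ [1, y]` and `ξ ↦ X_ξ`,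
`Ω(v + ξ, w + ζ) = ωN(v, w) + (1/2) (⟨Ad_{μ(x)} ξ, ζ⟩ - ⟨ξ, Ad_{μ(x)} ζ⟩)`. -/
structure IsInducedForm {n : ℕ} [TopologicalSpace G]
    [ChartedSpace (EuclideanSpace ℝ (Fin n)) G]
    (k : ℕ) [ChartedSpace (EuclideanSpace ℝ (Fin k)) K]
    (B : LinearMap.BilinForm ℝ (GroupLieAlgebra (𝓡 n) G))
    (d : ℕ) [TopologicalSpace N] [ChartedSpace (EuclideanSpace ℝ (Fin d)) N]
    (ωN : DiffForm d N 2) (μ : N → K)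
    (d' : ℕ) [ChartedSpace (EuclideanSpace ℝ (Fin d')) (Induction K N)]
    (Ω : DiffForm d' (Induction K N) 2) : Prop where
  invariant : ∀ g : G, pullback d' d' (fun x : Induction K N => g • x) Ω = Ω
  apply_eq : ∀ (x : N) (v w : TangentSpace (𝓡 d) x),
    ∀ ξ ∈ lieOrth k K B, ∀ ζ ∈ lieOrth k K B,
      Ω (Induction.mk K (1, x))
        ![mfderiv (𝓡 d) (𝓡 d') (fun y : N => Induction.mk K (1, y)) x v
            + generator ξ (Induction.mk K (1, x)),
          mfderiv (𝓡 d) (𝓡 d') (fun y : N => Induction.mk K (1, y)) x w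
            + generator ζ (Induction.mk K (1, x))] =
        ωN x ![v, w] + (1 / 2) * (B (Ad n (μ x : G) ξ) ζ - B ξ (Ad n (μ x : G) ζ))

end Induction

end QHam

end

/-! The geometric core concerns only the pair `(G, K)`, with `𝔭 = 𝔨^⊥`. Three facts about strongly
stable elements are needed: each is conjugate into `K`; if `a ∈ K` is strongly stable and `h a h⁻¹ ∈
K`, then `h ∈ K`; and for such `a` the operator `Ad a⁻¹ - 1` is invertible on `𝔭`. The first two say
that conjugation identifies `G ×_K (𝒟 ∩ K)` with `𝒟`. The third is their infinitesimal form: the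
generators from `𝔭` move `a` transversally to `K`.

All three come from the Cartan involution `θ` and the inner product `⟨x, θ y⟩`. The group acts on
the positive definite automorphisms of `𝔤` by `P ↦ Ad g ∘ P ∘ (Ad g)^*`. A compact subgroup fixes
such a `P`, found by minimizing the largest trace along the orbit (`exists_isPos_fixed`); `P` is the
square of some `Ad p` (`IsPos.exists_sqrt`), and conjugation by `p` turns the compact subgroup into
isometries. A strongly stable element fixes no nonzero vector of `𝔭`, because that vector would
generate an unbounded one-parameter group inside the compact centralizer (`eq_zero_of_AdE_eq`). The
isometry group is itself compact (`isCompact_isometrySubgroup`) and contains `K`, so maximality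
makes it equal to `K`.

For (a), the cross-section `N` is a regular level set whose tangent vectors are those with `μ^* θ^L`
in `𝔨`. Since the generator of `ζ` has `μ^* θ^L = Ad μ⁻¹ ζ - ζ`, every tangent vector of `M` along
`N` is tangent to `N` up to a generator from `𝔭`. The contraction axiom makes the two kinds of
vectors orthogonal and determines the form on generators. This yields both the kernel axiom for `N`
(`isQHamiltonian_restrict`) and the formula for the induced form (`isInducedForm_pullback`); the map
`[g, x] ↦ g • x` is bijective by the facts on `(G, K)` and has bijective differential.

For (b), the induced form is defined by translating to `[1, x]` and splitting there. The contraction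
axiom is checked at `[1, x]` and spread by equivariance. Then `dΩ = -μ^* η` holds on `T_x N` because
it holds for `N`, and on triples that contain a generator by Cartan's formula together with the
Maurer–Cartan equation for `μ` and `μ⁻¹` (`extDerivForm_generator_eq`). The kernel axiom again uses
that `Ad μ(x)` has no fixed vector in `𝔭`.

The supporting calculus consists of naturality of the exterior derivative, the inverse function
theorem, smooth structures on level sets and quotients, and the Maurer–Cartan equation. -/

noncomputable section

namespace QHam

open Set Filter Topology

set_option linter.unusedSectionVars false

/-! ### Smooth families of alternating forms on vector spaces -/

section AlternatingCalculus

variable {F E : Type*} [NormedAddCommGroup F] [NormedSpace ℝ F] [NormedAddCommGroup E]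
  [NormedSpace ℝ E] {r : ℕ} {n : ℕ∞ω}

/-- In finite dimension an alternating form is recovered linearly from its finitely many values on
tuples of basis vectors, so smoothness may be tested on fixed arguments. -/
lemma contDiffAt_alternating [FiniteDimensional ℝ E] {f : F → E [⋀^Fin r]→L[ℝ] ℝ} {x : F}
    (h : ∀ v : Fin r → E, ContDiffAt ℝ n (fun y => f y v) x) : ContDiffAt ℝ n f x := by
  let b := Module.finBasis ℝ E
  let ev : (E [⋀^Fin r]→L[ℝ] ℝ) →ₗ[ℝ] ((Fin r → Fin (Module.finrank ℝ E)) → ℝ) :=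
    { toFun := fun A s => A (fun i => b (s i))
      map_add' := fun A B => by ext s; simp
      map_smul' := fun c A => by ext s; simp }
  have hev : Function.Injective ev := by
    intro A B hAB
    apply ContinuousAlternatingMap.toAlternatingMap_injective
    apply AlternatingMap.coe_multilinearMap_injective
    exact Module.Basis.ext_multilinear (fun _ => b) fun s => congrFun hAB s
  obtain ⟨L, hL⟩ := LinearMap.exists_leftInverse_of_injective ev (LinearMap.ker_eq_bot.2 hev)
  have : f = fun y => L.toContinuousLinearMap (fun s => f y (fun i => b (s i))) := by
    ext1 y
    exact (LinearMap.congr_fun hL (f y)).symm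
  rw [this]
  exact L.toContinuousLinearMap.contDiff.contDiffAt.comp x (contDiffAt_pi.2 fun s => h _)

lemma contDiff_toContinuousMultilinearMap :
    ContDiff ℝ n (fun A : E [⋀^Fin r]→L[ℝ] ℝ => A.toContinuousMultilinearMap) :=
  ContinuousLinearMap.contDiff (ContinuousAlternatingMap.toContinuousMultilinearMapCLM ℝ :
    (E [⋀^Fin r]→L[ℝ] ℝ) →L[ℝ] E [×r]→L[ℝ] ℝ)

/-- The composite is linear in the form and multilinear in `r` copies of `A`, and continuous
multilinear maps are smooth. -/
lemma contDiffAt_alternating_comp {E' : Type*} [NormedAddCommGroup E'] [NormedSpace ℝ E']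
    [FiniteDimensional ℝ E]
    {f : F → E' [⋀^Fin r]→L[ℝ] ℝ} {A : F → E →L[ℝ] E'} {x : F}
    (hf : ContDiffAt ℝ n f x) (hA : ContDiffAt ℝ n A x) :
    ContDiffAt ℝ n (fun y => (f y).compContinuousLinearMap (A y)) x := by
  refine contDiffAt_alternating fun v => ?_
  let Φ := ContinuousMultilinearMap.compContinuousLinearMapContinuousMultilinear ℝ
    (fun _ : Fin r => E) (fun _ : Fin r => E') ℝ
  have hΦ : ContDiff ℝ n (fun p : Fin r → (E →L[ℝ] E') => Φ p) :=
    by apply ContinuousMultilinearMap.contDiff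
  have h1 : ContDiffAt ℝ n (fun y => Φ (fun _ => A y)) x :=
    hΦ.contDiffAt.comp x (contDiffAt_pi.2 fun _ => hA)
  have h2 : ContDiffAt ℝ n (fun y => (f y).toContinuousMultilinearMap) x :=
    (contDiff_toContinuousMultilinearMap (E := E')).contDiffAt.comp x hf
  exact (ContinuousMultilinearMap.apply ℝ (fun _ : Fin r => E) ℝ v).contDiff.contDiffAt.comp x
    (h1.clm_apply h2)

lemma contDiffAt_alternating_apply
    {f : F → E [⋀^Fin r]→L[ℝ] ℝ} {c : Fin r → F → E} {x : F}
    (hf : ContDiffAt ℝ n f x) (hc : ∀ i, ContDiffAt ℝ n (c i) x) :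
    ContDiffAt ℝ n (fun y => f y (fun i => c i y)) x := by
  -- A vector is encoded as the map `ℝ → E` that sends `1` to it; composing with these maps and
  -- evaluating at `1` returns the value of the form.
  let Φ := ContinuousMultilinearMap.compContinuousLinearMapContinuousMultilinear ℝ
    (fun _ : Fin r => ℝ) (fun _ : Fin r => E) ℝ
  have hΦ : ContDiff ℝ n (fun p : Fin r → (ℝ →L[ℝ] E) => Φ p) :=
    by apply ContinuousMultilinearMap.contDiff
  have h1 : ContDiffAt ℝ n (fun y => Φ (fun i => ContinuousLinearMap.toSpanSingleton ℝ (c i y))) x :=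
    hΦ.contDiffAt.comp x (contDiffAt_pi.2 fun i =>
      (ContinuousLinearMap.toSpanSingletonCLE (𝕜 := ℝ) (E := E)).contDiff.contDiffAt.comp x (hc i))
  have h2 : ContDiffAt ℝ n (fun y => (f y).toContinuousMultilinearMap) x :=
    contDiff_toContinuousMultilinearMap.contDiffAt.comp x hf
  have := (ContinuousMultilinearMap.apply ℝ (fun _ : Fin r => ℝ) ℝ 1).contDiff.contDiffAt.comp x
    (h1.clm_apply h2)
  refine this.congr_of_eventuallyEq (.of_forall fun y => ?_)
  simp [Φ, ContinuousMultilinearMap.compContinuousLinearMapContinuousMultilinear,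
    ContinuousMultilinearMap.compContinuousLinearMapMultilinear]

end AlternatingCalculus

/-! ### Smoothness and naturality of differential forms on manifolds -/

section Forms

variable {m : ℕ} {M : Type*} [TopologicalSpace M] [ChartedSpace (EuclideanSpace ℝ (Fin m)) M]
  [IsManifold (𝓡 m) ∞ M]
  {m' : ℕ} {M' : Type*} [TopologicalSpace M'] [ChartedSpace (EuclideanSpace ℝ (Fin m')) M']
  [IsManifold (𝓡 m') ∞ M'] {r : ℕ}

lemma mdifferentiableAt_extChartAt_symm' {x₀ : M} {y : EuclideanSpace ℝ (Fin m)}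
    (hy : y ∈ (extChartAt (𝓡 m) x₀).target) :
    MDifferentiableAt (𝓡 m) (𝓡 m) (extChartAt (𝓡 m) x₀).symm y :=
  ((contMDiffOn_extChartAt_symm (n := ∞) x₀).contMDiffAt
    ((isOpen_extChartAt_target x₀).mem_nhds hy)).mdifferentiableAt (by simp)

lemma mfderiv_extChartAt_symm_comp {x₀ z : M} (hz : z ∈ (extChartAt (𝓡 m) x₀).source)
    (v : TangentSpace (𝓡 m) z) :
    mfderiv (𝓡 m) (𝓡 m) (extChartAt (𝓡 m) x₀).symm (extChartAt (𝓡 m) x₀ z)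
      (mfderiv (𝓡 m) (𝓡 m) (extChartAt (𝓡 m) x₀) z v) = v := by
  have h1 := mdifferentiableAt_extChartAt_symm' ((extChartAt (𝓡 m) x₀).map_source hz)
  have h2 : MDifferentiableAt (𝓡 m) (𝓡 m) (extChartAt (𝓡 m) x₀) z :=
    mdifferentiableAt_extChartAt (by simpa using hz)
  have h3 : mfderiv (𝓡 m) (𝓡 m) ((extChartAt (𝓡 m) x₀).symm ∘ extChartAt (𝓡 m) x₀) z =
      mfderiv (𝓡 m) (𝓡 m) id z := by
    apply Filter.EventuallyEq.mfderiv_eq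
    filter_upwards [(isOpen_extChartAt_source (I := 𝓡 m) x₀).mem_nhds hz] with w hw
    exact (extChartAt (𝓡 m) x₀).left_inv hw
  rw [mfderiv_comp z h1 h2, mfderiv_id] at h3
  exact congrArg (fun A : TangentSpace (𝓡 m) z →L[ℝ] TangentSpace (𝓡 m) z => A v) h3

-- All tangent spaces are by definition the same Euclidean space, so an equation between base points
-- can be used without transporting vectors. The ascriptions make this identification visible.
omit [IsManifold (𝓡 m') ∞ M'] in
lemma form_congr_point (α : DiffForm m' M' r) {z z' : M'} (h : z = z')
    (v : Fin r → EuclideanSpace ℝ (Fin m')) :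
    (show EuclideanSpace ℝ (Fin m') [⋀^Fin r]→L[ℝ] ℝ from α z) v =
      (show EuclideanSpace ℝ (Fin m') [⋀^Fin r]→L[ℝ] ℝ from α z') v := by
  subst h; rfl

lemma chartForm_apply_mfderiv (α : DiffForm m M r) {x₀ z : M}
    (hz : z ∈ (extChartAt (𝓡 m) x₀).source) (v : Fin r → TangentSpace (𝓡 m) z) :
    chartForm α x₀ (extChartAt (𝓡 m) x₀ z)
      (fun i => mfderiv (𝓡 m) (𝓡 m) (extChartAt (𝓡 m) x₀) z (v i)) = α z v := by
  have h5 := (extChartAt (𝓡 m) x₀).left_inv hz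
  have : (fun i => mfderiv (𝓡 m) (𝓡 m) (extChartAt (𝓡 m) x₀).symm (extChartAt (𝓡 m) x₀ z)
      (mfderiv (𝓡 m) (𝓡 m) (extChartAt (𝓡 m) x₀) z (v i))) =
      (fun i => (v i : EuclideanSpace ℝ (Fin m))) :=
    funext fun i => mfderiv_extChartAt_symm_comp hz (v i)
  refine Eq.trans ?_ (form_congr_point α h5 v)
  exact congrArg (show EuclideanSpace ℝ (Fin m) [⋀^Fin r]→L[ℝ] ℝ from
    α ((extChartAt (𝓡 m) x₀).symm (extChartAt (𝓡 m) x₀ z))) this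

/-- In charts, the pullback of a form is the pullback along the map read in the charts. -/
lemma chartForm_pullback {f : M → M'} (α : DiffForm m' M' r) {x₀ : M} {w : M'}
    {y : EuclideanSpace ℝ (Fin m)} (hy : y ∈ (extChartAt (𝓡 m) x₀).target)
    (hf : MDifferentiableAt (𝓡 m) (𝓡 m') f ((extChartAt (𝓡 m) x₀).symm y))
    (hw : f ((extChartAt (𝓡 m) x₀).symm y) ∈ (extChartAt (𝓡 m') w).source) :
    chartForm (pullback m m' f α) x₀ y =
      (chartForm α w ((extChartAt (𝓡 m') w) (f ((extChartAt (𝓡 m) x₀).symm y)))).compContinuousLinearMap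
        (fderiv ℝ (extChartAt (𝓡 m') w ∘ f ∘ (extChartAt (𝓡 m) x₀).symm) y) := by
  have h1 := mdifferentiableAt_extChartAt_symm' hy
  have h2 : MDifferentiableAt (𝓡 m') (𝓡 m') (extChartAt (𝓡 m') w)
      (f ((extChartAt (𝓡 m) x₀).symm y)) := mdifferentiableAt_extChartAt (by simpa using hw)
  have h3 : fderiv ℝ (extChartAt (𝓡 m') w ∘ f ∘ (extChartAt (𝓡 m) x₀).symm) y =
      (mfderiv (𝓡 m') (𝓡 m') (extChartAt (𝓡 m') w) (f ((extChartAt (𝓡 m) x₀).symm y))).comp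
      ((mfderiv (𝓡 m) (𝓡 m') f ((extChartAt (𝓡 m) x₀).symm y)).comp
        (mfderiv (𝓡 m) (𝓡 m) (extChartAt (𝓡 m) x₀).symm y)) := by
    rw [← mfderiv_eq_fderiv, mfderiv_comp y h2 (hf.comp y h1), mfderiv_comp y hf h1]
    rfl
  ext v
  rw [h3]
  exact (chartForm_apply_mfderiv α hw fun i => mfderiv (𝓡 m) (𝓡 m') f
    ((extChartAt (𝓡 m) x₀).symm y) (mfderiv (𝓡 m) (𝓡 m) (extChartAt (𝓡 m) x₀).symm y (v i))).symm

/-- A form is smooth at a point if it is so in the chart at this point. -/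
def SmoothFormAt (α : DiffForm m M r) (x : M) : Prop :=
  ContDiffAt ℝ ∞ (chartForm α x) (extChartAt (𝓡 m) x x)

lemma contDiffAt_inCharts {f : M → M'} {x₀ : M} {w : M'}
    {y : EuclideanSpace ℝ (Fin m)} (hy : y ∈ (extChartAt (𝓡 m) x₀).target)
    (hf : ContMDiffAt (𝓡 m) (𝓡 m') ∞ f ((extChartAt (𝓡 m) x₀).symm y))
    (hw : f ((extChartAt (𝓡 m) x₀).symm y) ∈ (extChartAt (𝓡 m') w).source) :
    ContDiffAt ℝ ∞ (extChartAt (𝓡 m') w ∘ f ∘ (extChartAt (𝓡 m) x₀).symm) y := by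
  rw [← contMDiffAt_iff_contDiffAt]
  refine (contMDiffAt_extChartAt' (by simpa using hw)).comp y (hf.comp y ?_)
  exact (contMDiffOn_extChartAt_symm x₀).contMDiffAt ((isOpen_extChartAt_target x₀).mem_nhds hy)

lemma eventually_chartForm_pullback {f : M → M'} (α : DiffForm m' M' r) {x₀ : M} {w : M'}
    {y : EuclideanSpace ℝ (Fin m)} (hy : y ∈ (extChartAt (𝓡 m) x₀).target)
    (hf : ContMDiffAt (𝓡 m) (𝓡 m') ∞ f ((extChartAt (𝓡 m) x₀).symm y))
    (hw : f ((extChartAt (𝓡 m) x₀).symm y) ∈ (extChartAt (𝓡 m') w).source) :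
    chartForm (pullback m m' f α) x₀ =ᶠ[𝓝 y] fun t =>
      (chartForm α w ((extChartAt (𝓡 m') w ∘ f ∘ (extChartAt (𝓡 m) x₀).symm) t)).compContinuousLinearMap
        (fderiv ℝ (extChartAt (𝓡 m') w ∘ f ∘ (extChartAt (𝓡 m) x₀).symm) t) := by
  have hs : ContinuousAt (extChartAt (𝓡 m) x₀).symm y :=
    (continuousOn_extChartAt_symm x₀).continuousAt ((isOpen_extChartAt_target x₀).mem_nhds hy)
  have h1 : ∀ᶠ t in 𝓝 y, ContMDiffAt (𝓡 m) (𝓡 m') 1 f ((extChartAt (𝓡 m) x₀).symm t) :=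
    hs.eventually ((contMDiffAt_iff_contMDiffAt_nhds (by simp)).1 (ContMDiffAt.of_le hf (by simp)))
  have h2 : ∀ᶠ t in 𝓝 y, f ((extChartAt (𝓡 m) x₀).symm t) ∈ (extChartAt (𝓡 m') w).source :=
    (hf.continuousAt.comp hs).eventually ((isOpen_extChartAt_source w).mem_nhds hw)
  filter_upwards [h1, h2, (isOpen_extChartAt_target x₀).mem_nhds hy] with t h1 h2 h3
  exact chartForm_pullback α h3 (h1.mdifferentiableAt (by simp)) h2

lemma SmoothFormAt.chartForm_pullback {f : M → M'} {α : DiffForm m' M' r} {x₀ : M}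
    {y : EuclideanSpace ℝ (Fin m)} (hy : y ∈ (extChartAt (𝓡 m) x₀).target)
    (hf : ContMDiffAt (𝓡 m) (𝓡 m') ∞ f ((extChartAt (𝓡 m) x₀).symm y))
    (hα : SmoothFormAt α (f ((extChartAt (𝓡 m) x₀).symm y))) :
    ContDiffAt ℝ ∞ (chartForm (pullback m m' f α) x₀) y := by
  refine ContDiffAt.congr_of_eventuallyEq ?_
    (eventually_chartForm_pullback α hy hf (mem_extChartAt_source _))
  have h := contDiffAt_inCharts hy hf (mem_extChartAt_source (I := 𝓡 m') _)
  exact contDiffAt_alternating_comp (ContDiffAt.comp (g := chartForm α _) y hα h) (h.fderiv_right (by simp))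

omit [IsManifold (𝓡 m) ∞ M] in
lemma pullback_id (α : DiffForm m M r) : pullback m m id α = α := by
  funext x
  ext v
  simp only [pullback, mfderiv_id]
  rfl

lemma isSmoothForm_iff (α : DiffForm m M r) : IsSmoothForm α ↔ ∀ x, SmoothFormAt α x := by
  constructor
  · intro h x
    exact (h x).contDiffAt ((isOpen_extChartAt_target x).mem_nhds (mem_extChartAt_target x))
  · intro h x₀ y hy
    -- Pulling back along the identity compares the chart at `x₀` with the chart at the point that
    -- has coordinate `y`.
    have := SmoothFormAt.chartForm_pullback (f := (id : M → M)) hy contMDiffAt_id (h _)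
    rw [pullback_id] at this
    exact this.contDiffWithinAt

lemma SmoothFormAt.pullback {f : M → M'} {α : DiffForm m' M' r} {x : M}
    (hα : SmoothFormAt α (f x)) (hf : ContMDiffAt (𝓡 m) (𝓡 m') ∞ f x) :
    SmoothFormAt (pullback m m' f α) x := by
  apply SmoothFormAt.chartForm_pullback (mem_extChartAt_target x)
  · rwa [extChartAt_to_inv]
  · rwa [extChartAt_to_inv]

lemma IsSmoothForm.pullback {f : M → M'} {α : DiffForm m' M' r}
    (hα : IsSmoothForm α) (hf : ContMDiff (𝓡 m) (𝓡 m') ∞ f) :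
    IsSmoothForm (pullback m m' f α) :=
  (isSmoothForm_iff _).2 fun x => ((isSmoothForm_iff _).1 hα _).pullback (hf x)

/-- The exterior derivative is natural. -/
theorem extDerivForm_pullback {f : M → M'} {α : DiffForm m' M' r} {x : M}
    (hα : SmoothFormAt α (f x)) (hf : ContMDiffAt (𝓡 m) (𝓡 m') ∞ f x)
    (v : Fin (r + 1) → TangentSpace (𝓡 m) x) :
    extDerivForm (QHam.pullback m m' f α) x v =
      extDerivForm α (f x) (fun i => mfderiv (𝓡 m) (𝓡 m') f x (v i)) := by
  have hx := mem_extChartAt_target (I := 𝓡 m) x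
  have hf' : ContMDiffAt (𝓡 m) (𝓡 m') ∞ f ((extChartAt (𝓡 m) x).symm (extChartAt (𝓡 m) x x)) := by
    rwa [extChartAt_to_inv]
  have hw : f ((extChartAt (𝓡 m) x).symm (extChartAt (𝓡 m) x x)) ∈
      (extChartAt (𝓡 m') (f x)).source := by
    rw [extChartAt_to_inv]; exact mem_extChartAt_source _
  have h := contDiffAt_inCharts hx hf' hw
  have e : (extChartAt (𝓡 m') (f x) ∘ f ∘ (extChartAt (𝓡 m) x).symm) (extChartAt (𝓡 m) x x) =
      extChartAt (𝓡 m') (f x) (f x) := by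
    simp
  have hα' : DifferentiableAt ℝ (chartForm α (f x))
      ((extChartAt (𝓡 m') (f x) ∘ f ∘ (extChartAt (𝓡 m) x).symm) (extChartAt (𝓡 m) x x)) := by
    rw [e]; exact ContDiffAt.differentiableAt hα (by simp)
  -- The differential of `f` read in charts intertwines the differentials of the two charts; this
  -- turns naturality in Euclidean space into the intrinsic statement.
  have h2 : fderiv ℝ (extChartAt (𝓡 m') (f x) ∘ f ∘ (extChartAt (𝓡 m) x).symm)
      (extChartAt (𝓡 m) x x) ∘L mfderiv (𝓡 m) (𝓡 m) (extChartAt (𝓡 m) x) x =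
      mfderiv (𝓡 m') (𝓡 m') (extChartAt (𝓡 m') (f x)) (f x) ∘L mfderiv (𝓡 m) (𝓡 m') f x := by
    have hd1 : MDifferentiableAt (𝓡 m) (𝓡 m') f x := hf.mdifferentiableAt (by simp)
    have hd2 : MDifferentiableAt (𝓡 m') (𝓡 m') (extChartAt (𝓡 m') (f x)) (f x) :=
      mdifferentiableAt_extChartAt (by simp)
    have hd3 : MDifferentiableAt (𝓡 m) (𝓡 m) (extChartAt (𝓡 m) x) x :=
      mdifferentiableAt_extChartAt (by simp)
    have hd4 : MDifferentiableAt (𝓡 m) (𝓡 m')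
      (extChartAt (𝓡 m') (f x) ∘ f ∘ (extChartAt (𝓡 m) x).symm) (extChartAt (𝓡 m) x x) :=
      (h.differentiableAt (by simp)).mdifferentiableAt
    rw [← mfderiv_eq_fderiv, ← mfderiv_comp x hd2 hd1]
    refine (mfderiv_comp x hd4 hd3).symm.trans ?_
    apply Filter.EventuallyEq.mfderiv_eq
    filter_upwards [(isOpen_extChartAt_source (I := 𝓡 m) x).mem_nhds (mem_extChartAt_source x)] with z hz
    simp only [Function.comp_apply, (extChartAt (𝓡 m) x).left_inv hz]
  rw [extDerivForm, (eventually_chartForm_pullback α hx hf' hw).extDeriv_eq,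
    extDeriv_pullback hα' h (by simpa using ENat.LEInfty.out)]
  rw [e]
  exact congrArg (extDeriv (chartForm α (f x)) (extChartAt (𝓡 m') (f x) (f x)))
    (funext fun i => congrArg (fun A : TangentSpace (𝓡 m) x →L[ℝ] EuclideanSpace ℝ (Fin m') => A (v i)) h2)

end Forms

/-! ### Inverse function theorem and adapted charts -/

section InverseFunction

variable {E H : Type*} [NormedAddCommGroup E] [NormedSpace ℝ E] [FiniteDimensional ℝ E]
  [TopologicalSpace H] {I : ModelWithCorners ℝ E H} [I.Boundaryless]
  {M : Type*} [TopologicalSpace M] [ChartedSpace H M] [IsManifold I ∞ M]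
  {E' H' : Type*} [NormedAddCommGroup E'] [NormedSpace ℝ E'] [FiniteDimensional ℝ E']
  [TopologicalSpace H'] {J : ModelWithCorners ℝ E' H'} [J.Boundaryless]
  {N : Type*} [TopologicalSpace N] [ChartedSpace H' N] [IsManifold J ∞ N]

/-- A smooth map to a vector space with bijective differential is a chart near the point. -/
lemma exists_chart_of_bijective {f : M → E'} {x : M} {U : Set M} (hU : IsOpen U) (hx : x ∈ U)
    (hf : ContMDiffOn I 𝓘(ℝ, E') ∞ f U)
    (hb : Function.Bijective (mfderiv I 𝓘(ℝ, E') f x)) :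
    ∃ e : OpenPartialHomeomorph M E', x ∈ e.source ∧ e.source ⊆ U ∧ (∀ z, e z = f z) ∧
      ContMDiffOn I 𝓘(ℝ, E') ∞ e e.source ∧ ContMDiffOn 𝓘(ℝ, E') I ∞ e.symm e.target := by
  have : CompleteSpace E := FiniteDimensional.complete ℝ E
  let φ : OpenPartialHomeomorph M E :=
    (chartAt H x).trans I.toHomeomorph.toOpenPartialHomeomorph
  have hφ : ContMDiffOn I 𝓘(ℝ, E) ∞ φ φ.source := by
    have : φ.source = (chartAt H x).source := by simp [φ]
    rw [this]
    exact contMDiffOn_extChartAt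
  have hφt : φ.target = (extChartAt I x).target := by
    simp [φ, extChartAt, ModelWithCorners.toHomeomorph, I.range_eq_univ]
  have hφs : ContMDiffOn 𝓘(ℝ, E) I ∞ φ.symm φ.target := by
    rw [hφt]
    exact contMDiffOn_extChartAt_symm x
  have hxφ : x ∈ φ.source := by simp [φ]
  let g : E → E' := f ∘ φ.symm
  let V : Set E := φ.target ∩ φ.symm ⁻¹' U
  have hV : IsOpen V := φ.isOpen_inter_preimage_symm hU
  have hxV : φ x ∈ V := ⟨φ.map_source hxφ, by simpa [φ.left_inv hxφ] using hx⟩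
  have hg : ContDiffOn ℝ ∞ g V := by
    rw [← contMDiffOn_iff_contDiffOn]
    exact hf.comp (hφs.mono inter_subset_left) (fun y hy => hy.2)
  have hgd : ContinuousOn (fderiv ℝ g) V := hg.continuousOn_fderiv_of_isOpen hV (by simp)
  have hmd : MDifferentiableAt I 𝓘(ℝ, E') f x :=
    (hf.contMDiffAt (hU.mem_nhds hx)).mdifferentiableAt (by simp)
  have hD : (fderiv ℝ g (φ x) : E → E') = mfderiv I 𝓘(ℝ, E') f x := by
    have h1 := hmd.mfderiv
    rw [h1, I.range_eq_univ, fderivWithin_univ]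
    rfl
  have hgx : HasStrictFDerivAt g (fderiv ℝ g (φ x)) (φ x) :=
    (hg.contDiffAt (hV.mem_nhds hxV)).hasStrictFDerivAt (by simp)
  have hker : (fderiv ℝ g (φ x)).ker = ⊥ := LinearMap.ker_eq_bot.2 (by
    have := hb.1; rw [← hD] at this; exact this)
  have hrange : (fderiv ℝ g (φ x)).range = ⊤ := LinearMap.range_eq_top.2 (by
    have := hb.2; rw [← hD] at this; exact this)
  let L : E ≃L[ℝ] E' := ContinuousLinearEquiv.ofBijective (fderiv ℝ g (φ x)) hker hrange
  have hL : HasStrictFDerivAt g (L : E →L[ℝ] E') (φ x) := by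
    have : (L : E →L[ℝ] E') = fderiv ℝ g (φ x) := by ext v; rfl
    rw [this]; exact hgx
  -- Restricting to the points where the derivative is still invertible makes the inverse smooth on
  -- its whole domain, not only at the image of `x`.
  let W : Set E := V ∩ (fderiv ℝ g) ⁻¹' (range ((↑) : (E ≃L[ℝ] E') → E →L[ℝ] E'))
  have hW : IsOpen W := hgd.isOpen_inter_preimage hV (ContinuousLinearEquiv.isOpen (𝕜 := ℝ))
  have hxW : φ x ∈ W := ⟨hxV, L, rfl⟩
  let h := (hL.toOpenPartialHomeomorph g).restr W
  have hhs : h.source = (hL.toOpenPartialHomeomorph g).source ∩ W := by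
    simp [h, hW.interior_eq]
  let e := φ.trans h
  have hes : ∀ z, e z = f z ∨ z ∉ φ.source := by
    intro z
    by_cases hz : z ∈ φ.source
    · left
      change f (φ.symm (φ z)) = f z
      rw [φ.left_inv hz]
    · exact Or.inr hz
  have hesrc : e.source ⊆ φ.source := by
    intro z hz
    exact hz.1
  have hesU : e.source ⊆ U := by
    intro z hz
    have h1 : φ z ∈ h.source := hz.2
    rw [hhs] at h1
    have := h1.2.1.2
    simpa [φ.left_inv (hesrc hz)] using this
  have hesymm : ContMDiffOn 𝓘(ℝ, E') I ∞ e.symm e.target := by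
    have h1 : ContDiffOn ℝ ∞ h.symm h.target := by
      intro t ht
      have hs : h.symm t ∈ W := by
        have := h.map_target ht
        rw [hhs] at this
        exact this.2
      obtain ⟨A, hA⟩ := hs.2
      refine (h.contDiffAt_symm (f₀' := A) ht ?_ (hg.contDiffAt (hV.mem_nhds hs.1))).contDiffWithinAt
      rw [hA]
      exact ((hg.contDiffAt (hV.mem_nhds hs.1)).differentiableAt (by simp)).hasFDerivAt
    refine hφs.comp ((contMDiffOn_iff_contDiffOn.2 h1).mono ?_) ?_
    · intro t ht; exact ht.1
    · intro t ht; exact ht.2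
  have hxe : x ∈ e.source := by
    refine ⟨hxφ, ?_⟩
    change φ x ∈ h.source
    rw [hhs]
    exact ⟨hL.mem_toOpenPartialHomeomorph_source, hxW⟩
  have heq : EqOn e f e.source := fun z hz => (hes z).resolve_right fun hn => hn (hesrc hz)
  -- `e` is known to agree with `f` only on its source; the forward map is replaced by `f` itself so
  -- that the equation holds at all points.
  let e' : OpenPartialHomeomorph M E' :=
    { toPartialEquiv :=
        { toFun := f
          invFun := e.symm
          source := e.source
          target := e.target
          map_source' := fun z hz => heq hz ▸ e.map_source hz
          map_target' := fun t ht => e.map_target ht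
          left_inv' := fun z hz => heq hz ▸ e.left_inv hz
          right_inv' := fun t ht => by
            rw [← heq (e.map_target ht)]; exact e.right_inv ht }
      open_source := e.open_source
      open_target := e.open_target
      continuousOn_toFun := hf.continuousOn.mono hesU
      continuousOn_invFun := e.continuousOn_invFun }
  exact ⟨e', hxe, hesU, fun z => rfl, hf.mono hesU, hesymm⟩

omit [J.Boundaryless] in
/-- The inverse function theorem on manifolds. -/
theorem isLocalDiffeomorphAt_of_bijective {f : M → N} {x : M} (hf : ContMDiff I J ∞ f)
    (hb : Function.Bijective (mfderiv I J f x)) : IsLocalDiffeomorphAt I J ∞ f x := by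
  let ψ := extChartAt J (f x)
  let U : Set M := f ⁻¹' ψ.source
  have hU : IsOpen U := (isOpen_extChartAt_source (f x)).preimage hf.continuous
  have hx : x ∈ U := mem_extChartAt_source (f x)
  have hψf : ContMDiffOn I 𝓘(ℝ, E') ∞ (ψ ∘ f) U := by
    refine ContMDiffOn.comp (t := ψ.source) ?_ hf.contMDiffOn fun z hz => hz
    have : ψ.source = (chartAt H' (f x)).source := extChartAt_source (I := J) (f x)
    rw [this]; exact contMDiffOn_extChartAt
  have hψb : Function.Bijective (mfderiv J 𝓘(ℝ, E') ψ (f x)) := by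
    obtain ⟨A, hA⟩ := isInvertible_mfderiv_extChartAt (I := J) (mem_extChartAt_source (f x))
    change Function.Bijective (mfderiv J 𝓘(ℝ, E') (extChartAt J (f x)) (f x))
    rw [← hA]; exact A.bijective
  have hb' : Function.Bijective (mfderiv I 𝓘(ℝ, E') (ψ ∘ f) x) := by
    rw [mfderiv_comp x (mdifferentiableAt_extChartAt (by simp))
      (hf.mdifferentiableAt (by simp))]
    exact hψb.comp hb
  obtain ⟨e, hxe, heU, hef, he, hes⟩ := exists_chart_of_bijective hU hx hψf hb'
  refine ⟨⟨⟨f, e.symm ∘ ψ, e.source, ψ.source ∩ ψ ⁻¹' e.target, ?_, ?_, ?_, ?_⟩, e.open_source, ?_,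
    hf.contMDiffOn, ?_⟩, hxe, fun z _ => rfl⟩
  · intro z hz
    refine ⟨heU hz, ?_⟩
    change ψ (f z) ∈ e.target
    have := hef z ▸ e.map_source hz
    exact this
  · intro t ht
    exact e.map_target ht.2
  · intro z hz
    change e.symm (ψ (f z)) = z
    have h2 : ψ (f z) = e z := (hef z).symm
    rw [h2, e.left_inv hz]
  · intro t ht
    change f (e.symm (ψ t)) = t
    have h1 : e (e.symm (ψ t)) = ψ t := e.right_inv ht.2
    rw [hef] at h1
    exact ψ.injOn (heU (e.map_target ht.2)) ht.1 h1
  · exact (continuousOn_extChartAt (f x)).isOpen_inter_preimage (isOpen_extChartAt_source _)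
      e.open_target
  · refine hes.comp (t := e.target) ?_ fun t ht => ht.2
    have : ψ.source = (chartAt H' (f x)).source := extChartAt_source (I := J) (f x)
    refine ContMDiffOn.mono contMDiffOn_extChartAt (s := (chartAt H' (f x)).source) ?_
    rw [← this]; exact inter_subset_left

omit [J.Boundaryless] in
/-- Near a point where the differential is onto, `f` (read in a chart of the target and translated
by `c`) is the first component of a chart. -/
lemma exists_chart_of_surjective {F : Type*} [NormedAddCommGroup F] [NormedSpace ℝ F]
    [FiniteDimensional ℝ F] {f : M → N} {x : M} (hf : ContMDiff I J ∞ f)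
    (hs : Function.Surjective (mfderiv I J f x))
    (hdim : Module.finrank ℝ E = Module.finrank ℝ E' + Module.finrank ℝ F) (c : E') :
    ∃ e : OpenPartialHomeomorph M (E' × F), x ∈ e.source ∧
      e.source ⊆ f ⁻¹' (extChartAt J (f x)).source ∧
      (∀ z, (e z).1 = extChartAt J (f x) (f z) - c) ∧
      ContMDiffOn I 𝓘(ℝ, E' × F) ∞ e e.source ∧
      ContMDiffOn 𝓘(ℝ, E' × F) I ∞ e.symm e.target := by
  let ψ := extChartAt J (f x)
  let φ := extChartAt I x
  let U : Set M := φ.source ∩ f ⁻¹' ψ.source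
  have hU : IsOpen U := (isOpen_extChartAt_source x).inter
    ((isOpen_extChartAt_source (f x)).preimage hf.continuous)
  have hx : x ∈ U := ⟨mem_extChartAt_source x, mem_extChartAt_source (f x)⟩
  have hψf : ContMDiffOn I 𝓘(ℝ, E') ∞ (ψ ∘ f) U := by
    refine ContMDiffOn.comp (t := ψ.source) ?_ hf.contMDiffOn fun z hz => hz.2
    have : ψ.source = (chartAt H' (f x)).source := extChartAt_source (I := J) (f x)
    rw [this]; exact contMDiffOn_extChartAt
  have hφ : ContMDiffOn I 𝓘(ℝ, E) ∞ φ U := by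
    refine ContMDiffOn.mono contMDiffOn_extChartAt (s := (chartAt H x).source) ?_
    rw [← extChartAt_source (I := I)]; exact inter_subset_left
  have hψb : Function.Bijective (mfderiv J 𝓘(ℝ, E') ψ (f x)) := by
    obtain ⟨A, hA⟩ := isInvertible_mfderiv_extChartAt (I := J) (mem_extChartAt_source (f x))
    change Function.Bijective (mfderiv J 𝓘(ℝ, E') (extChartAt J (f x)) (f x))
    rw [← hA]; exact A.bijective
  have hφb : Function.Bijective (mfderiv I 𝓘(ℝ, E) φ x) := by
    obtain ⟨A, hA⟩ := isInvertible_mfderiv_extChartAt (I := I) (mem_extChartAt_source x)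
    change Function.Bijective (mfderiv I 𝓘(ℝ, E) (extChartAt I x) x)
    rw [← hA]; exact A.bijective
  let D : E →L[ℝ] E' := mfderiv I 𝓘(ℝ, E') (ψ ∘ f) x
  have hD : Function.Surjective D := by
    change Function.Surjective (mfderiv I 𝓘(ℝ, E') (ψ ∘ f) x)
    rw [mfderiv_comp x (mdifferentiableAt_extChartAt (by simp))
      (hf.mdifferentiableAt (by simp))]
    exact hψb.2.comp hs
  let A : E →L[ℝ] E := mfderiv I 𝓘(ℝ, E) φ x
  have hkerdim : Module.finrank ℝ (LinearMap.ker D.toLinearMap) = Module.finrank ℝ F := by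
    have h1 := LinearMap.finrank_range_add_finrank_ker D.toLinearMap
    rw [LinearMap.range_eq_top.2 hD, finrank_top] at h1
    omega
  let κ : LinearMap.ker D.toLinearMap ≃ₗ[ℝ] F := LinearEquiv.ofFinrankEq _ _ hkerdim
  obtain ⟨pr, hpr⟩ := (LinearMap.ker D.toLinearMap).exists_isCompl
  let P₀ : E →ₗ[ℝ] F := κ.toLinearMap ∘ₗ Submodule.projectionOnto _ _ hpr
  have hAb : Function.Bijective A := hφb
  let Ainv : E →ₗ[ℝ] E := (LinearEquiv.ofBijective A.toLinearMap hAb).symm.toLinearMap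
  -- `P₀` projects tangent vectors at `x` onto the kernel of the differential. The second component
  -- must be a function of the coordinate `φ z`, so the inverse of `A = dφ` is inserted to give it
  -- the differential `P₀`.
  let P : E →L[ℝ] F := (P₀ ∘ₗ Ainv).toContinuousLinearMap
  have hPA : ∀ v, P (A v) = P₀ v := fun v => by
    change P₀ ((LinearEquiv.ofBijective A.toLinearMap hAb).symm (A v)) = P₀ v
    congr 1
    exact (LinearEquiv.ofBijective A.toLinearMap hAb).symm_apply_apply v
  let g : M → E' × F := fun z => (ψ (f z) - c, P (φ z))
  have hPφ : ContMDiffOn I 𝓘(ℝ, F) ∞ (P ∘ φ) U := P.contMDiff.comp_contMDiffOn hφ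
  have hg : ContMDiffOn I 𝓘(ℝ, E' × F) ∞ g U :=
    (hψf.sub contMDiffOn_const).prodMk_space hPφ
  have hdψ : HasMFDerivAt I 𝓘(ℝ, E') (fun z => ψ (f z) - c) x D := by
    have h1 : HasMFDerivAt I 𝓘(ℝ, E') (ψ ∘ f) x D :=
      ((hψf.contMDiffAt (hU.mem_nhds hx)).mdifferentiableAt (by simp)).hasMFDerivAt
    have h2 : HasMFDerivAt 𝓘(ℝ, E') 𝓘(ℝ, E') (fun y : E' => y - c) (ψ (f x))
      (ContinuousLinearMap.id ℝ E') := ((hasFDerivAt_id _).sub_const c).hasMFDerivAt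
    exact HasMFDerivAt.comp x h2 h1
  have hdP : HasMFDerivAt I 𝓘(ℝ, F) (P ∘ φ) x (P ∘L A) := by
    have h1 : HasMFDerivAt I 𝓘(ℝ, E) φ x A :=
      ((hφ.contMDiffAt (hU.mem_nhds hx)).mdifferentiableAt (by simp)).hasMFDerivAt
    have h2 : HasMFDerivAt 𝓘(ℝ, E) 𝓘(ℝ, F) P (φ x) P := P.hasFDerivAt.hasMFDerivAt
    exact HasMFDerivAt.comp x h2 h1
  have hdg : HasMFDerivAt I 𝓘(ℝ, E' × F) g x (D.prod (P ∘L A)) := by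
    exact ⟨hdψ.1.prodMk hdP.1, hdψ.2.prodMk hdP.2⟩
  have hb : Function.Bijective (mfderiv I 𝓘(ℝ, E' × F) g x) := by
    rw [hdg.mfderiv]
    have hinj : Function.Injective (D.prod (P ∘L A)).toLinearMap := by
      rw [← LinearMap.ker_eq_bot, LinearMap.ker_eq_bot']
      intro v hv
      have h1 : D v = 0 := congrArg Prod.fst hv
      have h2 : P (A v) = 0 := congrArg Prod.snd hv
      rw [hPA] at h2
      have h3 : v ∈ LinearMap.ker D.toLinearMap := h1
      have h4 : Submodule.projectionOnto _ _ hpr v = ⟨v, h3⟩ :=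
        Submodule.projectionOnto_apply_left hpr ⟨v, h3⟩
      have h5 : κ ⟨v, h3⟩ = 0 := by rw [← h4]; exact h2
      simpa using h5
    have hfr : Module.finrank ℝ E = Module.finrank ℝ (E' × F) := by
      rw [Module.finrank_prod, hdim]
    exact ⟨hinj, (LinearMap.injective_iff_surjective_of_finrank_eq_finrank hfr).1 hinj⟩
  obtain ⟨e, hxe, heU, hef, he, hes⟩ := exists_chart_of_bijective hU hx hg hb
  exact ⟨e, hxe, fun z hz => (heU hz).2, fun z => by rw [hef], he, hes⟩

end InverseFunction

/-! ### Local sections of submersions, local retractions of immersions -/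

section Submersion

open Manifold

variable {E H : Type*} [NormedAddCommGroup E] [NormedSpace ℝ E]
  [TopologicalSpace H] {I : ModelWithCorners ℝ E H} [I.Boundaryless]
  {M : Type*} [TopologicalSpace M] [ChartedSpace H M] [IsManifold I ∞ M]
  {E' H' : Type*} [NormedAddCommGroup E'] [NormedSpace ℝ E']
  [TopologicalSpace H'] {J : ModelWithCorners ℝ E' H'} [J.Boundaryless]
  {N : Type*} [TopologicalSpace N] [ChartedSpace H' N] [IsManifold J ∞ N]

omit [ChartedSpace H M] [IsManifold I ∞ M] in
lemma extend_target_eq (e : OpenPartialHomeomorph M H) :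
    (e.extend I).target = I '' e.target := by
  rw [e.extend_target, I.range_eq_univ, inter_univ, I.image_eq, I.range_eq_univ, inter_univ]

omit [ChartedSpace H M] [IsManifold I ∞ M] in
lemma isOpen_extend_target (e : OpenPartialHomeomorph M H) : IsOpen (e.extend I).target := by
  rw [e.extend_target, I.range_eq_univ, inter_univ]
  exact e.open_target.preimage I.continuous_symm

omit [IsManifold I ∞ M] in
lemma contMDiffAt_extend_symm {e : OpenPartialHomeomorph M H}
    (he : e ∈ IsManifold.maximalAtlas I ∞ M) {y : E} (hy : y ∈ (e.extend I).target) :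
    ContMDiffAt 𝓘(ℝ, E) I ∞ (e.extend I).symm y := by
  have h := contMDiffOn_extend_symm he
  rw [← extend_target_eq] at h
  exact h.contMDiffAt ((isOpen_extend_target e).mem_nhds hy)

omit [J.Boundaryless] [IsManifold J ∞ N] in
/-- A submersion has a smooth local section through every point. -/
theorem exists_eventually_section_of_isSubmersionAt {f : M → N} {x : M} (hf : IsSubmersionAt I J ∞ f x) :
    ∃ s : N → M, (∀ᶠ y in 𝓝 (f x), ContMDiffAt J I ∞ s y) ∧ s (f x) = x ∧ ∀ᶠ y in 𝓝 (f x), f (s y) = y := by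
  have h := hf.isSubmersionAtOfComplement_complement
  let φ := h.domChart.extend I
  let ψ := h.codChart.extend J
  -- In charts the map is a projection; the section freezes the complementary coordinate at its
  -- value at `x`.
  let s : N → M := fun y => φ.symm (h.equiv.symm (ψ y, (h.equiv (φ x)).2))
  have hxφ : x ∈ φ.source := by
    rw [OpenPartialHomeomorph.extend_source]; exact h.mem_domChart_source
  have hxψ : f x ∈ ψ.source := by
    rw [OpenPartialHomeomorph.extend_source]; exact h.mem_codChart_source
  have hw : ∀ y ∈ φ.target, ψ (f (φ.symm y)) = (h.equiv y).1 := fun y hy => h.writtenInCharts hy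
  have hfx : ψ (f x) = (h.equiv (φ x)).1 := by
    rw [← hw _ (φ.map_source hxφ), φ.left_inv hxφ]
  have hinv : h.equiv.symm (ψ (f x), (h.equiv (φ x)).2) = φ x := by rw [hfx]; simp
  have hsx : s (f x) = x := by
    change φ.symm _ = x
    rw [hinv, φ.left_inv hxφ]
  have hlin : ∀ z ∈ ψ.source,
      ContMDiffAt J 𝓘(ℝ, E) ∞ (fun y => h.equiv.symm (ψ y, (h.equiv (φ x)).2)) z := fun z hz => by
    have hψc : ContMDiffAt J 𝓘(ℝ, E') ∞ ψ z :=
      OpenPartialHomeomorph.contMDiffAt_extend h.codChart_mem_maximalAtlas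
        (by rwa [OpenPartialHomeomorph.extend_source] at hz)
    have h1 : ContMDiffAt J 𝓘(ℝ, E' × hf.complement) ∞
        (fun y => (ψ y, (h.equiv (φ x)).2)) z := hψc.prodMk_space contMDiffAt_const
    exact ContMDiffAt.comp z (h.equiv.symm.toContinuousLinearMap.contMDiff.contMDiffAt) h1
  have e1 : ∀ᶠ y in 𝓝 (f x), h.equiv.symm (ψ y, (h.equiv (φ x)).2) ∈ φ.target :=
    (hlin _ hxψ).continuousAt.eventually_mem ((isOpen_extend_target _).mem_nhds
      (by rw [hinv]; exact φ.map_source hxφ))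
  have e2 : ∀ᶠ y in 𝓝 (f x), y ∈ ψ.source :=
    (OpenPartialHomeomorph.isOpen_extend_source _).mem_nhds hxψ
  refine ⟨s, ?_, hsx, ?_⟩
  · filter_upwards [e1, e2] with y h1 h2
    exact ContMDiffAt.comp y (g := φ.symm)
      (contMDiffAt_extend_symm h.domChart_mem_maximalAtlas h1) (hlin y h2)
  · filter_upwards [e1, e2] with y h1 h2
    have h3 := hw _ h1
    rw [ContinuousLinearEquiv.apply_symm_apply] at h3
    refine ψ.injOn ?_ h2 h3
    have h4 := h.source_subset_preimage_source
    have h5 : s y ∈ h.domChart.source := by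
      have := φ.map_target h1
      rwa [OpenPartialHomeomorph.extend_source] at this
    rw [OpenPartialHomeomorph.extend_source]
    exact h4 h5

omit [J.Boundaryless] [IsManifold J ∞ N] in
lemma exists_section_of_isSubmersionAt {f : M → N} {x : M} (hf : IsSubmersionAt I J ∞ f x) :
    ∃ s : N → M, ContMDiffAt J I ∞ s (f x) ∧ s (f x) = x ∧ ∀ᶠ y in 𝓝 (f x), f (s y) = y := by
  obtain ⟨s, h1, h2, h3⟩ := exists_eventually_section_of_isSubmersionAt hf
  exact ⟨s, h1.self_of_nhds, h2, h3⟩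

omit [I.Boundaryless] [J.Boundaryless] [IsManifold I ∞ M] [IsManifold J ∞ N] in
theorem mfderiv_surjective_of_section {f : M → N} {y : N}
    {s : N → M} (hf : MDifferentiableAt I J f (s y)) (hs : MDifferentiableAt J I s y)
    (h : ∀ᶠ z in 𝓝 y, f (s z) = z) : Function.Surjective (mfderiv I J f (s y)) := by
  have h0 : f ∘ s =ᶠ[𝓝 y] id := h
  have h1 := mfderiv_comp y hf hs
  rw [h0.mfderiv_eq, mfderiv_id] at h1
  exact fun w => ⟨mfderiv J I s y w, (DFunLike.congr_fun h1 w).symm⟩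

omit [J.Boundaryless] [IsManifold J ∞ N] in
theorem mfderiv_surjective_of_isSubmersionAt {f : M → N} {x : M}
    (hf : IsSubmersionAt I J ∞ f x) : Function.Surjective (mfderiv I J f x) := by
  obtain ⟨s, hs, hsx, h⟩ := exists_section_of_isSubmersionAt hf
  have h1 := mfderiv_surjective_of_section (I := I) (J := J) (f := f) (y := f x) (s := s)
    (by rw [hsx]; exact hf.contMDiffAt.mdifferentiableAt (by simp))
    (hs.mdifferentiableAt (by simp)) h
  rwa [hsx] at h1

omit [J.Boundaryless] [IsManifold J ∞ N] in
/-- An immersion has a smooth local retraction. -/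
theorem exists_retraction_of_isImmersionAt {f : M → N} {x : M} (hf : IsImmersionAt I J ∞ f x) :
    ∃ r : N → M, ContMDiffAt J I ∞ r (f x) ∧ ∀ᶠ y in 𝓝 x, r (f y) = y := by
  have h := hf.isImmersionAtOfComplement_complement
  let φ := h.domChart.extend I
  let ψ := h.codChart.extend J
  have hxφ : x ∈ φ.source := by
    rw [OpenPartialHomeomorph.extend_source]; exact h.mem_domChart_source
  have hw : ∀ y ∈ φ.target, ψ (f (φ.symm y)) = h.equiv (y, 0) := fun y hy => h.writtenInCharts hy
  have hw' : ∀ z ∈ φ.source, (h.equiv.symm (ψ (f z))).1 = φ z := fun z hz => by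
    have := hw _ (φ.map_source hz)
    rw [φ.left_inv hz] at this
    rw [this]; simp
  have hψc : ContMDiffAt J 𝓘(ℝ, E') ∞ ψ (f x) :=
    OpenPartialHomeomorph.contMDiffAt_extend h.codChart_mem_maximalAtlas h.mem_codChart_source
  have hlin : ContMDiffAt J 𝓘(ℝ, E) ∞ (fun y => (h.equiv.symm (ψ y)).1) (f x) := by
    have h1 : ContMDiffAt J 𝓘(ℝ, E × hf.complement) ∞ (fun y => h.equiv.symm (ψ y)) (f x) :=
      ContMDiffAt.comp (f x) (h.equiv.symm.toContinuousLinearMap.contMDiff.contMDiffAt) hψc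
    exact ContMDiffAt.comp (f x)
      ((ContinuousLinearMap.fst ℝ E hf.complement).contMDiff.contMDiffAt) h1
  refine ⟨fun y => φ.symm (h.equiv.symm (ψ y)).1, ?_, ?_⟩
  · refine ContMDiffAt.comp (f x) (g := φ.symm) ?_ hlin
    refine contMDiffAt_extend_symm h.domChart_mem_maximalAtlas ?_
    rw [hw' x hxφ]; exact φ.map_source hxφ
  · filter_upwards [(OpenPartialHomeomorph.isOpen_extend_source _).mem_nhds hxφ] with z hz
    rw [hw' z hz, φ.left_inv hz]

omit [J.Boundaryless] [IsManifold J ∞ N] in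
theorem mfderiv_injective_of_isImmersionAt {f : M → N} {x : M}
    (hf : IsImmersionAt I J ∞ f x) : Function.Injective (mfderiv I J f x) := by
  obtain ⟨r, hr, h⟩ := exists_retraction_of_isImmersionAt hf
  have h0 : r ∘ f =ᶠ[𝓝 x] id := h
  have h1 := mfderiv_comp x (hr.mdifferentiableAt (by simp))
    (hf.contMDiffAt.mdifferentiableAt (by simp))
  rw [h0.mfderiv_eq, mfderiv_id] at h1
  exact Function.LeftInverse.injective (g := mfderiv J I r (f x))
    fun v => (DFunLike.congr_fun h1 v).symm

omit [J.Boundaryless] in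
/-- A smooth map with surjective differential is a submersion. -/
theorem isSubmersionAtOfComplement_of_surjective [FiniteDimensional ℝ E] [FiniteDimensional ℝ E']
    {F : Type*} [NormedAddCommGroup F] [NormedSpace ℝ F]
    [FiniteDimensional ℝ F] {f : M → N} {x : M} (hf : ContMDiff I J ∞ f)
    (hs : Function.Surjective (mfderiv I J f x))
    (hdim : Module.finrank ℝ E = Module.finrank ℝ E' + Module.finrank ℝ F) :
    IsSubmersionAtOfComplement F I J ∞ f x := by
  obtain ⟨e, hxe, hes, hef, he, hesymm⟩ := exists_chart_of_surjective hf hs hdim 0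
  -- The maximal atlas consists of charts into `H`, so the chart into `E' × F` is carried there
  -- through `L` and the model with corners.
  let L : E ≃L[ℝ] E' × F := ContinuousLinearEquiv.ofFinrankEq (by rw [hdim, Module.finrank_prod])
  let e' : OpenPartialHomeomorph M H :=
    (e.trans L.symm.toHomeomorph.toOpenPartialHomeomorph).trans
      I.toHomeomorph.symm.toOpenPartialHomeomorph
  have hsrc : e'.source = e.source := by simp [e']
  have htgt : ∀ t ∈ e'.target, L (I t) ∈ e.target := fun t ht => by
    simpa [e'] using ht
  have he' : ContMDiffOn I I ∞ e' e'.source := by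
    rw [hsrc]
    have h1 : ContMDiffOn I 𝓘(ℝ, E) ∞ (fun z => L.symm (e z)) e.source :=
      L.symm.toContinuousLinearMap.contMDiff.comp_contMDiffOn he
    have h2 : ContMDiffOn 𝓘(ℝ, E) I ∞ I.symm univ := I.range_eq_univ ▸ I.contMDiffOn_symm
    exact h2.comp h1 fun _ _ => trivial
  have hes' : ContMDiffOn I I ∞ e'.symm e'.target := by
    have h1 : ContMDiffOn I 𝓘(ℝ, E' × F) ∞ (fun t => L (I t)) e'.target :=
      (L.toContinuousLinearMap.contMDiff.comp I.contMDiff).contMDiffOn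
    exact hesymm.comp h1 htgt
  have hval : ∀ z, L (e'.extend I z) = e z := fun z => by
    change L (I (I.symm (L.symm (e z)))) = e z
    rw [I.right_inv (by rw [I.range_eq_univ]; trivial), L.apply_symm_apply]
  refine IsSubmersionAtOfComplement.mk_of_charts L e' (chartAt H' (f x)) (by rw [hsrc]; exact hxe)
    (mem_chart_source H' (f x)) (e'.mem_maximalAtlas_of_contMDiffOn he' hes')
    (IsManifold.chart_mem_maximalAtlas _) ?_ ?_
  · rw [hsrc, ← extChartAt_source (I := J)]
    exact hes
  · intro y hy
    have h1 := hef ((e'.extend I).symm y)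
    rw [← hval, (e'.extend I).right_inv hy, sub_zero] at h1
    exact h1.symm

end Submersion

/-! ### Smooth structures from families of charts: level sets and quotients -/

section Atlas

variable {F : Type*} [NormedAddCommGroup F] [NormedSpace ℝ F]
  {Q : Type*} [TopologicalSpace Q]

/-- The charted space defined by a family of charts. -/
abbrev chartedSpaceOfFamily {ι : Type*} (c : ι → OpenPartialHomeomorph Q F) (i : Q → ι)
    (hi : ∀ y, y ∈ (c (i y)).source) : ChartedSpace F Q where
  atlas := range c
  chartAt y := c (i y)
  mem_chart_source := hi
  chart_mem_atlas _ := mem_range_self _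

lemma isManifold_chartedSpaceOfFamily {ι : Type*} (c : ι → OpenPartialHomeomorph Q F) (i : Q → ι)
    (hi : ∀ y, y ∈ (c (i y)).source)
    (h : ∀ a b, ContDiffOn ℝ ∞ (fun t => c b ((c a).symm t))
      ((c a).target ∩ (c a).symm ⁻¹' (c b).source)) :
    letI := chartedSpaceOfFamily c i hi
    IsManifold 𝓘(ℝ, F) ∞ Q := by
  let := chartedSpaceOfFamily c i hi
  refine isManifold_of_contDiffOn _ _ _ ?_
  rintro _ _ ⟨a, rfl⟩ ⟨b, rfl⟩
  refine (h a b).mono ?_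
  intro t ht
  exact ht.1

end Atlas

section LevelSet

variable {E H : Type*} [NormedAddCommGroup E] [NormedSpace ℝ E] [FiniteDimensional ℝ E]
  [TopologicalSpace H] {I : ModelWithCorners ℝ E H} [I.Boundaryless]
  {M : Type*} [TopologicalSpace M] [ChartedSpace H M] [IsManifold I ∞ M]
  {E' H' : Type*} [NormedAddCommGroup E'] [NormedSpace ℝ E'] [FiniteDimensional ℝ E']
  [TopologicalSpace H'] {J : ModelWithCorners ℝ E' H'} [J.Boundaryless]
  {Q : Type*} [TopologicalSpace Q] [ChartedSpace H' Q] [IsManifold J ∞ Q]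
  {F : Type*} [NormedAddCommGroup F] [NormedSpace ℝ F] [FiniteDimensional ℝ F]
  {N : Type*} [TopologicalSpace N]

/-- The chart of a level set cut out by a chart of the ambient manifold. -/
def sliceChart (i : N → M) (hi : IsEmbedding i) (e : OpenPartialHomeomorph M (E' × F))
    (h0 : ∀ z, i z ∈ e.source → (e (i z)).1 = 0)
    (h1 : ∀ t : F, ((0 : E'), t) ∈ e.target → e.symm (0, t) ∈ range i) (z₀ : N) :
    OpenPartialHomeomorph N F :=
  -- `z₀` only supplies the default value that `Function.invFun` requires; on the target a preimage
  -- exists.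
  have hinv : ∀ t : F, ((0 : E'), t) ∈ e.target →
      i (@Function.invFun _ _ ⟨z₀⟩ i (e.symm (0, t))) = e.symm (0, t) :=
    fun t ht => @Function.invFun_eq _ _ ⟨z₀⟩ _ _ (h1 t ht)
  have heq : ∀ z, i z ∈ e.source → ((0 : E'), (e (i z)).2) = e (i z) :=
    fun z hz => Prod.ext (h0 z hz).symm rfl
  { toFun := fun z => (e (i z)).2
    invFun := fun t => @Function.invFun _ _ ⟨z₀⟩ i (e.symm (0, t))
    source := i ⁻¹' e.source
    target := {t | ((0 : E'), t) ∈ e.target}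
    map_source' := fun z hz => by
      change ((0 : E'), (e (i z)).2) ∈ e.target
      rw [heq z hz]; exact e.map_source hz
    map_target' := fun t ht => by
      change i _ ∈ e.source
      rw [hinv t ht]; exact e.map_target ht
    left_inv' := fun z hz => by
      apply hi.injective
      have h2 : ((0 : E'), (e (i z)).2) ∈ e.target := by
        rw [heq z hz]; exact e.map_source hz
      rw [hinv _ h2, heq z hz, e.left_inv hz]
    right_inv' := fun t ht => by
      rw [hinv t ht, e.right_inv ht]
    open_source := e.open_source.preimage hi.continuous
    open_target := e.open_target.preimage (by fun_prop)
    continuousOn_toFun := continuous_snd.comp_continuousOn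
      (e.continuousOn.comp hi.continuous.continuousOn fun _ h => h)
    continuousOn_invFun := by
      rw [hi.continuousOn_iff]
      refine ContinuousOn.congr (f := fun t => e.symm ((0 : E'), t)) ?_ fun t ht => hinv t ht
      exact e.continuousOn_symm.comp (by fun_prop) fun t ht => ht }

omit [NormedSpace ℝ E'] [FiniteDimensional ℝ E'] [NormedSpace ℝ F] [FiniteDimensional ℝ F] in
lemma apply_sliceChart_symm (i : N → M) (hi : IsEmbedding i) (e : OpenPartialHomeomorph M (E' × F))
    (h0 : ∀ z, i z ∈ e.source → (e (i z)).1 = 0)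
    (h1 : ∀ t : F, ((0 : E'), t) ∈ e.target → e.symm (0, t) ∈ range i) (z₀ : N) {t : F}
    (ht : t ∈ (sliceChart i hi e h0 h1 z₀).target) :
    i ((sliceChart i hi e h0 h1 z₀).symm t) = e.symm (0, t) :=
  @Function.invFun_eq _ _ ⟨z₀⟩ _ _ (h1 t ht)

omit [J.Boundaryless] in
/-- The regular value theorem. -/
theorem exists_chartedSpace_levelSet {f : M → Q} (hf : ContMDiff I J ∞ f) (q : Q)
    {i : N → M} (hi : IsEmbedding i) (hr : range i = f ⁻¹' {q})
    (hs : ∀ z, Function.Surjective (mfderiv I J f (i z)))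
    (hdim : N → Module.finrank ℝ E = Module.finrank ℝ E' + Module.finrank ℝ F) :
    ∃ (_ : ChartedSpace F N) (_ : IsManifold 𝓘(ℝ, F) ∞ N),
      Manifold.IsSmoothEmbedding 𝓘(ℝ, F) I ∞ i := by
  have hfi : ∀ z, f (i z) = q := fun z => by
    have : i z ∈ f ⁻¹' {q} := hr ▸ mem_range_self z
    exact this
  -- Translating by the chart value of `q` puts the level set on the slice where the first component
  -- vanishes. The dimension count is taken at a point of `N`, so an empty level set imposes none.
  choose e hxe hes hef he hesymm using fun z : N =>
    exists_chart_of_surjective (F := F) hf (hs z) (hdim z) (extChartAt J (f (i z)) q)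
  have h0 : ∀ z₀ z, i z ∈ (e z₀).source → (e z₀ (i z)).1 = 0 := fun z₀ z hz => by
    rw [hef, hfi z, sub_self]
  have h1 : ∀ z₀, ∀ t : F, ((0 : E'), t) ∈ (e z₀).target → (e z₀).symm (0, t) ∈ range i := by
    intro z₀ t ht
    rw [hr]
    have h2 := hef z₀ ((e z₀).symm (0, t))
    rw [(e z₀).right_inv ht] at h2
    have h3 : extChartAt J (f (i z₀)) (f ((e z₀).symm (0, t))) = extChartAt J (f (i z₀)) q :=
      (sub_eq_zero.1 h2.symm)
    refine (extChartAt J (f (i z₀))).injOn (hes z₀ ((e z₀).map_target ht)) ?_ h3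
    rw [hfi z₀]; exact mem_extChartAt_source q
  let c : N → OpenPartialHomeomorph N F := fun z₀ => sliceChart i hi (e z₀) (h0 z₀) (h1 z₀) z₀
  have hcs : ∀ z₀ t, t ∈ (c z₀).target → i ((c z₀).symm t) = (e z₀).symm (0, t) :=
    fun z₀ t ht => apply_sliceChart_symm i hi (e z₀) (h0 z₀) (h1 z₀) z₀ ht
  have hinc : ContDiff ℝ ∞ (fun t : F => ((0 : E'), t)) := contDiff_const.prodMk contDiff_id
  let cs : ChartedSpace F N := chartedSpaceOfFamily c id hxe
  have man : IsManifold 𝓘(ℝ, F) ∞ N := by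
    refine isManifold_chartedSpaceOfFamily c id hxe fun a b => ?_
    have h2 : ContMDiffOn 𝓘(ℝ, F) 𝓘(ℝ, E' × F) ∞ (fun t : F => e b ((e a).symm (0, t)))
        ((c a).target ∩ (c a).symm ⁻¹' (c b).source) := by
      have h3 : ContMDiffOn 𝓘(ℝ, F) I ∞ (fun t : F => (e a).symm (0, t))
          ((c a).target ∩ (c a).symm ⁻¹' (c b).source) :=
        (hesymm a).comp hinc.contMDiff.contMDiffOn fun t ht => ht.1
      refine (he b).comp h3 fun t ht => ?_
      change (e a).symm (0, t) ∈ (e b).source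
      rw [← hcs a t ht.1]; exact ht.2
    have h4 : ContDiffOn ℝ ∞ (fun t : F => (e b ((e a).symm (0, t))).2)
        ((c a).target ∩ (c a).symm ⁻¹' (c b).source) :=
      contDiff_snd.comp_contDiffOn (contMDiffOn_iff_contDiffOn.1 h2)
    refine h4.congr fun t ht => ?_
    change (e b (i ((c a).symm t))).2 = _
    rw [hcs a t ht.1]
  refine ⟨cs, man, ?_, hi⟩
  refine Manifold.IsImmersionOfComplement.isImmersion (F := E') fun z₀ => ?_
  -- In the chart `e z₀`, with its factors exchanged, the inclusion becomes `t ↦ (t, 0)`, the normal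
  -- form of an immersion.
  let L : (F × E') ≃L[ℝ] E := ContinuousLinearEquiv.ofFinrankEq (by
    rw [hdim z₀, Module.finrank_prod, add_comm])
  let sw : (E' × F) ≃L[ℝ] (F × E') := ContinuousLinearEquiv.prodComm ℝ E' F
  let A : (E' × F) ≃L[ℝ] E := sw.trans L
  let e' : OpenPartialHomeomorph M H :=
    ((e z₀).trans A.toHomeomorph.toOpenPartialHomeomorph).trans
      I.toHomeomorph.symm.toOpenPartialHomeomorph
  have hsrc : e'.source = (e z₀).source := by simp [e']
  have htgt : ∀ t ∈ e'.target, A.symm (I t) ∈ (e z₀).target := fun t ht => by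
    simpa [e'] using ht
  have he' : ContMDiffOn I I ∞ e' e'.source := by
    rw [hsrc]
    have h1 : ContMDiffOn I 𝓘(ℝ, E) ∞ (fun z => A (e z₀ z)) (e z₀).source :=
      A.toContinuousLinearMap.contMDiff.comp_contMDiffOn (he z₀)
    have h2 : ContMDiffOn 𝓘(ℝ, E) I ∞ I.symm univ := I.range_eq_univ ▸ I.contMDiffOn_symm
    exact h2.comp h1 fun _ _ => trivial
  have hes' : ContMDiffOn I I ∞ e'.symm e'.target := by
    have h1 : ContMDiffOn I 𝓘(ℝ, E' × F) ∞ (fun t => A.symm (I t)) e'.target :=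
      (A.symm.toContinuousLinearMap.contMDiff.comp I.contMDiff).contMDiffOn
    exact (hesymm z₀).comp h1 htgt
  have hval : ∀ z, e'.extend I z = A (e z₀ z) := fun z => by
    change I (I.symm (A (e z₀ z))) = A (e z₀ z)
    rw [I.right_inv (by rw [I.range_eq_univ]; trivial)]
  refine Manifold.IsImmersionAtOfComplement.mk_of_charts L (c z₀) e' (hxe z₀)
    (by rw [hsrc]; exact hxe z₀) ?_ (e'.mem_maximalAtlas_of_contMDiffOn he' hes') ?_ ?_
  · exact IsManifold.chart_mem_maximalAtlas (I := 𝓘(ℝ, F)) (M := N) z₀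
  · intro z hz
    change i z ∈ e'.source
    rw [hsrc]; exact hz
  · intro t ht
    have ht' : t ∈ (c z₀).target := by simpa using ht
    change e'.extend I (i ((c z₀).symm t)) = L (t, 0)
    rw [hval, hcs z₀ t ht', (e z₀).right_inv ht']
    rfl

end LevelSet

section Quotient

variable {E H : Type*} [NormedAddCommGroup E] [NormedSpace ℝ E]
  [TopologicalSpace H] {I : ModelWithCorners ℝ E H}
  {P : Type*} [TopologicalSpace P] [ChartedSpace H P]
  {F : Type*} [NormedAddCommGroup F] [NormedSpace ℝ F]
  {Q : Type*} [TopologicalSpace Q]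

/-- A quotient of a manifold is a manifold if it has charts that lift smoothly. -/
theorem exists_chartedSpace_quotient {q : P → Q} (hq : Function.Surjective q)
    (hc : Continuous q)
    (h : ∀ p : P, ∃ (c : OpenPartialHomeomorph Q F) (s : F → P), q p ∈ c.source ∧
      ContMDiffOn I 𝓘(ℝ, F) ∞ (c ∘ q) (q ⁻¹' c.source) ∧
      ContMDiffOn 𝓘(ℝ, F) I ∞ s c.target ∧ s (c (q p)) = p ∧
      ∀ t ∈ c.target, q (s t) = c.symm t) :
    ∃ (_ : ChartedSpace F Q) (_ : IsManifold 𝓘(ℝ, F) ∞ Q), ContMDiff I 𝓘(ℝ, F) ∞ q ∧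
      ∀ p, ∃ s : Q → P, ContMDiffAt 𝓘(ℝ, F) I ∞ s (q p) ∧ s (q p) = p ∧
        ∀ᶠ y in 𝓝 (q p), q (s y) = y := by
  choose c s hcp hcq hs hsp hqs using h
  choose i hi using hq
  have hi' : ∀ y, y ∈ (c (i y)).source := fun y => by
    have := hcp (i y); rwa [hi] at this
  let cs : ChartedSpace F Q := chartedSpaceOfFamily c i hi'
  have man : IsManifold 𝓘(ℝ, F) ∞ Q := by
    refine isManifold_chartedSpaceOfFamily c i hi' fun a b => ?_
    rw [← contMDiffOn_iff_contDiffOn]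
    -- A transition map factors through `P`: lift by `s a`, then apply `c b ∘ q`, and both are
    -- smooth.
    have h2 : ContMDiffOn 𝓘(ℝ, F) 𝓘(ℝ, F) ∞ ((c b ∘ q) ∘ s a)
        ((c a).target ∩ (c a).symm ⁻¹' (c b).source) := by
      refine (hcq b).comp ((hs a).mono inter_subset_left) fun t ht => ?_
      change q (s a t) ∈ (c b).source
      rw [hqs a t ht.1]; exact ht.2
    refine h2.congr fun t ht => ?_
    change _ = c b (q (s a t))
    rw [hqs a t ht.1]
  have hat : ∀ p, c p ∈ IsManifold.maximalAtlas 𝓘(ℝ, F) ∞ Q := fun p =>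
    IsManifold.subset_maximalAtlas (mem_range_self p)
  refine ⟨cs, man, fun p => ?_, fun p => ⟨fun y => s p (c p y), ?_, hsp p, ?_⟩⟩
  · have h1 : ContMDiffAt I 𝓘(ℝ, F) ∞ (fun z => (c p).symm ((c p ∘ q) z)) p :=
      ContMDiffAt.comp p (contMDiffAt_symm_of_mem_maximalAtlas (hat p) ((c p).map_source (hcp p)))
        ((hcq p).contMDiffAt (((c p).open_source.preimage hc).mem_nhds (hcp p)))
    refine h1.congr_of_eventuallyEq ?_
    filter_upwards [((c p).open_source.preimage hc).mem_nhds (hcp p)] with z hz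
    exact ((c p).left_inv hz).symm
  · exact ContMDiffAt.comp (q p)
      ((hs p).contMDiffAt ((c p).open_target.mem_nhds ((c p).map_source (hcp p))))
      (contMDiffAt_of_mem_maximalAtlas (hat p) (hcp p))
  · filter_upwards [(c p).open_source.mem_nhds (hcp p)] with y hy
    rw [hqs p _ ((c p).map_source hy), (c p).left_inv hy]

end Quotient

/-! ### Maurer–Cartan forms, adjoint action and generators -/

section LieGroupCalculus

variable {n : ℕ} {G : Type*} [TopologicalSpace G] [ChartedSpace (EuclideanSpace ℝ (Fin n)) G]
  [Group G] [LieGroup (𝓡 n) ∞ G]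
  {V H : Type*} [NormedAddCommGroup V] [NormedSpace ℝ V] [TopologicalSpace H]
  {I : ModelWithCorners ℝ V H} {P : Type*} [TopologicalSpace P] [ChartedSpace H P]

lemma mdifferentiable_mul_left (a : G) : MDifferentiable (𝓡 n) (𝓡 n) (fun x : G => a * x) :=
  (contMDiff_mul_left (I := 𝓡 n) (n := ∞)).mdifferentiable (by simp)

lemma mdifferentiable_mul_right (a : G) : MDifferentiable (𝓡 n) (𝓡 n) (fun x : G => x * a) :=
  (contMDiff_mul_right (I := 𝓡 n) (n := ∞)).mdifferentiable (by simp)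

lemma contMDiff_conj (a : G) : ContMDiff (𝓡 n) (𝓡 n) ∞ (fun x : G => a * x * a⁻¹) :=
  (contMDiff_mul_right (I := 𝓡 n) (n := ∞)).comp (contMDiff_mul_left (I := 𝓡 n) (n := ∞))

lemma mdifferentiable_conj (a : G) : MDifferentiable (𝓡 n) (𝓡 n) (fun x : G => a * x * a⁻¹) :=
  (contMDiff_conj a).mdifferentiable (by simp)

/-- The chain rule with values read in the model space, so that the base point and the factorization
need only hold propositionally. Factoring one map in two ways gives many of the identities below. -/
lemma mfderiv_comp_apply' {V' H' V'' H'' : Type*} [NormedAddCommGroup V'] [NormedSpace ℝ V']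
    [TopologicalSpace H'] {I' : ModelWithCorners ℝ V' H'}
    [NormedAddCommGroup V''] [NormedSpace ℝ V''] [TopologicalSpace H'']
    {I'' : ModelWithCorners ℝ V'' H''} {P' : Type*} [TopologicalSpace P'] [ChartedSpace H' P']
    {P'' : Type*} [TopologicalSpace P''] [ChartedSpace H'' P'']
    {g : P' → P''} {f : P → P'} {h : P → P''} (hh : ∀ x, h x = g (f x)) (x : P) (y : P')
    (hy : f x = y)
    (hg : MDifferentiableAt I' I'' g y) (hf : MDifferentiableAt I I' f x) (v : V) :
    (mfderiv I I'' h x v : V'') = (mfderiv I' I'' g y (mfderiv I I' f x v : V') : V'') := by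
  obtain rfl : h = g ∘ f := funext hh
  subst hy
  exact mfderiv_comp_apply x hg hf v

@[simp] lemma Ad_one : Ad n (1 : G) = ContinuousLinearMap.id ℝ _ := by
  have : (fun x : G => 1 * x * 1⁻¹) = id := by ext; simp
  rw [Ad, this]
  exact mfderiv_id

lemma Ad_mul_apply (a b : G) (x : GroupLieAlgebra (𝓡 n) G) :
    Ad n (a * b) x = Ad n a (Ad n b x) :=
  mfderiv_comp_apply' (g := fun x : G => a * x * a⁻¹) (f := fun x : G => b * x * b⁻¹)
    (by intro x; simp [mul_assoc]) 1 1 (by simp)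
    (mdifferentiable_conj a _) (mdifferentiable_conj b _) x

@[simp] lemma Ad_inv_apply_Ad (a : G) (x : GroupLieAlgebra (𝓡 n) G) : Ad n a⁻¹ (Ad n a x) = x := by
  rw [← Ad_mul_apply, inv_mul_cancel, Ad_one]; rfl

@[simp] lemma Ad_apply_Ad_inv (a : G) (x : GroupLieAlgebra (𝓡 n) G) : Ad n a (Ad n a⁻¹ x) = x := by
  rw [← Ad_mul_apply, mul_inv_cancel, Ad_one]; rfl

/-- From `x g⁻¹ = g (g⁻¹ x) g⁻¹`. -/
lemma thetaR_apply (g : G) (v : TangentSpace (𝓡 n) g) : thetaR g v = Ad n g (thetaL g v) :=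
  mfderiv_comp_apply' (g := fun x : G => g * x * g⁻¹) (f := fun x : G => g⁻¹ * x)
    (by intro x; simp) g 1 (by simp)
    (mdifferentiable_conj g _) (mdifferentiable_mul_left _ _) v

/-- The differential of a left translation, which trivializes the tangent bundle. -/
def leftTrans (g : G) : GroupLieAlgebra (𝓡 n) G →L[ℝ] TangentSpace (𝓡 n) g :=
  (mfderiv (𝓡 n) (𝓡 n) (fun x : G => g * x) 1 : EuclideanSpace ℝ (Fin n) →L[ℝ] _)

@[simp] lemma thetaL_leftTrans (g : G) (x : GroupLieAlgebra (𝓡 n) G) :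
    thetaL g (leftTrans g x) = x := by
  have h := mfderiv_comp_apply' (I := 𝓡 n) (h := id) (g := fun x : G => g⁻¹ * x)
    (f := fun x : G => g * x)
    (by intro x; simp) 1 g (by simp) (mdifferentiable_mul_left _ _) (mdifferentiable_mul_left _ _) x
  rw [mfderiv_id] at h
  exact h.symm

@[simp] lemma leftTrans_thetaL (g : G) (v : TangentSpace (𝓡 n) g) :
    leftTrans g (thetaL g v) = v := by
  have h := mfderiv_comp_apply' (I := 𝓡 n) (h := id) (f := fun x : G => g⁻¹ * x)
    (g := fun x : G => g * x)
    (by intro x; simp) g 1 (by simp) (mdifferentiable_mul_left _ _) (mdifferentiable_mul_left _ _) v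
  rw [mfderiv_id] at h
  exact h.symm

lemma thetaL_bijective (g : G) : Function.Bijective (thetaL (n := n) g) :=
  ⟨Function.LeftInverse.injective (leftTrans_thetaL g),
    Function.RightInverse.surjective (thetaL_leftTrans g)⟩

@[simp] lemma thetaL_one (v : TangentSpace (𝓡 n) (1 : G)) :
    (thetaL (1 : G) v : EuclideanSpace ℝ (Fin n)) = v := by
  have h : (fun x : G => 1⁻¹ * x) = id := by ext; simp
  rw [thetaL, h, mfderiv_id]
  rfl

variable {A B : P → G} {p : P}

/-- The Leibniz rule for the left Maurer-Cartan form. -/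
lemma thetaL_mfderiv_mul (hA : MDifferentiableAt I (𝓡 n) A p) (hB : MDifferentiableAt I (𝓡 n) B p)
    (v : TangentSpace I p) :
    thetaL (A p * B p) (mfderiv I (𝓡 n) (fun q => A q * B q) p v) =
      Ad n (B p)⁻¹ (thetaL (A p) (mfderiv I (𝓡 n) A p v))
        + thetaL (B p) (mfderiv I (𝓡 n) B p v) := by
  have h1 : (mfderiv I (𝓡 n) (fun q => A q * B q) p v : EuclideanSpace ℝ (Fin n)) =
      (mfderiv (𝓡 n) (𝓡 n) (fun x : G => x * B p) (A p) (mfderiv I (𝓡 n) A p v) :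
        EuclideanSpace ℝ (Fin n)) +
      (mfderiv (𝓡 n) (𝓡 n) (fun x : G => A p * x) (B p) (mfderiv I (𝓡 n) B p v) :
        EuclideanSpace ℝ (Fin n)) := by
    have hmul : MDifferentiableAt ((𝓡 n).prod (𝓡 n)) (𝓡 n) (fun q : G × G => q.1 * q.2)
      (A p, B p) := (contMDiff_mul (𝓡 n) ∞).mdifferentiableAt (by simp)
    have h2 := mfderiv_comp_apply' (g := fun q : G × G => q.1 * q.2) (f := fun q => (A q, B q))
      (h := fun q => A q * B q)
      (fun _ => rfl) p (A p, B p) rfl hmul (hA.prodMk hB) v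
    refine h2.trans ?_
    have h3 := mfderiv_prod_eq_add_apply (v := (mfderiv I ((𝓡 n).prod (𝓡 n))
      (fun q => (A q, B q)) p v)) hmul
    refine h3.trans ?_
    rw [mfderiv_prodMk hA hB]
    rfl
  have h2 : (thetaL (A p * B p) (mfderiv (𝓡 n) (𝓡 n) (fun x : G => x * B p) (A p)
      (mfderiv I (𝓡 n) A p v)) : EuclideanSpace ℝ (Fin n)) =
      Ad n (B p)⁻¹ (thetaL (A p) (mfderiv I (𝓡 n) A p v)) := by
    have e1 := mfderiv_comp_apply' (I := 𝓡 n) (h := fun x : G => (A p * B p)⁻¹ * (x * B p))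
      (g := fun x : G => (A p * B p)⁻¹ * x) (f := fun x : G => x * B p) (fun _ => rfl) (A p) _ rfl
      (mdifferentiable_mul_left _ _) (mdifferentiable_mul_right _ _) (mfderiv I (𝓡 n) A p v)
    have e2 := mfderiv_comp_apply' (I := 𝓡 n) (h := fun x : G => (A p * B p)⁻¹ * (x * B p))
      (g := fun x : G => (B p)⁻¹ * x * ((B p)⁻¹)⁻¹) (f := fun x : G => (A p)⁻¹ * x)
      (by intro x; simp [mul_assoc]) (A p) 1 (by simp)
      (mdifferentiable_conj _ _) (mdifferentiable_mul_left _ _) (mfderiv I (𝓡 n) A p v)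
    exact e1.symm.trans e2
  have h3 : (thetaL (A p * B p) (mfderiv (𝓡 n) (𝓡 n) (fun x : G => A p * x) (B p)
      (mfderiv I (𝓡 n) B p v)) : EuclideanSpace ℝ (Fin n)) =
      thetaL (B p) (mfderiv I (𝓡 n) B p v) := by
    have e1 := mfderiv_comp_apply' (I := 𝓡 n) (h := fun x : G => (B p)⁻¹ * x)
      (g := fun x : G => (A p * B p)⁻¹ * x) (f := fun x : G => A p * x)
      (by intro x; simp [mul_assoc]) (B p) _ rfl
      (mdifferentiable_mul_left _ _) (mdifferentiable_mul_left _ _) (mfderiv I (𝓡 n) B p v)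
    exact e1.symm
  refine (congrArg (thetaL (A p * B p)) h1).trans ?_
  refine ((thetaL (A p * B p)).map_add _ _).trans ?_
  exact congrArg₂ (· + ·) h2 h3

lemma thetaL_mfderiv_const (a : G) (v : TangentSpace I p) :
    thetaL a (mfderiv I (𝓡 n) (fun _ : P => a) p v) = 0 := by
  rw [mfderiv_const]
  exact (thetaL a).map_zero

lemma mdifferentiableAt_inv (hA : MDifferentiableAt I (𝓡 n) A p) :
    MDifferentiableAt I (𝓡 n) (fun q => (A q)⁻¹) p :=
  MDifferentiableAt.comp p (((contMDiff_inv (𝓡 n) ∞).mdifferentiable (by simp)) (A p)) hA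

lemma mdifferentiableAt_mul (hA : MDifferentiableAt I (𝓡 n) A p)
    (hB : MDifferentiableAt I (𝓡 n) B p) : MDifferentiableAt I (𝓡 n) (fun q => A q * B q) p :=
  MDifferentiableAt.comp p (g := fun q : G × G => q.1 * q.2)
    ((contMDiff_mul (𝓡 n) ∞).mdifferentiableAt (by simp)) (hA.prodMk hB)

/-- The Leibniz rule applied to the constant product `A · A⁻¹ = 1`. -/
lemma thetaL_mfderiv_inv (hA : MDifferentiableAt I (𝓡 n) A p) (v : TangentSpace I p) :
    thetaL (A p)⁻¹ (mfderiv I (𝓡 n) (fun q => (A q)⁻¹) p v) =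
      -Ad n (A p) (thetaL (A p) (mfderiv I (𝓡 n) A p v)) := by
  have h := thetaL_mfderiv_mul hA (mdifferentiableAt_inv hA) v
  have h1 : (fun q => A q * (A q)⁻¹) = fun _ => (1 : G) := by ext; simp
  rw [h1, mfderiv_const] at h
  have h2 : (thetaL (A p * (A p)⁻¹) ((0 : TangentSpace I p →L[ℝ] TangentSpace (𝓡 n) (1 : G)) v)) = 0 :=
    (thetaL (A p * (A p)⁻¹)).map_zero
  rw [inv_inv] at h
  exact (neg_eq_of_add_eq_zero_right (h.symm.trans h2)).symm

/-- Left translation does not change the left Maurer-Cartan form. -/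
lemma thetaL_mfderiv_mul_left (a : G) (hA : MDifferentiableAt I (𝓡 n) A p)
    (v : TangentSpace I p) :
    thetaL (a * A p) (mfderiv I (𝓡 n) (fun q => a * A q) p v) =
      thetaL (A p) (mfderiv I (𝓡 n) A p v) := by
  have h := thetaL_mfderiv_mul (A := fun _ => a) mdifferentiableAt_const hA v
  rw [thetaL_mfderiv_const, map_zero, zero_add] at h
  exact h

lemma thetaL_mfderiv_conj (a : G) (hA : MDifferentiableAt I (𝓡 n) A p)
    (v : TangentSpace I p) :
    thetaL (a * A p * a⁻¹) (mfderiv I (𝓡 n) (fun q => a * A q * a⁻¹) p v) =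
      Ad n a (thetaL (A p) (mfderiv I (𝓡 n) A p v)) := by
  have h := thetaL_mfderiv_mul (A := fun q => a * A q) (B := fun _ => a⁻¹)
    (mdifferentiableAt_mul mdifferentiableAt_const hA) mdifferentiableAt_const v
  rw [thetaL_mfderiv_const, thetaL_mfderiv_mul_left a hA, add_zero, inv_inv] at h
  exact h

section Hom

variable {k : ℕ} {K : Type*} [TopologicalSpace K] [ChartedSpace (EuclideanSpace ℝ (Fin k)) K]
  [Group K] [LieGroup (𝓡 k) ∞ K] {φ : K →* G} (hφ : ContMDiff (𝓡 k) (𝓡 n) ∞ φ)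

-- Both sides differentiate the map `x ↦ φ(a)⁻¹ φ(x) = φ(a⁻¹ x)`.
include hφ in
lemma thetaL_mfderiv_hom (a : K) (v : TangentSpace (𝓡 k) a) :
    (thetaL (φ a) (mfderiv (𝓡 k) (𝓡 n) φ a v) : EuclideanSpace ℝ (Fin n)) =
      mfderiv (𝓡 k) (𝓡 n) φ 1 (thetaL a v : EuclideanSpace ℝ (Fin k)) := by
  have hd : MDifferentiable (𝓡 k) (𝓡 n) φ := hφ.mdifferentiable (by simp)
  have e1 := mfderiv_comp_apply' (I := 𝓡 k) (h := fun x : K => (φ a)⁻¹ * φ x)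
      (g := fun x : G => (φ a)⁻¹ * x) (f := φ) (fun _ => rfl) a _ rfl
      (mdifferentiable_mul_left _ _) (hd a) v
  have e2 := mfderiv_comp_apply' (I := 𝓡 k) (h := fun x : K => (φ a)⁻¹ * φ x)
      (g := φ) (f := fun x : K => a⁻¹ * x) (by intro x; simp) a 1 (by simp)
      (hd 1) (mdifferentiable_mul_left _ _) v
  exact e1.symm.trans e2

include hφ in
lemma Ad_mfderiv_hom (a : K) (v : GroupLieAlgebra (𝓡 k) K) :
    (Ad n (φ a) (mfderiv (𝓡 k) (𝓡 n) φ 1 v : EuclideanSpace ℝ (Fin n)) : EuclideanSpace ℝ (Fin n))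
      = mfderiv (𝓡 k) (𝓡 n) φ 1 (Ad k a v : EuclideanSpace ℝ (Fin k)) := by
  have hd : MDifferentiable (𝓡 k) (𝓡 n) φ := hφ.mdifferentiable (by simp)
  have e1 := mfderiv_comp_apply' (I := 𝓡 k) (h := fun x : K => φ a * φ x * (φ a)⁻¹)
      (g := fun x : G => φ a * x * (φ a)⁻¹) (f := φ) (fun _ => rfl) 1 1 (map_one φ)
      (mdifferentiable_conj _ _) (hd 1) v
  have e2 := mfderiv_comp_apply' (I := 𝓡 k) (h := fun x : K => φ a * φ x * (φ a)⁻¹)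
      (g := φ) (f := fun x : K => a * x * a⁻¹) (by intro x; simp) 1 1 (by simp)
      (hd 1) (mdifferentiable_conj _ _) v
  exact e1.symm.trans e2

end Hom

section Action

variable {m : ℕ} {M : Type*} [TopologicalSpace M] [ChartedSpace (EuclideanSpace ℝ (Fin m)) M]
  [MulAction G M]
  (hσ : ContMDiff ((𝓡 n).prod (𝓡 m)) (𝓡 m) ∞ (fun p : G × M => p.1 • p.2))

include hσ

omit [LieGroup (𝓡 n) ∞ G] in
lemma contMDiff_smul_left (g : G) : ContMDiff (𝓡 m) (𝓡 m) ∞ (fun x : M => g • x) :=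
  hσ.comp (contMDiff_const.prodMk contMDiff_id)

omit [LieGroup (𝓡 n) ∞ G] in
lemma mdifferentiable_smul_left (g : G) : MDifferentiable (𝓡 m) (𝓡 m) (fun x : M => g • x) :=
  (contMDiff_smul_left hσ g).mdifferentiable (by simp)

omit [LieGroup (𝓡 n) ∞ G] in
lemma mdifferentiable_smul_right (x : M) : MDifferentiable (𝓡 n) (𝓡 m) (fun g : G => g • x) :=
  (hσ.comp (contMDiff_id.prodMk contMDiff_const)).mdifferentiable (by simp)

/-- Write `g • x = a • ((a⁻¹ g) • x)`; the inner factor passes through `1` at `g = a`, where its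
differential is a generator. -/
lemma mfderiv_smul_right_apply (a : G) (x : M) (v : TangentSpace (𝓡 n) a) :
    (mfderiv (𝓡 n) (𝓡 m) (fun g : G => g • x) a v : EuclideanSpace ℝ (Fin m)) =
      mfderiv (𝓡 m) (𝓡 m) (fun y : M => a • y) x (generator (thetaL a v) x) := by
  have e1 := mfderiv_comp_apply' (I := 𝓡 n) (h := fun g : G => (a⁻¹ * g) • x)
      (g := fun g : G => g • x) (f := fun g : G => a⁻¹ * g) (fun _ => rfl) a 1 (by simp)
      (mdifferentiable_smul_right hσ x _) (mdifferentiable_mul_left _ _) v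
  have e2 := mfderiv_comp_apply' (I := 𝓡 n) (h := fun g : G => g • x)
      (g := fun y : M => a • y) (f := fun g : G => (a⁻¹ * g) • x)
      (by intro g; simp [smul_smul]) a x (by simp)
      (mdifferentiable_smul_left hσ a _)
      (MDifferentiableAt.comp a (g := fun g : G => g • x) (f := fun g : G => a⁻¹ * g)
        (mdifferentiable_smul_right hσ x _) (mdifferentiable_mul_left a⁻¹ a)) v
  refine e2.trans ?_
  exact congrArg (mfderiv (𝓡 m) (𝓡 m) (fun y : M => a • y) x) e1

omit [LieGroup (𝓡 n) ∞ G] in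
lemma generator_add (ξ ζ : GroupLieAlgebra (𝓡 n) G) (x : M) :
    generator (m := m) (ξ + ζ) x = generator ξ x + generator ζ x :=
  map_add (mfderiv (𝓡 n) (𝓡 m) (fun g : G => g • x) 1) ξ ζ

/-- The Leibniz rule for an action. -/
lemma mfderiv_smul_apply {b : P → M} (hA : MDifferentiableAt I (𝓡 n) A p)
    (hb : MDifferentiableAt I (𝓡 m) b p) (v : TangentSpace I p) :
    (mfderiv I (𝓡 m) (fun q => A q • b q) p v : EuclideanSpace ℝ (Fin m)) =
      mfderiv (𝓡 m) (𝓡 m) (fun y : M => A p • y) (b p)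
        (generator (thetaL (A p) (mfderiv I (𝓡 n) A p v)) (b p) + mfderiv I (𝓡 m) b p v) := by
  have hmul : MDifferentiableAt ((𝓡 n).prod (𝓡 m)) (𝓡 m) (fun q : G × M => q.1 • q.2)
      (A p, b p) := hσ.mdifferentiableAt (by simp)
  have h2 := mfderiv_comp_apply' (g := fun q : G × M => q.1 • q.2) (f := fun q => (A q, b q))
    (h := fun q => A q • b q)
    (fun _ => rfl) p (A p, b p) rfl hmul (hA.prodMk hb) v
  refine h2.trans ?_
  have h3 := mfderiv_prod_eq_add_apply (v := (mfderiv I ((𝓡 n).prod (𝓡 m))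
    (fun q => (A q, b q)) p v)) hmul
  refine h3.trans ?_
  rw [mfderiv_prodMk hA hb]
  refine Eq.trans ?_ ((mfderiv (𝓡 m) (𝓡 m) (fun y : M => A p • y) (b p)).map_add _ _).symm
  exact congrArg₂ (· + ·) (mfderiv_smul_right_apply hσ (A p) (b p) _) rfl

/-- From `g • (h • x) = (g h g⁻¹) • (g • x)`, differentiated in `h` at `1`. -/
lemma mfderiv_smul_generator (g : G) (ξ : GroupLieAlgebra (𝓡 n) G) (x : M) :
    (mfderiv (𝓡 m) (𝓡 m) (fun y : M => g • y) x (generator ξ x) : EuclideanSpace ℝ (Fin m)) =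
      generator (Ad n g ξ) (g • x) := by
  have e1 := mfderiv_comp_apply' (I := 𝓡 n) (h := fun h : G => (g * h) • x)
      (g := fun y : M => g • y) (f := fun h : G => h • x) (by intro h; simp [mul_smul]) 1 x
      (one_smul G x) (mdifferentiable_smul_left hσ g _) (mdifferentiable_smul_right hσ x _) ξ
  have e2 := mfderiv_comp_apply' (I := 𝓡 n) (h := fun h : G => (g * h) • x)
      (g := fun h : G => h • (g • x)) (f := fun h : G => g * h * g⁻¹)
      (by intro h; simp [smul_smul]) 1 1
      (by simp) (mdifferentiable_smul_right hσ _ _) (mdifferentiable_conj _ _) ξ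
  exact e1.symm.trans e2

/-- The moment map intertwines generators. -/
lemma thetaL_mfderiv_moment {μ : M → G} (hμ : MDifferentiable (𝓡 m) (𝓡 n) μ)
    (he : ∀ (g : G) (x : M), μ (g • x) = g * μ x * g⁻¹) (ξ : GroupLieAlgebra (𝓡 n) G) (x : M) :
    thetaL (μ x) (mfderiv (𝓡 m) (𝓡 n) μ x (generator ξ x)) = Ad n (μ x)⁻¹ ξ - ξ := by
  -- By equivariance `μ` along the orbit is `h ↦ h μ(x) h⁻¹`; its logarithmic derivative at `1`
  -- follows from the Leibniz rule.
  have e1 := mfderiv_comp_apply' (I := 𝓡 n) (h := fun h : G => h * μ x * h⁻¹)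
      (g := μ) (f := fun h : G => h • x) (by intro h; simp [he]) 1 x
      (one_smul G x) (hμ x) (mdifferentiable_smul_right hσ x _) ξ
  have hid : MDifferentiableAt (𝓡 n) (𝓡 n) (fun h : G => h) 1 := mdifferentiableAt_id
  have e2 := thetaL_mfderiv_mul (A := fun h : G => h * μ x) (B := fun h : G => h⁻¹) (p := 1)
    (mdifferentiableAt_mul hid mdifferentiableAt_const) (mdifferentiableAt_inv hid) ξ
  have e3 := thetaL_mfderiv_mul (A := fun h : G => h) (B := fun _ => μ x) (p := (1 : G))
    hid mdifferentiableAt_const ξ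
  have e4 := thetaL_mfderiv_inv (A := fun h : G => h) (p := (1 : G)) hid ξ
  have e5 : (thetaL (1 : G) (mfderiv (𝓡 n) (𝓡 n) (fun h : G => h) 1 ξ)) = ξ := by
    have : mfderiv (𝓡 n) (𝓡 n) (fun h : G => h) 1 = ContinuousLinearMap.id ℝ _ := mfderiv_id
    rw [this]; exact thetaL_one ξ
  rw [e5] at e3 e4
  rw [thetaL_mfderiv_const, add_zero] at e3
  rw [e3, e4] at e2
  have e6 : (1 : G) * μ x * 1⁻¹ = μ x := by simp
  have e7 : (thetaL (μ x) (mfderiv (𝓡 m) (𝓡 n) μ x (generator ξ x)) : EuclideanSpace ℝ (Fin n)) =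
      thetaL (1 * μ x * 1⁻¹) (mfderiv (𝓡 n) (𝓡 n) (fun h : G => h * μ x * h⁻¹) 1 ξ) := by
    rw [e1]
    have : ∀ g : G, g = μ x → ∀ v : EuclideanSpace ℝ (Fin n),
      (thetaL (μ x) v : EuclideanSpace ℝ (Fin n)) = thetaL g v := by
      rintro g rfl v; rfl
    exact this _ e6 _
  refine e7.trans (e2.trans ?_)
  rw [inv_inv, Ad_one]
  exact (sub_eq_add_neg _ _).symm

end Action

end LieGroupCalculus

/-! ### The Maurer–Cartan equation -/

section MaurerCartan

variable {n : ℕ} {G : Type*} [TopologicalSpace G] [ChartedSpace (EuclideanSpace ℝ (Fin n)) G]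
  [Group G] [LieGroup (𝓡 n) ∞ G]
  {V : Type*} [NormedAddCommGroup V] [NormedSpace ℝ V]
  {W H : Type*} [NormedAddCommGroup W] [NormedSpace ℝ W] [TopologicalSpace H]
  {I : ModelWithCorners ℝ W H} {P : Type*} [TopologicalSpace P] [ChartedSpace H P]

/-- The bracket of the Lie algebra of `G`, on the underlying vector space. -/
def lieBr (G : Type*) [TopologicalSpace G] [ChartedSpace (EuclideanSpace ℝ (Fin n)) G]
    [Group G] (x y : EuclideanSpace ℝ (Fin n)) : EuclideanSpace ℝ (Fin n) :=
  @Bracket.bracket (GroupLieAlgebra (𝓡 n) G) (GroupLieAlgebra (𝓡 n) G) _ x y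

/-- The pullback `A^* θ^L` for a map `A` from a vector space to a Lie group. -/
def logD (n : ℕ) {G : Type*} [TopologicalSpace G] [ChartedSpace (EuclideanSpace ℝ (Fin n)) G]
    [Group G] (A : V → G) (y : V) : V →L[ℝ] EuclideanSpace ℝ (Fin n) :=
  (thetaL (A y)).comp (mfderiv 𝓘(ℝ, V) (𝓡 n) A y)

/-- `Ad` with values in a normed space. -/
def AdE (n : ℕ) {G : Type*} [TopologicalSpace G] [ChartedSpace (EuclideanSpace ℝ (Fin n)) G]
    [Group G] (g : G) : EuclideanSpace ℝ (Fin n) →L[ℝ] EuclideanSpace ℝ (Fin n) := Ad n g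

lemma eventually_mdifferentiableAt {V' H' : Type*} [NormedAddCommGroup V'] [NormedSpace ℝ V']
    [TopologicalSpace H'] {I' : ModelWithCorners ℝ V' H'} {P' : Type*} [TopologicalSpace P']
    [ChartedSpace H' P'] [IsManifold I ∞ P] [IsManifold I' ∞ P'] {f : P → P'} {p : P}
    (hf : ContMDiffAt I I' ∞ f p) : ∀ᶠ q in 𝓝 p, MDifferentiableAt I I' f q := by
  have h1 : ContMDiffAt I I' 1 f p := ContMDiffAt.of_le hf (by simp)
  filter_upwards [(contMDiffAt_iff_contMDiffAt_nhds (by simp)).1 h1] with q hq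
  exact hq.mdifferentiableAt (by simp)

/-- The pullback `A^* θ^L`, as the differential of `z ↦ A(y)⁻¹ A(z)` at `y`. -/
def logDAux (n : ℕ) {G : Type*} [TopologicalSpace G] [ChartedSpace (EuclideanSpace ℝ (Fin n)) G]
    [Group G] (A : V → G) (y : V) : V →L[ℝ] EuclideanSpace ℝ (Fin n) :=
  mfderiv 𝓘(ℝ, V) (𝓡 n) (fun z => (A y)⁻¹ * A z) y

/-- The map `(y, z) ↦ A(y)⁻¹ A(z)` is `1` on the diagonal, so its partial differential in `z` there
has values in one fixed tangent space. The coordinate changes of the tangent bundle are then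
trivial, and smoothness of parametrized differentials applies. -/
lemma contMDiffAt_logD_aux {A : V → G} {y₀ : V} (hA : ContMDiffAt 𝓘(ℝ, V) (𝓡 n) ∞ A y₀) :
    ContMDiffAt 𝓘(ℝ, V) 𝓘(ℝ, V →L[ℝ] EuclideanSpace ℝ (Fin n)) ∞
      (logDAux n A) y₀ := by
  have hf : ContMDiffAt (𝓘(ℝ, V).prod 𝓘(ℝ, V)) (𝓡 n) ∞
      (Function.uncurry fun y z : V => (A y)⁻¹ * A z) (y₀, id y₀) := by
    have h1 : ContMDiffAt (𝓘(ℝ, V).prod 𝓘(ℝ, V)) (𝓡 n) ∞ (fun p : V × V => A p.1) (y₀, id y₀) :=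
      ContMDiffAt.comp (y₀, id y₀) (g := A) hA contMDiffAt_fst
    have h2 : ContMDiffAt (𝓘(ℝ, V).prod 𝓘(ℝ, V)) (𝓡 n) ∞ (fun p : V × V => A p.2) (y₀, id y₀) :=
      ContMDiffAt.comp (y₀, id y₀) (g := A) hA contMDiffAt_snd
    exact h1.inv.mul h2
  have h := ContMDiffAt.mfderiv (m := ∞) (fun y z : V => (A y)⁻¹ * A z) id hf contMDiffAt_id
    (by simp)
  refine h.congr_of_eventuallyEq (Eventually.of_forall fun y => ?_)
  refine (Eq.trans (inTangentCoordinates_eq _ _ _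
    (by rw [chartAt_self_eq]; exact mem_univ _) ?_) ?_).symm
  · simp only [id_eq, inv_mul_cancel]; exact mem_chart_source _ _
  · simp only [id_eq, inv_mul_cancel]
    ext v i
    have e1 : (tangentBundleCore 𝓘(ℝ, V) V).coordChange (achart V y₀) (achart V y) y
      = ContinuousLinearMap.id ℝ V := tangentBundleCore_coordChange_model_space _ _ _
    rw [e1]
    have e2 := (tangentBundleCore (𝓡 n) G).coordChange_self (achart _ (1 : G)) 1
      (mem_achart_source _ (1 : G))
    exact congrArg (fun w : EuclideanSpace ℝ (Fin n) => w i)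
      (e2 (mfderiv 𝓘(ℝ, V) (𝓡 n) (fun z => (A y)⁻¹ * A z) y v))

lemma logD_eq {A : V → G} {y : V} (hA : MDifferentiableAt 𝓘(ℝ, V) (𝓡 n) A y) :
    logD n A y = logDAux n A y := by
  ext1 v
  exact (mfderiv_comp_apply' (I := 𝓘(ℝ, V)) (g := fun x : G => (A y)⁻¹ * x) (f := A)
    (fun _ => rfl) y _ rfl (mdifferentiable_mul_left _ _) hA v).symm

theorem contDiffAt_logD {A : V → G} {y₀ : V} (hA : ContMDiffAt 𝓘(ℝ, V) (𝓡 n) ∞ A y₀) :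
    ContDiffAt ℝ ∞ (logD n A) y₀ := by
  rw [← contMDiffAt_iff_contDiffAt]
  refine (contMDiffAt_logD_aux hA).congr_of_eventuallyEq ?_
  filter_upwards [eventually_mdifferentiableAt hA] with y hy
  exact logD_eq hy

theorem contMDiff_AdE : ContMDiff (𝓡 n) 𝓘(ℝ, EuclideanSpace ℝ (Fin n) →L[ℝ] EuclideanSpace ℝ (Fin n))
    ∞ (AdE n : G → _) := by
  intro g₀
  have hf : ContMDiffAt ((𝓡 n).prod (𝓡 n)) (𝓡 n) ∞
      (Function.uncurry fun g x : G => g * x * g⁻¹) (g₀, (fun _ => 1 : G → G) g₀) :=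
    (contMDiffAt_fst.mul contMDiffAt_snd).mul contMDiffAt_fst.inv
  have h := ContMDiffAt.mfderiv (m := ∞) (fun g x : G => g * x * g⁻¹) (fun _ => 1) hf
    contMDiffAt_const (by simp)
  refine h.congr_of_eventuallyEq (Eventually.of_forall fun g => ?_)
  refine (Eq.trans (inTangentCoordinates_eq _ _ _ (by simp) ?_) ?_).symm
  · simp only [mul_one, mul_inv_cancel]; exact mem_chart_source _ _
  · simp only [mul_one, mul_inv_cancel]
    ext v i
    have e2 := (tangentBundleCore (𝓡 n) G).coordChange_self (achart _ (1 : G)) 1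
      (mem_achart_source _ (1 : G))
    refine (congrArg (fun w : EuclideanSpace ℝ (Fin n) => w i)
      (e2 (mfderiv (𝓡 n) (𝓡 n) (fun x => g * x * g⁻¹) 1 _))).trans ?_
    exact congrArg (fun w : EuclideanSpace ℝ (Fin n) =>
      (AdE n g w) i) (e2 v)

/-- The Maurer-Cartan equation at `1`, in the chart. -/
lemma maurerCartan_chart (u v : EuclideanSpace ℝ (Fin n)) :
    fderiv ℝ (logD n (extChartAt (𝓡 n) (1 : G)).symm) (extChartAt (𝓡 n) (1 : G) 1) u v
      - fderiv ℝ (logD n (extChartAt (𝓡 n) (1 : G)).symm) (extChartAt (𝓡 n) (1 : G) 1) v u =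
    -lieBr G (logD n (extChartAt (𝓡 n) (1 : G)).symm (extChartAt (𝓡 n) (1 : G) 1) u)
      (logD n (extChartAt (𝓡 n) (1 : G)).symm (extChartAt (𝓡 n) (1 : G) 1) v) := by
  set φ := extChartAt (𝓡 n) (1 : G) with hφ
  set y₀ := φ 1 with hy₀
  set δ := logD n φ.symm with hδ
  have hy₀t : y₀ ∈ φ.target := mem_extChartAt_target (1 : G)
  have hsm : ContMDiffAt 𝓘(ℝ, EuclideanSpace ℝ (Fin n)) (𝓡 n) ∞ φ.symm y₀ :=
    (contMDiffOn_extChartAt_symm (1 : G)).contMDiffAt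
      ((isOpen_extChartAt_target (1 : G)).mem_nhds hy₀t)
  have hδs : ContDiffAt ℝ ∞ δ y₀ := contDiffAt_logD hsm
  have hinv : ∀ y ∈ φ.target, ∃ A : EuclideanSpace ℝ (Fin n) ≃L[ℝ] EuclideanSpace ℝ (Fin n),
      (A : EuclideanSpace ℝ (Fin n) →L[ℝ] EuclideanSpace ℝ (Fin n)) =
        (mfderiv 𝓘(ℝ, EuclideanSpace ℝ (Fin n)) (𝓡 n) φ.symm y :
          EuclideanSpace ℝ (Fin n) →L[ℝ] EuclideanSpace ℝ (Fin n)) := by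
    intro y hy
    have h := isInvertible_mfderivWithin_extChartAt_symm (I := 𝓡 n) (x := (1 : G)) hy
    rw [ModelWithCorners.range_eq_univ, mfderivWithin_univ] at h
    exact h
  let T : G → EuclideanSpace ℝ (Fin n) ≃L[ℝ] EuclideanSpace ℝ (Fin n) := fun g =>
    ContinuousLinearEquiv.equivOfInverse (thetaL g) (leftTrans g) (leftTrans_thetaL g)
      (thetaL_leftTrans g)
  have hδinv : ∀ y ∈ φ.target, ∃ A : EuclideanSpace ℝ (Fin n) ≃L[ℝ] EuclideanSpace ℝ (Fin n),
      (A : EuclideanSpace ℝ (Fin n) →L[ℝ] EuclideanSpace ℝ (Fin n)) = δ y := by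
    intro y hy
    obtain ⟨A, hA⟩ := hinv y hy
    refine ⟨A.trans (T (φ.symm y)), ?_⟩
    ext1 w
    exact congrArg (thetaL (φ.symm y)) (DFunLike.congr_fun hA w)
  -- `F ξ` is the left-invariant field of `ξ` in the chart, characterized by `δ (F ξ) = ξ`.
  -- Differentiating this identity expresses the derivatives of `F ξ`, hence the bracket, through
  -- those of `δ`.
  let F : EuclideanSpace ℝ (Fin n) → EuclideanSpace ℝ (Fin n) → EuclideanSpace ℝ (Fin n) :=
    fun ξ y => (δ y).inverse ξ
  have hFδ : ∀ ξ, ∀ y ∈ φ.target, δ y (F ξ y) = ξ := fun ξ y hy => by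
    obtain ⟨A, hA⟩ := hδinv y hy
    have hi : (δ y).IsInvertible := ⟨A, hA⟩
    exact hi.self_apply_inverse ξ
  have hFd : ∀ ξ, DifferentiableAt ℝ (F ξ) y₀ := fun ξ => by
    obtain ⟨A, hA⟩ := hδinv y₀ hy₀t
    have h1 : ContDiffAt ℝ ∞ ContinuousLinearMap.inverse (δ y₀) := hA ▸ contDiffAt_map_inverse A
    have h2 : ContDiffAt ℝ ∞ (fun y => (δ y).inverse) y₀ := ContDiffAt.comp y₀ h1 hδs
    exact (h2.differentiableAt (by simp)).clm_apply (differentiableAt_const ξ)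
  have hδd : DifferentiableAt ℝ δ y₀ := hδs.differentiableAt (by simp)
  have hder : ∀ ξ w, δ y₀ (fderiv ℝ (F ξ) y₀ w) = -fderiv ℝ δ y₀ w (F ξ y₀) := by
    intro ξ w
    have h1 : HasFDerivAt (fun y => δ y (F ξ y)) _ y₀ :=
      hδd.hasFDerivAt.clm_apply (hFd ξ).hasFDerivAt
    have h2 : HasFDerivAt (fun y => δ y (F ξ y)) (0 : _ →L[ℝ] EuclideanSpace ℝ (Fin n)) y₀ := by
      refine (hasFDerivAt_const ξ y₀).congr_of_eventuallyEq ?_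
      filter_upwards [(isOpen_extChartAt_target (1 : G)).mem_nhds hy₀t] with y hy
      exact hFδ ξ y hy
    have h3 := DFunLike.congr_fun (h1.unique h2) w
    simp only [add_apply, ContinuousLinearMap.comp_apply,
      ContinuousLinearMap.flip_apply] at h3
    exact eq_neg_of_add_eq_zero_left h3
  have hpull : ∀ ξ : EuclideanSpace ℝ (Fin n), ∀ᶠ y in 𝓝 y₀,
      VectorField.mpullbackWithin 𝓘(ℝ, EuclideanSpace ℝ (Fin n)) (𝓡 n) φ.symm
        (mulInvariantVectorField (I := 𝓡 n) (G := G) ξ) (range (𝓡 n)) y = F ξ y := by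
    intro ξ
    filter_upwards [(isOpen_extChartAt_target (1 : G)).mem_nhds hy₀t] with y hy
    obtain ⟨A, hA⟩ := hinv y hy
    obtain ⟨B, hB⟩ := hδinv y hy
    have hAB : ∀ w, B w = thetaL (φ.symm y) (A w) := fun w => by
      have h1 : B w = δ y w := DFunLike.congr_fun hB w
      rw [h1]
      exact congrArg (thetaL (φ.symm y)) (DFunLike.congr_fun hA w).symm
    rw [VectorField.mpullbackWithin_apply, ModelWithCorners.range_eq_univ, mfderivWithin_univ]
    let D : EuclideanSpace ℝ (Fin n) →L[ℝ] EuclideanSpace ℝ (Fin n) :=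
      mfderiv 𝓘(ℝ, EuclideanSpace ℝ (Fin n)) (𝓡 n) φ.symm y
    have hD : (A : EuclideanSpace ℝ (Fin n) →L[ℝ] EuclideanSpace ℝ (Fin n)) = D := hA
    let w₀ : EuclideanSpace ℝ (Fin n) := leftTrans (φ.symm y) ξ
    change D.inverse w₀ = (δ y).inverse ξ
    rw [← hD, ← hB, ContinuousLinearMap.inverse_equiv, ContinuousLinearMap.inverse_equiv]
    apply B.injective
    have h2 : B (B.symm ξ) = ξ := B.apply_symm_apply ξ
    refine Eq.trans ?_ h2.symm
    refine (hAB _).trans ?_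
    refine (congrArg (thetaL (φ.symm y)) (A.apply_symm_apply _)).trans ?_
    exact thetaL_leftTrans (φ.symm y) ξ
  -- The bracket of the Lie algebra is by definition that of the left-invariant fields at `1`, which
  -- is computed in the chart.
  have hbr : ∀ ξ ζ : EuclideanSpace ℝ (Fin n),
      lieBr G ξ ζ = δ y₀ (fderiv ℝ (F ζ) y₀ (F ξ y₀) - fderiv ℝ (F ξ) y₀ (F ζ y₀)) := by
    intro ξ ζ
    let Vp : EuclideanSpace ℝ (Fin n) → EuclideanSpace ℝ (Fin n) → EuclideanSpace ℝ (Fin n) :=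
      fun ξ => VectorField.mpullbackWithin 𝓘(ℝ, EuclideanSpace ℝ (Fin n)) (𝓡 n) φ.symm
            (mulInvariantVectorField (I := 𝓡 n) (G := G) ξ) (range (𝓡 n))
    let D : EuclideanSpace ℝ (Fin n) →L[ℝ] EuclideanSpace ℝ (Fin n) :=
      mfderiv (𝓡 n) 𝓘(ℝ, EuclideanSpace ℝ (Fin n)) φ (1 : G)
    have h1 : lieBr G ξ ζ = D.inverse
        (VectorField.lieBracketWithin ℝ (Vp ξ) (Vp ζ)
          (φ.symm ⁻¹' univ ∩ range (𝓡 n)) y₀) := rfl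
    have h2 : VectorField.lieBracketWithin ℝ (Vp ξ) (Vp ζ)
          (φ.symm ⁻¹' univ ∩ range (𝓡 n)) y₀ =
        fderiv ℝ (F ζ) y₀ (F ξ y₀) - fderiv ℝ (F ξ) y₀ (F ζ y₀) := by
      rw [preimage_univ, univ_inter, ModelWithCorners.range_eq_univ,
        VectorField.lieBracketWithin_univ]
      exact Filter.EventuallyEq.lieBracket_vectorField_eq (𝕜 := ℝ) (V₁ := Vp ξ) (V := F ξ)
        (W₁ := Vp ζ) (W := F ζ) (hpull ξ) (hpull ζ)
    rw [h1, h2]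
    have hDi : D.IsInvertible :=
      isInvertible_mfderiv_extChartAt (I := 𝓡 n) (mem_extChartAt_source (1 : G))
    obtain ⟨A, hA⟩ := hDi
    set z := fderiv ℝ (F ζ) y₀ (F ξ y₀) - fderiv ℝ (F ξ) y₀ (F ζ y₀) with hz
    rw [← hA, ContinuousLinearMap.inverse_equiv]
    have h3 : A (mfderiv 𝓘(ℝ, EuclideanSpace ℝ (Fin n)) (𝓡 n) φ.symm y₀ z) = z := by
      have h4 := mfderiv_comp_apply' (I := 𝓘(ℝ, EuclideanSpace ℝ (Fin n)))
        (h := φ ∘ φ.symm) (g := φ) (f := φ.symm) (I'' := 𝓘(ℝ, EuclideanSpace ℝ (Fin n)))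
        (fun _ => rfl) y₀ 1 (φ.left_inv (mem_extChartAt_source (1 : G)))
        (mdifferentiableAt_extChartAt (by simp)) (hsm.mdifferentiableAt (by simp)) z
      have h5 : (φ ∘ φ.symm) =ᶠ[𝓝 y₀] id := by
        filter_upwards [(isOpen_extChartAt_target (1 : G)).mem_nhds hy₀t] with y hy
        exact φ.right_inv hy
      rw [h5.mfderiv_eq, mfderiv_id] at h4
      have h6 := DFunLike.congr_fun hA
        (mfderiv 𝓘(ℝ, EuclideanSpace ℝ (Fin n)) (𝓡 n) φ.symm y₀ z)
      exact h6.trans h4.symm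
    have h7 : A.symm z = mfderiv 𝓘(ℝ, EuclideanSpace ℝ (Fin n)) (𝓡 n) φ.symm y₀ z := by
      apply A.injective
      exact (A.apply_symm_apply z).trans h3.symm
    refine h7.trans ?_
    have h8 : φ.symm y₀ = 1 := φ.left_inv (mem_extChartAt_source (1 : G))
    have h9 : ∀ g : G, g = 1 → ∀ w : EuclideanSpace ℝ (Fin n),
        (thetaL g w : EuclideanSpace ℝ (Fin n)) = w := by
      rintro g rfl w; exact thetaL_one w
    exact (h9 _ h8 _).symm
  -- With `ξ = δ w` the invariant field takes the prescribed value `w` at the base point, so all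
  -- tangent vectors are covered.
  have hFu : ∀ w, F (δ y₀ w) y₀ = w := fun w => by
    obtain ⟨A, hA⟩ := hδinv y₀ hy₀t
    have hi : (δ y₀).IsInvertible := ⟨A, hA⟩
    exact hi.inverse_apply_self w
  rw [hbr, map_sub, hder, hder, hFu, hFu]
  abel

/-- The Maurer-Cartan equation. -/
theorem maurerCartan {A : V → G} {y₀ : V} (hA : ContMDiffAt 𝓘(ℝ, V) (𝓡 n) ∞ A y₀) (u v : V) :
    fderiv ℝ (logD n A) y₀ u v - fderiv ℝ (logD n A) y₀ v u =
      -lieBr G (logD n A y₀ u) (logD n A y₀ v) := by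
  set φ := extChartAt (𝓡 n) (1 : G) with hφ
  -- Left translation does not change `A^* θ^L`, so the value at `y₀` may be taken to be `1`. Then
  -- the map factors through the chart at `1`, and its form is a pullback of the one treated there.
  let A' : V → G := fun y => (A y₀)⁻¹ * A y
  have hA' : ContMDiffAt 𝓘(ℝ, V) (𝓡 n) ∞ A' y₀ :=
    ContMDiffAt.comp y₀ (contMDiff_mul_left (I := 𝓡 n) (n := ∞)).contMDiffAt hA
  have hA'0 : A' y₀ = 1 := inv_mul_cancel _
  let f : V → EuclideanSpace ℝ (Fin n) := fun y => φ (A' y)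
  have hf : ContDiffAt ℝ ∞ f y₀ := by
    rw [← contMDiffAt_iff_contDiffAt]
    refine ContMDiffAt.comp y₀ (g := φ) ?_ hA'
    rw [hA'0]; exact contMDiffAt_extChartAt
  have hf0 : f y₀ = φ 1 := congrArg φ hA'0
  have hsm : ContMDiffAt 𝓘(ℝ, EuclideanSpace ℝ (Fin n)) (𝓡 n) ∞ φ.symm (f y₀) := by
    rw [hf0]
    exact (contMDiffOn_extChartAt_symm (1 : G)).contMDiffAt
      ((isOpen_extChartAt_target (1 : G)).mem_nhds (mem_extChartAt_target (1 : G)))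
  have hδ : ContDiffAt ℝ ∞ (logD n φ.symm) (f y₀) := contDiffAt_logD hsm
  have hev : logD n A =ᶠ[𝓝 y₀] fun y => (logD n φ.symm (f y)).comp (fderiv ℝ f y) := by
    have h1 : ∀ᶠ y in 𝓝 y₀, A' y ∈ φ.source :=
      hA'.continuousAt.eventually_mem ((isOpen_extChartAt_source (1 : G)).mem_nhds
        (by rw [hA'0]; exact mem_extChartAt_source (1 : G)))
    have h2 : ∀ᶠ y in 𝓝 y₀, DifferentiableAt ℝ f y := by
      filter_upwards [eventually_mdifferentiableAt hf.contMDiffAt] with y hy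
      exact hy.differentiableAt
    have h3 : ∀ᶠ y in 𝓝 y₀, MDifferentiableAt 𝓘(ℝ, EuclideanSpace ℝ (Fin n)) (𝓡 n) φ.symm (f y) :=
      hf.continuousAt.eventually (eventually_mdifferentiableAt hsm)
    filter_upwards [h1.eventually_nhds, h2, h3, eventually_mdifferentiableAt hA] with y h1 h2 h3 h4
    ext1 w
    have e1 : A' =ᶠ[𝓝 y] fun z => φ.symm (f z) := by
      filter_upwards [h1] with z hz
      exact (φ.left_inv hz).symm
    have e2 := thetaL_mfderiv_mul_left (A y₀)⁻¹ h4 w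
    have e3 := mfderiv_comp_apply' (I := 𝓘(ℝ, V)) (h := fun z => φ.symm (f z)) (g := φ.symm)
      (f := f) (I' := 𝓘(ℝ, EuclideanSpace ℝ (Fin n))) (fun _ => rfl) y _ rfl h3
      h2.mdifferentiableAt w
    rw [← e1.mfderiv_eq, mfderiv_eq_fderiv] at e3
    have e4 : ∀ g : G, g = A' y → ∀ w : EuclideanSpace ℝ (Fin n),
        (thetaL (A' y) w : EuclideanSpace ℝ (Fin n)) = thetaL g w := by
      rintro g rfl w; rfl
    have e5 : (thetaL (A' y) (mfderiv 𝓘(ℝ, V) (𝓡 n) A' y w) : EuclideanSpace ℝ (Fin n)) =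
        logD n φ.symm (f y) (fderiv ℝ f y w) :=
      (congrArg (thetaL (A' y)) e3).trans (e4 _ e1.self_of_nhds.symm _)
    exact e2.symm.trans e5
  have hfd : DifferentiableAt ℝ (fderiv ℝ f) y₀ :=
    (hf.fderiv_right (m := ∞) (by simp)).differentiableAt (by simp)
  have hd : HasFDerivAt (fun y => (logD n φ.symm (f y)).comp (fderiv ℝ f y)) _ y₀ :=
    HasFDerivAt.clm_comp ((hδ.differentiableAt (by simp)).hasFDerivAt.comp y₀
      (hf.differentiableAt (by simp)).hasFDerivAt) hfd.hasFDerivAt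
  have hsymm : IsSymmSndFDerivAt ℝ f y₀ := hf.isSymmSndFDerivAt (by simpa using ENat.LEInfty.out)
  rw [hev.fderiv_eq, hd.fderiv, hev.self_of_nhds]
  have hmc := maurerCartan_chart (G := G) (fderiv ℝ f y₀ u) (fderiv ℝ f y₀ v)
  rw [← hφ, ← hf0] at hmc
  simp only [add_apply, ContinuousLinearMap.comp_apply,
    ContinuousLinearMap.flip_apply, ContinuousLinearMap.compL_apply]
  -- The terms with the second derivative of `f` cancel by symmetry.
  rw [← hmc, hsymm.eq u v]
  abel

end MaurerCartan

/-! ### The differential of the adjoint representation -/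

section AdDerivative

variable {n : ℕ} {G : Type*} [TopologicalSpace G] [ChartedSpace (EuclideanSpace ℝ (Fin n)) G]
  [Group G] [LieGroup (𝓡 n) ∞ G]
  {V : Type*} [NormedAddCommGroup V] [NormedSpace ℝ V]
  {W H : Type*} [NormedAddCommGroup W] [NormedSpace ℝ W] [TopologicalSpace H]
  {I : ModelWithCorners ℝ W H} {P : Type*} [TopologicalSpace P] [ChartedSpace H P]

lemma lieBr_add_left (x y z : EuclideanSpace ℝ (Fin n)) :
    lieBr G (x + y) z = lieBr G x z + lieBr G y z :=
  add_lie (L := GroupLieAlgebra (𝓡 n) G) (M := GroupLieAlgebra (𝓡 n) G) x y z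

lemma lieBr_add_right (x y z : EuclideanSpace ℝ (Fin n)) :
    lieBr G x (y + z) = lieBr G x y + lieBr G x z :=
  lie_add (L := GroupLieAlgebra (𝓡 n) G) (M := GroupLieAlgebra (𝓡 n) G) x y z

lemma lieBr_smul_left (c : ℝ) (x y : EuclideanSpace ℝ (Fin n)) :
    lieBr G (c • x) y = c • lieBr G x y :=
  smul_lie (L := GroupLieAlgebra (𝓡 n) G) (M := GroupLieAlgebra (𝓡 n) G) c x y

lemma lieBr_smul_right (c : ℝ) (x y : EuclideanSpace ℝ (Fin n)) :
    lieBr G x (c • y) = c • lieBr G x y :=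
  lie_smul (L := GroupLieAlgebra (𝓡 n) G) (M := GroupLieAlgebra (𝓡 n) G) c x y

variable (n G) in
/-- The bracket as a continuous bilinear map. -/
def lieBrL : EuclideanSpace ℝ (Fin n) →L[ℝ] EuclideanSpace ℝ (Fin n) →L[ℝ]
    EuclideanSpace ℝ (Fin n) :=
  LinearMap.toContinuousLinearMap
    (LinearMap.toContinuousLinearMap.toLinearMap ∘ₗ
      LinearMap.mk₂ ℝ (lieBr G) lieBr_add_left lieBr_smul_left lieBr_add_right lieBr_smul_right)

@[simp] lemma lieBrL_apply (x y : EuclideanSpace ℝ (Fin n)) : lieBrL n G x y = lieBr G x y := rfl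

lemma lieBr_neg_left (x y : EuclideanSpace ℝ (Fin n)) : lieBr G (-x) y = -lieBr G x y := by
  simp only [← lieBrL_apply, map_neg, neg_apply]

lemma lieBr_neg_right (x y : EuclideanSpace ℝ (Fin n)) : lieBr G x (-y) = -lieBr G x y := by
  simp only [← lieBrL_apply, map_neg]

@[simp] lemma AdE_one : AdE n (1 : G) = ContinuousLinearMap.id ℝ _ := Ad_one

lemma AdE_mul_apply (a b : G) (x : EuclideanSpace ℝ (Fin n)) :
    AdE n (a * b) x = AdE n a (AdE n b x) := Ad_mul_apply a b x

@[simp] lemma AdE_inv_apply_AdE (a : G) (x : EuclideanSpace ℝ (Fin n)) :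
    AdE n a⁻¹ (AdE n a x) = x := Ad_inv_apply_Ad a x

@[simp] lemma AdE_apply_AdE_inv (a : G) (x : EuclideanSpace ℝ (Fin n)) :
    AdE n a (AdE n a⁻¹ x) = x := Ad_apply_Ad_inv a x

lemma logD_mul {A B : V → G} {y : V} (hA : MDifferentiableAt 𝓘(ℝ, V) (𝓡 n) A y)
    (hB : MDifferentiableAt 𝓘(ℝ, V) (𝓡 n) B y) (v : V) :
    logD n (fun z => A z * B z) y v = AdE n (B y)⁻¹ (logD n A y v) + logD n B y v :=
  thetaL_mfderiv_mul hA hB v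

lemma logD_inv {A : V → G} {y : V} (hA : MDifferentiableAt 𝓘(ℝ, V) (𝓡 n) A y) (v : V) :
    logD n (fun z => (A z)⁻¹) y v = -AdE n (A y) (logD n A y v) :=
  thetaL_mfderiv_inv hA v

lemma logD_comp {V' : Type*} [NormedAddCommGroup V'] [NormedSpace ℝ V'] {A : V' → G} {f : V → V'}
    {y : V} (hA : MDifferentiableAt 𝓘(ℝ, V') (𝓡 n) A (f y)) (hf : DifferentiableAt ℝ f y) (v : V) :
    logD n (fun z => A (f z)) y v = logD n A (f y) (fderiv ℝ f y v) := by
  have h := mfderiv_comp_apply' (I := 𝓘(ℝ, V)) (h := fun z => A (f z)) (g := A) (f := f)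
    (I' := 𝓘(ℝ, V')) (fun _ => rfl) y _ rfl hA hf.mdifferentiableAt v
  rw [mfderiv_eq_fderiv] at h
  exact congrArg (thetaL (A (f y))) h

variable (n G) in
/-- The inverse of the chart at `1`. -/
def expChart : EuclideanSpace ℝ (Fin n) → G := (extChartAt (𝓡 n) (1 : G)).symm

variable (n G) in
/-- The image of `1` in the chart at `1`. -/
def expZero : EuclideanSpace ℝ (Fin n) := extChartAt (𝓡 n) (1 : G) 1

lemma expChart_expZero : expChart n G (expZero n G) = 1 :=
  (extChartAt (𝓡 n) (1 : G)).left_inv (mem_extChartAt_source (1 : G))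

lemma contMDiffAt_expChart : ContMDiffAt 𝓘(ℝ, EuclideanSpace ℝ (Fin n)) (𝓡 n) ∞
    (expChart n G) (expZero n G) :=
  (contMDiffOn_extChartAt_symm (1 : G)).contMDiffAt
    ((isOpen_extChartAt_target (1 : G)).mem_nhds (mem_extChartAt_target (1 : G)))

lemma logD_extChartAt_symm (g : G) (v : TangentSpace (𝓡 n) g) :
    logD n (extChartAt (𝓡 n) g).symm (extChartAt (𝓡 n) g g)
      (mfderiv (𝓡 n) 𝓘(ℝ, EuclideanSpace ℝ (Fin n)) (extChartAt (𝓡 n) g) g v) = thetaL g v := by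
  have h1 := mfderiv_extChartAt_symm_comp (mem_extChartAt_source (I := 𝓡 n) g) v
  have h2 : ∀ g' : G, g' = g → ∀ w : EuclideanSpace ℝ (Fin n),
    (thetaL g' w : EuclideanSpace ℝ (Fin n)) = thetaL g w := by rintro _ rfl w; rfl
  refine (congrArg (thetaL _) h1).trans ?_
  exact h2 _ ((extChartAt (𝓡 n) g).left_inv (mem_extChartAt_source g)) v

lemma exists_logD_expChart (Y : EuclideanSpace ℝ (Fin n)) :
    ∃ w, logD n (expChart n G) (expZero n G) w = Y :=
  ⟨mfderiv (𝓡 n) 𝓘(ℝ, EuclideanSpace ℝ (Fin n)) (extChartAt (𝓡 n) (1 : G)) 1 Y,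
    (logD_extChartAt_symm (1 : G) Y).trans (thetaL_one Y)⟩

lemma contDiffAt_AdE {A : V → G} {y : V} (hA : ContMDiffAt 𝓘(ℝ, V) (𝓡 n) ∞ A y) :
    ContDiffAt ℝ ∞ (fun z => AdE n (A z)) y := by
  rw [← contMDiffAt_iff_contDiffAt]
  exact ContMDiffAt.comp y contMDiff_AdE.contMDiffAt hA

/-- The derivative of the adjoint representation is the bracket. -/
theorem fderiv_AdE {A : V → G} {y₀ : V} (hA : ContMDiffAt 𝓘(ℝ, V) (𝓡 n) ∞ A y₀) (u : V)
    (Y : EuclideanSpace ℝ (Fin n)) :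
    fderiv ℝ (fun y => AdE n (A y)) y₀ u Y =
      lieBr G (AdE n (A y₀) (logD n A y₀ u)) (AdE n (A y₀) Y) := by
  obtain ⟨w, hw⟩ := exists_logD_expChart (G := G) Y
  set z₀ := expZero n G
  -- The Maurer–Cartan equation is applied to `F(y, z) = c(z) A(y)⁻¹`, with `c` the inverse of the
  -- chart at `1`. Its form is `Ad (A y)` applied to `c^* θ^L - A^* θ^L`, so on `(u, 0)` and `(0,
  -- w)` the left side reduces to the derivative of `Ad (A y)`.
  let F : V × EuclideanSpace ℝ (Fin n) → G := fun p => expChart n G p.2 * (A p.1)⁻¹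
  have hfst : ContMDiffAt 𝓘(ℝ, V × EuclideanSpace ℝ (Fin n)) 𝓘(ℝ, V) ∞
    (Prod.fst : V × EuclideanSpace ℝ (Fin n) → V) (y₀, z₀) := contDiff_fst.contMDiff.contMDiffAt
  have hsnd : ContMDiffAt 𝓘(ℝ, V × EuclideanSpace ℝ (Fin n)) 𝓘(ℝ, EuclideanSpace ℝ (Fin n)) ∞
    (Prod.snd : V × EuclideanSpace ℝ (Fin n) → _) (y₀, z₀) := contDiff_snd.contMDiff.contMDiffAt
  have hA1 : ContMDiffAt 𝓘(ℝ, V × EuclideanSpace ℝ (Fin n)) (𝓡 n) ∞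
      (fun p : V × EuclideanSpace ℝ (Fin n) => A p.1) (y₀, z₀) :=
    ContMDiffAt.comp (y₀, z₀) (g := A) hA hfst
  have hC1 : ContMDiffAt 𝓘(ℝ, V × EuclideanSpace ℝ (Fin n)) (𝓡 n) ∞
      (fun p : V × EuclideanSpace ℝ (Fin n) => expChart n G p.2) (y₀, z₀) :=
    ContMDiffAt.comp (y₀, z₀) (g := expChart n G) contMDiffAt_expChart hsnd
  have hF : ContMDiffAt 𝓘(ℝ, V × EuclideanSpace ℝ (Fin n)) (𝓡 n) ∞ F (y₀, z₀) := hC1.mul hA1.inv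
  have hev : ∀ᶠ p in 𝓝 (y₀, z₀), ∀ q : V × EuclideanSpace ℝ (Fin n), logD n F p q =
      AdE n (A p.1) (logD n (expChart n G) p.2 q.2) - AdE n (A p.1) (logD n A p.1 q.1) := by
    have e1 : ∀ᶠ p : V × EuclideanSpace ℝ (Fin n) in 𝓝 (y₀, z₀),
        MDifferentiableAt 𝓘(ℝ, V) (𝓡 n) A p.1 :=
      continuousAt_fst.eventually (eventually_mdifferentiableAt hA)
    have e2 : ∀ᶠ p : V × EuclideanSpace ℝ (Fin n) in 𝓝 (y₀, z₀),
        MDifferentiableAt 𝓘(ℝ, EuclideanSpace ℝ (Fin n)) (𝓡 n) (expChart n G) p.2 :=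
      continuousAt_snd.eventually (eventually_mdifferentiableAt contMDiffAt_expChart)
    filter_upwards [e1, e2, eventually_mdifferentiableAt hA1, eventually_mdifferentiableAt hC1]
      with p h1 h2 h3 h4 q
    refine (logD_mul h4 (mdifferentiableAt_inv h3) q).trans ?_
    rw [logD_inv h3, inv_inv, ← sub_eq_add_neg,
      logD_comp (A := expChart n G) h2 differentiableAt_snd,
      logD_comp (A := A) h1 differentiableAt_fst, fderiv_fst, fderiv_snd]
    rfl
  have hAd : HasFDerivAt (fun p : V × EuclideanSpace ℝ (Fin n) => AdE n (A p.1)) _ (y₀, z₀) :=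
    HasFDerivAt.comp (y₀, z₀) (g := fun y => AdE n (A y))
      ((contDiffAt_AdE hA).differentiableAt (by simp)).hasFDerivAt hasFDerivAt_fst
  have hdC0 : HasFDerivAt (fun z => logD n (expChart n G) z w) _ z₀ :=
    ((contDiffAt_logD contMDiffAt_expChart).differentiableAt (by simp)).hasFDerivAt.clm_apply
      (hasFDerivAt_const (𝕜 := ℝ) w z₀)
  have hdC : HasFDerivAt (fun p : V × EuclideanSpace ℝ (Fin n) =>
      logD n (expChart n G) p.2 w) _ (y₀, z₀) :=
    HasFDerivAt.comp (y₀, z₀) (g := fun z => logD n (expChart n G) z w) hdC0 hasFDerivAt_snd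
  have hdA0 : HasFDerivAt (fun z => logD n A z u) _ y₀ :=
    ((contDiffAt_logD hA).differentiableAt (by simp)).hasFDerivAt.clm_apply
      (hasFDerivAt_const u y₀)
  have hdA : HasFDerivAt (fun p : V × EuclideanSpace ℝ (Fin n) => logD n A p.1 u) _ (y₀, z₀) :=
    HasFDerivAt.comp (y₀, z₀) (g := fun z => logD n A z u) hdA0 hasFDerivAt_fst
  have hF1 := (HasFDerivAt.clm_apply (𝕜 := ℝ) hAd hdC).congr_of_eventuallyEq
    (f₁ := fun p : V × EuclideanSpace ℝ (Fin n) => logD n F p (0, w)) (by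
      filter_upwards [hev] with p hp
      rw [hp]; simp)
  have hF2 := (HasFDerivAt.clm_apply (𝕜 := ℝ) hAd hdA).neg.congr_of_eventuallyEq
    (f₁ := fun p : V × EuclideanSpace ℝ (Fin n) => logD n F p (u, 0)) (by
      filter_upwards [hev] with p hp
      rw [hp]; simp)
  have hFd : DifferentiableAt ℝ (logD n F) (y₀, z₀) :=
    (contDiffAt_logD hF).differentiableAt (by simp)
  have hc : ∀ q q' : V × EuclideanSpace ℝ (Fin n),
      fderiv ℝ (fun p => logD n F p q) (y₀, z₀) q' = fderiv ℝ (logD n F) (y₀, z₀) q' q := by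
    intro q q'
    rw [(hFd.hasFDerivAt.clm_apply (hasFDerivAt_const q _)).fderiv]
    simp
  have hmc := maurerCartan hF (u, 0) (0, w)
  rw [← hc, ← hc, hF1.fderiv, hF2.fderiv, hev.self_of_nhds, hev.self_of_nhds] at hmc
  simp only [hw, add_apply, ContinuousLinearMap.comp_apply, ContinuousLinearMap.flip_apply,
    ContinuousLinearMap.coe_fst', ContinuousLinearMap.coe_snd', map_zero, zero_add, add_zero,
    zero_apply, neg_apply, neg_zero, sub_zero, zero_sub, lieBr_neg_left, neg_neg] at hmc
  exact hmc

variable (n) in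
/-- The differential of the adjoint representation. -/
def dAdE (g : G) : EuclideanSpace ℝ (Fin n) →L[ℝ]
    (EuclideanSpace ℝ (Fin n) →L[ℝ] EuclideanSpace ℝ (Fin n)) :=
  mfderiv (𝓡 n) 𝓘(ℝ, EuclideanSpace ℝ (Fin n) →L[ℝ] EuclideanSpace ℝ (Fin n)) (AdE n) g

variable (n) in
/-- `thetaL` as a map to Euclidean space. -/
def thetaLE (g : G) : EuclideanSpace ℝ (Fin n) →L[ℝ] EuclideanSpace ℝ (Fin n) :=
  (show TangentSpace (𝓡 n) g →L[ℝ] GroupLieAlgebra (𝓡 n) G from thetaL g)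

/-- The derivative of the adjoint representation is the bracket. -/
theorem dAdE_apply (g : G) (v Y : EuclideanSpace ℝ (Fin n)) :
    dAdE n g v Y = lieBr G (AdE n g (thetaLE n g v)) (AdE n g Y) := by
  set φ := extChartAt (𝓡 n) g
  have hφ : ContMDiffAt 𝓘(ℝ, EuclideanSpace ℝ (Fin n)) (𝓡 n) ∞ φ.symm (φ g) :=
    (contMDiffOn_extChartAt_symm g).contMDiffAt
      ((isOpen_extChartAt_target g).mem_nhds (mem_extChartAt_target g))
  have h1 : AdE n =ᶠ[𝓝 g] fun x => AdE n (φ.symm (φ x)) := by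
    filter_upwards [(isOpen_extChartAt_source (I := 𝓡 n) g).mem_nhds
      (mem_extChartAt_source (I := 𝓡 n) g)] with x hx
    rw [φ.left_inv hx]
  have h2 := mfderiv_comp_apply' (I := 𝓡 n) (h := fun x => AdE n (φ.symm (φ x)))
    (g := fun y => AdE n (φ.symm y)) (f := φ) (I' := 𝓘(ℝ, EuclideanSpace ℝ (Fin n)))
    (I'' := 𝓘(ℝ, EuclideanSpace ℝ (Fin n) →L[ℝ] EuclideanSpace ℝ (Fin n)))
    (fun _ => rfl) g _ rfl ((contDiffAt_AdE hφ).differentiableAt (by simp)).mdifferentiableAt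
    (mdifferentiableAt_extChartAt (mem_chart_source _ g)) v
  rw [← h1.mfderiv_eq, mfderiv_eq_fderiv] at h2
  let u : EuclideanSpace ℝ (Fin n) :=
    (mfderiv (𝓡 n) 𝓘(ℝ, EuclideanSpace ℝ (Fin n)) φ g : TangentSpace (𝓡 n) g →L[ℝ] _) v
  have h3 : dAdE n g v Y = fderiv ℝ (fun y => AdE n (φ.symm y)) (φ g) u Y :=
    congrArg (fun A : EuclideanSpace ℝ (Fin n) →L[ℝ] EuclideanSpace ℝ (Fin n) => A Y) h2
  have h4 : logD n φ.symm (φ g) u = thetaLE n g v := logD_extChartAt_symm g v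
  have h5 := fderiv_AdE hφ u Y
  rw [h4, φ.left_inv (mem_extChartAt_source g)] at h5
  exact h3.trans h5

/-- `Ad g` is an automorphism of the Lie algebra. -/
theorem AdE_lieBr (g : G) (x y : EuclideanSpace ℝ (Fin n)) :
    AdE n g (lieBr G x y) = lieBr G (AdE n g x) (AdE n g y) := by
  obtain ⟨w, hw⟩ := exists_logD_expChart (G := G) x
  set z₀ := expZero n G
  have hC : ContMDiffAt 𝓘(ℝ, EuclideanSpace ℝ (Fin n)) (𝓡 n) ∞ (expChart n G) z₀ :=
    contMDiffAt_expChart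
  have hC' : ContMDiffAt 𝓘(ℝ, EuclideanSpace ℝ (Fin n)) (𝓡 n) ∞
      (fun z => g * expChart n G z * g⁻¹) z₀ := ContMDiffAt.comp z₀ (contMDiff_conj g _) hC
  have hd : ∀ {A : EuclideanSpace ℝ (Fin n) → G} (_ : ContMDiffAt 𝓘(ℝ, EuclideanSpace ℝ (Fin n))
      (𝓡 n) ∞ A z₀) (Y u : EuclideanSpace ℝ (Fin n)),
      HasFDerivAt (fun z => AdE n (A z) Y) ((fderiv ℝ (fun z => AdE n (A z)) z₀).flip Y) z₀ :=
    fun {A} h Y u => by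
      have := ((contDiffAt_AdE h).differentiableAt (by simp)).hasFDerivAt.clm_apply
        (hasFDerivAt_const Y z₀)
      simpa using this
  have h1 : HasFDerivAt (fun z => AdE n g (AdE n (expChart n G z) y)) _ z₀ :=
    (AdE n g).hasFDerivAt.comp z₀ (hd hC y w)
  have h2 := hd hC' (AdE n g y) w
  -- Differentiating `Ad (g c g⁻¹) Ad g = Ad g Ad c` in `c` at `1` gives the claim.
  have h3 : (fun z => AdE n (g * expChart n G z * g⁻¹) (AdE n g y)) =
      fun z => AdE n g (AdE n (expChart n G z) y) := by
    funext z
    simp only [AdE_mul_apply, AdE_inv_apply_AdE]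
  rw [h3] at h2
  have h4 := DFunLike.congr_fun (h1.unique h2) w
  have h5 : logD n (fun z => g * expChart n G z * g⁻¹) z₀ w = AdE n g (logD n (expChart n G) z₀ w) :=
    thetaL_mfderiv_conj g (hC.mdifferentiableAt (by simp)) w
  simp only [ContinuousLinearMap.comp_apply, ContinuousLinearMap.flip_apply] at h4
  rw [fderiv_AdE hC, fderiv_AdE hC', h5, hw, expChart_expZero] at h4
  simpa using h4

/-- The differential of a smooth homomorphism is a homomorphism of Lie algebras. -/
theorem mfderiv_hom_lieBr {k : ℕ} {K : Type*} [TopologicalSpace K]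
    [ChartedSpace (EuclideanSpace ℝ (Fin k)) K] [Group K] [LieGroup (𝓡 k) ∞ K] {φ : K →* G}
    (hφ : ContMDiff (𝓡 k) (𝓡 n) ∞ φ) {D : EuclideanSpace ℝ (Fin k) →L[ℝ] EuclideanSpace ℝ (Fin n)}
    (hD : ∀ v : EuclideanSpace ℝ (Fin k), D v = mfderiv (𝓡 k) (𝓡 n) φ 1 v)
    (x y : EuclideanSpace ℝ (Fin k)) :
    D (lieBr K x y) = lieBr G (D x) (D y) := by
  obtain ⟨w, hw⟩ := exists_logD_expChart (G := K) x
  set z₀ := expZero k K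
  have hC : ContMDiffAt 𝓘(ℝ, EuclideanSpace ℝ (Fin k)) (𝓡 k) ∞ (expChart k K) z₀ :=
    contMDiffAt_expChart
  have hC' : ContMDiffAt 𝓘(ℝ, EuclideanSpace ℝ (Fin k)) (𝓡 n) ∞
      (fun z => φ (expChart k K z)) z₀ := ContMDiffAt.comp z₀ (hφ _) hC
  have h1 : HasFDerivAt (fun z => D (AdE k (expChart k K z) y)) _ z₀ :=
    D.hasFDerivAt.comp z₀ (((contDiffAt_AdE hC).differentiableAt (by simp)).hasFDerivAt.clm_apply
        (hasFDerivAt_const y z₀))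
  have h2 : HasFDerivAt (fun z => AdE n (φ (expChart k K z)) (D y)) _ z₀ :=
    ((contDiffAt_AdE hC').differentiableAt (by simp)).hasFDerivAt.clm_apply
        (hasFDerivAt_const (D y) z₀)
  -- `D` intertwines the adjoint actions; differentiating this at `1` produces a bracket on each
  -- side.
  have h3 : (fun z => AdE n (φ (expChart k K z)) (D y)) = fun z => D (AdE k (expChart k K z) y) := by
    funext z
    rw [hD, hD]
    exact Ad_mfderiv_hom hφ _ _
  rw [h3] at h2
  have h4 := DFunLike.congr_fun (h1.unique h2) w
  have h5 : logD n (fun z => φ (expChart k K z)) z₀ w = D (logD k (expChart k K) z₀ w) := by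
    have e1 := mfderiv_comp_apply' (I := 𝓘(ℝ, EuclideanSpace ℝ (Fin k))) (I' := 𝓡 k)
      (h := fun z => φ (expChart k K z)) (g := φ) (f := expChart k K) (fun _ => rfl) z₀ _ rfl
      (hφ.mdifferentiableAt (by simp)) (hC.mdifferentiableAt (by simp)) w
    rw [hD]
    refine (congrArg (thetaL _) e1).trans ?_
    exact thetaL_mfderiv_hom hφ _ _
  simp only [ContinuousLinearMap.comp_apply, ContinuousLinearMap.flip_apply, add_apply,
    zero_apply, map_zero, zero_add] at h4
  rw [fderiv_AdE hC, fderiv_AdE hC', h5, hw, expChart_expZero, map_one] at h4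
  simpa using h4

end AdDerivative

/-! ### Maps with vanishing differential -/

section Constant

variable {E H E' H' : Type*} [NormedAddCommGroup E] [NormedSpace ℝ E] [TopologicalSpace H]
  {I : ModelWithCorners ℝ E H} [I.Boundaryless] [NormedAddCommGroup E'] [NormedSpace ℝ E']
  [TopologicalSpace H'] {J : ModelWithCorners ℝ E' H'}
  {P : Type*} [TopologicalSpace P] [ChartedSpace H P] [IsManifold I ∞ P]
  {P' : Type*} [TopologicalSpace P'] [ChartedSpace H' P'] [IsManifold J ∞ P']

lemma isLocallyConstant_of_mfderiv_eq_zero {f : P → P'} (hf : MDifferentiable I J f)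
    (h0 : ∀ x, mfderiv I J f x = 0) : IsLocallyConstant f := by
  rw [IsLocallyConstant.iff_eventually_eq]
  intro x
  set φ := extChartAt I x
  set ψ := extChartAt J (f x)
  have hφc : ContinuousAt φ.symm (φ x) := continuousAt_extChartAt_symm x
  have hleft : φ.symm (φ x) = x := φ.left_inv (mem_extChartAt_source x)
  have hN : ∀ᶠ y in 𝓝 (φ x), y ∈ φ.target ∧ f (φ.symm y) ∈ ψ.source := by
    refine Filter.Eventually.and ((isOpen_extChartAt_target x).mem_nhds (mem_extChartAt_target x)) ?_
    have : ContinuousAt (fun y => f (φ.symm y)) (φ x) :=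
      ContinuousAt.comp (g := f) hf.continuous.continuousAt hφc
    refine this.eventually ?_
    simp only [hleft]
    exact extChartAt_source_mem_nhds (f x)
  obtain ⟨r, hr, hball⟩ := Metric.eventually_nhds_iff_ball.1 hN
  have hd : ∀ y ∈ Metric.ball (φ x) r,
      HasFDerivAt (fun y => ψ (f (φ.symm y))) (0 : E →L[ℝ] E') y := by
    intro y hy
    obtain ⟨h1, h2⟩ := hball y hy
    have e1 : MDifferentiableAt 𝓘(ℝ, E) I φ.symm y :=
      ((contMDiffOn_extChartAt_symm (n := ∞) x).contMDiffAt
        ((isOpen_extChartAt_target x).mem_nhds h1)).mdifferentiableAt (by simp)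
    have e2 : HasMFDerivAt I J f (φ.symm y) (0 : E →L[ℝ] E') := by
      have := (hf (φ.symm y)).hasMFDerivAt
      rw [h0] at this
      exact this
    have e3 : MDifferentiableAt J 𝓘(ℝ, E') ψ (f (φ.symm y)) :=
      mdifferentiableAt_extChartAt (by simpa [ψ] using h2)
    have := e3.hasMFDerivAt.comp y (e2.comp y e1.hasMFDerivAt)
    have h4 := this.hasFDerivAt
    refine h4.congr_fderiv ?_
    ext v
    exact map_zero (mfderiv J 𝓘(ℝ, E') ψ (f (φ.symm y)) : E' →L[ℝ] E')
  have hcont : ContinuousAt φ x := continuousAt_extChartAt x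
  filter_upwards [hcont (Metric.ball_mem_nhds (φ x) hr),
    extChartAt_source_mem_nhds (I := I) x] with z hz hzs
  have key := (Metric.isOpen_ball (x := φ x) (ε := r)).is_const_of_fderiv_eq_zero (𝕜 := ℝ)
    (convex_ball _ _).isPreconnected
    (fun y hy => (hd y hy).differentiableAt.differentiableWithinAt)
    (fun y hy => (hd y hy).fderiv) hz (Metric.mem_ball_self hr)
  have hz' : φ.symm (φ z) = z := φ.left_inv hzs
  simp only [hz', hleft] at key
  refine ψ.injOn ?_ (mem_extChartAt_source (f x)) key
  have := (hball (φ z) hz).2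
  rwa [hz'] at this

end Constant

/-! ### One-parameter groups -/

section Curves

variable {n : ℕ} {G : Type*} [TopologicalSpace G] [ChartedSpace (EuclideanSpace ℝ (Fin n)) G]
  [Group G] [LieGroup (𝓡 n) ∞ G]

/-- `A B⁻¹` has zero differential by the Leibniz rule, so it is constant on the connected space `P`.
-/
lemma eq_of_thetaL_eq {E H : Type*} [NormedAddCommGroup E] [NormedSpace ℝ E] [TopologicalSpace H]
    {I : ModelWithCorners ℝ E H} [I.Boundaryless]
    {P : Type*} [TopologicalSpace P] [ChartedSpace H P] [IsManifold I ∞ P] [PreconnectedSpace P]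
    {A B : P → G} (hA : MDifferentiable I (𝓡 n) A) (hB : MDifferentiable I (𝓡 n) B)
    (h : ∀ p v, thetaL (A p) (mfderiv I (𝓡 n) A p v) = thetaL (B p) (mfderiv I (𝓡 n) B p v))
    {p₀ : P} (h0 : A p₀ = B p₀) : A = B := by
  have : IsManifold (𝓡 n) ∞ G := inferInstance
  let F : P → G := fun p => A p * (B p)⁻¹
  have hF : MDifferentiable I (𝓡 n) F := fun p =>
    mdifferentiableAt_mul (hA p) (mdifferentiableAt_inv (hB p))
  have hF0 : ∀ p, mfderiv I (𝓡 n) F p = 0 := by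
    intro p
    ext1 v
    apply (thetaL_bijective (n := n) (F p)).1
    refine (thetaL_mfderiv_mul (hA p) (mdifferentiableAt_inv (hB p)) v).trans ?_
    rw [inv_inv, thetaL_mfderiv_inv (hB p), h, add_neg_cancel]
    exact (map_zero (thetaL (F p))).symm
  have hc := isLocallyConstant_of_mfderiv_eq_zero hF hF0
  funext p
  have := hc.apply_eq_of_preconnectedSpace p p₀
  simp only [F, h0, mul_inv_cancel] at this
  exact mul_inv_eq_one.1 this

/-- `γ` is the curve through `1` with left logarithmic derivative `X`. -/
structure IsExpCurve (X : EuclideanSpace ℝ (Fin n)) (γ : ℝ → G) : Prop where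
  zero : γ 0 = 1
  mdiff : MDifferentiable 𝓘(ℝ, ℝ) (𝓡 n) γ
  logD_eq : ∀ t v : ℝ, logD n γ t v = v • X

/-- The curve integrates the left-invariant field of `X`. Left translates of one local integral
curve through `1` provide, from every starting point, a curve on the same interval, and such a
uniform interval makes the field complete. -/
lemma exists_isExpCurve [T2Space G] (X : EuclideanSpace ℝ (Fin n)) :
    ∃ γ : ℝ → G, IsExpCurve X γ := by
  have : IsManifold (𝓡 n) ∞ G := inferInstance
  have : IsManifold (𝓡 n) 1 G := IsManifold.of_le (n := ∞) (by simp)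
  let v : (g : G) → TangentSpace (𝓡 n) g := fun g =>
    mulInvariantVectorField (I := 𝓡 n) (G := G) X g
  have hv : ContMDiff (𝓡 n) (𝓡 n).tangent 1 (fun g => (⟨g, v g⟩ : TangentBundle (𝓡 n) G)) :=
    (contMDiff_mulInvariantVectorField (I := 𝓡 n) (G := G) X).of_le (by simp)
  have hthv : ∀ g : G, (thetaL g (v g) : EuclideanSpace ℝ (Fin n)) = X := fun g =>
    thetaL_leftTrans g X
  obtain ⟨γ₀, h0, h1⟩ := exists_isMIntegralCurveAt_of_contMDiffAt_boundaryless (t₀ := 0)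
    (hv (1 : G))
  obtain ⟨ε, hε, h2⟩ := isMIntegralCurveAt_iff'.1 h1
  rw [Real.ball_zero_eq_Ioo] at h2
  have key : ∀ x : G, ∃ γ : ℝ → G, γ 0 = x ∧ IsMIntegralCurveOn γ v (Ioo (-ε) ε) := by
    intro x
    refine ⟨fun t => x * γ₀ t, by simp [h0], fun t ht => ?_⟩
    have e1 := h2 t ht
    have e1' : HasMFDerivAt 𝓘(ℝ, ℝ) (𝓡 n) γ₀ t _ := e1.hasMFDerivAt (Ioo_mem_nhds ht.1 ht.2)
    have e2 : MDifferentiableAt 𝓘(ℝ, ℝ) (𝓡 n) (fun t => x * γ₀ t) t :=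
      mdifferentiableAt_mul mdifferentiableAt_const e1'.mdifferentiableAt
    have e3 := e2.hasMFDerivAt
    refine HasMFDerivAt.hasMFDerivWithinAt ?_
    refine e3.congr_mfderiv ?_
    refine ContinuousLinearMap.ext fun (s : ℝ) => ?_
    apply (thetaL_bijective (n := n) (x * γ₀ t)).1
    refine (thetaL_mfderiv_mul_left x e1'.mdifferentiableAt s).trans ?_
    rw [e1'.mfderiv]
    refine Eq.trans (b := s • X) ?_ ?_
    · exact (map_smul (thetaL (γ₀ t)) s (v (γ₀ t))).trans (congrArg (s • ·) (hthv _))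
    · exact ((map_smul (thetaL (x * γ₀ t)) s (v (x * γ₀ t))).trans
        (congrArg (s • ·) (hthv _))).symm
  obtain ⟨γ, h3, h4⟩ := exists_isMIntegralCurve_of_isMIntegralCurveOn hv hε key (1 : G)
  refine ⟨γ, h3, fun t => (h4 t).mdifferentiableAt, fun t s => ?_⟩
  have := (h4 t).mfderiv
  have e : logD n γ t s = thetaL (γ t) (mfderiv 𝓘(ℝ, ℝ) (𝓡 n) γ t s) := rfl
  rw [e, this]
  exact (map_smul (thetaL (γ t)) s (v (γ t))).trans (congrArg (s • ·) (hthv _))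

lemma IsExpCurve.hasDerivAt_AdE {X : EuclideanSpace ℝ (Fin n)} {γ : ℝ → G} (h : IsExpCurve X γ)
    (b : EuclideanSpace ℝ (Fin n)) (t : ℝ) :
    HasDerivAt (fun s => AdE n (γ s) b) (AdE n (γ t) (lieBr G X b)) t := by
  have h1 : HasMFDerivAt 𝓘(ℝ, ℝ) 𝓘(ℝ, EuclideanSpace ℝ (Fin n) →L[ℝ] EuclideanSpace ℝ (Fin n))
      (fun s => AdE n (γ s)) t _ :=
    HasMFDerivAt.comp t ((contMDiff_AdE.mdifferentiable (by simp)) (γ t)).hasMFDerivAt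
      (h.mdiff t).hasMFDerivAt
  let D : ℝ →L[ℝ] (EuclideanSpace ℝ (Fin n) →L[ℝ] EuclideanSpace ℝ (Fin n)) :=
    (dAdE n (γ t)).comp
      (mfderiv 𝓘(ℝ, ℝ) (𝓡 n) γ t : ℝ →L[ℝ] EuclideanSpace ℝ (Fin n))
  have h1' : HasFDerivAt (fun s => AdE n (γ s)) D t := h1.hasFDerivAt
  have h2 := h1'.hasDerivAt.clm_apply (hasDerivAt_const t b)
  refine h2.congr_deriv ?_
  rw [map_zero, add_zero]
  refine (dAdE_apply (γ t) _ b).trans ?_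
  have h3 : thetaLE n (γ t) (mfderiv 𝓘(ℝ, ℝ) (𝓡 n) γ t (1 : ℝ)) = X :=
    (h.logD_eq t 1).trans (one_smul _ _)
  rw [AdE_lieBr]
  exact congrArg (fun z => lieBr G (AdE n (γ t) z) (AdE n (γ t) b)) h3

/-- `exp(-l t) Ad (γ t) b` has zero derivative. -/
lemma IsExpCurve.AdE_eigenvector {X b : EuclideanSpace ℝ (Fin n)} {γ : ℝ → G}
    (h : IsExpCurve X γ) {l : ℝ} (hb : lieBr G X b = l • b) (t : ℝ) :
    AdE n (γ t) b = Real.exp (l * t) • b := by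
  have h1 : ∀ s, HasDerivAt (fun s => Real.exp (-(l * s)) • AdE n (γ s) b) 0 s := by
    intro s
    have e1 : HasDerivAt (fun s : ℝ => Real.exp (-(l * s))) (Real.exp (-(l * s)) * -(l * 1)) s :=
      (((hasDerivAt_id s).const_mul l).neg).exp
    refine (e1.smul (h.hasDerivAt_AdE b s)).congr_deriv ?_
    rw [hb, map_smul, smul_smul, ← add_smul]
    simp
  have h2 := is_const_of_deriv_eq_zero (fun s => (h1 s).differentiableAt)
    (fun s => (h1 s).deriv) t 0
  simp only [h.zero, mul_zero, neg_zero, Real.exp_zero, one_smul, AdE_one] at h2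
  have h3 := congrArg (fun z => Real.exp (l * t) • z) h2
  simpa [smul_smul, ← Real.exp_add] using h3

lemma IsExpCurve.conj {X : EuclideanSpace ℝ (Fin n)} {γ : ℝ → G} (h : IsExpCurve X γ) (a : G) :
    IsExpCurve (AdE n a X) (fun t => a * γ t * a⁻¹) where
  zero := by simp [h.zero]
  mdiff t := mdifferentiableAt_mul (mdifferentiableAt_mul mdifferentiableAt_const (h.mdiff t))
    mdifferentiableAt_const
  logD_eq t v := by
    refine (thetaL_mfderiv_conj a (h.mdiff t) v).trans ?_
    refine (congrArg (AdE n a) (h.logD_eq t v)).trans ?_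
    rw [map_smul]

lemma IsExpCurve.unique {X : EuclideanSpace ℝ (Fin n)} {γ γ' : ℝ → G} (h : IsExpCurve X γ)
    (h' : IsExpCurve X γ') : γ = γ' :=
  eq_of_thetaL_eq h.mdiff h'.mdiff (fun t v => (h.logD_eq t v).trans (h'.logD_eq t v).symm)
    (p₀ := 0) (h.zero.trans h'.zero.symm)

/-- In a connected group the kernel of `Ad` is central. -/
lemma mul_comm_of_AdE_eq_one [ConnectedSpace G] {g : G}
    (hg : AdE n g = ContinuousLinearMap.id ℝ _) (x : G) : g * x = x * g := by
  have : IsManifold (𝓡 n) ∞ G := inferInstance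
  -- If `Ad g = 1`, conjugation by `g` and the identity have the same left logarithmic derivative,
  -- and they agree at `1`.
  have h := eq_of_thetaL_eq (I := 𝓡 n) (A := fun x : G => g * x * g⁻¹) (B := fun x => x)
    (mdifferentiable_conj g) mdifferentiable_id (fun p v => ?_) (p₀ := 1) (by simp)
  · have := congrFun h x
    change g * x * g⁻¹ = x at this
    rw [mul_inv_eq_iff_eq_mul] at this
    exact this
  · refine (thetaL_mfderiv_conj (A := fun x => x) g mdifferentiableAt_id v).trans ?_
    exact DFunLike.congr_fun hg _

end Curves

/-! ### Automorphisms near the identity are inner -/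

section Inner

variable {n : ℕ} {G : Type*} [TopologicalSpace G] [ChartedSpace (EuclideanSpace ℝ (Fin n)) G]
  [Group G] [LieGroup (𝓡 n) ∞ G]

variable (n G) in
/-- `A` preserves the Lie bracket. -/
def PreservesBr (A : EuclideanSpace ℝ (Fin n) →L[ℝ] EuclideanSpace ℝ (Fin n)) : Prop :=
  ∀ x y, A (lieBr G x y) = lieBr G (A x) (A y)

lemma eq_zero_of_lieBr_eq_zero [LieAlgebra.IsSemisimple ℝ (GroupLieAlgebra (𝓡 n) G)]
    {x : EuclideanSpace ℝ (Fin n)} (h : ∀ y, lieBr G x y = 0) : x = 0 := by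
  have h1 : ∀ x : GroupLieAlgebra (𝓡 n) G, (∀ y : GroupLieAlgebra (𝓡 n) G, ⁅x, y⁆ = 0) → x = 0 := by
    intro x hx
    have h2 : x ∈ LieAlgebra.center ℝ (GroupLieAlgebra (𝓡 n) G) := by
      intro y
      rw [← lie_skew, hx, neg_zero]
    rw [LieAlgebra.center_eq_bot] at h2
    exact h2
  exact h1 x h

lemma exists_eq_lieBr_of_derivation [LieAlgebra.IsSemisimple ℝ (GroupLieAlgebra (𝓡 n) G)]
    {D : EuclideanSpace ℝ (Fin n) →ₗ[ℝ] EuclideanSpace ℝ (Fin n)}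
    (h : ∀ x y, D (lieBr G x y) = lieBr G (D x) y + lieBr G x (D y)) :
    ∃ z, ∀ y, D y = lieBr G z y := by
  let D' : LieDerivation ℝ (GroupLieAlgebra (𝓡 n) G) (GroupLieAlgebra (𝓡 n) G) :=
    { toLinearMap := D
      leibniz' := fun x y => by
        refine (h x y).trans ?_
        rw [sub_eq_add_neg, lie_skew]
        exact add_comm _ _ }
  obtain ⟨z, hz⟩ := LieDerivation.IsKilling.exists_eq_ad D'
  refine ⟨z, fun y => ?_⟩
  have := congrArg (fun d : LieDerivation ℝ (GroupLieAlgebra (𝓡 n) G) _ => d y) hz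
  exact this.symm.trans (DFunLike.congr_fun (LieDerivation.coe_ad_apply_eq_ad_apply z) y)

set_option maxHeartbeats 800000 in
/-- Automorphisms of the Lie algebra close to the identity are inner, by small elements. -/
theorem exists_AdE_eq_of_preservesBr [LieAlgebra.IsSemisimple ℝ (GroupLieAlgebra (𝓡 n) G)]
    {C : Set G} (hC : C ∈ 𝓝 1) :
    ∃ W ∈ 𝓝 (ContinuousLinearMap.id ℝ (EuclideanSpace ℝ (Fin n))),
      ∀ A ∈ W, PreservesBr n G A → ∃ g ∈ C, AdE n g = A := by
  have : IsManifold (𝓡 n) ∞ G := inferInstance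
  have hinj : LinearMap.ker (lieBrL n G).toLinearMap = ⊥ := by
    rw [LinearMap.ker_eq_bot']
    intro x hx
    exact eq_zero_of_lieBr_eq_zero (G := G) fun y => DFunLike.congr_fun hx y
  -- `ad` is injective because the centre is trivial. With a linear left inverse `π`, the map `g ↦ π
  -- (Ad g)` has the identity as differential at `1`.
  obtain ⟨π₀, hπ₀⟩ := LinearMap.exists_leftInverse_of_injective (lieBrL n G).toLinearMap hinj
  let π : (EuclideanSpace ℝ (Fin n) →L[ℝ] EuclideanSpace ℝ (Fin n)) →L[ℝ] EuclideanSpace ℝ (Fin n) := LinearMap.toContinuousLinearMap π₀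
  have hπ : ∀ x, π (lieBrL n G x) = x := fun x => DFunLike.congr_fun hπ₀ x
  -- a chart at `1` through the adjoint representation
  have hbij : Function.Bijective (mfderiv (𝓡 n) 𝓘(ℝ, EuclideanSpace ℝ (Fin n)) (fun g : G => π (AdE n g)) 1) := by
    have e : ∀ v : EuclideanSpace ℝ (Fin n), (mfderiv (𝓡 n) 𝓘(ℝ, EuclideanSpace ℝ (Fin n)) (fun g : G => π (AdE n g)) 1 v : EuclideanSpace ℝ (Fin n)) = v := by
      intro v
      have h1 := mfderiv_comp_apply' (I := 𝓡 n) (h := fun g : G => π (AdE n g)) (g := π)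
        (f := AdE n) (I' := 𝓘(ℝ, EuclideanSpace ℝ (Fin n) →L[ℝ] EuclideanSpace ℝ (Fin n))) (I'' := 𝓘(ℝ, EuclideanSpace ℝ (Fin n))) (fun _ => rfl) 1 _ rfl
        π.differentiableAt.mdifferentiableAt ((contMDiff_AdE.mdifferentiable (by simp)) _) v
      rw [mfderiv_eq_fderiv, π.fderiv] at h1
      refine h1.trans ?_
      have h2 : dAdE n (1 : G) v = lieBrL n G v := by
        ext1 y
        refine (dAdE_apply (1 : G) v y).trans ?_
        have h3 : thetaLE n (1 : G) v = v := thetaL_one v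
        simp [h3]
      exact (congrArg π h2).trans (hπ v)
    exact ⟨fun a b hab => (e a).symm.trans (hab.trans (e b)), fun w => ⟨w, e w⟩⟩
  obtain ⟨e, he1, heC, hef, -, -⟩ := exists_chart_of_bijective (I := 𝓡 n) (U := interior C)
    (f := fun g : G => π (AdE n g)) isOpen_interior (mem_interior_iff_mem_nhds.2 hC)
    (π.contDiff.contMDiff.comp contMDiff_AdE).contMDiffOn hbij
  -- the equations of the automorphism group
  let b := EuclideanSpace.basisFun (Fin n) ℝ
  let f : (EuclideanSpace ℝ (Fin n) →L[ℝ] EuclideanSpace ℝ (Fin n)) → Fin n → Fin n → EuclideanSpace ℝ (Fin n) := fun A i j =>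
    A (lieBr G (b i) (b j)) - lieBr G (A (b i)) (A (b j))
  have hf0 : ∀ A, PreservesBr n G A → f A = 0 := fun A hA => by
    funext i j; exact sub_eq_zero.2 (hA _ _)
  have hfd : ContDiff ℝ ∞ f := by
    refine contDiff_pi.2 fun i => contDiff_pi.2 fun j => ContDiff.sub ?_ ?_
    · exact contDiff_id.clm_apply contDiff_const
    · exact ((lieBrL n G).contDiff.comp (contDiff_id.clm_apply contDiff_const)).clm_apply
        (contDiff_id.clm_apply contDiff_const)
  have hfD : ∀ D i j, fderiv ℝ f (ContinuousLinearMap.id ℝ (EuclideanSpace ℝ (Fin n))) D i j =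
      D (lieBr G (b i) (b j)) - (lieBr G (D (b i)) (b j) + lieBr G (b i) (D (b j))) := by
    intro D i j
    have e1 : HasFDerivAt (fun A => f A i j)
        ((ContinuousLinearMap.proj (R := ℝ) (φ := fun _ : Fin n => EuclideanSpace ℝ (Fin n)) j).comp
          ((ContinuousLinearMap.proj (R := ℝ) (φ := fun _ : Fin n => Fin n → EuclideanSpace ℝ (Fin n)) i).comp
            (fderiv ℝ f (ContinuousLinearMap.id ℝ (EuclideanSpace ℝ (Fin n)))))) (ContinuousLinearMap.id ℝ (EuclideanSpace ℝ (Fin n))) :=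
      hasFDerivAt_pi'.1 (hasFDerivAt_pi'.1
        ((hfd.differentiable (by simp)) _).hasFDerivAt i) j
    have h2 : ∀ v : EuclideanSpace ℝ (Fin n), HasFDerivAt (fun A : EuclideanSpace ℝ (Fin n) →L[ℝ] EuclideanSpace ℝ (Fin n) => A v)
        (ContinuousLinearMap.apply ℝ (EuclideanSpace ℝ (Fin n)) v) (ContinuousLinearMap.id ℝ (EuclideanSpace ℝ (Fin n))) := fun v =>
      (ContinuousLinearMap.apply ℝ (EuclideanSpace ℝ (Fin n)) v).hasFDerivAt
    have e2 : HasFDerivAt (fun A => f A i j) _ (ContinuousLinearMap.id ℝ (EuclideanSpace ℝ (Fin n))) :=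
      (h2 (lieBr G (b i) (b j))).sub
        (HasFDerivAt.clm_apply (𝕜 := ℝ) (((lieBrL n G).hasFDerivAt (x := b i)).comp
          (ContinuousLinearMap.id ℝ (EuclideanSpace ℝ (Fin n))) (h2 (b i))) (h2 (b j)))
    have e3 := DFunLike.congr_fun (e1.unique e2) D
    refine e3.trans ?_
    simp only [sub_apply, add_apply, ContinuousLinearMap.comp_apply, ContinuousLinearMap.flip_apply,
      ContinuousLinearMap.apply_apply, Function.comp_apply, ContinuousLinearMap.id_apply,
      lieBrL_apply]
    rw [add_comm (lieBr G (b i) _)]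
  -- The linearized equations of the automorphism group say that `D` is a derivation, and
  -- derivations of a semisimple Lie algebra are inner.
  have hDer : ∀ D : EuclideanSpace ℝ (Fin n) →L[ℝ] EuclideanSpace ℝ (Fin n), fderiv ℝ f (ContinuousLinearMap.id ℝ (EuclideanSpace ℝ (Fin n))) D = 0 →
      ∃ z, D = lieBrL n G z := by
    intro D hD
    have h1 : ∀ x y, D (lieBr G x y) = lieBr G (D x) y + lieBr G x (D y) := by
      let T₁ : EuclideanSpace ℝ (Fin n) →ₗ[ℝ] EuclideanSpace ℝ (Fin n) →ₗ[ℝ] EuclideanSpace ℝ (Fin n) := LinearMap.mk₂ ℝ (fun x y => D (lieBr G x y))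
        (by intros; simp [lieBr_add_left]) (by intros; simp [lieBr_smul_left])
        (by intros; simp [lieBr_add_right]) (by intros; simp [lieBr_smul_right])
      let T₂ : EuclideanSpace ℝ (Fin n) →ₗ[ℝ] EuclideanSpace ℝ (Fin n) →ₗ[ℝ] EuclideanSpace ℝ (Fin n) :=
        LinearMap.mk₂ ℝ (fun x y => lieBr G (D x) y + lieBr G x (D y))
        (by intros; simp only [lieBr_add_left, map_add]; abel)
        (by intros; simp [lieBr_smul_left])
        (by intros; simp only [lieBr_add_right, map_add]; abel)
        (by intros; simp [lieBr_smul_right])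
      have : T₁ = T₂ := by
        refine b.toBasis.ext fun i => b.toBasis.ext fun j => ?_
        have h2 := hfD D i j
        rw [hD] at h2
        have h3 := sub_eq_zero.1 h2.symm
        simpa [T₁, T₂, b] using h3
      exact fun x y => LinearMap.congr_fun₂ this x y
    obtain ⟨z, hz⟩ := exists_eq_lieBr_of_derivation (G := G) (D := D.toLinearMap) h1
    exact ⟨z, ContinuousLinearMap.ext hz⟩
  -- together with `π` they are an immersion at the identity
  let Φ : (EuclideanSpace ℝ (Fin n) →L[ℝ] EuclideanSpace ℝ (Fin n)) → (Fin n → Fin n → EuclideanSpace ℝ (Fin n)) × EuclideanSpace ℝ (Fin n) := fun A => (f A, π A)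
  have hΦd : ContDiff ℝ ∞ Φ := hfd.prodMk π.contDiff
  have hΦinj : LinearMap.ker (fderiv ℝ Φ (ContinuousLinearMap.id ℝ (EuclideanSpace ℝ (Fin n)))).toLinearMap = ⊥ := by
    rw [LinearMap.ker_eq_bot']
    intro D hD
    have h1 : HasFDerivAt Φ _ (ContinuousLinearMap.id ℝ (EuclideanSpace ℝ (Fin n))) :=
      ((hfd.differentiable (by simp)) _).hasFDerivAt.prodMk π.hasFDerivAt
    have hD' : fderiv ℝ Φ (ContinuousLinearMap.id ℝ (EuclideanSpace ℝ (Fin n))) D = 0 := hD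
    rw [h1.fderiv] at hD'
    obtain ⟨z, rfl⟩ := hDer D (congrArg Prod.fst hD')
    have h2 : π (lieBrL n G z) = 0 := congrArg Prod.snd hD'
    rw [hπ] at h2
    rw [h2, map_zero]
  -- Composing with a left inverse of its differential turns `Φ` into a map with identity
  -- derivative; hence `Φ` is injective near the identity.
  obtain ⟨Λ₀, hΛ₀⟩ := LinearMap.exists_leftInverse_of_injective
    (fderiv ℝ Φ (ContinuousLinearMap.id ℝ (EuclideanSpace ℝ (Fin n)))).toLinearMap hΦinj
  let Λ := LinearMap.toContinuousLinearMap Λ₀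
  have hstrict : HasStrictFDerivAt (fun A => Λ (Φ A))
      ((ContinuousLinearEquiv.refl ℝ (EuclideanSpace ℝ (Fin n) →L[ℝ] EuclideanSpace ℝ (Fin n)) : (EuclideanSpace ℝ (Fin n) →L[ℝ] EuclideanSpace ℝ (Fin n)) →L[ℝ] (EuclideanSpace ℝ (Fin n) →L[ℝ] EuclideanSpace ℝ (Fin n))))
      (ContinuousLinearMap.id ℝ (EuclideanSpace ℝ (Fin n))) := by
    have h1 := Λ.hasStrictFDerivAt.comp (ContinuousLinearMap.id ℝ (EuclideanSpace ℝ (Fin n)))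
      (hΦd.contDiffAt.hasStrictFDerivAt (by simp))
    refine h1.congr_fderiv ?_
    ext1 D
    exact DFunLike.congr_fun hΛ₀ D
  let T := hstrict.toOpenPartialHomeomorph
  have hTs : T.source ∈ 𝓝 (ContinuousLinearMap.id ℝ (EuclideanSpace ℝ (Fin n))) :=
    T.open_source.mem_nhds hstrict.mem_toOpenPartialHomeomorph_source
  have hTinj : ∀ A ∈ T.source, ∀ A' ∈ T.source, Φ A = Φ A' → A = A' := fun A hA A' hA' h =>
    T.injOn hA hA' (congrArg Λ h)
  have he0 : e 1 = π (ContinuousLinearMap.id ℝ (EuclideanSpace ℝ (Fin n))) := by rw [hef, AdE_one]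
  have hcont : ContinuousAt (fun A => AdE n (e.symm (π A))) (ContinuousLinearMap.id ℝ (EuclideanSpace ℝ (Fin n))) := by
    refine ContinuousAt.comp (g := AdE n) contMDiff_AdE.continuous.continuousAt ?_
    refine ContinuousAt.comp (g := e.symm) ?_ π.continuous.continuousAt
    rw [← he0]
    exact e.continuousAt_symm (e.map_source he1)
  have hc0 : AdE n (e.symm (π (ContinuousLinearMap.id ℝ (EuclideanSpace ℝ (Fin n))))) = ContinuousLinearMap.id ℝ (EuclideanSpace ℝ (Fin n)) := by
    rw [← he0, e.left_inv he1, AdE_one]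
  refine ⟨{A | A ∈ T.source ∧ π A ∈ e.target ∧ AdE n (e.symm (π A)) ∈ T.source}, ?_, ?_⟩
  · refine Filter.Eventually.and hTs (Filter.Eventually.and ?_ ?_)
    · refine π.continuous.continuousAt.eventually (e.open_target.mem_nhds ?_)
      rw [← he0]
      exact e.map_source he1
    · refine hcont.eventually ?_
      simp only [hc0]
      exact hTs
  · rintro A ⟨h1, h2, h3⟩ hA
    have h4 := e.map_target h2
    -- `A` and `Ad (e.symm (π A))` both satisfy the automorphism equations and have the same image
    -- under `π`, so injectivity of `Φ` identifies them.
    refine ⟨e.symm (π A), interior_subset (heC h4), hTinj _ h3 _ h1 ?_⟩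
    refine Prod.ext ?_ ?_
    · exact (hf0 _ (AdE_lieBr _)).trans (hf0 A hA).symm
    · exact (hef _).symm.trans (e.right_inv h2)

end Inner

/-! ### Diagonalization and functional calculus -/

section Spectral

variable {V : Type*} [AddCommGroup V] [Module ℝ V] [FiniteDimensional ℝ V]

/-- The spectral theorem with respect to an arbitrary inner product. -/
lemma exists_eigenbasis {b : LinearMap.BilinForm ℝ V} (hs : ∀ x y, b x y = b y x)
    (hp : ∀ x, x ≠ 0 → 0 < b x x) {P : V →ₗ[ℝ] V} (hP : ∀ x y, b (P x) y = b x (P y)) :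
    ∃ (e : Module.Basis (Fin (Module.finrank ℝ V)) ℝ V) (l : Fin (Module.finrank ℝ V) → ℝ),
      (∀ i j, b (e i) (e j) = if i = j then 1 else 0) ∧ ∀ i, P (e i) = l i • e i := by
  let core : InnerProductSpace.Core ℝ V :=
    { inner := fun x y => b x y
      conj_inner_symm := fun x y => hs y x
      re_inner_nonneg := fun x => by
        rcases eq_or_ne x 0 with rfl | h
        · simp
        · exact (hp x h).le
      add_left := fun x y z => by simp
      smul_left := fun x y r => by simp
      definite := fun x h => by
        by_contra hx
        exact (hp x hx).ne' h }
  let _ : NormedAddCommGroup V := core.toNormedAddCommGroup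
  let _ : InnerProductSpace ℝ V := InnerProductSpace.ofCore core.toCore
  have hsym : P.IsSymmetric := hP
  refine ⟨(hsym.eigenvectorBasis rfl).toBasis, hsym.eigenvalues rfl, fun i j => ?_, fun i => ?_⟩
  · have := orthonormal_iff_ite.1 (hsym.eigenvectorBasis rfl).orthonormal i j
    rw [OrthonormalBasis.coe_toBasis]
    exact this
  · simp [hsym.apply_eigenvectorBasis rfl i]

/-- Functional calculus for diagonalizable operators. -/
lemma exists_functionalCalculus {ι : Type*} [Fintype ι] (e : Module.Basis ι ℝ V) {l : ι → ℝ}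
    {P : V →ₗ[ℝ] V} (hP : ∀ i, P (e i) = l i • e i) (f : ℝ → ℝ) :
    ∃ F : V →ₗ[ℝ] V, ∀ v μ, P v = μ • v → F v = f μ • v := by
  classical
  refine ⟨e.constr ℝ fun i => f (l i) • e i, fun v μ hv => ?_⟩
  -- A coordinate of `v` can be nonzero only where `l i = μ`; this is why the conclusion covers all
  -- eigenvectors and not just the basis.
  have h1 : ∀ i, l i * e.repr v i = μ * e.repr v i := by
    intro i
    have h2 : P v = ∑ j, (e.repr v j * l j) • e j := by
      conv_lhs => rw [← e.sum_repr v]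
      simp only [map_sum, map_smul, hP, smul_smul]
    have h3 := congrArg (fun w => e.repr w i) hv
    simp only [h2, map_smul, Finsupp.smul_apply, smul_eq_mul] at h3
    rw [e.repr_sum_self] at h3
    linarith
  conv_rhs => rw [← e.sum_repr v]
  rw [Module.Basis.constr_apply_fintype (S := ℝ), Finset.smul_sum]
  refine Finset.sum_congr rfl fun i _ => ?_
  rw [e.equivFun_apply, smul_smul, smul_smul]
  congr 1
  rcases eq_or_ne (e.repr v i) 0 with h | h
  · simp [h]
  · rw [mul_right_cancel₀ h (h1 i), mul_comm]

end Spectral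

/-! ### Cartan involutions and positive definite automorphisms -/

section Cartan

variable {n : ℕ} {G : Type*} [TopologicalSpace G] [ChartedSpace (EuclideanSpace ℝ (Fin n)) G]
  [Group G] [LieGroup (𝓡 n) ∞ G]

variable (n G) in
/-- An invariant form together with a Cartan involution for which it is definite. -/
structure CartanData where
  /-- the invariant form -/
  form : LinearMap.BilinForm ℝ (EuclideanSpace ℝ (Fin n))
  /-- the involution -/
  inv : EuclideanSpace ℝ (Fin n) →L[ℝ] EuclideanSpace ℝ (Fin n)
  inv_inv : ∀ x, inv (inv x) = x
  inv_lieBr : PreservesBr n G inv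
  symm : ∀ x y, form x y = form y x
  form_inv : ∀ x y, form (inv x) (inv y) = form x y
  form_AdE : ∀ (g : G) x y, form (AdE n g x) (AdE n g y) = form x y
  pos : ∀ x, x ≠ 0 → 0 < form x (inv x)

namespace CartanData

variable (D : CartanData n G)

/-- The inner product of a Cartan involution. -/
def ip : LinearMap.BilinForm ℝ (EuclideanSpace ℝ (Fin n)) := D.form.compl₂ D.inv.toLinearMap

lemma ip_apply (x y : EuclideanSpace ℝ (Fin n)) : D.ip x y = D.form x (D.inv y) := rfl

lemma ip_symm (x y : EuclideanSpace ℝ (Fin n)) : D.ip x y = D.ip y x := by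
  rw [ip_apply, ip_apply, ← D.form_inv, D.inv_inv, D.symm]

lemma ip_self_nonneg (x : EuclideanSpace ℝ (Fin n)) : 0 ≤ D.ip x x := by
  rcases eq_or_ne x 0 with rfl | h
  · simp
  · exact (D.pos x h).le

lemma eq_zero_of_ip_self {x : EuclideanSpace ℝ (Fin n)} (h : D.ip x x ≤ 0) : x = 0 := by
  by_contra hx
  exact (D.pos x hx).not_ge h

/-- The adjoint of `Ad g`. -/
def dag (g : G) : EuclideanSpace ℝ (Fin n) →L[ℝ] EuclideanSpace ℝ (Fin n) :=
  D.inv.comp ((AdE n g⁻¹).comp D.inv)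

lemma dag_apply (g : G) (x : EuclideanSpace ℝ (Fin n)) :
    D.dag g x = D.inv (AdE n g⁻¹ (D.inv x)) := rfl

lemma form_AdE_left (g : G) (x y : EuclideanSpace ℝ (Fin n)) :
    D.form (AdE n g x) y = D.form x (AdE n g⁻¹ y) := by
  rw [← D.form_AdE g⁻¹, AdE_inv_apply_AdE]

lemma ip_AdE_left (g : G) (x y : EuclideanSpace ℝ (Fin n)) :
    D.ip (AdE n g x) y = D.ip x (D.dag g y) := by
  rw [ip_apply, ip_apply, form_AdE_left, dag_apply, D.inv_inv]

lemma ip_AdE_right (g : G) (x y : EuclideanSpace ℝ (Fin n)) :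
    D.ip x (AdE n g y) = D.ip (D.dag g x) y := by
  rw [D.ip_symm, ip_AdE_left, D.ip_symm]

lemma dag_mul_apply (g h : G) (x : EuclideanSpace ℝ (Fin n)) :
    D.dag (g * h) x = D.dag h (D.dag g x) := by
  simp only [dag_apply, D.inv_inv, mul_inv_rev, AdE_mul_apply]

lemma dag_one_apply (x : EuclideanSpace ℝ (Fin n)) : D.dag 1 x = x := by
  simp [dag_apply, D.inv_inv]

lemma dag_lieBr (g : G) : PreservesBr n G (D.dag g) := fun x y => by
  simp only [dag_apply, D.inv_lieBr x y, AdE_lieBr, D.inv_lieBr (AdE n g⁻¹ _)]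

lemma form_dag (g : G) (x y : EuclideanSpace ℝ (Fin n)) :
    D.form (D.dag g x) (D.dag g y) = D.form x y := by
  simp only [dag_apply, D.form_inv, D.form_AdE]

/-- The positive definite automorphisms. -/
structure IsPos (P : EuclideanSpace ℝ (Fin n) →L[ℝ] EuclideanSpace ℝ (Fin n)) : Prop where
  br : PreservesBr n G P
  form : ∀ x y, D.form (P x) (P y) = D.form x y
  symm : ∀ x y, D.ip (P x) y = D.ip x (P y)
  nonneg : ∀ x, 0 ≤ D.ip (P x) x

lemma isPos_id : D.IsPos (ContinuousLinearMap.id ℝ _) where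
  br _ _ := rfl
  form _ _ := rfl
  symm _ _ := rfl
  nonneg := D.ip_self_nonneg

variable {D} in
lemma IsPos.conj {P : EuclideanSpace ℝ (Fin n) →L[ℝ] EuclideanSpace ℝ (Fin n)} (h : D.IsPos P)
    (g : G) : D.IsPos ((AdE n g).comp (P.comp (D.dag g))) where
  br x y := by
    simp only [ContinuousLinearMap.comp_apply, D.dag_lieBr g x y, h.br (D.dag g x), AdE_lieBr]
  form x y := by
    simp only [ContinuousLinearMap.comp_apply, D.form_AdE, h.form, D.form_dag]
  symm x y := by
    simp only [ContinuousLinearMap.comp_apply, D.ip_AdE_left, D.ip_AdE_right, h.symm]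
  nonneg x := by
    simp only [ContinuousLinearMap.comp_apply, D.ip_AdE_left]
    exact h.nonneg _

lemma form_eq_zero {x : EuclideanSpace ℝ (Fin n)} (h : ∀ y, D.form x y = 0) : x = 0 :=
  D.eq_zero_of_ip_self (h _).le

/-- Positive definite automorphisms are squares of symmetric inner automorphisms. -/
theorem IsPos.exists_sqrt [T2Space G] [LieAlgebra.IsSemisimple ℝ (GroupLieAlgebra (𝓡 n) G)]
    {P : EuclideanSpace ℝ (Fin n) →L[ℝ] EuclideanSpace ℝ (Fin n)} (h : D.IsPos P) :
    ∃ (X : EuclideanSpace ℝ (Fin n)) (p : G),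
      (∀ x y, D.ip (lieBr G X x) y = D.ip x (lieBr G X y)) ∧
      (∀ x y, D.ip (AdE n p x) y = D.ip x (AdE n p y)) ∧ (∀ x, 0 ≤ D.ip (AdE n p x) x) ∧
      (∀ x, AdE n p (AdE n p x) = P x) ∧
      (∀ a : G, (∀ x, AdE n a (P x) = P (AdE n a x)) → AdE n a X = X) ∧
      (X = 0 → ∀ x, P x = x) := by
  obtain ⟨e, l, he, hl⟩ := exists_eigenbasis D.ip_symm D.pos (P := P.toLinearMap) h.symm
  have hl' : ∀ i, P (e i) = l i • e i := hl
  -- Only nonnegativity is assumed; the eigenvalue zero is excluded because `P` preserves a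
  -- nondegenerate form.
  have hpos : ∀ i, 0 < l i := by
    intro i
    have h1 := h.nonneg (e i)
    rw [hl', map_smul, LinearMap.smul_apply, he, if_pos rfl, smul_eq_mul, mul_one] at h1
    refine lt_of_le_of_ne h1 fun h0 => ?_
    have h2 : e i = 0 := D.form_eq_zero fun y => by
      rw [← h.form, hl', ← h0]
      simp
    exact e.ne_zero i h2
  -- `F` is half the logarithm of `P`. The bracket of eigenvectors for `l i` and `l j` is an
  -- eigenvector for the product and `log` turns products into sums, so `F` is a derivation. It is
  -- therefore some `ad X`, and the square root is `Ad (exp X)`.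
  obtain ⟨F, hF⟩ := exists_functionalCalculus e hl (fun s => Real.log s / 2)
  have hFe : ∀ i, F (e i) = (Real.log (l i) / 2) • e i := fun i => hF _ _ (hl i)
  have hder : ∀ x y, F (lieBr G x y) = lieBr G (F x) y + lieBr G x (F y) := by
    let T₁ : EuclideanSpace ℝ (Fin n) →ₗ[ℝ] EuclideanSpace ℝ (Fin n) →ₗ[ℝ]
        EuclideanSpace ℝ (Fin n) := LinearMap.mk₂ ℝ (fun x y => F (lieBr G x y))
        (by intros; simp [lieBr_add_left]) (by intros; simp [lieBr_smul_left])
        (by intros; simp [lieBr_add_right]) (by intros; simp [lieBr_smul_right])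
    let T₂ : EuclideanSpace ℝ (Fin n) →ₗ[ℝ] EuclideanSpace ℝ (Fin n) →ₗ[ℝ]
        EuclideanSpace ℝ (Fin n) := LinearMap.mk₂ ℝ (fun x y => lieBr G (F x) y + lieBr G x (F y))
        (by intros; simp only [lieBr_add_left, map_add]; abel)
        (by intros; simp [lieBr_smul_left])
        (by intros; simp only [lieBr_add_right, map_add]; abel)
        (by intros; simp [lieBr_smul_right])
    have : T₁ = T₂ := by
      refine e.ext fun i => e.ext fun j => ?_
      have h1 : P (lieBr G (e i) (e j)) = (l i * l j) • lieBr G (e i) (e j) := by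
        rw [h.br, hl', hl', lieBr_smul_left, lieBr_smul_right, smul_smul]
      have h2 := hF _ _ h1
      rw [Real.log_mul (hpos i).ne' (hpos j).ne'] at h2
      simp only [T₁, T₂, LinearMap.mk₂_apply]
      rw [h2, hFe, hFe, lieBr_smul_left, lieBr_smul_right, ← add_smul]
      ring_nf
    exact fun x y => LinearMap.congr_fun₂ this x y
  obtain ⟨X, hX⟩ := exists_eq_lieBr_of_derivation (G := G) hder
  obtain ⟨γ, hγ⟩ := exists_isExpCurve (G := G) X
  have hXe : ∀ i, lieBr G X (e i) = (Real.log (l i) / 2) • e i := fun i => by rw [← hX, hFe]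
  have hpe : ∀ i, AdE n (γ 1) (e i) = Real.exp (Real.log (l i) / 2 * 1) • e i := fun i =>
    hγ.AdE_eigenvector (hXe i) 1
  have hsymm : ∀ (A : EuclideanSpace ℝ (Fin n) →ₗ[ℝ] EuclideanSpace ℝ (Fin n)) (c : _ → ℝ),
      (∀ i, A (e i) = c i • e i) → ∀ x y, D.ip (A x) y = D.ip x (A y) := by
    intro A c hA
    have : D.ip.compl₁₂ A LinearMap.id = D.ip.compl₁₂ LinearMap.id A := by
      refine e.ext fun i => e.ext fun j => ?_
      simp only [LinearMap.compl₁₂_apply, LinearMap.id_apply, hA, map_smul, LinearMap.smul_apply,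
        he, smul_eq_mul]
      split_ifs with hij
      · rw [hij]
      · simp
    exact fun x y => LinearMap.congr_fun₂ this x y
  refine ⟨X, γ 1, hsymm (lieBrL n G X).toLinearMap _ hXe,
    hsymm (AdE n (γ 1)).toLinearMap _ hpe, fun x => ?_, fun x => ?_, fun a ha => ?_, fun h0 => ?_⟩
  · rw [← e.sum_repr x]
    simp only [map_sum, map_smul, hpe, LinearMap.sum_apply, LinearMap.smul_apply, he, smul_eq_mul]
    refine Finset.sum_nonneg fun i _ => ?_
    have : 0 ≤ e.repr x i * (e.repr x i * Real.exp (Real.log (l i) / 2 * 1)) := by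
      rw [← mul_assoc]
      exact mul_nonneg (mul_self_nonneg _) (Real.exp_pos _).le
    simpa using this
  · have : (AdE n (γ 1)).toLinearMap ∘ₗ (AdE n (γ 1)).toLinearMap = P.toLinearMap := by
      refine e.ext fun i => ?_
      simp only [LinearMap.comp_apply, ContinuousLinearMap.coe_coe, hpe, map_smul, hl', smul_smul]
      rw [← Real.exp_add, mul_one, add_halves, Real.exp_log (hpos i)]
    exact DFunLike.congr_fun this x
  -- If `Ad a` commutes with `P`, it preserves the eigenspaces and so commutes with `ad X`; then `Ad
  -- a X - X` is central.
  · have h1 : ∀ y, lieBr G X (AdE n a y) = AdE n a (lieBr G X y) := by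
      have : (lieBrL n G X).toLinearMap ∘ₗ (AdE n a).toLinearMap =
          (AdE n a).toLinearMap ∘ₗ (lieBrL n G X).toLinearMap := by
        refine e.ext fun i => ?_
        simp only [LinearMap.comp_apply, ContinuousLinearMap.coe_coe, lieBrL_apply, hXe, map_smul]
        rw [← hX]
        refine hF _ _ ?_
        refine (ha (e i)).symm.trans ?_
        rw [hl', map_smul]
      exact fun y => DFunLike.congr_fun this y
    refine sub_eq_zero.1 (eq_zero_of_lieBr_eq_zero (G := G) fun y => ?_)
    have h2 := h1 (AdE n a⁻¹ y)
    rw [AdE_lieBr, AdE_apply_AdE_inv] at h2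
    rw [sub_eq_add_neg, lieBr_add_left, lieBr_neg_left, h2, add_neg_cancel]
  · have : P.toLinearMap = LinearMap.id := by
      refine e.ext fun i => ?_
      have h1 := hXe i
      rw [h0, ← lieBrL_apply, map_zero, zero_apply] at h1
      have h2 := smul_eq_zero.1 h1.symm
      rcases h2 with h2 | h2
      · have h3 : Real.log (l i) = 0 := by linarith
        have h4 : l i = 1 := Real.eq_one_of_pos_of_log_eq_zero (hpos i) h3
        exact (hl' i).trans (by rw [h4, one_smul]; rfl)
      · exact absurd h2 (e.ne_zero i)
    exact fun x => DFunLike.congr_fun this x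

end CartanData

end Cartan

/-! ### Compact subgroups, isometries and strongly stable elements -/

section CartanTheory

variable {n : ℕ} {G : Type*} [TopologicalSpace G] [ChartedSpace (EuclideanSpace ℝ (Fin n)) G]
  [Group G] [LieGroup (𝓡 n) ∞ G]

namespace CartanData

variable (D : CartanData n G)

lemma continuous_ip_left (y : EuclideanSpace ℝ (Fin n)) : Continuous fun x => D.ip x y :=
  LinearMap.continuous_of_finiteDimensional (D.ip.flip y)

lemma continuous_ip : Continuous fun p : EuclideanSpace ℝ (Fin n) × EuclideanSpace ℝ (Fin n) =>
    D.ip p.1 p.2 :=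
  (LinearMap.toContinuousLinearMap
    (LinearMap.toContinuousLinearMap.toLinearMap ∘ₗ D.ip)).isBoundedBilinearMap.continuous

lemma continuous_dag : Continuous (D.dag : G → _) := by
  have : IsTopologicalGroup G := topologicalGroup_of_lieGroup (𝓡 n) ∞
  exact continuous_const.clm_comp
    ((contMDiff_AdE.continuous.comp continuous_inv).clm_comp continuous_const)

/-- The subgroup of the elements that act by isometries. -/
def isometrySubgroup : Subgroup G where
  carrier := {g | ∀ x, D.inv (AdE n g x) = AdE n g (D.inv x)}
  one_mem' := fun x => by simp
  mul_mem' := fun {g h} hg hh x => by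
    rw [AdE_mul_apply, AdE_mul_apply, hg, hh]
  inv_mem' := fun {g} hg x => by
    have := hg (AdE n g⁻¹ x)
    rw [AdE_apply_AdE_inv] at this
    rw [this, AdE_inv_apply_AdE]

lemma dag_of_mem {g : G} (hg : g ∈ D.isometrySubgroup) (x : EuclideanSpace ℝ (Fin n)) :
    D.dag g x = AdE n g⁻¹ x := by
  have h : g⁻¹ ∈ D.isometrySubgroup := inv_mem hg
  rw [dag_apply, ← h, D.inv_inv]

lemma mem_of_dag {g : G} (h : ∀ x, AdE n g (D.dag g x) = x) : g ∈ D.isometrySubgroup := by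
  intro x
  have h1 := h (D.inv (AdE n g x))
  rw [dag_apply, D.inv_inv, AdE_inv_apply_AdE] at h1
  exact h1.symm

lemma exists_orthonormalBasis : ∃ e : Module.Basis (Fin n) ℝ (EuclideanSpace ℝ (Fin n)),
    ∀ i j, D.ip (e i) (e j) = if i = j then 1 else 0 := by
  obtain ⟨e, l, he, -⟩ := exists_eigenbasis D.ip_symm D.pos (P := LinearMap.id) fun _ _ => rfl
  refine ⟨e.reindex (finCongr finrank_euclideanSpace_fin), fun i j => ?_⟩
  rw [Module.Basis.reindex_apply, Module.Basis.reindex_apply, he]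
  simp

/-- A bounded closed set of matrices is compact. -/
lemma isCompact_of_entries {ι : Type*} [Fintype ι]
    (e : Module.Basis ι ℝ (EuclideanSpace ℝ (Fin n)))
    {S : Set (EuclideanSpace ℝ (Fin n) →L[ℝ] EuclideanSpace ℝ (Fin n))} (hS : IsClosed S) {R : ℝ}
    (hR : ∀ P ∈ S, ∀ i j, |D.ip (P (e i)) (e j)| ≤ R) : IsCompact S := by
  let T : (EuclideanSpace ℝ (Fin n) →L[ℝ] EuclideanSpace ℝ (Fin n)) →ₗ[ℝ] (ι → ι → ℝ) :=
    { toFun := fun P i j => D.ip (P (e i)) (e j)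
      map_add' := fun P Q => by ext; simp
      map_smul' := fun c P => by ext; simp }
  have hT : LinearMap.ker T = ⊥ := by
    rw [LinearMap.ker_eq_bot']
    intro P hP
    have h1 : P.toLinearMap = 0 := by
      refine e.ext fun i => D.eq_zero_of_ip_self ?_
      have h2 : D.ip (P (e i)) = 0 := e.ext fun j => congrFun (congrFun hP i) j
      exact (DFunLike.congr_fun h2 _).le
    ext1 x
    exact DFunLike.congr_fun h1 x
  have hemb := LinearMap.isClosedEmbedding_of_injective hT
  have hK : IsCompact (Set.pi univ fun _ : ι => Set.pi univ fun _ : ι => Icc (-R) R) :=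
    isCompact_univ_pi fun _ => isCompact_univ_pi fun _ => isCompact_Icc
  refine (hemb.isCompact_preimage hK).of_isClosed_subset hS fun P hP => ?_
  exact fun i _ j _ => abs_le.1 (hR P hP i j)

lemma isClosed_isPos : IsClosed {P | D.IsPos P} := by
  have ha : ∀ x, Continuous fun P : EuclideanSpace ℝ (Fin n) →L[ℝ] EuclideanSpace ℝ (Fin n) => P x :=
    fun x => (ContinuousLinearMap.apply ℝ (EuclideanSpace ℝ (Fin n)) x).continuous
  have hi : ∀ x y, Continuous fun P : EuclideanSpace ℝ (Fin n) →L[ℝ] EuclideanSpace ℝ (Fin n) =>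
      D.ip (P x) y := fun x y => (D.continuous_ip_left y).comp (ha x)
  have : {P | D.IsPos P} = (⋂ x, ⋂ y, {P | P (lieBr G x y) = lieBr G (P x) (P y)}) ∩
      (⋂ x, ⋂ y, {P | D.ip (P x) (D.inv (P y)) = D.form x y}) ∩
      (⋂ x, ⋂ y, {P | D.ip (P x) y = D.ip x (P y)}) ∩ (⋂ x, {P | 0 ≤ D.ip (P x) x}) := by
    ext P
    simp only [mem_ofPred_eq, mem_inter_iff, mem_iInter, ip_apply, D.inv_inv]
    exact ⟨fun h => ⟨⟨⟨h.br, h.form⟩, h.symm⟩, h.nonneg⟩, fun h => ⟨h.1.1.1, h.1.1.2, h.1.2, h.2⟩⟩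
  rw [this]
  refine ((IsClosed.inter ?_ ?_).inter ?_).inter ?_
  · refine isClosed_iInter fun x => isClosed_iInter fun y => isClosed_eq (ha _) ?_
    exact ((lieBrL n G).continuous.comp (ha x)).clm_apply (ha y)
  · refine isClosed_iInter fun x => isClosed_iInter fun y => isClosed_eq ?_ continuous_const
    exact D.continuous_ip.comp ((ha x).prodMk (D.inv.continuous.comp (ha y)))
  · refine isClosed_iInter fun x => isClosed_iInter fun y => isClosed_eq (hi x y) ?_
    exact D.continuous_ip.comp (continuous_const.prodMk (ha y))
  · exact isClosed_iInter fun x => isClosed_le continuous_const (hi x x)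

section FixedPoint

variable {ι : Type*} [Fintype ι] (e : Module.Basis ι ℝ (EuclideanSpace ℝ (Fin n)))

/-- The trace of `Ad c ∘ P ∘ (Ad c)^*`. -/
def energy (P : EuclideanSpace ℝ (Fin n) →L[ℝ] EuclideanSpace ℝ (Fin n)) (c : G) : ℝ :=
  ∑ i, D.ip (P (D.dag c (e i))) (D.dag c (e i))

lemma continuous_energy : Continuous fun p :
    (EuclideanSpace ℝ (Fin n) →L[ℝ] EuclideanSpace ℝ (Fin n)) × G => D.energy e p.1 p.2 := by
  have h : ∀ i, Continuous fun p : (EuclideanSpace ℝ (Fin n) →L[ℝ] EuclideanSpace ℝ (Fin n)) × G =>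
      D.dag p.2 (e i) := fun i =>
    (D.continuous_dag.comp continuous_snd).clm_apply continuous_const
  refine continuous_finsetSum _ fun i _ => ?_
  exact D.continuous_ip.comp ((continuous_fst.clm_apply (h i)).prodMk (h i))

lemma continuous_energy_right
    (P : EuclideanSpace ℝ (Fin n) →L[ℝ] EuclideanSpace ℝ (Fin n)) :
    Continuous fun c : G => D.energy e P c := by
  have h : ∀ i, Continuous fun c : G => D.dag c (e i) := fun i =>
    D.continuous_dag.clm_apply continuous_const
  refine continuous_finsetSum _ fun i _ => ?_
  exact D.continuous_ip.comp ((P.continuous.comp (h i)).prodMk (h i))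

/-- Moving `P` by `d` amounts to a right translation of `c`; so for `d` in a group the set of
energies over that group does not change. -/
lemma energy_conj (P : EuclideanSpace ℝ (Fin n) →L[ℝ] EuclideanSpace ℝ (Fin n)) (c d : G) :
    D.energy e ((AdE n d).comp (P.comp (D.dag d))) c = D.energy e P (c * d) := by
  simp only [energy, ContinuousLinearMap.comp_apply, D.ip_AdE_left, D.dag_mul_apply]

-- Positivity on `e i ± e j` bounds an entry by the mean of two diagonal entries, and each of these
-- is at most the sum of all diagonal entries.
variable {e} in
lemma abs_entry_le {P : EuclideanSpace ℝ (Fin n) →L[ℝ] EuclideanSpace ℝ (Fin n)} (h : D.IsPos P)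
    (i j : ι) : |D.ip (P (e i)) (e j)| ≤ D.energy e P 1 := by
  have h1 : ∀ i, D.ip (P (e i)) (e i) ≤ D.energy e P 1 := fun i => by
    have := Finset.single_le_sum (f := fun i => D.ip (P (D.dag 1 (e i))) (D.dag 1 (e i)))
      (fun i _ => h.nonneg _) (Finset.mem_univ i)
    simpa only [energy, D.dag_one_apply] using this
  have h2 := h.nonneg (e i + e j)
  have h3 := h.nonneg (e i - e j)
  have h4 : D.ip (P (e j)) (e i) = D.ip (P (e i)) (e j) := by rw [h.symm, D.ip_symm]
  simp only [map_add, map_sub, LinearMap.add_apply, LinearMap.sub_apply, h4] at h2 h3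
  have := h1 i
  have := h1 j
  rw [abs_le]
  constructor <;> linarith

set_option maxHeartbeats 1000000 in
/-- A compact group of inner automorphisms fixes a positive definite automorphism. -/
theorem exists_isPos_fixed [T2Space G] [LieAlgebra.IsSemisimple ℝ (GroupLieAlgebra (𝓡 n) G)]
    {Z : Subgroup G} (hZ : IsCompact (Z : Set G)) :
    ∃ P, D.IsPos P ∧ ∀ c ∈ Z, ∀ x, AdE n c (P (D.dag c x)) = P x := by
  obtain ⟨e, he⟩ := D.exists_orthonormalBasis
  -- The fixed point is a minimizer of the largest energy along the orbit under `Z`. A minimum is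
  -- attained because a sublevel set is closed with bounded entries.
  let F : (EuclideanSpace ℝ (Fin n) →L[ℝ] EuclideanSpace ℝ (Fin n)) → ℝ := fun P =>
    sSup (D.energy e P '' (Z : Set G))
  have hF : Continuous F := hZ.continuous_sSup (D.continuous_energy e)
  have hEc := D.continuous_energy_right e
  have hle : ∀ P, ∀ c ∈ Z, D.energy e P c ≤ F P := fun P c hc =>
    le_csSup ((hZ.image (hEc P)).bddAbove) (mem_image_of_mem _ hc)
  have hmax : ∀ P, ∃ c ∈ Z, F P = D.energy e P c := fun P => by
    obtain ⟨c, hc, h1⟩ := hZ.exists_sSup_image_eq ⟨1, Z.one_mem⟩ (hEc P).continuousOn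
    exact ⟨c, hc, h1⟩
  set R := F (ContinuousLinearMap.id ℝ _)
  have hcomp : IsCompact ({P | D.IsPos P} ∩ {P | F P ≤ R}) := by
    refine D.isCompact_of_entries e (D.isClosed_isPos.inter (isClosed_le hF continuous_const))
      (R := R) ?_
    exact fun P hP i j => (D.abs_entry_le hP.1 i j).trans ((hle P 1 Z.one_mem).trans hP.2)
  obtain ⟨P, ⟨hP, hPR⟩, hPmin⟩ := hcomp.exists_isMinOn
    ⟨ContinuousLinearMap.id ℝ _, D.isPos_id, le_refl R⟩ hF.continuousOn
  have hmin : ∀ Q, D.IsPos Q → F P ≤ F Q := by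
    intro Q hQ
    by_cases h : F Q ≤ R
    · exact hPmin ⟨hQ, h⟩
    · exact hPR.trans (not_le.1 h).le
  refine ⟨P, hP, fun d hd x => ?_⟩
  set Q := (AdE n d).comp (P.comp (D.dag d)) with hQdef
  have hQ : D.IsPos Q := hP.conj d
  have hQF : F Q ≤ F P := by
    obtain ⟨c, hc, h1⟩ := hmax Q
    rw [h1, hQdef, energy_conj]
    exact hle P _ (Z.mul_mem hc hd)
  -- the midpoint of `P` and `Q`
  obtain ⟨-, p, -, hps, -, hpp, -, -⟩ := hP.exists_sqrt
  have hdagp : ∀ x, D.dag p x = AdE n p x := fun x => by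
    refine sub_eq_zero.1 (D.eq_zero_of_ip_self ?_)
    have : ∀ y, D.ip (D.dag p x - AdE n p x) y = 0 := fun y => by
      rw [map_sub, LinearMap.sub_apply, ← D.ip_AdE_right, hps, sub_self]
    exact (this _).le
  have hdagp' : ∀ x, D.dag p⁻¹ x = AdE n p⁻¹ x := fun x => by
    have h1 := D.dag_mul_apply p⁻¹ p x
    rw [inv_mul_cancel, D.dag_one_apply, hdagp] at h1
    conv_rhs => rw [h1, AdE_inv_apply_AdE]
  -- Writing `p` and `r` for their adjoint actions: if `P = p²` and `p⁻¹ Q p⁻¹ = r²`, the geodesic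
  -- from `P` to `Q` has midpoint `M = p r p`.
  have hR : D.IsPos ((AdE n p⁻¹).comp (Q.comp (D.dag p⁻¹))) := hQ.conj p⁻¹
  obtain ⟨-, r, -, hrs, hr0, hrr, -, -⟩ := hR.exists_sqrt
  have hQr : ∀ x, Q x = AdE n p (AdE n r (AdE n r (AdE n p x))) := fun x => by
    rw [hrr]
    simp only [ContinuousLinearMap.comp_apply, hdagp', AdE_inv_apply_AdE, AdE_apply_AdE_inv]
  have hr : D.IsPos (AdE n r) := ⟨AdE_lieBr r, D.form_AdE r, hrs, hr0⟩
  have hM : D.IsPos ((AdE n p).comp ((AdE n r).comp (D.dag p))) := hr.conj p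
  set M := (AdE n p).comp ((AdE n r).comp (D.dag p)) with hMdef
  obtain ⟨c, hc, h1⟩ := hmax M
  let y : Fin _ → EuclideanSpace ℝ (Fin n) := fun i => AdE n p (D.dag c (e i))
  have e1 : D.energy e P c = ∑ i, D.ip (y i) (y i) := by
    refine Finset.sum_congr rfl fun i _ => ?_
    rw [← hpp, hps]
  have e2 : D.energy e Q c = ∑ i, D.ip (AdE n r (y i)) (AdE n r (y i)) := by
    refine Finset.sum_congr rfl fun i _ => ?_
    rw [hQr, hps, hrs]
  have e3 : D.energy e M c = ∑ i, D.ip (AdE n r (y i)) (y i) := by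
    refine Finset.sum_congr rfl fun i _ => ?_
    rw [hMdef]
    simp only [ContinuousLinearMap.comp_apply, hdagp, hps]
    rfl
  -- Since `c` maximizes the energy of `M`, the right side is at most `F P + F Q - 2 F M`, which is
  -- nonpositive by minimality of `P` and `F Q ≤ F P`. Hence `Ad r = 1` and `Q = P`.
  have e4 : ∑ i, D.ip (AdE n r (y i) - y i) (AdE n r (y i) - y i) =
      D.energy e P c + D.energy e Q c - 2 * D.energy e M c := by
    rw [e1, e2, e3, Finset.mul_sum, ← Finset.sum_add_distrib, ← Finset.sum_sub_distrib]
    refine Finset.sum_congr rfl fun i _ => ?_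
    simp only [map_sub, LinearMap.sub_apply]
    rw [D.ip_symm (y i) (AdE n r (y i))]
    ring
  have e5 : ∑ i, D.ip (AdE n r (y i) - y i) (AdE n r (y i) - y i) ≤ 0 := by
    have := hmin M hM
    have := hle P c hc
    have := hle Q c hc
    linarith
  have e6 : ∀ i, AdE n r (y i) = y i := fun i => by
    refine sub_eq_zero.1 (D.eq_zero_of_ip_self ?_)
    exact (Finset.single_le_sum (f := fun i => D.ip (AdE n r (y i) - y i) (AdE n r (y i) - y i))
      (fun i _ => D.ip_self_nonneg _) (Finset.mem_univ i)).trans e5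
  have e7 : ∀ z, AdE n r (AdE n p (D.dag c z)) = AdE n p (D.dag c z) := by
    have : (AdE n r).toLinearMap ∘ₗ (AdE n p).toLinearMap ∘ₗ (D.dag c).toLinearMap =
      (AdE n p).toLinearMap ∘ₗ (D.dag c).toLinearMap := e.ext e6
    exact fun z => DFunLike.congr_fun this z
  have e8 : ∀ z, AdE n r z = z := fun z => by
    have h2 := e7 (D.dag c⁻¹ (AdE n p⁻¹ z))
    rw [← D.dag_mul_apply, inv_mul_cancel, D.dag_one_apply, AdE_apply_AdE_inv] at h2
    exact h2
  change Q x = P x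
  rw [hQr, e8, e8, hpp]

end FixedPoint

/-- An element with compact centralizer commutes with no noncompact one-parameter group. -/
theorem eq_zero_of_AdE_eq [T2Space G] [LieAlgebra.IsSemisimple ℝ (GroupLieAlgebra (𝓡 n) G)]
    {a : G} (ha : a ∈ stronglyStable G) {Y : EuclideanSpace ℝ (Fin n)} (haY : AdE n a Y = Y)
    (hY : ∀ x y, D.ip (lieBr G Y x) y = D.ip x (lieBr G Y y)) : Y = 0 := by
  obtain ⟨e, l, he, hl⟩ := exists_eigenbasis D.ip_symm D.pos (P := (lieBrL n G Y).toLinearMap) hY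
  obtain ⟨γ, hγ⟩ := exists_isExpCurve (G := G) Y
  have h1 : (fun t => a * γ t * a⁻¹) = γ := by
    have := hγ.conj a
    rw [haY] at this
    exact this.unique hγ
  -- The one-parameter group of `Y` commutes with `a`, so it stays in a compact set; a nonzero
  -- eigenvalue of `ad Y` would make its adjoint action unbounded.
  have h2 : ∀ t, γ t ∈ Subgroup.centralizer {a} := fun t => by
    rw [Subgroup.mem_centralizer_singleton_iff]
    exact (mul_inv_eq_iff_eq_mul.1 (congrFun h1 t)).symm
  have hc : IsCompact (Subgroup.centralizer {a} : Set G) := ha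
  have h3 : ∀ i, l i = 0 := by
    intro i
    by_contra h0
    have hb := (hc.image (f := fun g => AdE n g (e i))
      (contMDiff_AdE.continuous.clm_apply continuous_const)).isBounded
    obtain ⟨C, hC⟩ := hb.exists_norm_le
    have h4 : ∀ s : ℝ, Real.exp s * ‖e i‖ ≤ C := fun s => by
      have h5 := hC _ (mem_image_of_mem _ (h2 (s / l i)))
      rw [hγ.AdE_eigenvector (hl i), norm_smul, Real.norm_eq_abs, Real.abs_exp,
        mul_div_cancel₀ _ h0] at h5
      exact h5
    have h6 : 0 < ‖e i‖ := norm_pos_iff.2 (e.ne_zero i)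
    have h7 := h4 (C / ‖e i‖)
    have h8 := Real.add_one_le_exp (C / ‖e i‖)
    have h9 : C / ‖e i‖ * ‖e i‖ = C := div_mul_cancel₀ _ h6.ne'
    nlinarith
  refine eq_zero_of_lieBr_eq_zero (G := G) fun y => ?_
  have : (lieBrL n G Y).toLinearMap = 0 := e.ext fun i => by
    rw [hl, h3, zero_smul]; rfl
  exact DFunLike.congr_fun this y

/-- An element with compact centralizer is conjugate to an isometry. -/
theorem exists_conj_mem [T2Space G] [LieAlgebra.IsSemisimple ℝ (GroupLieAlgebra (𝓡 n) G)]
    {g : G} (hg : g ∈ stronglyStable G) : ∃ h : G, h⁻¹ * g * h ∈ D.isometrySubgroup := by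
  -- `g` lies in its own compact centralizer, so it fixes some `P = (Ad p)²`. Translating `P` to the
  -- identity shows that `p⁻¹ g p` fixes the identity, i.e. acts by an isometry.
  obtain ⟨P, hP, hfix⟩ := D.exists_isPos_fixed (Z := Subgroup.centralizer {g}) hg
  obtain ⟨-, p, -, hps, -, hpp, -, -⟩ := hP.exists_sqrt
  have hg' : g ∈ Subgroup.centralizer {g} := by
    rw [Subgroup.mem_centralizer_singleton_iff]
  have hdagp : ∀ x, D.dag p x = AdE n p x := fun x => by
    refine sub_eq_zero.1 (D.eq_zero_of_ip_self ?_)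
    have : ∀ y, D.ip (D.dag p x - AdE n p x) y = 0 := fun y => by
      rw [map_sub, LinearMap.sub_apply, ← D.ip_AdE_right, hps, sub_self]
    exact (this _).le
  have hdagp' : ∀ x, D.dag p⁻¹ x = AdE n p⁻¹ x := fun x => by
    have h1 := D.dag_mul_apply p⁻¹ p x
    rw [inv_mul_cancel, D.dag_one_apply, hdagp] at h1
    conv_rhs => rw [h1, AdE_inv_apply_AdE]
  refine ⟨p, D.mem_of_dag fun x => ?_⟩
  have h1 := hfix g hg' (AdE n p⁻¹ x)
  rw [← hpp, ← hpp, AdE_apply_AdE_inv] at h1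
  simp only [D.dag_mul_apply, AdE_mul_apply, hdagp, hdagp']
  rw [h1, AdE_inv_apply_AdE]

/-- Two isometries with compact centralizer are conjugate only by isometries. -/
theorem mem_of_conj_mem [T2Space G] [LieAlgebra.IsSemisimple ℝ (GroupLieAlgebra (𝓡 n) G)]
    {a h : G} (ha : a ∈ stronglyStable G) (haK : a ∈ D.isometrySubgroup)
    (hh : h * a * h⁻¹ ∈ D.isometrySubgroup) : h ∈ D.isometrySubgroup := by
  -- This is the identity moved by `h`. As `a` and `b = h a h⁻¹` are isometries, `Ad b` commutes
  -- with it and hence fixes `X`, half its logarithm. Strong stability of `b` forces `X = 0`, so `h`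
  -- is an isometry.
  have hQ : D.IsPos ((AdE n h).comp ((ContinuousLinearMap.id ℝ _).comp (D.dag h))) :=
    D.isPos_id.conj h
  obtain ⟨b, hb⟩ : ∃ b, b = h * a * h⁻¹ := ⟨_, rfl⟩
  rw [← hb] at hh
  obtain ⟨X, -, hX, -, -, -, hcomm, h0⟩ := hQ.exists_sqrt
  have hbS : b ∈ stronglyStable G := by
    have : IsTopologicalGroup G := topologicalGroup_of_lieGroup (𝓡 n) ∞
    have h1 : (Subgroup.centralizer {b} : Set G) =
        (fun x => h * x * h⁻¹) '' (Subgroup.centralizer {a} : Set G) := by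
      ext x
      constructor
      · intro hx
        refine ⟨h⁻¹ * x * h, ?_, by group⟩
        rw [SetLike.mem_coe, Subgroup.mem_centralizer_singleton_iff] at hx ⊢
        calc h⁻¹ * x * h * a = h⁻¹ * (x * b) * h := by rw [hb]; group
          _ = a * (h⁻¹ * x * h) := by rw [hx, hb]; group
      · rintro ⟨x, hx, rfl⟩
        rw [SetLike.mem_coe, Subgroup.mem_centralizer_singleton_iff] at hx ⊢
        calc h * x * h⁻¹ * b = h * (x * a) * h⁻¹ := by rw [hb]; group
          _ = b * (h * x * h⁻¹) := by rw [hx, hb]; group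
    have ha' : IsCompact (Subgroup.centralizer {a} : Set G) := ha
    change IsCompact (Subgroup.centralizer {b} : Set G)
    rw [h1]
    exact ha'.image ((continuous_const.mul continuous_id).mul continuous_const)
  have hX0 : X = 0 := by
    refine D.eq_zero_of_AdE_eq hbS (hcomm b fun x => ?_) hX
    simp only [ContinuousLinearMap.comp_apply, ContinuousLinearMap.id_apply]
    have e1 : ∀ x, AdE n b (D.dag b x) = x := fun x => by
      rw [D.dag_of_mem hh, AdE_apply_AdE_inv]
    have e2 : ∀ x, AdE n a (D.dag a x) = x := fun x => by
      rw [D.dag_of_mem haK, AdE_apply_AdE_inv]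
    have e3 : ∀ x, D.dag b (AdE n b x) = x := fun x => by
      rw [D.dag_of_mem hh, AdE_inv_apply_AdE]
    have e4 : b * h = h * a := by rw [hb]; group
    calc AdE n b (AdE n h (D.dag h x)) = AdE n (b * h) (D.dag (b * h) (AdE n b x)) := by
          rw [D.dag_mul_apply, e3, AdE_mul_apply]
      _ = AdE n h (D.dag h (AdE n b x)) := by
          rw [e4, D.dag_mul_apply, AdE_mul_apply, e2]
  exact D.mem_of_dag (h0 hX0)

/-- The group of isometries is compact if some element has compact centralizer. -/
theorem isCompact_isometrySubgroup [T2Space G] [ConnectedSpace G]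
    [LieAlgebra.IsSemisimple ℝ (GroupLieAlgebra (𝓡 n) G)]
    {g₀ : G} (hg₀ : g₀ ∈ stronglyStable G) : IsCompact (D.isometrySubgroup : Set G) := by
  have : IsTopologicalGroup G := topologicalGroup_of_lieGroup (𝓡 n) ∞
  have : LocallyCompactSpace G := ChartedSpace.locallyCompactSpace (EuclideanSpace ℝ (Fin n)) G
  obtain ⟨e, he⟩ := D.exists_orthonormalBasis
  obtain ⟨C, hC, hC1⟩ := exists_compact_mem_nhds (1 : G)
  obtain ⟨W, hW, hWC⟩ := exists_AdE_eq_of_preservesBr (n := n) hC1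
  have hAd : Continuous (AdE n : G → _) := contMDiff_AdE.continuous
  have hclosed : IsClosed (D.isometrySubgroup : Set G) := by
    have : (D.isometrySubgroup : Set G) =
        ⋂ x, {g | D.inv (AdE n g x) = AdE n g (D.inv x)} := by
      ext g; simp only [mem_iInter]; rfl
    rw [this]
    exact isClosed_iInter fun x => isClosed_eq
      (D.inv.continuous.comp (hAd.clm_apply continuous_const)) (hAd.clm_apply continuous_const)
  -- `T` is compact because isometries have bounded entries. It is covered by finitely many
  -- translates of a neighbourhood in which automorphisms are `Ad` of elements of `C`; the remaining
  -- ambiguity is the kernel of `Ad`, which is central and so lies in the compact centralizer of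
  -- `g₀`.
  set T := closure (AdE n '' (D.isometrySubgroup : Set G)) with hT
  have hTc : IsCompact T := by
    refine D.isCompact_of_entries e isClosed_closure (R := 1) fun P hP i j => ?_
    revert P
    have hcl : IsClosed {P : EuclideanSpace ℝ (Fin n) →L[ℝ] EuclideanSpace ℝ (Fin n) |
        |D.ip (P (e i)) (e j)| ≤ 1} :=
      isClosed_le ((D.continuous_ip_left _).comp
        (ContinuousLinearMap.apply ℝ (EuclideanSpace ℝ (Fin n)) (e i)).continuous).abs
        continuous_const
    refine closure_minimal ?_ hcl
    rintro _ ⟨g, hg, rfl⟩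
    have h1 : D.ip (AdE n g (e i)) (AdE n g (e i)) = 1 := by
      rw [D.ip_AdE_left, D.dag_of_mem hg, AdE_inv_apply_AdE, he, if_pos rfl]
    have h2 : D.ip (e j) (e j) = 1 := by rw [he, if_pos rfl]
    have h3 := D.ip_self_nonneg (AdE n g (e i) + e j)
    have h4 := D.ip_self_nonneg (AdE n g (e i) - e j)
    simp only [map_add, map_sub, LinearMap.add_apply, LinearMap.sub_apply,
      D.ip_symm (e j) (AdE n g (e i)), h1, h2] at h3 h4
    change |D.ip (AdE n g (e i)) (e j)| ≤ 1
    refine abs_le.2 ?_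
    constructor <;> linarith
  have hexp : ∀ z, ∑ i, D.ip z (e i) • e i = z := fun z => by
    have : ∑ i, (D.ip.flip (e i)).smulRight (e i) = LinearMap.id := e.ext fun j => by
      simp [he]
    have h1 := DFunLike.congr_fun this z
    simpa using h1
  -- The adjoint for the inner product, written in the orthonormal basis so that it is linear on all
  -- endomorphisms and therefore continuous.
  let star : (EuclideanSpace ℝ (Fin n) →L[ℝ] EuclideanSpace ℝ (Fin n)) →ₗ[ℝ]
      (EuclideanSpace ℝ (Fin n) →L[ℝ] EuclideanSpace ℝ (Fin n)) :=
    { toFun := fun A => LinearMap.toContinuousLinearMap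
        (∑ i, (D.ip.flip (A (e i))).smulRight (e i))
      map_add' := fun A A' => by ext1 x; simp [add_smul, Finset.sum_add_distrib]
      map_smul' := fun c A => by ext1 x; simp [Finset.smul_sum, smul_smul] }
  have hstar : ∀ A x, star A x = ∑ i, D.ip x (A (e i)) • e i := fun A x => by
    simp [star]
  have hstarc : Continuous star := LinearMap.continuous_of_finiteDimensional star
  have hstarAd : ∀ g ∈ D.isometrySubgroup, ∀ x, star (AdE n g) x = AdE n g⁻¹ x := fun g hg x => by
    rw [hstar, ← D.dag_of_mem hg, ← hexp (D.dag g x)]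
    simp only [D.ip_AdE_right]
  have hstarT : ∀ A ∈ T, (star A).comp A = ContinuousLinearMap.id ℝ _ := by
    have hcl : IsClosed {A | (star A).comp A = ContinuousLinearMap.id ℝ _} :=
      isClosed_eq (hstarc.clm_comp continuous_id) continuous_const
    refine closure_minimal ?_ hcl
    rintro _ ⟨g, hg, rfl⟩
    refine ContinuousLinearMap.ext fun x => ?_
    rw [ContinuousLinearMap.comp_apply, hstarAd g hg, AdE_inv_apply_AdE]
    rfl
  let U : G → Set (EuclideanSpace ℝ (Fin n) →L[ℝ] EuclideanSpace ℝ (Fin n)) := fun g =>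
    {A | (star A).comp (AdE n g) ∈ interior W}
  have hU : ∀ g, IsOpen (U g) := fun g =>
    isOpen_interior.preimage (hstarc.clm_comp continuous_const)
  have hcover : T ⊆ ⋃ g : D.isometrySubgroup, U g := by
    intro A hA
    have hO : IsOpen {A' | (star A).comp A' ∈ interior W} :=
      isOpen_interior.preimage (continuous_const.clm_comp continuous_id)
    have hAO : A ∈ {A' | (star A).comp A' ∈ interior W} := by
      change (star A).comp A ∈ interior W
      rw [hstarT A hA]
      exact mem_interior_iff_mem_nhds.2 hW
    obtain ⟨_, h1, g, hg, rfl⟩ := mem_closure_iff.1 hA _ hO hAO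
    exact mem_iUnion.2 ⟨⟨g, hg⟩, h1⟩
  obtain ⟨F, hF⟩ := hTc.elim_finite_subcover (fun g : D.isometrySubgroup => U g)
    (fun g => hU g) hcover
  let Z : Set G := Subgroup.centralizer {g₀}
  have hZ : IsCompact Z := hg₀
  have hcompact : IsCompact (⋃ g ∈ F, (fun p : G × G => (g : G) * p.1⁻¹ * p.2) '' (C ×ˢ Z)) := by
    refine F.isCompact_biUnion fun g _ => (hC.prod hZ).image ?_
    exact (continuous_const.mul continuous_fst.inv).mul continuous_snd
  refine hcompact.of_isClosed_subset hclosed fun h hh => ?_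
  have h1 : AdE n h ∈ T := subset_closure (mem_image_of_mem _ hh)
  obtain ⟨g, hgF, hg⟩ := mem_iUnion₂.1 (hF h1)
  have h4 : (star (AdE n h)).comp (AdE n (g : G)) = AdE n (h⁻¹ * g) := by
    ext1 x
    rw [ContinuousLinearMap.comp_apply, hstarAd h hh, AdE_mul_apply]
  have h5 : (star (AdE n h)).comp (AdE n (g : G)) ∈ interior W := hg
  rw [h4] at h5
  -- `h⁻¹ g` acts like some `c ∈ C`, so `c g⁻¹ h` is in the kernel of `Ad`, and `h = g c⁻¹ (c g⁻¹
  -- h)`.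
  obtain ⟨c, hc, hcA⟩ := hWC _ (interior_subset h5) (AdE_lieBr _)
  refine mem_iUnion₂.2 ⟨g, hgF, (c, c * (g : G)⁻¹ * h), ⟨hc, ?_⟩, by simp [mul_assoc]⟩
  have h2 : AdE n (c * (g : G)⁻¹ * h) = ContinuousLinearMap.id ℝ _ := by
    ext1 x
    rw [mul_assoc, AdE_mul_apply, hcA, ← AdE_mul_apply]
    simp [mul_assoc]
  exact Subgroup.mem_centralizer_singleton_iff.2 (mul_comm_of_AdE_eq_one h2 g₀)

end CartanData

end CartanTheory

/-! ### The normalized form of the pair `(G, K)` -/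

section Pair

variable {n : ℕ} {G : Type*} [TopologicalSpace G] [ChartedSpace (EuclideanSpace ℝ (Fin n)) G]
  [Group G] [LieGroup (𝓡 n) ∞ G]

/-- Differentiate the `Ad`-invariance of the form along the one-parameter group of `Y`. -/
lemma CartanData.form_lieBr (D : CartanData n G) [T2Space G] (Y x z : EuclideanSpace ℝ (Fin n)) :
    D.form (lieBr G Y x) z = -D.form x (lieBr G Y z) := by
  obtain ⟨γ, hγ⟩ := exists_isExpCurve (G := G) Y
  let b : EuclideanSpace ℝ (Fin n) →L[ℝ] EuclideanSpace ℝ (Fin n) →L[ℝ] ℝ :=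
    LinearMap.toContinuousLinearMap
      (LinearMap.toContinuousLinearMap.toLinearMap ∘ₗ D.form)
  have h1 := (b.hasFDerivAt.comp_hasDerivAt (0 : ℝ) (hγ.hasDerivAt_AdE x 0)).clm_apply
    (hγ.hasDerivAt_AdE z 0)
  have h2 : (fun t => b (AdE n (γ t) x) (AdE n (γ t) z)) = fun _ => D.form x z := by
    funext t; exact D.form_AdE _ _ _
  have h3 : HasDerivAt (fun t => b (AdE n (γ t) x) (AdE n (γ t) z)) 0 0 := by
    rw [h2]; exact hasDerivAt_const _ _
  have h4 := h1.unique h3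
  simp only [hγ.zero, AdE_one, ContinuousLinearMap.id_apply, Function.comp_apply] at h4
  have h5 : D.form (lieBr G Y x) z + D.form x (lieBr G Y z) = 0 := h4
  linarith

variable {k : ℕ} {K : Subgroup G} [ChartedSpace (EuclideanSpace ℝ (Fin k)) K]
  {B : LinearMap.BilinForm ℝ (GroupLieAlgebra (𝓡 n) G)}

namespace IsNormalizedForm

variable (hB : IsNormalizedForm k K B)
include hB

lemma apply_kp {x y : GroupLieAlgebra (𝓡 n) G} (hx : x ∈ lieSub n k K) (hy : y ∈ lieOrth k K B) :
    B x y = 0 := hy x hx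

lemma apply_pk {x y : GroupLieAlgebra (𝓡 n) G} (hx : x ∈ lieOrth k K B) (hy : y ∈ lieSub n k K) :
    B x y = 0 := by rw [hB.symm]; exact hx y hy

lemma exists_add (x : GroupLieAlgebra (𝓡 n) G) :
    ∃ u ∈ lieSub n k K, ∃ v ∈ lieOrth k K B, u + v = x := by
  have : x ∈ lieSub n k K ⊔ lieOrth k K B := by
    rw [hB.cartan.isCompl.sup_eq_top]; trivial
  exact Submodule.mem_sup.1 this

lemma exists_involution : ∃ θ : GroupLieAlgebra (𝓡 n) G →ₗ[ℝ] GroupLieAlgebra (𝓡 n) G,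
    (∀ x ∈ lieSub n k K, θ x = x) ∧ ∀ x ∈ lieOrth k K B, θ x = -x := by
  refine ⟨(2 : ℝ) • (lieSub n k K).projection (lieOrth k K B) hB.cartan.isCompl - LinearMap.id,
    fun x hx => ?_, fun x hx => ?_⟩
  · rw [LinearMap.sub_apply, LinearMap.smul_apply, Submodule.projection_apply_of_mem_left _ hx,
      LinearMap.id_apply, two_smul, add_sub_cancel_right]
  · have : (lieSub n k K).projection (lieOrth k K B) hB.cartan.isCompl x = 0 := by
      rw [← LinearMap.mem_ker, Submodule.ker_projection]; exact hx
    rw [LinearMap.sub_apply, LinearMap.smul_apply, this, LinearMap.id_apply, smul_zero, zero_sub]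

/-- The bracket relations of the Cartan decomposition make the involution an automorphism, and the
signs of `B` on `𝔨` and `𝔭` make `B(x, θ x)` positive. -/
lemma exists_cartanData : ∃ D : CartanData n G, (∀ x y, D.form x y = B x y) ∧
    (∀ x ∈ lieSub n k K, (D.inv x : GroupLieAlgebra (𝓡 n) G) = x) ∧
    ∀ x ∈ lieOrth k K B, (D.inv x : GroupLieAlgebra (𝓡 n) G) = -x := by
  obtain ⟨θ, h1, h2⟩ := hB.exists_involution
  have hc := hB.cartan
  have hii : ∀ x, θ (θ x) = x := fun x => by
    obtain ⟨u, hu, v, hv, rfl⟩ := hB.exists_add x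
    simp only [map_add, h1 u hu, h2 v hv, map_neg, neg_neg]
  have hbr : ∀ x y : GroupLieAlgebra (𝓡 n) G, θ ⁅x, y⁆ = ⁅θ x, θ y⁆ := fun x y => by
    obtain ⟨u, hu, v, hv, rfl⟩ := hB.exists_add x
    obtain ⟨u', hu', v', hv', rfl⟩ := hB.exists_add y
    have e4 : ⁅v, u'⁆ ∈ lieOrth k K B := by
      rw [← lie_skew]; exact neg_mem (hc.lie_kp u' hu' v hv)
    simp only [map_add, h1 u hu, h2 v hv, h1 u' hu', h2 v' hv', add_lie, lie_add, neg_lie, lie_neg,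
      h1 _ (hc.lie_kk u hu u' hu'), h2 _ (hc.lie_kp u hu v' hv'), h2 _ e4,
      h1 _ (hc.lie_pp v hv v' hv'), neg_add, neg_neg]
  have hform : ∀ x y, B (θ x) (θ y) = B x y := fun x y => by
    obtain ⟨u, hu, v, hv, rfl⟩ := hB.exists_add x
    obtain ⟨u', hu', v', hv', rfl⟩ := hB.exists_add y
    simp only [map_add, LinearMap.add_apply, h1 u hu, h2 v hv, h1 u' hu', h2 v' hv', map_neg,
      LinearMap.neg_apply, hB.apply_kp hu hv', hB.apply_pk hv hu']
    simp
  have hpos : ∀ x, x ≠ 0 → 0 < B x (θ x) := fun x hx => by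
    obtain ⟨u, hu, v, hv, rfl⟩ := hB.exists_add x
    simp only [map_add, LinearMap.add_apply, h1 u hu, h2 v hv, map_neg, hB.apply_kp hu hv,
      hB.apply_pk hv hu]
    by_cases hu0 : u = 0
    · have hv0 : v ≠ 0 := by rintro rfl; exact hx (by rw [hu0, add_zero])
      have := hB.neg v hv hv0
      simp only [hu0, map_zero]
      linarith
    · have h3 := hB.pos u hu hu0
      by_cases hv0 : v = 0
      · simp only [hv0, map_zero]
        linarith
      · have := hB.neg v hv hv0
        linarith
  let θ' : EuclideanSpace ℝ (Fin n) →ₗ[ℝ] EuclideanSpace ℝ (Fin n) := θ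
  exact ⟨{ form := B, inv := LinearMap.toContinuousLinearMap θ', inv_inv := hii, inv_lieBr := hbr,
           symm := hB.symm, form_inv := hform, form_AdE := hB.ad_invariant, pos := hpos }, fun _ _ => rfl, h1, h2⟩

lemma apply_lie [T2Space G] (x y z : GroupLieAlgebra (𝓡 n) G) : B ⁅x, y⁆ z = -B y ⁅x, z⁆ := by
  obtain ⟨D, h1, -, -⟩ := hB.exists_cartanData
  exact (h1 _ _).symm.trans ((D.form_lieBr x y z).trans (congrArg Neg.neg (h1 _ _)))

variable [LieGroup (𝓡 k) ∞ K]
  (hK : Manifold.IsSmoothEmbedding (𝓡 k) (𝓡 n) ∞ (Subtype.val : K → G))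
include hK

omit hB in
lemma lieIncl_injective : Function.Injective (lieIncl n k K) :=
  mfderiv_injective_of_isImmersionAt (hK.isImmersion.isImmersionAt 1)

omit hB in
lemma finrank_lieSub : Module.finrank ℝ (lieSub n k K) = k := by
  rw [lieSub, LinearMap.finrank_range_of_inj (lieIncl_injective hK)]
  exact finrank_euclideanSpace_fin

omit hB in
lemma contMDiff_subtype : ContMDiff (𝓡 k) (𝓡 n) ∞ K.subtype := hK.isImmersion.contMDiff

omit hB in
lemma Ad_lieIncl (a : K) (x : GroupLieAlgebra (𝓡 k) K) :
    Ad n (a : G) (lieIncl n k K x) = lieIncl n k K (Ad k a x) :=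
  Ad_mfderiv_hom (contMDiff_subtype hK) a x

omit hB in
lemma lieIncl_lie (x y : GroupLieAlgebra (𝓡 k) K) :
    lieIncl n k K ⁅x, y⁆ = ⁅lieIncl n k K x, lieIncl n k K y⁆ :=
  mfderiv_hom_lieBr (contMDiff_subtype hK)
    (D := (lieIncl n k K : GroupLieAlgebra (𝓡 k) K →L[ℝ] GroupLieAlgebra (𝓡 n) G))
    (fun _ => rfl) x y

omit hB in
lemma Ad_mem_lieSub {a : G} (ha : a ∈ K) {x : GroupLieAlgebra (𝓡 n) G} (hx : x ∈ lieSub n k K) :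
    Ad n a x ∈ lieSub n k K := by
  obtain ⟨y, rfl⟩ := hx
  exact ⟨Ad k ⟨a, ha⟩ y, (Ad_lieIncl hK ⟨a, ha⟩ y).symm⟩

lemma Ad_mem_lieOrth {a : G} (ha : a ∈ K) {x : GroupLieAlgebra (𝓡 n) G}
    (hx : x ∈ lieOrth k K B) : Ad n a x ∈ lieOrth k K B := by
  intro y hy
  have h1 := hx _ (Ad_mem_lieSub hK (inv_mem ha) hy)
  change B (Ad n a⁻¹ y) x = 0 at h1
  change B y (Ad n a x) = 0
  rwa [← hB.ad_invariant a, Ad_apply_Ad_inv] at h1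

/-- `Ad K` preserves both eigenspaces of the involution. -/
lemma le_isometrySubgroup {D : CartanData n G}
    (h1 : ∀ x ∈ lieSub n k K, (D.inv x : GroupLieAlgebra (𝓡 n) G) = x)
    (h2 : ∀ x ∈ lieOrth k K B, (D.inv x : GroupLieAlgebra (𝓡 n) G) = -x) :
    K ≤ D.isometrySubgroup := by
  intro a ha x
  obtain ⟨u, hu, v, hv, huv⟩ := hB.exists_add x
  have key : ∀ u v : EuclideanSpace ℝ (Fin n), D.inv u = u → D.inv v = -v →
      D.inv (AdE n a u) = AdE n a u → D.inv (AdE n a v) = -(AdE n a v) →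
      D.inv (AdE n a (u + v)) = AdE n a (D.inv (u + v)) := fun u v e1 e2 e3 e4 => by
    rw [map_add, map_add, e3, e4, map_add, e1, e2, map_add, map_neg]
  subst huv
  exact key u v (h1 u hu) (h2 v hv) (h1 _ (Ad_mem_lieSub hK ha hu))
    (h2 _ (hB.Ad_mem_lieOrth hK ha hv))

variable [T2Space G] [ConnectedSpace G] [LieAlgebra.IsSemisimple ℝ (GroupLieAlgebra (𝓡 n) G)]
  (hmax : Maximal (fun H : Subgroup G => IsCompact (H : Set G)) K)

-- For `Y ∈ 𝔭` the operator `ad Y` is symmetric for the inner product, so `Y` generates a noncompact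
-- one-parameter group unless it vanishes.
omit [ConnectedSpace G] in
lemma eq_zero_of_Ad_eq {a : G} (ha : a ∈ stronglyStable G)
    {Y : GroupLieAlgebra (𝓡 n) G} (hY : Y ∈ lieOrth k K B) (haY : Ad n a Y = Y) : Y = 0 := by
  obtain ⟨D, h0, h1, h2⟩ := hB.exists_cartanData
  have key : ∀ Y : EuclideanSpace ℝ (Fin n), D.inv Y = -Y → AdE n a Y = Y → Y = 0 :=
    fun Y e2 e1 => D.eq_zero_of_AdE_eq ha e1 fun x y => ?_
  · exact key Y (h2 Y hY) haY
  rw [D.ip_apply, D.ip_apply, D.form_lieBr, D.inv_lieBr, e2, lieBr_neg_left, map_neg]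

/-- `Ad a⁻¹ - 1` maps `𝔭` to itself and is injective there, since `a` fixes no nonzero vector of
`𝔭`; in finite dimension it is onto. This is the transversality behind both halves of the theorem.
-/
lemma exists_Ad_inv_sub {a : G} (ha : a ∈ stronglyStable G) (haK : a ∈ K)
    {Y : GroupLieAlgebra (𝓡 n) G} (hY : Y ∈ lieOrth k K B) :
    ∃ Z ∈ lieOrth k K B, Ad n a⁻¹ Z - Z = Y := by
  let T : lieOrth k K B →ₗ[ℝ] lieOrth k K B :=
    { toFun := fun Z => ⟨Ad n a⁻¹ Z - Z, sub_mem (hB.Ad_mem_lieOrth hK (inv_mem haK) Z.2) Z.2⟩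
      map_add' := fun Z Z' => by
        ext1
        simp only [Submodule.coe_add, map_add]
        abel
      map_smul' := fun c Z => by
        ext1
        simp only [Submodule.coe_smul, map_smul, RingHom.id_apply, smul_sub] }
  have hT : Function.Injective T := by
    rw [← LinearMap.ker_eq_bot, LinearMap.ker_eq_bot']
    intro Z hZ
    have h1 : Ad n a⁻¹ (Z : GroupLieAlgebra (𝓡 n) G) - Z = 0 := congrArg Subtype.val hZ
    have h2 := congrArg (Ad n a) (sub_eq_zero.1 h1)
    rw [Ad_apply_Ad_inv] at h2
    exact Subtype.ext (hB.eq_zero_of_Ad_eq hK ha Z.2 h2.symm)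
  obtain ⟨Z, hZ⟩ := LinearMap.injective_iff_surjective.1 hT ⟨Y, hY⟩
  exact ⟨Z, Z.2, congrArg Subtype.val hZ⟩

include hmax

/-- The isometry group of the involution contains `K` and is compact because a strongly stable
element is given. Maximality makes the two equal, so statements about isometries become statements
about `K`. -/
lemma exists_conj_mem {g : G} (hg : g ∈ stronglyStable G) : ∃ h : G, h⁻¹ * g * h ∈ K := by
  obtain ⟨D, h0, h1, h2⟩ := hB.exists_cartanData
  obtain ⟨h, hh⟩ := D.exists_conj_mem hg
  exact ⟨h, hmax.2 (D.isCompact_isometrySubgroup hg) (hB.le_isometrySubgroup hK h1 h2) hh⟩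

lemma mem_of_conj_mem {a h : G} (ha : a ∈ stronglyStable G) (haK : a ∈ K)
    (hh : h * a * h⁻¹ ∈ K) : h ∈ K := by
  obtain ⟨D, h0, h1, h2⟩ := hB.exists_cartanData
  have hle := hB.le_isometrySubgroup hK h1 h2
  exact hmax.2 (D.isCompact_isometrySubgroup ha) hle (D.mem_of_conj_mem ha (hle haK) (hle hh))

end IsNormalizedForm

end Pair

/-! ### Cartan's formula for invariant 2-forms -/

section CartanFormula

/-- Cartan's formula for a local flow that preserves a 2-form on a vector space. -/
lemma extDeriv_of_flow {E : Type*} [NormedAddCommGroup E] [NormedSpace ℝ E]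
    [FiniteDimensional ℝ E] {α : E → E [⋀^Fin 2]→L[ℝ] ℝ} {Ψ : ℝ × E → E} {β : E → E → ℝ} {y₀ : E}
    (hα : ContDiffAt ℝ ∞ α y₀) (hΨ : ContDiffAt ℝ ∞ Ψ (0, y₀))
    (h0 : ∀ᶠ y in 𝓝 y₀, Ψ (0, y) = y)
    (h1 : ∀ᶠ p in 𝓝 ((0 : ℝ), y₀), ∀ u v,
      α (Ψ p) ![fderiv ℝ Ψ p (0, u), fderiv ℝ Ψ p (0, v)] = α p.2 ![u, v])
    (h2 : ∀ᶠ y in 𝓝 y₀, ∀ v,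
      α (Ψ (0, y)) ![fderiv ℝ Ψ (0, y) (1, 0), fderiv ℝ Ψ (0, y) (0, v)] = β y v) (b c : E) :
    extDeriv α y₀ ![fderiv ℝ Ψ (0, y₀) (1, 0), b, c] =
      -(fderiv ℝ (fun y => β y c) y₀ b - fderiv ℝ (fun y => β y b) y₀ c) := by
  have h00 : Ψ (0, y₀) = y₀ := h0.self_of_nhds
  have hi : HasFDerivAt (fun y : E => ((0 : ℝ), y)) (ContinuousLinearMap.inr ℝ ℝ E) y₀ :=
    hasFDerivAt_prodMk_right 0 y₀
  have hD : fderiv ℝ Ψ (0, y₀) ∘L ContinuousLinearMap.inr ℝ ℝ E = ContinuousLinearMap.id ℝ E := by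
    have e1 : HasFDerivAt (fun y => Ψ (0, y)) (fderiv ℝ Ψ (0, y₀) ∘L ContinuousLinearMap.inr ℝ ℝ E)
        y₀ := (hΨ.differentiableAt (by simp)).hasFDerivAt.comp y₀ hi
    exact e1.unique ((hasFDerivAt_id y₀).congr_of_eventuallyEq h0)
  have hD' : ∀ v, fderiv ℝ Ψ (0, y₀) (0, v) = v := fun v => DFunLike.congr_fun hD v
  have hα' : ContDiffAt ℝ ∞ α (Ψ (0, y₀)) := by rwa [h00]
  -- The pullback of `α` to `ℝ × E` has the pullback of `dα` as exterior derivative. On `(1, 0), (0,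
  -- b), (0, c)` the time derivative vanishes by invariance, and the other two terms are derivatives
  -- of the contraction `β`.
  let Θ : ℝ × E → (ℝ × E) [⋀^Fin 2]→L[ℝ] ℝ := fun p =>
    (α (Ψ p)).compContinuousLinearMap (fderiv ℝ Ψ p)
  have hΘ : ContDiffAt ℝ ∞ Θ (0, y₀) :=
    contDiffAt_alternating_comp (hα'.comp _ hΨ) (hΨ.fderiv_right (m := ∞) (by simp))
  have hΘd : DifferentiableAt ℝ Θ (0, y₀) := hΘ.differentiableAt (by simp)
  have key := extDeriv_pullback (hα'.differentiableAt (by simp)) hΨ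
    (by simpa using ENat.LEInfty.out)
  have key2 := DFunLike.congr_fun key ![(1, 0), (0, b), (0, c)]
  have e0 : (fun i => fderiv ℝ Ψ (0, y₀) ((![(1, 0), (0, b), (0, c)] : Fin 3 → ℝ × E) i)) =
      ![fderiv ℝ Ψ (0, y₀) (1, 0), b, c] := by
    funext i
    fin_cases i
    · rfl
    · exact hD' b
    · exact hD' c
  have e1 : extDeriv α (Ψ (0, y₀)) (fun i => fderiv ℝ Ψ (0, y₀)
      ((![(1, 0), (0, b), (0, c)] : Fin 3 → ℝ × E) i)) =
      extDeriv Θ (0, y₀) ![(1, 0), (0, b), (0, c)] := key2.symm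
  rw [e0, h00, extDeriv_apply hΘd, Fin.sum_univ_three] at e1
  rw [e1]
  have r0 : (0 : Fin 3).removeNth (![(1, 0), (0, b), (0, c)] : Fin 3 → ℝ × E) =
      ![(0, b), (0, c)] := by funext i; fin_cases i <;> rfl
  have r1 : (1 : Fin 3).removeNth (![(1, 0), (0, b), (0, c)] : Fin 3 → ℝ × E) =
      ![(1, 0), (0, c)] := by funext i; fin_cases i <;> rfl
  have r2 : (2 : Fin 3).removeNth (![(1, 0), (0, b), (0, c)] : Fin 3 → ℝ × E) =
      ![(1, 0), (0, b)] := by funext i; fin_cases i <;> rfl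
  have hΘ2 : ∀ p P Q, Θ p ![P, Q] = α (Ψ p) ![fderiv ℝ Ψ p P, fderiv ℝ Ψ p Q] := fun p P Q => by
    change α (Ψ p) (fun i => fderiv ℝ Ψ p ((![P, Q] : Fin 2 → ℝ × E) i)) = _
    congr 1
    funext i; fin_cases i <;> rfl
  have hev : ∀ v : Fin 2 → ℝ × E, DifferentiableAt ℝ (fun p => Θ p v) (0, y₀) := fun v =>
    (contDiffAt_alternating_apply (c := fun i _ => v i) hΘ
      (fun _ => contDiffAt_const)).differentiableAt (by simp)
  have s0 : fderiv ℝ (fun p => Θ p ![(0, b), (0, c)]) (0, y₀) (1, 0) = 0 := by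
    have e2 : (fun p => Θ p ![(0, b), (0, c)]) =ᶠ[𝓝 (0, y₀)] fun p => α p.2 ![b, c] := by
      filter_upwards [h1] with p hp
      rw [hΘ2, hp]
    have e3 : DifferentiableAt ℝ (fun y => α y ![b, c]) y₀ :=
      (contDiffAt_alternating_apply (c := fun i _ => (![b, c] : Fin 2 → E) i) hα
        (fun _ => contDiffAt_const)).differentiableAt (by simp)
    have e4 : HasFDerivAt (fun p : ℝ × E => α p.2 ![b, c]) _ (0, y₀) :=
      HasFDerivAt.comp (0, y₀) (g := fun y => α y ![b, c]) e3.hasFDerivAt hasFDerivAt_snd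
    rw [e2.fderiv_eq, e4.fderiv]
    simp
  have s1 : ∀ b c, fderiv ℝ (fun p => Θ p ![(1, 0), (0, c)]) (0, y₀) (0, b) =
      fderiv ℝ (fun y => β y c) y₀ b := fun b c => by
    have e2 : (fun y => β y c) =ᶠ[𝓝 y₀] fun y => Θ (0, y) ![(1, 0), (0, c)] := by
      filter_upwards [h2] with y hy
      rw [hΘ2, hy]
    have e3 : HasFDerivAt (fun y => Θ (0, y) ![(1, 0), (0, c)]) _ y₀ :=
      HasFDerivAt.comp y₀ (g := fun p => Θ p ![(1, 0), (0, c)]) (hev _).hasFDerivAt hi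
    rw [e2.fderiv_eq, e3.fderiv]
    rfl
  simp only [r0, r1, r2]
  have t1 : (![(1, 0), (0, b), (0, c)] : Fin 3 → ℝ × E) 1 = (0, b) := rfl
  have t2 : (![(1, 0), (0, b), (0, c)] : Fin 3 → ℝ × E) 2 = (0, c) := rfl
  have t0 : (![(1, 0), (0, b), (0, c)] : Fin 3 → ℝ × E) 0 = (1, 0) := rfl
  rw [t0, t1, t2, s0, s1, s1]
  norm_num
  ring

variable {n m : ℕ} {G : Type*} [TopologicalSpace G] [ChartedSpace (EuclideanSpace ℝ (Fin n)) G]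
  [Group G] [LieGroup (𝓡 n) ∞ G]
  {M : Type*} [TopologicalSpace M] [ChartedSpace (EuclideanSpace ℝ (Fin m)) M]
  [IsManifold (𝓡 m) ∞ M] [MulAction G M]

lemma pullback_apply₂ {m' : ℕ} {M' : Type*} [TopologicalSpace M']
    [ChartedSpace (EuclideanSpace ℝ (Fin m')) M'] (f : M → M') (α : DiffForm m' M' 2) (x : M)
    (u v : TangentSpace (𝓡 m) x) : pullback m m' f α x ![u, v] =
      α (f x) ![mfderiv (𝓡 m) (𝓡 m') f x u, mfderiv (𝓡 m) (𝓡 m') f x v] := by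
  change α (f x) (fun i => mfderiv (𝓡 m) (𝓡 m') f x ((![u, v] : Fin 2 → TangentSpace (𝓡 m) x) i)) = _
  congr 1
  funext i; fin_cases i <;> rfl

variable (n m G) in
/-- `generator` as a map between Euclidean spaces. -/
def genE (ξ : EuclideanSpace ℝ (Fin n)) (x : M) : EuclideanSpace ℝ (Fin m) :=
  generator (G := G) ξ x

variable (m) in
/-- The differential of the inverse of a chart as a map between Euclidean spaces. -/
def dChartSymm (x : M) (y : EuclideanSpace ℝ (Fin m)) :
    EuclideanSpace ℝ (Fin m) →L[ℝ] EuclideanSpace ℝ (Fin m) :=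
  mfderiv (𝓡 m) (𝓡 m) (extChartAt (𝓡 m) x).symm y

/-- At time `0` the group element, base point and vectors reach their values only up to
propositional equality; substituting for variables avoids rewriting inside dependent types. -/
lemma generator_congr {g : G} (hg : g = 1) {z x : M} (hz : z = x)
    {η ξ : GroupLieAlgebra (𝓡 n) G} (hη : η = ξ) {w : EuclideanSpace ℝ (Fin m)} (hw : w = 0) :
    (mfderiv (𝓡 m) (𝓡 m) (fun y : M => g • y) z
      (genE n m G η z + w)) = (generator ξ x : EuclideanSpace ℝ (Fin m)) := by
  subst hg hz hη hw
  have : (fun y : M => (1 : G) • y) = id := by funext y; exact one_smul G y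
  rw [this, mfderiv_id, add_zero]
  rfl

/-- Cartan's formula `ι(X_ξ) dΩ = - d ι(X_ξ) Ω` for an invariant 2-form. -/
theorem extDerivForm_generator
    (hσ : ContMDiff ((𝓡 n).prod (𝓡 m)) (𝓡 m) ∞ (fun p : G × M => p.1 • p.2))
    {Ω : DiffForm m M 2} (hΩ : IsSmoothForm Ω)
    (hinv : ∀ g : G, pullback m m (fun x : M => g • x) Ω = Ω)
    (ξ : GroupLieAlgebra (𝓡 n) G) (x : M)
    {β : EuclideanSpace ℝ (Fin m) → EuclideanSpace ℝ (Fin m) → ℝ}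
    (hβ : ∀ᶠ y in 𝓝 (extChartAt (𝓡 m) x x), ∀ w : EuclideanSpace ℝ (Fin m),
      Ω ((extChartAt (𝓡 m) x).symm y) ![generator ξ ((extChartAt (𝓡 m) x).symm y),
        mfderiv (𝓡 m) (𝓡 m) (extChartAt (𝓡 m) x).symm y w] = β y w)
    (b c : TangentSpace (𝓡 m) x) :
    extDerivForm Ω x ![generator ξ x, b, c] =
      -(fderiv ℝ (fun y => β y (mfderiv (𝓡 m) (𝓡 m) (extChartAt (𝓡 m) x) x c))
          (extChartAt (𝓡 m) x x) (mfderiv (𝓡 m) (𝓡 m) (extChartAt (𝓡 m) x) x b)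
        - fderiv ℝ (fun y => β y (mfderiv (𝓡 m) (𝓡 m) (extChartAt (𝓡 m) x) x b))
          (extChartAt (𝓡 m) x x) (mfderiv (𝓡 m) (𝓡 m) (extChartAt (𝓡 m) x) x c)) := by
  set φ := extChartAt (𝓡 m) x with hφ
  obtain ⟨w₀, hw₀⟩ := exists_logD_expChart (G := G) ξ
  let y₀ : EuclideanSpace ℝ (Fin m) := φ x
  -- Since the form is invariant under every group element, any smooth curve through `1` with
  -- velocity `ξ` can replace the flow; here it is a straight line in the chart at `1`.
  let l : ℝ × EuclideanSpace ℝ (Fin m) → EuclideanSpace ℝ (Fin n) :=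
    fun p => expZero n G + p.1 • w₀
  let A : ℝ × EuclideanSpace ℝ (Fin m) → G := fun p => expChart n G (l p)
  let q : ℝ × EuclideanSpace ℝ (Fin m) → M := fun p => φ.symm p.2
  let F : ℝ × EuclideanSpace ℝ (Fin m) → M := fun p => A p • q p
  let Ψ : ℝ × EuclideanSpace ℝ (Fin m) → EuclideanSpace ℝ (Fin m) := fun p => φ (F p)
  have hl : ContDiff ℝ ∞ l := contDiff_const.add (contDiff_fst.smul contDiff_const)
  have hl0 : ∀ y, l (0, y) = expZero n G := fun y => by simp [l]
  have hA0 : ∀ y, A (0, y) = 1 := fun y => by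
    change expChart n G (l (0, y)) = 1
    rw [hl0, expChart_expZero]
  have hleft : φ.symm y₀ = x := φ.left_inv (mem_extChartAt_source x)
  have hAs : ContMDiffAt 𝓘(ℝ, ℝ × EuclideanSpace ℝ (Fin m)) (𝓡 n) ∞ A (0, y₀) := by
    refine ContMDiffAt.comp (0, y₀) (g := expChart n G) ?_ hl.contMDiff.contMDiffAt
    rw [hl0]
    exact contMDiffAt_expChart
  have hsymm : ∀ y ∈ φ.target, ContMDiffAt (𝓡 m) (𝓡 m) ∞ φ.symm y := fun y hy =>
    (contMDiffOn_extChartAt_symm x).contMDiffAt ((isOpen_extChartAt_target x).mem_nhds hy)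
  have hqs : ContMDiffAt 𝓘(ℝ, ℝ × EuclideanSpace ℝ (Fin m)) (𝓡 m) ∞ q (0, y₀) :=
    ContMDiffAt.comp (0, y₀) (g := φ.symm) (hsymm y₀ (mem_extChartAt_target x))
      contDiff_snd.contMDiff.contMDiffAt
  have hFs : ContMDiffAt 𝓘(ℝ, ℝ × EuclideanSpace ℝ (Fin m)) (𝓡 m) ∞ F (0, y₀) :=
    ContMDiffAt.comp (0, y₀) (g := fun p : G × M => p.1 • p.2) hσ.contMDiffAt (hAs.prodMk hqs)
  have hF0 : F (0, y₀) = x := by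
    change A (0, y₀) • φ.symm y₀ = x
    rw [hA0, hleft, one_smul]
  have hΨs : ContDiffAt ℝ ∞ Ψ (0, y₀) := by
    rw [← contMDiffAt_iff_contDiffAt]
    refine ContMDiffAt.comp (0, y₀) (g := φ) ?_ hFs
    rw [hF0]
    exact contMDiffAt_extChartAt
  -- near the base point everything is defined
  have hev : ∀ᶠ p in 𝓝 ((0 : ℝ), y₀), MDifferentiableAt 𝓘(ℝ, ℝ × EuclideanSpace ℝ (Fin m)) (𝓡 n) A p ∧
      MDifferentiableAt 𝓘(ℝ, EuclideanSpace ℝ (Fin n)) (𝓡 n) (expChart n G) (l p) ∧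
      p.2 ∈ φ.target ∧ F p ∈ φ.source := by
    refine (eventually_mdifferentiableAt hAs).and (Filter.Eventually.and ?_ (Filter.Eventually.and ?_ ?_))
    · refine hl.continuous.continuousAt.eventually (p := fun z => MDifferentiableAt _ _ _ z) ?_
      rw [hl0]
      exact eventually_mdifferentiableAt contMDiffAt_expChart
    · exact continuousAt_snd.eventually ((isOpen_extChartAt_target x).mem_nhds
        (mem_extChartAt_target x))
    · refine hFs.continuousAt.eventually ?_
      rw [hF0]
      exact extChartAt_source_mem_nhds x
  have hlogA : ∀ p, MDifferentiableAt 𝓘(ℝ, EuclideanSpace ℝ (Fin n)) (𝓡 n) (expChart n G) (l p) →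
      ∀ P : ℝ × EuclideanSpace ℝ (Fin m),
      logD n A p P = logD n (expChart n G) (l p) (P.1 • w₀) := fun p hp P => by
    have e1 : HasFDerivAt l ((ContinuousLinearMap.fst ℝ ℝ (EuclideanSpace ℝ (Fin m))).smulRight w₀)
        p := ((hasFDerivAt_fst (𝕜 := ℝ) (p := p)).smul_const w₀).const_add (expZero n G)
    refine (logD_comp (A := expChart n G) hp e1.differentiableAt P).trans ?_
    rw [e1.fderiv]
    rfl
  have hFd : ∀ p, MDifferentiableAt 𝓘(ℝ, ℝ × EuclideanSpace ℝ (Fin m)) (𝓡 n) A p →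
      p.2 ∈ φ.target → MDifferentiableAt 𝓘(ℝ, ℝ × EuclideanSpace ℝ (Fin m)) (𝓡 m) q p ∧
      ∀ P : ℝ × EuclideanSpace ℝ (Fin m),
      (mfderiv 𝓘(ℝ, ℝ × EuclideanSpace ℝ (Fin m)) (𝓡 m) F p P : EuclideanSpace ℝ (Fin m)) =
      mfderiv (𝓡 m) (𝓡 m) (fun z : M => A p • z) (q p)
        (genE n m G (logD n A p P) (q p) + dChartSymm m x p.2 P.2) := fun p h1 h2 => by
    have e1 : MDifferentiableAt (𝓡 m) (𝓡 m) φ.symm p.2 := (hsymm _ h2).mdifferentiableAt (by simp)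
    have e2 : MDifferentiableAt 𝓘(ℝ, ℝ × EuclideanSpace ℝ (Fin m)) 𝓘(ℝ, EuclideanSpace ℝ (Fin m))
        (Prod.snd : ℝ × EuclideanSpace ℝ (Fin m) → _) p := differentiableAt_snd.mdifferentiableAt
    have e3 : MDifferentiableAt 𝓘(ℝ, ℝ × EuclideanSpace ℝ (Fin m)) (𝓡 m) q p :=
      MDifferentiableAt.comp p (g := φ.symm) e1 e2
    refine ⟨e3, fun P => (mfderiv_smul_apply hσ h1 e3 P).trans ?_⟩
    have e4 := mfderiv_comp_apply' (I := 𝓘(ℝ, ℝ × EuclideanSpace ℝ (Fin m))) (h := q) (g := φ.symm)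
      (f := Prod.snd) (fun _ => rfl) p p.2 rfl e1 e2 P
    rw [mfderiv_eq_fderiv, fderiv_snd] at e4
    exact congrArg (fun w : EuclideanSpace ℝ (Fin m) =>
      (mfderiv (𝓡 m) (𝓡 m) (fun z : M => A p • z) (q p)
        (genE n m G (logD n A p P) (q p) + w))) e4
  have hΨd : ∀ p, MDifferentiableAt 𝓘(ℝ, ℝ × EuclideanSpace ℝ (Fin m)) (𝓡 n) A p →
      p.2 ∈ φ.target → F p ∈ φ.source → ∀ P : ℝ × EuclideanSpace ℝ (Fin m), fderiv ℝ Ψ p P =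
      mfderiv (𝓡 m) (𝓡 m) φ (F p)
        (mfderiv 𝓘(ℝ, ℝ × EuclideanSpace ℝ (Fin m)) (𝓡 m) F p P : EuclideanSpace ℝ (Fin m)) :=
    fun p h1 h2 h3 P => by
    have e1 : MDifferentiableAt 𝓘(ℝ, ℝ × EuclideanSpace ℝ (Fin m)) (𝓡 m) F p :=
      MDifferentiableAt.comp p (g := fun p : G × M => p.1 • p.2) (hσ.mdifferentiableAt (by simp))
        (h1.prodMk (hFd p h1 h2).1)
    have e2 : MDifferentiableAt (𝓡 m) (𝓡 m) φ (F p) := mdifferentiableAt_extChartAt (by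
      simpa [hφ] using h3)
    have := mfderiv_comp_apply' (I := 𝓘(ℝ, ℝ × EuclideanSpace ℝ (Fin m))) (h := Ψ) (g := φ)
      (f := F) (fun _ => rfl) p _ rfl e2 e1 P
    rw [mfderiv_eq_fderiv] at this
    exact this
  -- Translation by `A p` drops out by invariance; what is left is the generator of the logarithmic
  -- derivative of `A` plus the differential of the inverse chart.
  have hΘ : ∀ᶠ p in 𝓝 ((0 : ℝ), y₀), ∀ P Q : ℝ × EuclideanSpace ℝ (Fin m),
      chartForm Ω x (Ψ p) ![fderiv ℝ Ψ p P, fderiv ℝ Ψ p Q] =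
        Ω (q p) ![genE n m G (logD n (expChart n G) (l p) (P.1 • w₀)) (q p) + dChartSymm m x p.2 P.2,
          genE n m G (logD n (expChart n G) (l p) (Q.1 • w₀)) (q p) + dChartSymm m x p.2 Q.2] := by
    filter_upwards [hev] with p ⟨h1, h1', h2, h3⟩ P Q
    rw [hΨd p h1 h2 h3, hΨd p h1 h2 h3, (hFd p h1 h2).2, (hFd p h1 h2).2, hlogA p h1', hlogA p h1']
    set P' : EuclideanSpace ℝ (Fin m) := _ + dChartSymm m x p.2 P.2
    set Q' : EuclideanSpace ℝ (Fin m) := _ + dChartSymm m x p.2 Q.2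
    have e1 := chartForm_apply_mfderiv Ω (x₀ := x) h3
      ![mfderiv (𝓡 m) (𝓡 m) (fun z : M => A p • z) (q p) P',
        mfderiv (𝓡 m) (𝓡 m) (fun z : M => A p • z) (q p) Q']
    have e2 := pullback_apply₂ (fun z : M => A p • z) Ω (q p) P' Q'
    rw [hinv] at e2
    refine Eq.trans ?_ (e1.trans e2.symm)
    refine congrArg (chartForm Ω x (φ (F p))) ?_
    funext i; fin_cases i <;> rfl
  have hgen0 : ∀ z : M, genE n m G 0 z = 0 :=
    fun z => map_zero (mfderiv (𝓡 n) (𝓡 m) (fun g : G => g • z) 1 :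
      GroupLieAlgebra (𝓡 n) G →L[ℝ] TangentSpace (𝓡 m) ((1 : G) • z))
  have hpair : Filter.Tendsto (fun y : EuclideanSpace ℝ (Fin m) => ((0 : ℝ), y)) (𝓝 y₀)
      (𝓝 ((0 : ℝ), y₀)) := (Continuous.prodMk_right (0 : ℝ)).tendsto y₀
  have hΩs : ContDiffAt ℝ ∞ (chartForm Ω x) y₀ := (isSmoothForm_iff Ω).1 hΩ x
  have main := extDeriv_of_flow (α := chartForm Ω x) (Ψ := Ψ) (β := β) hΩs hΨs ?_ ?_ ?_
    (mfderiv (𝓡 m) (𝓡 m) φ x b) (mfderiv (𝓡 m) (𝓡 m) φ x c)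
  · have e5 : fderiv ℝ Ψ (0, y₀) (1, 0) = mfderiv (𝓡 m) (𝓡 m) φ x (generator ξ x) := by
      obtain ⟨h1, h1', h2, h3⟩ := hev.self_of_nhds
      have e6 := hΨd _ h1 h2 h3 (1, 0)
      have e7 := (hFd _ h1 h2).2 (1, 0)
      have e8 : ∀ z, z = x → ∀ v : EuclideanSpace ℝ (Fin m),
        (mfderiv (𝓡 m) (𝓡 m) φ z v : EuclideanSpace ℝ (Fin m)) = mfderiv (𝓡 m) (𝓡 m) φ x v := by
        rintro _ rfl v; rfl
      refine e6.trans ((e8 _ hF0 _).trans (congrArg _ (e7.trans ?_)))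
      refine generator_congr (hA0 _) hleft ?_ (map_zero (mfderiv (𝓡 m) (𝓡 m) φ.symm y₀))
      refine (hlogA _ h1' (1, 0)).trans ?_
      rw [hl0, one_smul]
      exact hw₀
    rw [e5] at main
    refine Eq.trans ?_ main
    change extDeriv (chartForm Ω x) (φ x) (fun i => mfderiv (𝓡 m) (𝓡 m) φ x _) = _
    refine congrArg (extDeriv (chartForm Ω x) (φ x)) ?_
    funext i; fin_cases i <;> rfl
  · filter_upwards [(isOpen_extChartAt_target (I := 𝓡 m) x).mem_nhds (mem_extChartAt_target (I := 𝓡 m) x)] with y hy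
    change φ (A (0, y) • φ.symm y) = y
    rw [hA0, one_smul, φ.right_inv hy]
  · filter_upwards [hΘ] with p hp u v
    rw [hp]
    simp only [zero_smul, map_zero]
    have e1 := hgen0 (q p)
    have e2 : chartForm Ω x p.2 ![u, v] = Ω (q p) ![mfderiv (𝓡 m) (𝓡 m) φ.symm p.2 u,
      mfderiv (𝓡 m) (𝓡 m) φ.symm p.2 v] := by
      change Ω (q p) (fun i => mfderiv (𝓡 m) (𝓡 m) φ.symm p.2
        ((![u, v] : Fin 2 → EuclideanSpace ℝ (Fin m)) i)) = _
      congr 1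
      funext i; fin_cases i <;> rfl
    rw [e2]
    refine congrArg (Ω (q p)) ?_
    funext i; fin_cases i
    · exact (congrArg (· + _) e1).trans (zero_add _)
    · exact (congrArg (· + _) e1).trans (zero_add _)
  · filter_upwards [hpair.eventually hΘ, hβ] with y hy hβy v
    rw [hy, ← hβy]
    refine congrArg (Ω (q (0, y))) ?_
    simp only [zero_smul, map_zero, one_smul, hl0, hw₀]
    funext i; fin_cases i
    · exact add_zero _
    · exact (congrArg (· + _) (hgen0 _)).trans (zero_add _)

end CartanFormula

/-! ### The Cartan form and the projection `G → G ⧸ K` -/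

section Restriction

variable {n : ℕ} {G : Type*} [TopologicalSpace G] [ChartedSpace (EuclideanSpace ℝ (Fin n)) G]
  [Group G] [LieGroup (𝓡 n) ∞ G]
  {k : ℕ} {K : Subgroup G} [ChartedSpace (EuclideanSpace ℝ (Fin k)) K] [LieGroup (𝓡 k) ∞ K]
  {B : LinearMap.BilinForm ℝ (GroupLieAlgebra (𝓡 n) G)}

variable (n) in
/-- The logarithmic derivative `μ^* θ^L`. -/
def dlog (m : ℕ) {M : Type*} [TopologicalSpace M] [ChartedSpace (EuclideanSpace ℝ (Fin m)) M]
    (μ : M → G) (x : M) : TangentSpace (𝓡 m) x →L[ℝ] GroupLieAlgebra (𝓡 n) G :=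
  (thetaL (μ x)).comp (mfderiv (𝓡 m) (𝓡 n) μ x)

/-- Invariance makes `B(x, [y, z])` cyclically symmetric, so the three terms coincide and `3 · 2 /
12 = 1 / 2`. -/
lemma cartanForm_eq [T2Space G] (hB : IsNormalizedForm k K B) (g : G)
    (u v w : TangentSpace (𝓡 n) g) : cartanForm B g u v w =
      (1 / 2) * B (thetaL g u) ⁅thetaL g v, thetaL g w⁆ := by
  have key : ∀ x y z : GroupLieAlgebra (𝓡 n) G, (1 / 12 : ℝ) * (B x ((2 : ℝ) • ⁅y, z⁆) +
      B y ((2 : ℝ) • ⁅z, x⁆) + B z ((2 : ℝ) • ⁅x, y⁆)) = (1 / 2) * B x ⁅y, z⁆ := fun x y z => by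
    have h1 : B y ⁅z, x⁆ = B x ⁅y, z⁆ := by
      rw [hB.symm, hB.apply_lie, ← lie_skew, map_neg, neg_neg]
    have h2 : B z ⁅x, y⁆ = B x ⁅y, z⁆ := by
      rw [hB.symm, ← lie_skew, map_neg, LinearMap.neg_apply, hB.apply_lie, neg_neg]
    simp only [map_smul, smul_eq_mul, h1, h2]
    ring
  exact key _ _ _

variable (hK : Manifold.IsSmoothEmbedding (𝓡 k) (𝓡 n) ∞ (Subtype.val : K → G))
include hK

lemma cartanForm_restrictForm_eq [T2Space G] (hB : IsNormalizedForm k K B) (c : K)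
    (u v w : TangentSpace (𝓡 k) c) : cartanForm (restrictForm k K B) c u v w =
      (1 / 2) * B (lieIncl n k K (thetaL c u))
        ⁅lieIncl n k K (thetaL c v), lieIncl n k K (thetaL c w)⁆ := by
  have key : ∀ x y z : GroupLieAlgebra (𝓡 k) K, (1 / 12 : ℝ) * (
      restrictForm k K B x ((2 : ℝ) • ⁅y, z⁆) +
      restrictForm k K B y ((2 : ℝ) • ⁅z, x⁆) + restrictForm k K B z ((2 : ℝ) • ⁅x, y⁆)) =
      (1 / 2) * B (lieIncl n k K x) ⁅lieIncl n k K y, lieIncl n k K z⁆ := fun x y z => by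
    change (1 / 12 : ℝ) * (
      B (lieIncl n k K x) (lieIncl n k K ((2 : ℝ) • ⁅y, z⁆)) +
      B (lieIncl n k K y) (lieIncl n k K ((2 : ℝ) • ⁅z, x⁆)) +
      B (lieIncl n k K z) (lieIncl n k K ((2 : ℝ) • ⁅x, y⁆))) = _
    generalize hx : lieIncl n k K x = x'
    generalize hy : lieIncl n k K y = y'
    generalize hz : lieIncl n k K z = z'
    have h1 : B y' ⁅z', x'⁆ = B x' ⁅y', z'⁆ := by
      rw [hB.symm, hB.apply_lie, ← lie_skew, map_neg, neg_neg]
    have h2 : B z' ⁅x', y'⁆ = B x' ⁅y', z'⁆ := by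
      rw [hB.symm, ← lie_skew, map_neg, LinearMap.neg_apply, hB.apply_lie, neg_neg]
    simp only [map_smul, smul_eq_mul, IsNormalizedForm.lieIncl_lie hK, hx, hy, hz, h1, h2]
    ring
  exact key _ _ _

/-- Makes the truncated subtraction `n - k` an honest difference in all dimension counts. -/
lemma le_dim : k ≤ n := by
  have h1 := Submodule.finrank_le (lieSub n k K)
  rw [IsNormalizedForm.finrank_lieSub hK] at h1
  exact h1.trans (finrank_euclideanSpace_fin (𝕜 := ℝ) (n := n)).le

/-- The kernel of the differential of `G → G ⧸ K`. -/
lemma mfderiv_quotient_eq_zero_iff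
    [ChartedSpace (EuclideanSpace ℝ (Fin (n - k))) (G ⧸ K)] [IsManifold (𝓡 (n - k)) ∞ (G ⧸ K)]
    (hGK : Manifold.IsSubmersion (𝓡 n) (𝓡 (n - k)) ∞ (QuotientGroup.mk : G → G ⧸ K))
    (g : G) (v : TangentSpace (𝓡 n) g) :
    mfderiv (𝓡 n) (𝓡 (n - k)) (QuotientGroup.mk : G → G ⧸ K) g v = 0 ↔
      thetaL g v ∈ lieSub n k K := by
  have hle := le_dim hK
  have hπ : MDifferentiable (𝓡 n) (𝓡 (n - k)) (QuotientGroup.mk : G → G ⧸ K) :=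
    hGK.contMDiff.mdifferentiable (by simp)
  let D : EuclideanSpace ℝ (Fin n) →ₗ[ℝ] EuclideanSpace ℝ (Fin (n - k)) :=
    (mfderiv (𝓡 n) (𝓡 (n - k)) (QuotientGroup.mk : G → G ⧸ K) g).toLinearMap
  have hD : Function.Surjective D := mfderiv_surjective_of_isSubmersionAt (hGK.isSubmersionAt g)
  let T : EuclideanSpace ℝ (Fin n) ≃ₗ[ℝ] GroupLieAlgebra (𝓡 n) G :=
    LinearEquiv.ofBijective (thetaL g).toLinearMap (thetaL_bijective g)
  let S : Submodule ℝ (EuclideanSpace ℝ (Fin n)) := (lieSub n k K).map T.symm.toLinearMap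
  have hS : Module.finrank ℝ S = k := by
    rw [LinearEquiv.finrank_map_eq, IsNormalizedForm.finrank_lieSub hK]
  have hker : Module.finrank ℝ (LinearMap.ker D) = k := by
    have h1 := LinearMap.finrank_range_add_finrank_ker D
    rw [LinearMap.range_eq_top.2 hD, finrank_top, finrank_euclideanSpace_fin,
      finrank_euclideanSpace_fin] at h1
    omega
  -- The map `c ↦ g c` on `K` stays in one coset, which gives this inclusion; equality follows
  -- because both spaces have dimension `k`.
  have hSk : S ≤ LinearMap.ker D := by
    rintro _ ⟨_, ⟨w, rfl⟩, rfl⟩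
    have hval : MDifferentiable (𝓡 k) (𝓡 n) (Subtype.val : K → G) :=
      (IsNormalizedForm.contMDiff_subtype hK).mdifferentiable (by simp)
    have e0 : T.symm (lieIncl n k K w) =
        mfderiv (𝓡 k) (𝓡 n) (fun c : K => g * (c : G)) 1 w := by
      refine T.symm_apply_eq.2 ?_
      have e1 := thetaL_mfderiv_mul_left g (hval 1) w
      have e2 : ∀ h, h = g → ∀ w : EuclideanSpace ℝ (Fin n),
          (thetaL h w : EuclideanSpace ℝ (Fin n)) = thetaL g w := by
        rintro _ rfl w; rfl
      have e3 : ∀ h : G, h = 1 → ∀ w : EuclideanSpace ℝ (Fin n),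
          (thetaL h w : EuclideanSpace ℝ (Fin n)) = w := by
        rintro _ rfl w; exact thetaL_one w
      exact (((e2 _ (mul_one g) _).symm.trans e1).trans (e3 _ rfl _)).symm
    change mfderiv (𝓡 n) (𝓡 (n - k)) (QuotientGroup.mk : G → G ⧸ K) g (T.symm (lieIncl n k K w)) = 0
    have e4 := mfderiv_comp_apply' (I := 𝓡 k) (h := fun _ : K => (QuotientGroup.mk g : G ⧸ K))
      (g := (QuotientGroup.mk : G → G ⧸ K)) (f := fun c : K => g * (c : G))
      (fun c => (QuotientGroup.mk_mul_of_mem g c.2).symm) 1 g (mul_one g) (hπ g)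
      (MDifferentiableAt.comp (1 : K) (g := fun x : G => g * x) (mdifferentiable_mul_left g _)
        (hval 1)) w
    rw [mfderiv_const] at e4
    refine (congrArg _ e0).trans e4.symm
  have hEq := Submodule.eq_of_le_of_finrank_eq hSk (hS.trans hker.symm)
  have h1 : ∀ v : EuclideanSpace ℝ (Fin n), v ∈ S ↔ T v ∈ lieSub n k K := fun v => by
    change v ∈ Submodule.map T.symm.toLinearMap _ ↔ _
    rw [Submodule.mem_map_equiv, LinearEquiv.symm_symm]
  have h2 := h1 v
  rw [hEq] at h2
  exact h2

end Restriction

/-! ### Equivariant moment maps, alternating forms, pullbacks -/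

section Equivariant

variable {n : ℕ} {G : Type*} [TopologicalSpace G] [ChartedSpace (EuclideanSpace ℝ (Fin n)) G]
  [Group G] [LieGroup (𝓡 n) ∞ G]
  {m : ℕ} {M : Type*} [TopologicalSpace M] [ChartedSpace (EuclideanSpace ℝ (Fin m)) M]
  [MulAction G M]
  (hσ : ContMDiff ((𝓡 n).prod (𝓡 m)) (𝓡 m) ∞ (fun p : G × M => p.1 • p.2))

include hσ

lemma mfderiv_smul_inv (g : G) (x : M) (v : TangentSpace (𝓡 m) (g • x)) :
    (mfderiv (𝓡 m) (𝓡 m) (fun y : M => g • y) x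
      (mfderiv (𝓡 m) (𝓡 m) (fun y : M => g⁻¹ • y) (g • x) v : EuclideanSpace ℝ (Fin m)) :
        EuclideanSpace ℝ (Fin m)) = v := by
  have h := mfderiv_comp_apply' (I := 𝓡 m) (h := id) (g := fun y : M => g • y)
    (f := fun y : M => g⁻¹ • y) (fun y => (smul_inv_smul g y).symm) (g • x) x (inv_smul_smul g x)
    (mdifferentiable_smul_left hσ g _) (mdifferentiable_smul_left hσ g⁻¹ _) v
  rw [mfderiv_id] at h
  exact h.symm

lemma mfderiv_smul_surjective (g : G) (x : M) (w : TangentSpace (𝓡 m) (g • x)) :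
    ∃ v : TangentSpace (𝓡 m) x, mfderiv (𝓡 m) (𝓡 m) (fun y : M => g • y) x v = w :=
  ⟨_, mfderiv_smul_inv hσ g x w⟩

variable {μ : M → G} (hμ : MDifferentiable (𝓡 m) (𝓡 n) μ)
  (he : ∀ (g : G) (x : M), μ (g • x) = g * μ x * g⁻¹)
include hμ he

lemma dlog_generator (ξ : GroupLieAlgebra (𝓡 n) G) (x : M) :
    dlog n m μ x (generator ξ x) = Ad n (μ x)⁻¹ ξ - ξ :=
  thetaL_mfderiv_moment hσ hμ he ξ x

lemma dlog_smul (g : G) (x : M) (v : TangentSpace (𝓡 m) x) :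
    dlog n m μ (g • x) (mfderiv (𝓡 m) (𝓡 m) (fun y : M => g • y) x v) = Ad n g (dlog n m μ x v) := by
  have e1 := mfderiv_comp_apply' (I := 𝓡 m) (h := fun y => g * μ y * g⁻¹) (g := μ)
    (f := fun y : M => g • y) (fun y => (he g y).symm) x _ rfl (hμ _)
    (mdifferentiable_smul_left hσ g x) v
  have e2 := thetaL_mfderiv_conj (n := n) g (hμ x) v
  have e3 : ∀ h h' : G, h = h' → ∀ w : EuclideanSpace ℝ (Fin n),
      (thetaL h w : EuclideanSpace ℝ (Fin n)) = thetaL h' w := by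
    rintro _ _ rfl w; rfl
  refine (congrArg (thetaL (n := n) (μ (g • x))) e1.symm).trans ?_
  exact (e3 _ _ (he g x) _).trans e2

end Equivariant

section Alternating

variable {V : Type*} [AddCommGroup V] [Module ℝ V] [TopologicalSpace V] (α : V [⋀^Fin 2]→L[ℝ] ℝ)

lemma alt_add_left (u u' v : V) : α ![u + u', v] = α ![u, v] + α ![u', v] :=
  α.vecCons_add (n := 1) ![v] u u'

lemma alt_swap (u v : V) : α ![u, v] = -α ![v, u] := by
  have h := α.map_swap ![v, u] (i := 0) (j := 1) (by decide)
  have e : (![v, u] ∘ Equiv.swap (0 : Fin 2) 1 : Fin 2 → V) = ![u, v] := by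
    funext i; fin_cases i <;> rfl
  rwa [e] at h

lemma alt_add_right (u v v' : V) : α ![u, v + v'] = α ![u, v] + α ![u, v'] := by
  rw [alt_swap, alt_add_left, alt_swap α v, alt_swap α v']
  ring

end Alternating

section Pullback

variable {m : ℕ} {M : Type*} [TopologicalSpace M] [ChartedSpace (EuclideanSpace ℝ (Fin m)) M]
  {m' : ℕ} {M' : Type*} [TopologicalSpace M'] [ChartedSpace (EuclideanSpace ℝ (Fin m')) M']
  {m'' : ℕ} {M'' : Type*} [TopologicalSpace M''] [ChartedSpace (EuclideanSpace ℝ (Fin m'')) M'']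
  {r : ℕ}

lemma pullback_comp {g : M' → M''} {f : M → M'} (hg : MDifferentiable (𝓡 m') (𝓡 m'') g)
    (hf : MDifferentiable (𝓡 m) (𝓡 m') f) (α : DiffForm m'' M'' r) :
    pullback m m'' (g ∘ f) α = pullback m m' f (pullback m' m'' g α) := by
  funext x
  ext v
  change α (g (f x)) (fun j => mfderiv (𝓡 m) (𝓡 m'') (g ∘ f) x (v j)) =
    α (g (f x)) (fun j => mfderiv (𝓡 m') (𝓡 m'') g (f x) (mfderiv (𝓡 m) (𝓡 m') f x (v j)))
  congr 1
  funext j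
  exact mfderiv_comp_apply x (hg _) (hf x) (v j)

lemma pullback_invariant {f : M → M'} {a : M → M} {b : M' → M'} (hab : ∀ x, f (a x) = b (f x))
    (hf : MDifferentiable (𝓡 m) (𝓡 m') f) (ha : MDifferentiable (𝓡 m) (𝓡 m) a)
    (hb : MDifferentiable (𝓡 m') (𝓡 m') b) {α : DiffForm m' M' r} (h : pullback m' m' b α = α) :
    pullback m m a (pullback m m' f α) = pullback m m' f α := by
  have e : f ∘ a = b ∘ f := funext hab
  rw [← pullback_comp hf ha, e, pullback_comp hb hf, h]

end Pullback

/-! ### The cross-section is q-Hamiltonian -/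

section Restriction

variable {n : ℕ} {G : Type*} [TopologicalSpace G] [ChartedSpace (EuclideanSpace ℝ (Fin n)) G]
  [Group G] [LieGroup (𝓡 n) ∞ G]
  {k : ℕ} {K : Subgroup G} [ChartedSpace (EuclideanSpace ℝ (Fin k)) K] [LieGroup (𝓡 k) ∞ K]
  {B : LinearMap.BilinForm ℝ (GroupLieAlgebra (𝓡 n) G)}
  {m : ℕ} {M : Type*} [TopologicalSpace M] [ChartedSpace (EuclideanSpace ℝ (Fin m)) M]
  [MulAction G M]
  {d : ℕ} {N : Type*} [TopologicalSpace N] [ChartedSpace (EuclideanSpace ℝ (Fin d)) N]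
  [MulAction K N]
  {i : N → M} {μ : M → G} {μN : N → K}

lemma lieIncl_mem (κ : GroupLieAlgebra (𝓡 k) K) : lieIncl n k K κ ∈ lieSub n k K := ⟨κ, rfl⟩

/-- The contraction axiom in terms of the logarithmic derivative of the moment map. -/
lemma IsQHamiltonian.contraction {ωM : DiffForm m M 2} (hM : IsQHamiltonian B m ωM μ)
    (ξ : GroupLieAlgebra (𝓡 n) G) (x : M) (v : TangentSpace (𝓡 m) x) :
    ωM x ![generator ξ x, v] = (1 / 2) * B (dlog n m μ x v + Ad n (μ x) (dlog n m μ x v)) ξ := by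
  rw [hM.contraction_eq, thetaR_apply]
  rfl

/-- Equivariant maps are compatible with generators. -/
lemma mfderiv_generator_of_equivariant
    (hK : Manifold.IsSmoothEmbedding (𝓡 k) (𝓡 n) ∞ (Subtype.val : K → G))
    (hσ : ContMDiff ((𝓡 n).prod (𝓡 m)) (𝓡 m) ∞ (fun p : G × M => p.1 • p.2))
    (hσN : ContMDiff ((𝓡 k).prod (𝓡 d)) (𝓡 d) ∞ (fun p : K × N => p.1 • p.2))
    (hi : MDifferentiable (𝓡 d) (𝓡 m) i) (he : ∀ (c : K) (x : N), i (c • x) = (c : G) • i x)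
    (κ : GroupLieAlgebra (𝓡 k) K) (x : N) :
    (mfderiv (𝓡 d) (𝓡 m) i x (generator κ x) : EuclideanSpace ℝ (Fin m)) =
      generator (lieIncl n k K κ) (i x) := by
  have e1 := mfderiv_comp_apply' (I := 𝓡 k) (h := fun c : K => (c : G) • i x) (g := i)
    (f := fun c : K => c • x) (fun c => (he c x).symm) 1 x (one_smul K x) (hi x)
    (mdifferentiable_smul_right hσN x 1) κ
  have e2 := mfderiv_comp_apply' (I := 𝓡 k) (h := fun c : K => (c : G) • i x)
    (g := fun g : G => g • i x) (f := (Subtype.val : K → G)) (fun c => rfl) 1 1 rfl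
    (mdifferentiable_smul_right hσ (i x) 1)
    ((IsNormalizedForm.contMDiff_subtype hK).mdifferentiable (by simp) 1) κ
  exact e1.symm.trans e2

lemma dlog_restrict
    (hK : Manifold.IsSmoothEmbedding (𝓡 k) (𝓡 n) ∞ (Subtype.val : K → G))
    (hμ : MDifferentiable (𝓡 m) (𝓡 n) μ) (hμN : MDifferentiable (𝓡 d) (𝓡 k) μN)
    (hi : MDifferentiable (𝓡 d) (𝓡 m) i) (hμi : ∀ x, μ (i x) = μN x)
    (x : N) (v : TangentSpace (𝓡 d) x) :
    dlog n m μ (i x) (mfderiv (𝓡 d) (𝓡 m) i x v) = lieIncl n k K (dlog k d μN x v) := by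
  have hs := IsNormalizedForm.contMDiff_subtype hK
  have e1 := mfderiv_comp_apply' (I := 𝓡 d) (h := fun x => (μN x : G)) (g := μ) (f := i)
    (fun x => (hμi x).symm) x _ rfl (hμ _) (hi x) v
  have e2 := mfderiv_comp_apply' (I := 𝓡 d) (h := fun x => (μN x : G)) (g := K.subtype) (f := μN)
    (fun x => rfl) x _ rfl (hs.mdifferentiable (by simp) _) (hμN x) v
  have e3 := thetaL_mfderiv_hom hs (μN x) (mfderiv (𝓡 d) (𝓡 k) μN x v)
  have e4 : ∀ h h' : G, h = h' → ∀ w : EuclideanSpace ℝ (Fin n),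
      (thetaL h w : EuclideanSpace ℝ (Fin n)) = thetaL h' w := by
    rintro _ _ rfl w; rfl
  refine (congrArg (thetaL (n := n) (μ (i x))) (e1.symm.trans e2)).trans ?_
  exact (e4 _ _ (hμi x) _).trans e3

variable [T2Space G] [ConnectedSpace G] [LieAlgebra.IsSemisimple ℝ (GroupLieAlgebra (𝓡 n) G)]

/-- Tangent vectors along the cross-section split into a tangent vector and a generator in `𝔭`. -/
lemma exists_dlog_sub_generator_mem (hB : IsNormalizedForm k K B)
    (hK : Manifold.IsSmoothEmbedding (𝓡 k) (𝓡 n) ∞ (Subtype.val : K → G))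
    (hσ : ContMDiff ((𝓡 n).prod (𝓡 m)) (𝓡 m) ∞ (fun p : G × M => p.1 • p.2))
    (hμ : MDifferentiable (𝓡 m) (𝓡 n) μ)
    (he : ∀ (g : G) (x : M), μ (g • x) = g * μ x * g⁻¹) {x : M} (hx : μ x ∈ stronglyStable G)
    (hxK : μ x ∈ K) (b : TangentSpace (𝓡 m) x) :
    ∃ ζ ∈ lieOrth k K B, dlog n m μ x (b - generator ζ x) ∈ lieSub n k K := by
  obtain ⟨u, hu, v, hv, huv⟩ := hB.exists_add (dlog n m μ x b)
  -- The generator of `ζ` has logarithmic derivative `Ad (μ x)⁻¹ ζ - ζ`; `ζ` is chosen so that this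
  -- is the `𝔭`-component of that of `b`.
  obtain ⟨ζ, hζ, hζv⟩ := hB.exists_Ad_inv_sub hK hx hxK hv
  refine ⟨ζ, hζ, ?_⟩
  rw [map_sub, dlog_generator hσ hμ he, hζv, ← huv, add_sub_cancel_right]
  exact hu

/-- The cross-section of a q-Hamiltonian manifold is q-Hamiltonian. -/
theorem isQHamiltonian_restrict [IsManifold (𝓡 m) ∞ M] [IsManifold (𝓡 d) ∞ N]
    (hB : IsNormalizedForm k K B)
    (hK : Manifold.IsSmoothEmbedding (𝓡 k) (𝓡 n) ∞ (Subtype.val : K → G))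
    {ωM : DiffForm m M 2} (hM : IsQHamiltonian B m ωM μ)
    (hD : ∀ x, μ x ∈ stronglyStable G)
    (hσN : ContMDiff ((𝓡 k).prod (𝓡 d)) (𝓡 d) ∞ (fun p : K × N => p.1 • p.2))
    (hi : ContMDiff (𝓡 d) (𝓡 m) ∞ i) (he : ∀ (c : K) (x : N), i (c • x) = (c : G) • i x)
    (hinj : ∀ x, Function.Injective (mfderiv (𝓡 d) (𝓡 m) i x))
    (htan : ∀ x (b : TangentSpace (𝓡 m) (i x)), dlog n m μ (i x) b ∈ lieSub n k K →
      ∃ v, mfderiv (𝓡 d) (𝓡 m) i x v = b)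
    (hμN : ContMDiff (𝓡 d) (𝓡 k) ∞ μN) (hμi : ∀ x, μ (i x) = μN x)
    (heN : ∀ (c : K) (x : N), μN (c • x) = c * μN x * c⁻¹) :
    IsQHamiltonian (restrictForm k K B) d (pullback d m i ωM) μN := by
  have hid : MDifferentiable (𝓡 d) (𝓡 m) i := hi.mdifferentiable (by simp)
  have hμd : MDifferentiable (𝓡 m) (𝓡 n) μ := hM.smooth_moment.mdifferentiable (by simp)
  have hdl := dlog_restrict hK hμd (hμN.mdifferentiable (by simp)) hid hμi
  have hgen := mfderiv_generator_of_equivariant hK hM.contMDiff_smul hσN hid he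
  have hAd : ∀ (x : N) (κ : GroupLieAlgebra (𝓡 k) K),
      Ad n (μ (i x)) (lieIncl n k K κ) = lieIncl n k K (Ad k (μN x) κ) := fun x κ => by
    rw [hμi]; exact IsNormalizedForm.Ad_lieIncl hK _ _
  refine ⟨hσN, hM.smooth_form.pullback hi, hμN, fun c => ?_, heN, fun x u v w => ?_,
    fun κ x v => ?_, fun x v => ⟨fun h => ?_, ?_⟩⟩
  · exact pullback_invariant (he c) hid (mdifferentiable_smul_left hσN c)
      (mdifferentiable_smul_left hM.contMDiff_smul (c : G)) (hM.invariant c)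
  · rw [extDerivForm_pullback ((isSmoothForm_iff _).1 hM.smooth_form _) (hi x)]
    have e0 : (fun j => mfderiv (𝓡 d) (𝓡 m) i x ((![u, v, w] : Fin 3 → TangentSpace (𝓡 d) x) j)) =
      ![mfderiv (𝓡 d) (𝓡 m) i x u, mfderiv (𝓡 d) (𝓡 m) i x v, mfderiv (𝓡 d) (𝓡 m) i x w] := by
      funext j; fin_cases j <;> rfl
    rw [e0, hM.extDeriv_eq, cartanForm_eq hB, cartanForm_restrictForm_eq hK hB]
    change -(1 / 2 * B (dlog n m μ (i x) (mfderiv (𝓡 d) (𝓡 m) i x u))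
      ⁅dlog n m μ (i x) (mfderiv (𝓡 d) (𝓡 m) i x v), dlog n m μ (i x) (mfderiv (𝓡 d) (𝓡 m) i x w)⁆)
      = _
    rw [hdl, hdl, hdl]
    rfl
  · rw [pullback_apply₂, thetaR_apply]
    have e1 := hM.contraction (lieIncl n k K κ) (i x) (mfderiv (𝓡 d) (𝓡 m) i x v)
    rw [hdl, hAd, ← map_add] at e1
    refine Eq.trans ?_ e1
    refine congrArg (ωM (i x)) ?_
    funext j; fin_cases j
    · exact hgen κ x
    · rfl
  -- The kernel of the restricted form lies in the kernel of `ωM`: every tangent vector is tangent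
  -- to the cross-section up to a generator from `𝔭`, and by the contraction axiom such generators
  -- are orthogonal to vectors whose `dlog` is in `𝔨`.
  · have h1 : ∀ b : TangentSpace (𝓡 m) (i x), ωM (i x) ![mfderiv (𝓡 d) (𝓡 m) i x v, b] = 0 := by
      intro b
      obtain ⟨ζ, hζ, hb⟩ := exists_dlog_sub_generator_mem hB hK hM.contMDiff_smul hμd hM.equivariant
        (hD (i x)) (by rw [hμi]; exact (μN x).2) b
      obtain ⟨w, hw⟩ := htan x _ hb
      have e1 : b = mfderiv (𝓡 d) (𝓡 m) i x w + generator ζ (i x) := by rw [hw, sub_add_cancel]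
      have e2 := h w
      rw [pullback_apply₂] at e2
      rw [e1, alt_add_right, e2, alt_swap, hM.contraction, hdl, hAd, ← map_add,
        hB.apply_kp (lieIncl_mem _) hζ]
      simp
    obtain ⟨ξ, hξ, hξv⟩ := (hM.ker_eq _ _).1 h1
    have h2 := dlog_generator hM.contMDiff_smul hμd hM.equivariant ξ (i x)
    -- Consequently `dlog` of the generator is `-2 ξ`; it is in `𝔨` by tangency, so `ξ` comes from
    -- the Lie algebra of `K`.
    have h3 : Ad n (μ (i x))⁻¹ ξ = -ξ := by
      rw [← Ad_inv_apply_Ad (μ (i x)) (-ξ), map_neg, eq_neg_of_add_eq_zero_left hξ, neg_neg]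
    rw [hξv, hdl, h3] at h2
    have h4 : ξ ∈ lieSub n k K := by
      have h5 : (-(1 / 2) : ℝ) • (-ξ - ξ) ∈ lieSub n k K := by
        rw [← h2]; exact Submodule.smul_mem _ _ ⟨_, rfl⟩
      convert h5 using 1
      module
    obtain ⟨κ, rfl⟩ := h4
    refine ⟨κ, ?_, ?_⟩
    · apply IsNormalizedForm.lieIncl_injective hK
      rw [map_add, map_zero, ← hAd]
      exact hξ
    · apply hinj x
      exact (hgen κ x).trans hξv
  · rintro ⟨κ, hκ, rfl⟩ w
    rw [pullback_apply₂]
    have h1 := (hM.ker_eq (i x) (generator (lieIncl n k K κ) (i x))).2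
      ⟨lieIncl n k K κ, by rw [hAd, ← map_add, hκ, map_zero], rfl⟩ (mfderiv (𝓡 d) (𝓡 m) i x w)
    refine Eq.trans ?_ h1
    refine congrArg (ωM (i x)) ?_
    funext j; fin_cases j
    · exact hgen κ x
    · rfl

end Restriction

/-! ### Algebra and topology of the induction -/

namespace Induction

section Algebra

variable {G : Type*} [Group G] {K : Subgroup G} {N : Type*} [MulAction K N]

lemma mk_eq_mk_iff {p q : G × N} :
    Induction.mk K p = Induction.mk K q ↔ ∃ c : K, q = (p.1 * (c : G)⁻¹, c • p.2) :=
  Quotient.eq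

lemma mk_mul_inv (p : G × N) (c : K) :
    Induction.mk K (p.1 * (c : G)⁻¹, c • p.2) = Induction.mk K p :=
  (mk_eq_mk_iff.2 ⟨c, rfl⟩).symm

lemma mk_mul (g : G) (c : K) (x : N) :
    Induction.mk K (g * (c : G), x) = Induction.mk K (g, c • x) := by
  rw [← mk_mul_inv (g * (c : G), x) c, mul_inv_cancel_right]

lemma smul_mk (g h : G) (x : N) : g • Induction.mk K (h, x) = Induction.mk K (g * h, x) := rfl

lemma mk_eq_smul (g : G) (x : N) : Induction.mk K (g, x) = g • Induction.mk K (1, x) := by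
  rw [smul_mk, mul_one]

lemma mk_one_smul (c : K) (x : N) :
    Induction.mk K (1, c • x) = (c : G) • Induction.mk K (1, x) := by
  rw [smul_mk, mul_one, ← mk_mul, one_mul]

lemma mk_surjective : Function.Surjective (Induction.mk K : G × N → Induction K N) :=
  Quotient.mk_surjective

end Algebra

section Topology

variable {G : Type*} [Group G] [TopologicalSpace G] [IsTopologicalGroup G] {K : Subgroup G}
  {N : Type*} [MulAction K N] [TopologicalSpace N] [ContinuousSMul K N]

lemma isQuotientMap_mk : IsQuotientMap (Induction.mk K : G × N → Induction K N) :=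
  isQuotientMap_quotient_mk'

lemma continuous_mk : Continuous (Induction.mk K : G × N → Induction K N) :=
  isQuotientMap_mk.continuous

/-- The saturation of an open set is a union of preimages under the homeomorphisms by which `K`
acts. -/
lemma isOpenMap_mk : IsOpenMap (Induction.mk K : G × N → Induction K N) := by
  intro V hV
  rw [← isQuotientMap_mk.isOpen_preimage]
  have : (Induction.mk K : G × N → Induction K N) ⁻¹' (Induction.mk K '' V) =
      ⋃ c : K, (fun p : G × N => (p.1 * (c : G)⁻¹, c • p.2)) ⁻¹' V := by
    ext p
    simp only [mem_preimage, mem_image, mem_iUnion]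
    refine ⟨?_, fun ⟨c, hc⟩ => ⟨_, hc, mk_mul_inv p c⟩⟩
    rintro ⟨v, hv, hvp⟩
    obtain ⟨c, rfl⟩ := mk_eq_mk_iff.1 hvp.symm
    exact ⟨c, hv⟩
  rw [this]
  exact isOpen_iUnion fun c => hV.preimage (by fun_prop)

lemma isOpenQuotientMap_mk : IsOpenQuotientMap (Induction.mk K : G × N → Induction K N) :=
  ⟨mk_surjective, continuous_mk, isOpenMap_mk⟩

lemma secondCountableTopology [SecondCountableTopology G] [SecondCountableTopology N] :
    SecondCountableTopology (Induction K N) :=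
  isQuotientMap_mk.secondCountableTopology isOpenMap_mk

variable [CompactSpace K]

/-- The saturation of a closed set is the projection of a closed set along the compact factor `K`.
-/
lemma isClosedMap_mk : IsClosedMap (Induction.mk K : G × N → Induction K N) := by
  intro C hC
  rw [← isQuotientMap_mk.isClosed_preimage]
  have : (Induction.mk K : G × N → Induction K N) ⁻¹' (Induction.mk K '' C) =
      Prod.snd '' ((fun r : K × (G × N) => (r.2.1 * (r.1 : G)⁻¹, r.1 • r.2.2)) ⁻¹' C) := by
    ext p
    simp only [mem_preimage, mem_image, Prod.exists]
    refine ⟨?_, ?_⟩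
    · rintro ⟨g, x, hv, hvp⟩
      obtain ⟨c, hc⟩ := mk_eq_mk_iff.1 hvp.symm
      exact ⟨c, p.1, p.2, hc ▸ hv, rfl⟩
    · rintro ⟨c, g, x, hc, rfl⟩
      exact ⟨_, _, hc, mk_mul_inv (g, x) c⟩
  rw [this]
  exact isClosedMap_snd_of_compactSpace _ (hC.preimage (by fun_prop))

lemma isProperMap_mk : IsProperMap (Induction.mk K : G × N → Induction K N) := by
  refine isProperMap_iff_isClosedMap_and_compact_fibers.2 ⟨continuous_mk, isClosedMap_mk, fun y => ?_⟩
  obtain ⟨p, rfl⟩ := mk_surjective y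
  have : (Induction.mk K : G × N → Induction K N) ⁻¹' {Induction.mk K p} =
      range fun c : K => (p.1 * (c : G)⁻¹, c • p.2) := by
    ext q
    simp only [mem_preimage, mem_singleton_iff, mem_range]
    rw [eq_comm, mk_eq_mk_iff]
    exact exists_congr fun c => eq_comm
  rw [this]
  exact isCompact_range (by fun_prop)

lemma t2Space [T2Space G] [T2Space N] : T2Space (Induction K N) := by
  rw [t2Space_iff_of_isOpenQuotientMap isOpenQuotientMap_mk]
  have : {q : (G × N) × (G × N) | Induction.mk K q.1 = Induction.mk K q.2} =
      Prod.snd '' {r : K × ((G × N) × (G × N)) |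
        r.2.2 = (r.2.1.1 * (r.1 : G)⁻¹, r.1 • r.2.1.2)} := by
    ext q
    simp only [mem_ofPred_eq, mem_image]
    rw [mk_eq_mk_iff]
    exact ⟨fun ⟨c, hc⟩ => ⟨(c, q), hc, rfl⟩, fun ⟨r, hr, hrq⟩ => ⟨r.1, hrq ▸ hr⟩⟩
  rw [this]
  exact isClosedMap_snd_of_compactSpace _ (isClosed_eq (by fun_prop) (by fun_prop))

/-- On representatives `(g, p) ↦ (g p, p)` is a closed embedding, hence proper, and the projection
to the induction is proper because `K` is compact. Properness descends along the surjection `G × (G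
× N) → G × Induction K N`. -/
lemma properSMul [T2Space G] [T2Space N] : ProperSMul G (Induction K N) := by
  refine ⟨?_⟩
  have hc : Continuous fun r : G × (G × N) => (r.1 * r.2.1, r.2.2) := by fun_prop
  have h1 : IsClosedEmbedding fun r : G × (G × N) => ((r.1 * r.2.1, r.2.2), r.2) := by
    refine IsClosedEmbedding.mk (IsEmbedding.of_leftInverse
      (f := fun s : (G × N) × (G × N) => (s.1.1 * s.2.1⁻¹, s.2)) (fun r => by simp)
      (by fun_prop) (by fun_prop)) ?_
    have : range (fun r : G × (G × N) => ((r.1 * r.2.1, r.2.2), r.2)) =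
        {s : (G × N) × (G × N) | s.1.2 = s.2.2} := by
      ext s
      simp only [mem_range, mem_ofPred_eq]
      constructor
      · rintro ⟨r, rfl⟩; rfl
      · intro hs
        exact ⟨(s.1.1 * s.2.1⁻¹, s.2), Prod.ext (Prod.ext (by simp) hs.symm) rfl⟩
    rw [this]
    exact isClosed_eq (by fun_prop) (by fun_prop)
  have h2 : IsProperMap (Prod.map (Induction.mk K) (Induction.mk K) ∘
      fun r : G × (G × N) => ((r.1 * r.2.1, r.2.2), r.2)) :=
    (isProperMap_mk.prodMap isProperMap_mk).comp h1.isProperMap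
  have hq : IsOpenQuotientMap (Prod.map id (Induction.mk K) : G × (G × N) → G × Induction K N) :=
    IsOpenQuotientMap.id.prodMap isOpenQuotientMap_mk
  refine isProperMap_of_comp_of_surj hq.continuous ?_ (h2 : IsProperMap
    ((fun gx : G × Induction K N => (gx.1 • gx.2, gx.2)) ∘ Prod.map id (Induction.mk K)))
    hq.surjective
  rw [hq.isQuotientMap.continuous_iff]
  exact h2.continuous

end Topology

/-! ### The smooth structure of the induction -/

section Charts

open Manifold

variable {n : ℕ} {G : Type*} [TopologicalSpace G] [ChartedSpace (EuclideanSpace ℝ (Fin n)) G]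
  [Group G] [LieGroup (𝓡 n) ∞ G]
  {k : ℕ} {K : Subgroup G} [ChartedSpace (EuclideanSpace ℝ (Fin k)) K] [LieGroup (𝓡 k) ∞ K]
  {d : ℕ} {N : Type*} [TopologicalSpace N] [ChartedSpace (EuclideanSpace ℝ (Fin d)) N]
  [IsManifold (𝓡 d) ∞ N] [MulAction K N]
  {r : ℕ} [ChartedSpace (EuclideanSpace ℝ (Fin r)) (G ⧸ K)] [IsManifold (𝓡 r) ∞ (G ⧸ K)]

/-- Near the base point of `G ⧸ K`, the group `G` is a product of `G ⧸ K` and `K`. -/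
lemma exists_local_product
    (hK : IsSmoothEmbedding (𝓡 k) (𝓡 n) ∞ (Subtype.val : K → G))
    (hGK : IsSubmersion (𝓡 n) (𝓡 r) ∞ (QuotientGroup.mk : G → G ⧸ K)) :
    ∃ (U : Set (G ⧸ K)) (s : G ⧸ K → G) (κ : G → K), IsOpen U ∧ QuotientGroup.mk 1 ∈ U ∧
      ContMDiffOn (𝓡 r) (𝓡 n) ∞ s U ∧ s (QuotientGroup.mk 1) = 1 ∧
      (∀ y ∈ U, (QuotientGroup.mk (s y) : G ⧸ K) = y) ∧
      ContMDiffOn (𝓡 n) (𝓡 k) ∞ κ ((QuotientGroup.mk : G → G ⧸ K) ⁻¹' U) ∧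
      ∀ g : G, (QuotientGroup.mk g : G ⧸ K) ∈ U → s (QuotientGroup.mk g) * (κ g : G) = g := by
  obtain ⟨s, hs, hs1, hsec⟩ := exists_eventually_section_of_isSubmersionAt (hGK.isSubmersionAt 1)
  obtain ⟨U, hU, hUo, h1U⟩ := mem_nhds_iff.1 (hs.and hsec)
  have hκ : ∀ g : G, (QuotientGroup.mk g : G ⧸ K) ∈ U →
      (s (QuotientGroup.mk g))⁻¹ * g ∈ K := fun g hg => QuotientGroup.eq.1 (hU hg).2
  classical
  let κ : G → K := fun g => if h : (s (QuotientGroup.mk g))⁻¹ * g ∈ K then ⟨_, h⟩ else 1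
  have hκ' : ∀ g : G, (QuotientGroup.mk g : G ⧸ K) ∈ U →
      (κ g : G) = (s (QuotientGroup.mk g))⁻¹ * g := fun g hg => by
    simp only [κ, dif_pos (hκ g hg)]
  have hsU : ContMDiffOn (𝓡 r) (𝓡 n) ∞ s U := fun y hy => (hU hy).1.contMDiffWithinAt
  refine ⟨U, s, κ, hUo, h1U, hsU, hs1, fun y hy => (hU hy).2, ?_, fun g hg => ?_⟩
  · have hπ := hGK.contMDiff
    have hVo : IsOpen ((QuotientGroup.mk : G → G ⧸ K) ⁻¹' U) := hUo.preimage hπ.continuous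
    have h2 : ContMDiffOn (𝓡 n) (𝓡 n) ∞ (fun g : G => (s (QuotientGroup.mk g))⁻¹ * g)
        ((QuotientGroup.mk : G → G ⧸ K) ⁻¹' U) :=
      ContMDiffOn.mul (ContMDiffOn.inv (hsU.comp hπ.contMDiffOn fun g hg => hg)) contMDiffOn_id
    have h3 : ContMDiffOn (𝓡 n) (𝓡 n) ∞ ((Subtype.val : K → G) ∘ κ)
        ((QuotientGroup.mk : G → G ⧸ K) ⁻¹' U) := h2.congr fun g hg => hκ' g hg
    intro g hg
    refine ContMDiffAt.contMDiffWithinAt ((ContMDiffAt.iff_comp_isImmersionAt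
      (hK.isImmersion.isImmersionAt (κ g))).2 ⟨?_, h3.contMDiffAt (hVo.mem_nhds hg)⟩)
    rw [IsInducing.subtypeVal.continuousAt_iff]
    exact (h3.contMDiffAt (hVo.mem_nhds hg)).continuousAt
  · rw [hκ' g hg, mul_inv_cancel_left]

/-- The smooth structure on the induction. -/
theorem exists_chartedSpace [T2Space G]
    (hK : IsSmoothEmbedding (𝓡 k) (𝓡 n) ∞ (Subtype.val : K → G))
    (hGK : IsSubmersion (𝓡 n) (𝓡 r) ∞ (QuotientGroup.mk : G → G ⧸ K))
    (hσN : ContMDiff ((𝓡 k).prod (𝓡 d)) (𝓡 d) ∞ (fun p : K × N => p.1 • p.2))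
    {d' : ℕ} (hd : d' = d + r) :
    ∃ (_ : ChartedSpace (EuclideanSpace ℝ (Fin d')) (Induction K N))
      (_ : IsManifold (𝓡 d') ∞ (Induction K N)),
      ContMDiff ((𝓡 n).prod (𝓡 d)) (𝓡 d') ∞ (Induction.mk K : G × N → Induction K N) ∧
      ∀ p : G × N, ∃ s : Induction K N → G × N,
        ContMDiffAt (𝓡 d') ((𝓡 n).prod (𝓡 d)) ∞ s (Induction.mk K p) ∧
        s (Induction.mk K p) = p ∧ ∀ᶠ y in 𝓝 (Induction.mk K p), Induction.mk K (s y) = y := by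
  have := topologicalGroup_of_lieGroup (𝓡 n) ∞ (G := G)
  have : ContinuousSMul K N := ⟨hσN.continuous⟩
  obtain ⟨U, s, κ, hU, h1U, hs, hs1, hsec, hκ, hκs⟩ := exists_local_product hK hGK
  let L : (EuclideanSpace ℝ (Fin r) × EuclideanSpace ℝ (Fin d)) ≃L[ℝ] EuclideanSpace ℝ (Fin d') :=
    ContinuousLinearEquiv.ofFinrankEq (by
      rw [Module.finrank_prod, finrank_euclideanSpace_fin, finrank_euclideanSpace_fin,
        finrank_euclideanSpace_fin, hd, add_comm])
  have hκ1 : κ 1 = 1 := by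
    have := hκs 1 h1U
    rw [hs1, one_mul] at this
    exact Subtype.ext this
  have hκc : ∀ (g : G) (c : K), (QuotientGroup.mk g : G ⧸ K) ∈ U → κ (g * (c : G)⁻¹) = κ g * c⁻¹ :=
    fun g c hg => by
    have e0 : (QuotientGroup.mk (g * (c : G)⁻¹) : G ⧸ K) = QuotientGroup.mk g :=
      QuotientGroup.mk_mul_of_mem g (K.inv_mem c.2)
    have h1 := hκs (g * (c : G)⁻¹) (by rw [e0]; exact hg)
    rw [e0] at h1
    have h2 := h1.trans (congrArg (· * (c : G)⁻¹) (hκs g hg).symm)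
    simp only [mul_assoc] at h2
    exact Subtype.ext (mul_left_cancel h2)
  refine exists_chartedSpace_quotient mk_surjective continuous_mk ?_
  rintro ⟨g₀, x₀⟩
  let ψ := extChartAt (𝓡 r) (QuotientGroup.mk 1 : G ⧸ K)
  let χ := extChartAt (𝓡 d) x₀
  -- Near `[g₀, x₀]` the coordinates of `[g, x]` are the coset of `g₀⁻¹ g` and the point `κ(g₀⁻¹ g)
  -- • x`; neither changes under `(g, x) ↦ (g c⁻¹, c • x)`. The inverse `S` takes values in `G × N`
  -- and so doubles as a local section.
  let π : G → G ⧸ K := fun g => QuotientGroup.mk (g₀⁻¹ * g)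
  have hπ : ContMDiff (𝓡 n) (𝓡 r) ∞ π := hGK.contMDiff.comp contMDiff_mul_left
  let O : Set (G × N) := {p | π p.1 ∈ U ∩ ψ.source}
  let ρ : G × N → N := fun p => κ (g₀⁻¹ * p.1) • p.2
  let W : Set (G × N) := O ∩ ρ ⁻¹' χ.source
  let C : G × N → EuclideanSpace ℝ (Fin d') := fun p => L (ψ (π p.1), χ (ρ p))
  let S : EuclideanSpace ℝ (Fin d') → G × N := fun t =>
    (g₀ * s (ψ.symm (L.symm t).1), χ.symm (L.symm t).2)
  let V : Set (EuclideanSpace ℝ (Fin d')) :=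
    {t | (L.symm t).1 ∈ ψ.target ∩ ψ.symm ⁻¹' U ∧ (L.symm t).2 ∈ χ.target}
  have hψs : ContMDiffOn (𝓡 r) (𝓡 r) ∞ ψ.symm ψ.target := contMDiffOn_extChartAt_symm _
  have hχs : ContMDiffOn (𝓡 d) (𝓡 d) ∞ χ.symm χ.target := contMDiffOn_extChartAt_symm _
  have hψ : ContMDiffOn (𝓡 r) (𝓡 r) ∞ ψ ψ.source := by
    have h : ψ.source = (chartAt (EuclideanSpace ℝ (Fin r)) (QuotientGroup.mk 1 : G ⧸ K)).source :=
      extChartAt_source (I := 𝓡 r) _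
    rw [h]; exact contMDiffOn_extChartAt
  have hχ : ContMDiffOn (𝓡 d) (𝓡 d) ∞ χ χ.source := by
    have h : χ.source = (chartAt (EuclideanSpace ℝ (Fin d)) x₀).source :=
      extChartAt_source (I := 𝓡 d) _
    rw [h]; exact contMDiffOn_extChartAt
  have hO : IsOpen O := (hU.inter (isOpen_extChartAt_source _)).preimage
    (hπ.continuous.comp continuous_fst)
  have hρ : ContMDiffOn ((𝓡 n).prod (𝓡 d)) (𝓡 d) ∞ ρ O := by
    refine ContMDiff.comp_contMDiffOn (g := fun p : K × N => p.1 • p.2) hσN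
      (ContMDiffOn.prodMk ?_ contMDiff_snd.contMDiffOn)
    exact hκ.comp (contMDiff_mul_left.comp contMDiff_fst).contMDiffOn fun p hp => hp.1
  have hW : IsOpen W := hρ.continuousOn.isOpen_inter_preimage hO (isOpen_extChartAt_source _)
  have hCW : ContMDiffOn ((𝓡 n).prod (𝓡 d)) (𝓡 d') ∞ C W := by
    refine L.contDiff.contMDiff.comp_contMDiffOn (ContMDiffOn.prodMk_space ?_ ?_)
    · exact hψ.comp (hπ.comp contMDiff_fst).contMDiffOn fun p hp => hp.1.2
    · exact hχ.comp (hρ.mono inter_subset_left) fun p hp => hp.2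
  have hLs : ContMDiff (𝓡 d') 𝓘(ℝ, EuclideanSpace ℝ (Fin r) × EuclideanSpace ℝ (Fin d)) ∞ L.symm :=
    L.symm.contDiff.contMDiff
  have hL1 : ContMDiff (𝓡 d') (𝓡 r) ∞ fun t => (L.symm t).1 := contDiff_fst.contMDiff.comp hLs
  have hL2 : ContMDiff (𝓡 d') (𝓡 d) ∞ fun t => (L.symm t).2 := contDiff_snd.contMDiff.comp hLs
  have hV : IsOpen V :=
    ((hψs.continuousOn.isOpen_inter_preimage (isOpen_extChartAt_target _) hU).preimage
      hL1.continuous).inter ((isOpen_extChartAt_target _).preimage hL2.continuous)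
  have hSV : ContMDiffOn (𝓡 d') ((𝓡 n).prod (𝓡 d)) ∞ S V := by
    refine ContMDiffOn.prodMk ?_ ?_
    · refine contMDiff_mul_left.comp_contMDiffOn (ContMDiffOn.comp (t := U) hs
        (ContMDiffOn.comp hψs hL1.contMDiffOn fun t ht => ht.1.1) fun t ht => ht.1.2)
    · exact hχs.comp hL2.contMDiffOn fun t ht => ht.2
  have hinv : ∀ (p : G × N) (c : K), p ∈ W → (p.1 * (c : G)⁻¹, c • p.2) ∈ W ∧
      C (p.1 * (c : G)⁻¹, c • p.2) = C p := fun p c hp => by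
    have e1 : π (p.1 * (c : G)⁻¹) = π p.1 := by
      change (QuotientGroup.mk _ : G ⧸ K) = _
      rw [← mul_assoc]
      exact QuotientGroup.mk_mul_of_mem _ (K.inv_mem c.2)
    have e2 : ρ (p.1 * (c : G)⁻¹, c • p.2) = ρ p := by
      change κ (g₀⁻¹ * (p.1 * (c : G)⁻¹)) • c • p.2 = _
      rw [← mul_assoc, hκc _ _ hp.1.1, smul_smul, inv_mul_cancel_right]
    refine ⟨⟨?_, ?_⟩, ?_⟩
    · change π (p.1 * (c : G)⁻¹) ∈ U ∩ ψ.source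
      rw [e1]; exact hp.1
    · change ρ (p.1 * (c : G)⁻¹, c • p.2) ∈ χ.source
      rw [e2]; exact hp.2
    · change L (ψ (π (p.1 * (c : G)⁻¹)), χ (ρ (p.1 * (c : G)⁻¹, c • p.2))) = _
      rw [e1, e2]
  have hsat : ∀ p q : G × N, Induction.mk K p = Induction.mk K q → p ∈ W → q ∈ W ∧ C q = C p := by
    intro p q hpq hp
    obtain ⟨c, rfl⟩ := mk_eq_mk_iff.1 hpq
    exact hinv p c hp
  have hpre : (Induction.mk K : G × N → Induction K N) ⁻¹' (Induction.mk K '' W) = W := by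
    ext q
    exact ⟨fun ⟨p, hp, hpq⟩ => (hsat p q hpq hp).1, fun hq => ⟨q, hq, rfl⟩⟩
  -- An arbitrary choice of representatives suffices, because `W` is saturated and `C` is constant
  -- on the fibres over it.
  let out : Induction K N → G × N := Function.surjInv mk_surjective
  have hout : ∀ y, Induction.mk K (out y) = y := Function.surjInv_eq mk_surjective
  have hCout : ∀ p ∈ W, C (out (Induction.mk K p)) = C p := fun p hp =>
    (hsat p _ (hout _).symm hp).2
  have hCS : ∀ t ∈ V, S t ∈ W ∧ C (S t) = t := fun t ht => by
    have e0 : g₀⁻¹ * (g₀ * s (ψ.symm (L.symm t).1)) = s (ψ.symm (L.symm t).1) :=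
      inv_mul_cancel_left _ _
    have e1 : π (S t).1 = ψ.symm (L.symm t).1 := by
      change (QuotientGroup.mk (g₀⁻¹ * (g₀ * s (ψ.symm (L.symm t).1))) : G ⧸ K) = _
      rw [e0, hsec _ ht.1.2]
    have e2 : ρ (S t) = χ.symm (L.symm t).2 := by
      change κ (g₀⁻¹ * (g₀ * s (ψ.symm (L.symm t).1))) • χ.symm (L.symm t).2 = _
      have h1 := hκs (s (ψ.symm (L.symm t).1)) (by rw [hsec _ ht.1.2]; exact ht.1.2)
      rw [hsec _ ht.1.2] at h1
      have h2 : κ (s (ψ.symm (L.symm t).1)) = 1 := Subtype.ext (mul_eq_left.1 h1)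
      rw [e0, h2, one_smul]
    refine ⟨⟨⟨?_, ?_⟩, ?_⟩, ?_⟩
    · rw [e1]; exact ht.1.2
    · rw [e1]; exact ψ.map_target ht.1.1
    · change ρ (S t) ∈ χ.source
      rw [e2]; exact χ.map_target ht.2
    · change L (ψ (π (S t).1), χ (ρ (S t))) = t
      rw [e1, e2, ψ.right_inv ht.1.1, χ.right_inv ht.2, Prod.mk.eta, L.apply_symm_apply]
  have hSC : ∀ p ∈ W, C p ∈ V ∧ Induction.mk K (S (C p)) = Induction.mk K p := fun p hp => by
    have e0 : L.symm (C p) = (ψ (π p.1), χ (ρ p)) := L.symm_apply_apply _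
    refine ⟨⟨⟨?_, ?_⟩, ?_⟩, ?_⟩
    · rw [e0]; exact ψ.map_source hp.1.2
    · change ψ.symm (L.symm (C p)).1 ∈ U
      rw [e0]; change ψ.symm (ψ (π p.1)) ∈ U
      rw [ψ.left_inv hp.1.2]; exact hp.1.1
    · rw [e0]; exact χ.map_source hp.2
    · change Induction.mk K (g₀ * s (ψ.symm (L.symm (C p)).1), χ.symm (L.symm (C p)).2) = _
      rw [e0]
      change Induction.mk K (g₀ * s (ψ.symm (ψ (π p.1))), χ.symm (χ (ρ p))) = _
      rw [ψ.left_inv hp.1.2, χ.left_inv hp.2]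
      change Induction.mk K (g₀ * s (π p.1), κ (g₀⁻¹ * p.1) • p.2) = _
      rw [← mk_mul, mul_assoc, hκs _ hp.1.1, mul_inv_cancel_left]
  let c : OpenPartialHomeomorph (Induction K N) (EuclideanSpace ℝ (Fin d')) :=
    { toFun := fun y => C (out y)
      invFun := fun t => Induction.mk K (S t)
      source := Induction.mk K '' W
      target := V
      map_source' := by
        rintro _ ⟨p, hp, rfl⟩
        rw [hCout p hp]
        exact (hSC p hp).1
      map_target' := fun t ht => ⟨_, (hCS t ht).1, rfl⟩
      left_inv' := by
        rintro _ ⟨p, hp, rfl⟩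
        rw [hCout p hp]
        exact (hSC p hp).2
      right_inv' := fun t ht => by
        rw [hCout _ (hCS t ht).1]
        exact (hCS t ht).2
      open_source := isOpenMap_mk _ hW
      open_target := hV
      continuousOn_toFun := by
        rw [isQuotientMap_mk.continuousOn_isOpen_iff (isOpenMap_mk _ hW), hpre]
        exact hCW.continuousOn.congr fun p hp => hCout p hp
      continuousOn_invFun := continuous_mk.comp_continuousOn hSV.continuousOn }
  have hp₀ : (g₀, x₀) ∈ W := by
    refine ⟨?_, ?_⟩
    · change (QuotientGroup.mk (g₀⁻¹ * g₀) : G ⧸ K) ∈ U ∩ ψ.source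
      rw [inv_mul_cancel]
      exact ⟨h1U, mem_extChartAt_source _⟩
    · change κ (g₀⁻¹ * g₀) • x₀ ∈ χ.source
      rw [inv_mul_cancel, hκ1, one_smul]
      exact mem_extChartAt_source _
  refine ⟨c, S, ⟨_, hp₀, rfl⟩, ?_, hSV, ?_, fun t _ => rfl⟩
  · change ContMDiffOn _ _ _ _ (Induction.mk K ⁻¹' (Induction.mk K '' W))
    rw [hpre]
    exact hCW.congr fun p hp => hCout p hp
  · change S (C (out (Induction.mk K (g₀, x₀)))) = _
    rw [hCout _ hp₀]
    have e0 : L.symm (C (g₀, x₀)) = (ψ (π g₀), χ (ρ (g₀, x₀))) := L.symm_apply_apply _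
    change (g₀ * s (ψ.symm (L.symm (C (g₀, x₀))).1), χ.symm (L.symm (C (g₀, x₀))).2) = _
    rw [e0]
    change (g₀ * s (ψ.symm (ψ (π g₀))), χ.symm (χ (ρ (g₀, x₀)))) = _
    rw [ψ.left_inv hp₀.1.2, χ.left_inv hp₀.2]
    change (g₀ * s (QuotientGroup.mk (g₀⁻¹ * g₀)), κ (g₀⁻¹ * g₀) • x₀) = _
    rw [inv_mul_cancel, hs1, mul_one, hκ1, one_smul]

end Charts

end Induction

/-! ### Smooth maps and tangent vectors on the induction -/

namespace Induction

open Manifold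

section Smooth

variable {n : ℕ} {G : Type*} [TopologicalSpace G] [ChartedSpace (EuclideanSpace ℝ (Fin n)) G]
  [Group G] [LieGroup (𝓡 n) ∞ G]
  {K : Subgroup G}
  {d : ℕ} {N : Type*} [TopologicalSpace N] [ChartedSpace (EuclideanSpace ℝ (Fin d)) N]
  [IsManifold (𝓡 d) ∞ N] [MulAction K N]
  {d' : ℕ} [ChartedSpace (EuclideanSpace ℝ (Fin d')) (Induction K N)]
  [IsManifold (𝓡 d') ∞ (Induction K N)]

variable (K) in
/-- The map `x ↦ [1, x]`. -/
abbrev incl (x : N) : Induction K N := Induction.mk K (1, x)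

lemma mk_eq_smul_incl (p : G × N) : Induction.mk K p = p.1 • incl K p.2 := mk_eq_smul p.1 p.2

lemma exists_eq_smul_incl (y : Induction K N) : ∃ (g : G) (x : N), y = g • incl K x := by
  obtain ⟨p, rfl⟩ := mk_surjective y
  exact ⟨p.1, p.2, mk_eq_smul_incl p⟩

section

variable (hq : ContMDiff ((𝓡 n).prod (𝓡 d)) (𝓡 d') ∞ (Induction.mk K : G × N → Induction K N))

include hq in
lemma contMDiff_incl : ContMDiff (𝓡 d) (𝓡 d') ∞ (incl K : N → Induction K N) :=
  hq.comp (contMDiff_const.prodMk contMDiff_id)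

variable (hs : ∀ p : G × N, ∃ s : Induction K N → G × N,
        ContMDiffAt (𝓡 d') ((𝓡 n).prod (𝓡 d)) ∞ s (Induction.mk K p) ∧
        s (Induction.mk K p) = p ∧ ∀ᶠ y in 𝓝 (Induction.mk K p), Induction.mk K (s y) = y)

include hs

-- Near each point `F` is a smooth local section of the projection followed by the lift of `F` to `G
-- × N`.
omit [LieGroup (𝓡 n) ∞ G] [IsManifold (𝓡 d) ∞ N] [IsManifold (𝓡 d') ∞ (Induction K N)] in
lemma contMDiff_of_comp_mk {V H : Type*} [NormedAddCommGroup V] [NormedSpace ℝ V]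
    [TopologicalSpace H] {J : ModelWithCorners ℝ V H} {X : Type*} [TopologicalSpace X]
    [ChartedSpace H X] {F : Induction K N → X}
    (hF : ContMDiff ((𝓡 n).prod (𝓡 d)) J ∞ (fun p : G × N => F (Induction.mk K p))) :
    ContMDiff (𝓡 d') J ∞ F := by
  intro y
  obtain ⟨p, rfl⟩ := mk_surjective y
  obtain ⟨s, h1, h2, h3⟩ := hs p
  have h4 : ContMDiffAt (𝓡 d') J ∞ (fun y => F (Induction.mk K (s y))) (Induction.mk K p) :=
    ContMDiffAt.comp _ (g := fun p : G × N => F (Induction.mk K p)) (hF _) h1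
  refine h4.congr_of_eventuallyEq ?_
  filter_upwards [h3] with y hy
  rw [hy]

include hq

omit [IsManifold (𝓡 d) ∞ N] [IsManifold (𝓡 d') ∞ (Induction K N)] in
lemma contMDiff_smul : ContMDiff ((𝓡 n).prod (𝓡 d')) (𝓡 d') ∞
    (fun p : G × Induction K N => p.1 • p.2) := by
  rintro ⟨h, y⟩
  obtain ⟨p, rfl⟩ := mk_surjective y
  obtain ⟨s, h1, h2, h3⟩ := hs p
  have h1' : ContMDiffAt ((𝓡 n).prod (𝓡 d')) ((𝓡 n).prod (𝓡 d)) ∞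
      (fun r : G × Induction K N => s r.2) (h, Induction.mk K p) :=
    ContMDiffAt.comp (h, Induction.mk K p) (g := s) h1 contMDiffAt_snd
  have h4 : ContMDiffAt ((𝓡 n).prod (𝓡 d')) (𝓡 d') ∞
      (fun r : G × Induction K N => Induction.mk K (r.1 * (s r.2).1, (s r.2).2))
      (h, Induction.mk K p) := by
    refine ContMDiffAt.comp _ (g := Induction.mk K) (hq _) ?_
    exact ContMDiffAt.prodMk (ContMDiffAt.mul contMDiffAt_fst
      (ContMDiffAt.comp _ (g := Prod.fst) contMDiffAt_fst h1'))
      (ContMDiffAt.comp _ (g := Prod.snd) contMDiffAt_snd h1')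
  refine h4.congr_of_eventuallyEq ?_
  filter_upwards [continuousAt_snd.eventually h3] with r hr
  change r.1 • r.2 = r.1 • Induction.mk K (s r.2)
  rw [hr]

lemma mfderiv_mk_surjective (p : G × N) : Function.Surjective
    (mfderiv ((𝓡 n).prod (𝓡 d)) (𝓡 d') (Induction.mk K : G × N → Induction K N) p) := by
  obtain ⟨s, h1, h2, h3⟩ := hs p
  have h4 := mfderiv_surjective_of_section (f := (Induction.mk K : G × N → Induction K N))
    (y := Induction.mk K p) (s := s) (hq.mdifferentiable (by simp) _)
    (h1.mdifferentiableAt (by simp)) h3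
  rwa [h2] at h4

lemma isSubmersion_mk {k : ℕ} (hd : n + d = d' + k) : IsSubmersion ((𝓡 n).prod (𝓡 d)) (𝓡 d') ∞
    (Induction.mk K : G × N → Induction K N) := by
  have : IsManifold ((𝓡 n).prod (𝓡 d)) ∞ (G × N) := inferInstance
  have h : IsSubmersionOfComplement (EuclideanSpace ℝ (Fin k)) ((𝓡 n).prod (𝓡 d)) (𝓡 d') ∞
      (Induction.mk K : G × N → Induction K N) := fun p =>
    isSubmersionAtOfComplement_of_surjective hq (mfderiv_mk_surjective hq hs p) (by
      rw [Module.finrank_prod, finrank_euclideanSpace_fin, finrank_euclideanSpace_fin,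
        finrank_euclideanSpace_fin, finrank_euclideanSpace_fin, hd])
  exact h.isSubmersion

/-- The projection is onto on tangent vectors and has the form `(g, x) ↦ g • [1, x]`; the Leibniz
rule for the action splits its differential at `(1, x)`. -/
lemma exists_mfderiv_mk_eq (x : N) (w : TangentSpace (𝓡 d') (incl K x)) :
    ∃ (ξ : GroupLieAlgebra (𝓡 n) G) (v : TangentSpace (𝓡 d) x),
      mfderiv (𝓡 d) (𝓡 d') (incl K) x v + generator ξ (incl K x) = w := by
  obtain ⟨u, hu⟩ := mfderiv_mk_surjective hq hs (1, x) w
  have hσ := contMDiff_smul hq hs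
  have hincl := contMDiff_incl hq
  have e2 : MDifferentiableAt ((𝓡 n).prod (𝓡 d)) (𝓡 d') (fun p : G × N => incl K p.2) (1, x) :=
    MDifferentiableAt.comp (1, x) (g := incl K) (hincl.mdifferentiable (by simp) _)
      mdifferentiableAt_snd
  have e1 := mfderiv_smul_apply hσ (A := Prod.fst) (b := fun p : G × N => incl K p.2) (p := (1, x))
    mdifferentiableAt_fst e2 u
  have e3 : (fun p : G × N => p.1 • incl K p.2) = Induction.mk K := by
    funext p; exact (mk_eq_smul_incl p).symm
  rw [e3] at e1
  have e4 : (fun y : Induction K N => (1 : G) • y) = id := by funext y; exact one_smul G y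
  have e5 := mfderiv_comp_apply' (I := (𝓡 n).prod (𝓡 d)) (h := fun p : G × N => incl K p.2)
    (g := incl K) (f := Prod.snd) (fun _ => rfl) (1, x) x rfl (hincl.mdifferentiable (by simp) _)
    mdifferentiableAt_snd u
  rw [mfderiv_snd] at e5
  refine ⟨thetaL (1 : G) u.1, u.2, ?_⟩
  have key : ∀ (T : EuclideanSpace ℝ (Fin d') →L[ℝ] EuclideanSpace ℝ (Fin d'))
      (a b b' w w' : EuclideanSpace ℝ (Fin d')), T = ContinuousLinearMap.id ℝ _ → b = b' →
      w' = T (a + b) → w' = w → b' + a = w := by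
    rintro T a b b' w w' rfl rfl rfl rfl
    exact add_comm _ _
  have e6 : mfderiv ((𝓡 n).prod (𝓡 d)) (𝓡 n) (Prod.fst : G × N → G) (1, x) u = u.1 := by
    rw [mfderiv_fst]; rfl
  rw [e6] at e1
  refine key _ _ _ _ _ _ ?_ e5 e1 hu
  change mfderiv (𝓡 d') (𝓡 d') (fun y : Induction K N => (1 : G) • y) (incl K x) = _
  rw [e4, mfderiv_id]
  rfl

end

end Smooth

section Decomposition

variable {n : ℕ} {G : Type*} [TopologicalSpace G] [ChartedSpace (EuclideanSpace ℝ (Fin n)) G]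
  [Group G] [LieGroup (𝓡 n) ∞ G]
  {k : ℕ} {K : Subgroup G} [ChartedSpace (EuclideanSpace ℝ (Fin k)) K] [LieGroup (𝓡 k) ∞ K]
  {B : LinearMap.BilinForm ℝ (GroupLieAlgebra (𝓡 n) G)}
  {d : ℕ} {N : Type*} [TopologicalSpace N] [ChartedSpace (EuclideanSpace ℝ (Fin d)) N]
  [IsManifold (𝓡 d) ∞ N] [MulAction K N]
  {d' : ℕ} [ChartedSpace (EuclideanSpace ℝ (Fin d')) (Induction K N)]
  [IsManifold (𝓡 d') ∞ (Induction K N)]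
  (hB : IsNormalizedForm k K B)
  (hK : IsSmoothEmbedding (𝓡 k) (𝓡 n) ∞ (Subtype.val : K → G))
  (hσN : ContMDiff ((𝓡 k).prod (𝓡 d)) (𝓡 d) ∞ (fun p : K × N => p.1 • p.2))
  (hq : ContMDiff ((𝓡 n).prod (𝓡 d)) (𝓡 d') ∞ (Induction.mk K : G × N → Induction K N))
  (hs : ∀ p : G × N, ∃ s : Induction K N → G × N,
        ContMDiffAt (𝓡 d') ((𝓡 n).prod (𝓡 d)) ∞ s (Induction.mk K p) ∧
        s (Induction.mk K p) = p ∧ ∀ᶠ y in 𝓝 (Induction.mk K p), Induction.mk K (s y) = y)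

include hK hσN hq hs

lemma mfderiv_incl_generator (κ : GroupLieAlgebra (𝓡 k) K) (x : N) :
    (mfderiv (𝓡 d) (𝓡 d') (incl K) x (generator κ x) : EuclideanSpace ℝ (Fin d')) =
      generator (lieIncl n k K κ) (incl K x) :=
  mfderiv_generator_of_equivariant hK (contMDiff_smul hq hs) hσN
    ((contMDiff_incl hq).mdifferentiable (by simp)) mk_one_smul κ x

include hB

/-- The tangent space of the induction at `[1, x]` is `T_x N ⊕ 𝔭`: existence. -/
lemma exists_decomposition (x : N) (w : TangentSpace (𝓡 d') (incl K x)) :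
    ∃ ζ ∈ lieOrth k K B, ∃ v : TangentSpace (𝓡 d) x,
      mfderiv (𝓡 d) (𝓡 d') (incl K) x v + generator ζ (incl K x) = w := by
  obtain ⟨ξ, v, h⟩ := exists_mfderiv_mk_eq hq hs x w
  -- The `𝔨`-part of the generator is absorbed into `T_x N`, because `x ↦ [1, x]` is
  -- `K`-equivariant.
  obtain ⟨u, ⟨κ, rfl⟩, ζ, hζ, rfl⟩ := hB.exists_add ξ
  refine ⟨ζ, hζ, v + generator κ x, ?_⟩
  have key : ∀ a b b' c e w : EuclideanSpace ℝ (Fin d'), b = b' → e = b' + c → a + e = w →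
      (a + b) + c = w := by
    rintro a _ b c _ _ rfl rfl rfl
    exact add_assoc _ _ _
  refine (congrArg (fun z : TangentSpace (𝓡 d') (incl K x) => z + generator ζ (incl K x))
    (map_add (mfderiv (𝓡 d) (𝓡 d') (incl K) x) v (generator κ x))).trans ?_
  exact key _ _ _ _ _ _ (mfderiv_incl_generator hK hσN hq hs κ x)
    (generator_add (contMDiff_smul hq hs) (lieIncl n k K κ) ζ (incl K x)) h

/-- The tangent space of the induction at `[1, x]` is `T_x N ⊕ 𝔭`: uniqueness. -/
lemma eq_zero_of_decomposition (hd : n + d = d' + k) (x : N) {ζ : GroupLieAlgebra (𝓡 n) G}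
    (hζ : ζ ∈ lieOrth k K B) {v : TangentSpace (𝓡 d) x}
    (h : mfderiv (𝓡 d) (𝓡 d') (incl K) x v + generator ζ (incl K x) = 0) : ζ = 0 ∧ v = 0 := by
  let D : EuclideanSpace ℝ (Fin d) →ₗ[ℝ] EuclideanSpace ℝ (Fin d') :=
    (mfderiv (𝓡 d) (𝓡 d') (incl K) x).toLinearMap
  let X : GroupLieAlgebra (𝓡 n) G →ₗ[ℝ] EuclideanSpace ℝ (Fin d') :=
    (mfderiv (𝓡 n) (𝓡 d') (fun g : G => g • incl K x) 1 :
      GroupLieAlgebra (𝓡 n) G →L[ℝ] TangentSpace (𝓡 d') ((1 : G) • incl K x)).toLinearMap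
  let T : (EuclideanSpace ℝ (Fin d) × lieOrth k K B) →ₗ[ℝ] EuclideanSpace ℝ (Fin d') :=
    D.coprod (X.comp (lieOrth k K B).subtype)
  have hT : Function.Surjective T := fun w => by
    obtain ⟨ζ, hζ, v, hv⟩ := exists_decomposition hB hK hσN hq hs x w
    exact ⟨(v, ⟨ζ, hζ⟩), hv⟩
  have hp : k + Module.finrank ℝ (lieOrth k K B) = n := by
    have h1 := Submodule.finrank_add_eq_of_isCompl hB.cartan.isCompl
    rw [IsNormalizedForm.finrank_lieSub hK] at h1
    exact h1.trans (finrank_euclideanSpace_fin (𝕜 := ℝ) (n := n))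
  -- Surjectivity is already known, so equality of dimensions yields injectivity.
  have hdim : Module.finrank ℝ (EuclideanSpace ℝ (Fin d) × lieOrth k K B) =
      Module.finrank ℝ (EuclideanSpace ℝ (Fin d')) := by
    rw [Module.finrank_prod, finrank_euclideanSpace_fin, finrank_euclideanSpace_fin]
    omega
  have hinj := (LinearMap.injective_iff_surjective_of_finrank_eq_finrank hdim).2 hT
  have h0 : T (v, ⟨ζ, hζ⟩) = T 0 := by
    rw [map_zero]; exact h
  have h1 := hinj h0
  exact ⟨congrArg Subtype.val (congrArg Prod.snd h1), congrArg Prod.fst h1⟩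

end Decomposition

end Induction

open Manifold

lemma contMDiff_of_comp_isSmoothEmbedding {V H : Type*} [NormedAddCommGroup V] [NormedSpace ℝ V]
    [TopologicalSpace H] {I : ModelWithCorners ℝ V H} {X : Type*} [TopologicalSpace X]
    [ChartedSpace H X] [IsManifold I ∞ X]
    {V' H' : Type*} [NormedAddCommGroup V'] [NormedSpace ℝ V']
    [TopologicalSpace H'] {J : ModelWithCorners ℝ V' H'} {Y : Type*} [TopologicalSpace Y]
    [ChartedSpace H' Y] [IsManifold J ∞ Y]
    {V'' H'' : Type*} [NormedAddCommGroup V''] [NormedSpace ℝ V'']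
    [TopologicalSpace H''] {J' : ModelWithCorners ℝ V'' H''} {Z : Type*} [TopologicalSpace Z]
    [ChartedSpace H'' Z] [IsManifold J' ∞ Z] {i : Y → Z} (hi : IsSmoothEmbedding J J' ∞ i)
    {f : X → Y} (hf : ContMDiff I J' ∞ (i ∘ f)) : ContMDiff I J ∞ f :=
  (ContMDiff.iff_comp_isImmersion hi.isImmersion).2
    ⟨hi.isEmbedding.isInducing.continuous_iff.2 hf.continuous, hf⟩

/-! ### The cross-section as a submanifold -/

section Slice

variable {n : ℕ} {G : Type*} [TopologicalSpace G] [ChartedSpace (EuclideanSpace ℝ (Fin n)) G]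
  [Group G] [LieGroup (𝓡 n) ∞ G]
  {k : ℕ} {K : Subgroup G} [ChartedSpace (EuclideanSpace ℝ (Fin k)) K] [LieGroup (𝓡 k) ∞ K]
  [ChartedSpace (EuclideanSpace ℝ (Fin (n - k))) (G ⧸ K)] [IsManifold (𝓡 (n - k)) ∞ (G ⧸ K)]
  {B : LinearMap.BilinForm ℝ (GroupLieAlgebra (𝓡 n) G)}
  {m : ℕ} {M : Type*} [TopologicalSpace M] [ChartedSpace (EuclideanSpace ℝ (Fin m)) M]
  [IsManifold (𝓡 m) ∞ M] [MulAction G M] {μ : M → G}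

lemma quotient_mk_eq_one_iff (g : G) :
    (QuotientGroup.mk g : G ⧸ K) = QuotientGroup.mk 1 ↔ g ∈ K := by
  rw [eq_comm, QuotientGroup.eq, inv_one, one_mul]

section

variable (hK : IsSmoothEmbedding (𝓡 k) (𝓡 n) ∞ (Subtype.val : K → G))
  (hGK : IsSubmersion (𝓡 n) (𝓡 (n - k)) ∞ (QuotientGroup.mk : G → G ⧸ K))
  (hμ : ContMDiff (𝓡 m) (𝓡 n) ∞ μ)
include hGK hμ

lemma mfderiv_quotient_comp (x : M) (b : TangentSpace (𝓡 m) x) :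
    (mfderiv (𝓡 m) (𝓡 (n - k)) (fun x : M => (QuotientGroup.mk (μ x) : G ⧸ K)) x b :
      EuclideanSpace ℝ (Fin (n - k))) = mfderiv (𝓡 n) (𝓡 (n - k)) (QuotientGroup.mk : G → G ⧸ K)
        (μ x) (mfderiv (𝓡 m) (𝓡 n) μ x b) :=
  mfderiv_comp_apply' (I := 𝓡 m) (g := (QuotientGroup.mk : G → G ⧸ K)) (f := μ) (fun _ => rfl) x _
    rfl (hGK.contMDiff.mdifferentiable (by simp) _) (hμ.mdifferentiable (by simp) x) b

/-- The cross-section is an embedded submanifold. -/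
lemma exists_chartedSpace_crossSection (he : ∀ (g : G) (x : M), μ (g • x) = g * μ x * g⁻¹)
    (hreg : IsRegularValue m (n - k) (fun x : M => (QuotientGroup.mk (μ x) : G ⧸ K))
      (QuotientGroup.mk 1)) {d : ℕ} (hd : crossSection K μ he → m = n - k + d) :
    ∃ (_ : ChartedSpace (EuclideanSpace ℝ (Fin d)) (crossSection K μ he))
      (_ : IsManifold (𝓡 d) ∞ (crossSection K μ he)),
      IsSmoothEmbedding (𝓡 d) (𝓡 m) ∞ (Subtype.val : crossSection K μ he → M) := by
  refine exists_chartedSpace_levelSet (f := fun x : M => (QuotientGroup.mk (μ x) : G ⧸ K))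
    (hGK.contMDiff.comp hμ) (QuotientGroup.mk 1) IsEmbedding.subtypeVal ?_ (fun z => ?_)
    fun z => ?_
  · ext x
    rw [mem_preimage, mem_singleton_iff, quotient_mk_eq_one_iff]
    exact ⟨fun ⟨z, hz⟩ => hz ▸ z.2, fun hx => ⟨⟨x, hx⟩, rfl⟩⟩
  · exact hreg _ ((quotient_mk_eq_one_iff _).2 z.2)
  · rw [finrank_euclideanSpace_fin, finrank_euclideanSpace_fin, finrank_euclideanSpace_fin]
    exact hd z

include hK

variable {d : ℕ} {N : Type*} [TopologicalSpace N] [ChartedSpace (EuclideanSpace ℝ (Fin d)) N]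
  [IsManifold (𝓡 d) ∞ N] {i : N → M}

/-- The tangent space of the cross-section. -/
lemma exists_mfderiv_eq_of_dlog_mem (hi : IsSmoothEmbedding (𝓡 d) (𝓡 m) ∞ i)
    (hiK : ∀ x, μ (i x) ∈ K)
    (hreg : IsRegularValue m (n - k) (fun x : M => (QuotientGroup.mk (μ x) : G ⧸ K))
      (QuotientGroup.mk 1)) (hd : m = n - k + d) (x : N) (b : TangentSpace (𝓡 m) (i x))
    (hb : dlog n m μ (i x) b ∈ lieSub n k K) :
    ∃ v : TangentSpace (𝓡 d) x, mfderiv (𝓡 d) (𝓡 m) i x v = b := by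
  let D : EuclideanSpace ℝ (Fin d) →ₗ[ℝ] EuclideanSpace ℝ (Fin m) :=
    (mfderiv (𝓡 d) (𝓡 m) i x).toLinearMap
  let T : EuclideanSpace ℝ (Fin m) →ₗ[ℝ] EuclideanSpace ℝ (Fin (n - k)) :=
    (mfderiv (𝓡 m) (𝓡 (n - k)) (fun x : M => (QuotientGroup.mk (μ x) : G ⧸ K)) (i x)).toLinearMap
  have hD : Function.Injective D := mfderiv_injective_of_isImmersionAt (hi.isImmersion.isImmersionAt x)
  have hT : Function.Surjective T := hreg _ ((quotient_mk_eq_one_iff _).2 (hiK x))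
  -- Vectors tangent to the cross-section are killed by the differential of `x ↦ μ(x) K`. By
  -- dimension they fill its kernel, which consists of the vectors with `dlog` in `𝔨`.
  have hle : LinearMap.range D ≤ LinearMap.ker T := by
    rintro _ ⟨v, rfl⟩
    have e := mfderiv_comp_apply' (I := 𝓡 d)
      (h := fun _ : N => (QuotientGroup.mk 1 : G ⧸ K))
      (g := fun x : M => (QuotientGroup.mk (μ x) : G ⧸ K)) (f := i)
      (fun x => ((quotient_mk_eq_one_iff _).2 (hiK x)).symm) x _ rfl
      ((hGK.contMDiff.comp hμ).mdifferentiable (by simp) _)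
      (hi.isImmersion.contMDiff.mdifferentiable (by simp) x) v
    rw [mfderiv_const] at e
    exact e.symm
  have h1 := LinearMap.finrank_range_of_inj hD
  have h2 := LinearMap.finrank_range_add_finrank_ker T
  rw [LinearMap.range_eq_top.2 hT, finrank_top] at h2
  rw [finrank_euclideanSpace_fin] at h1
  rw [finrank_euclideanSpace_fin, finrank_euclideanSpace_fin] at h2
  have heq := Submodule.eq_of_le_of_finrank_eq hle (by omega)
  have hb' : (b : EuclideanSpace ℝ (Fin m)) ∈ LinearMap.ker T :=
    (mfderiv_quotient_comp hGK hμ (i x) b).trans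
      ((mfderiv_quotient_eq_zero_iff hK hGK (μ (i x)) (mfderiv (𝓡 m) (𝓡 n) μ (i x) b)).2 hb)
  rw [← heq] at hb'
  exact hb'

end

end Slice

/-! ### The equivariant map from the induction -/

section InductionMap

variable {G : Type*} [Group G] {K : Subgroup G} {M : Type*} [MulAction G M]
  {N : Type*} [MulAction K N] {i : N → M} (he : ∀ (c : K) (x : N), i (c • x) = (c : G) • i x)

/-- The map `[g, x] ↦ g • i x`. -/
def inductionMap : Induction K N → M :=
  Quotient.lift (fun p : G × N => p.1 • i p.2) (by
    rintro a _ ⟨c, rfl⟩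
    simp [he, smul_smul])

lemma inductionMap_mk (p : G × N) : inductionMap he (Induction.mk K p) = p.1 • i p.2 := rfl

lemma inductionMap_smul (g : G) (y : Induction K N) :
    inductionMap he (g • y) = g • inductionMap he y := by
  obtain ⟨p, rfl⟩ := Induction.mk_surjective y
  exact mul_smul g p.1 (i p.2)

variable {n : ℕ} [TopologicalSpace G] [ChartedSpace (EuclideanSpace ℝ (Fin n)) G]
  [LieGroup (𝓡 n) ∞ G]
  {k : ℕ} [ChartedSpace (EuclideanSpace ℝ (Fin k)) K] [LieGroup (𝓡 k) ∞ K]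
  {B : LinearMap.BilinForm ℝ (GroupLieAlgebra (𝓡 n) G)}
  {m : ℕ} [TopologicalSpace M] [ChartedSpace (EuclideanSpace ℝ (Fin m)) M]
  [IsManifold (𝓡 m) ∞ M] {μ : M → G}
  {d : ℕ} [TopologicalSpace N] [ChartedSpace (EuclideanSpace ℝ (Fin d)) N] [IsManifold (𝓡 d) ∞ N]
  [T2Space G] [ConnectedSpace G] [LieAlgebra.IsSemisimple ℝ (GroupLieAlgebra (𝓡 n) G)]

/-- Injectivity holds because an element that conjugates a strongly stable element of `K` into `K`
lies in `K`; surjectivity because every strongly stable element is conjugate into `K`. -/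
lemma inductionMap_bijective (hB : IsNormalizedForm k K B)
    (hK : IsSmoothEmbedding (𝓡 k) (𝓡 n) ∞ (Subtype.val : K → G))
    (hmax : Maximal (fun H : Subgroup G => IsCompact (H : Set G)) K)
    (hμ : ∀ (g : G) (x : M), μ (g • x) = g * μ x * g⁻¹) (hD : ∀ x, μ x ∈ stronglyStable G)
    (hi : Function.Injective i) (hr : ∀ x, x ∈ range i ↔ μ x ∈ K) :
    Function.Bijective (inductionMap he) := by
  refine ⟨fun y y' h => ?_, fun y => ?_⟩
  · obtain ⟨⟨g, x⟩, rfl⟩ := Induction.mk_surjective y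
    obtain ⟨⟨g', x'⟩, rfl⟩ := Induction.mk_surjective y'
    have h1 : g • i x = g' • i x' := h
    have h2 : (g'⁻¹ * g) • i x = i x' := by rw [mul_smul, h1, inv_smul_smul]
    have h3 : g'⁻¹ * g ∈ K := by
      refine hB.mem_of_conj_mem hK hmax (hD (i x)) ((hr _).1 ⟨x, rfl⟩) ?_
      rw [← hμ, h2]
      exact (hr _).1 ⟨x', rfl⟩
    have h4 : (⟨g'⁻¹ * g, h3⟩ : K) • x = x' := hi ((he _ _).trans h2)
    rw [← h4, ← Induction.mk_mul]
    simp
  · obtain ⟨h, hh⟩ := hB.exists_conj_mem hK hmax (hD y)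
    obtain ⟨x, hx⟩ := (hr (h⁻¹ • y)).2 (by rw [hμ, inv_inv]; exact hh)
    refine ⟨Induction.mk K (h, x), ?_⟩
    rw [inductionMap_mk]
    change h • i x = y
    rw [hx, smul_inv_smul]

variable {d' : ℕ} [ChartedSpace (EuclideanSpace ℝ (Fin d')) (Induction K N)]
  [IsManifold (𝓡 d') ∞ (Induction K N)]
  (hs : ∀ p : G × N, ∃ s : Induction K N → G × N,
        ContMDiffAt (𝓡 d') ((𝓡 n).prod (𝓡 d)) ∞ s (Induction.mk K p) ∧
        s (Induction.mk K p) = p ∧ ∀ᶠ y in 𝓝 (Induction.mk K p), Induction.mk K (s y) = y)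
include hs

lemma contMDiff_inductionMap
    (hσ : ContMDiff ((𝓡 n).prod (𝓡 m)) (𝓡 m) ∞ (fun p : G × M => p.1 • p.2))
    (hi : ContMDiff (𝓡 d) (𝓡 m) ∞ i) : ContMDiff (𝓡 d') (𝓡 m) ∞ (inductionMap he) :=
  Induction.contMDiff_of_comp_mk hs
    (hσ.comp (contMDiff_fst.prodMk (hi.comp contMDiff_snd)))

variable (hq : ContMDiff ((𝓡 n).prod (𝓡 d)) (𝓡 d') ∞ (Induction.mk K : G × N → Induction K N))
  (hσ : ContMDiff ((𝓡 n).prod (𝓡 m)) (𝓡 m) ∞ (fun p : G × M => p.1 • p.2))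
  (hi : ContMDiff (𝓡 d) (𝓡 m) ∞ i)
include hq hσ hi

lemma mfderiv_inductionMap_incl (x : N) (v : TangentSpace (𝓡 d) x)
    (ξ : GroupLieAlgebra (𝓡 n) G) :
    (mfderiv (𝓡 d') (𝓡 m) (inductionMap he) (Induction.incl K x)
      (mfderiv (𝓡 d) (𝓡 d') (Induction.incl K) x v + generator ξ (Induction.incl K x)) :
        EuclideanSpace ℝ (Fin m)) =
      (mfderiv (𝓡 d) (𝓡 m) i x v + generator ξ (i x) : TangentSpace (𝓡 m) (i x)) := by
  have hΦ : MDifferentiable (𝓡 d') (𝓡 m) (inductionMap he) :=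
    (contMDiff_inductionMap he hs hσ hi).mdifferentiable (by simp)
  have h0 : ∀ x, i x = inductionMap he (Induction.incl K x) := fun x => (one_smul G (i x)).symm
  have e1 := mfderiv_comp_apply' (I := 𝓡 d) (h := i) (g := inductionMap he)
    (f := Induction.incl K) h0 x _ rfl (hΦ _)
    ((Induction.contMDiff_incl hq).mdifferentiable (by simp) x) v
  have e2 := mfderiv_comp_apply' (I := 𝓡 n) (h := fun g : G => g • i x) (g := inductionMap he)
    (f := fun g : G => g • Induction.incl K x)
    (fun g => by rw [inductionMap_smul, ← h0]) 1 (Induction.incl K x) (one_smul G _) (hΦ _)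
    (mdifferentiable_smul_right (Induction.contMDiff_smul hq hs) _ 1) ξ
  have key : ∀ (T : EuclideanSpace ℝ (Fin d') →L[ℝ] EuclideanSpace ℝ (Fin m))
    (a b : EuclideanSpace ℝ (Fin d')) (a' b' : EuclideanSpace ℝ (Fin m)), a' = T a → b' = T b →
      T (a + b) = a' + b' := by
    rintro T a b _ _ rfl rfl
    exact map_add T a b
  exact key (mfderiv (𝓡 d') (𝓡 m) (inductionMap he) (Induction.incl K x)) _ _ _ _ e1 e2

/-- By equivariance the points `[1, x]` suffice. -/
lemma mfderiv_inductionMap_surjective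
    (hsplit : ∀ (x : N) (b : TangentSpace (𝓡 m) (i x)), ∃ (ξ : GroupLieAlgebra (𝓡 n) G)
      (v : TangentSpace (𝓡 d) x), mfderiv (𝓡 d) (𝓡 m) i x v + generator ξ (i x) = b)
    (y : Induction K N) :
    Function.Surjective (mfderiv (𝓡 d') (𝓡 m) (inductionMap he) y) := by
  have hΦ : MDifferentiable (𝓡 d') (𝓡 m) (inductionMap he) :=
    (contMDiff_inductionMap he hs hσ hi).mdifferentiable (by simp)
  have hσI := Induction.contMDiff_smul hq hs
  obtain ⟨g, x, rfl⟩ := Induction.exists_eq_smul_incl y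
  intro b
  have h0 : g • inductionMap he (Induction.incl K x) = inductionMap he (g • Induction.incl K x) :=
    (inductionMap_smul he g _).symm
  have h1 : inductionMap he (Induction.incl K x) = i x := one_smul G (i x)
  obtain ⟨c, hc⟩ := mfderiv_smul_surjective hσ g (inductionMap he (Induction.incl K x))
    (show EuclideanSpace ℝ (Fin m) from b)
  obtain ⟨ξ, v, hv⟩ := hsplit x (show EuclideanSpace ℝ (Fin m) from c)
  have e1 := mfderiv_inductionMap_incl he hs hq hσ hi x v ξ
  have e2 := mfderiv_comp_apply' (I := 𝓡 d') (h := fun y => g • inductionMap he y)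
    (g := inductionMap he) (f := fun y => g • y) (fun y => (inductionMap_smul he g y).symm)
    (Induction.incl K x) _ rfl (hΦ _) (mdifferentiable_smul_left hσI g _)
    (mfderiv (𝓡 d) (𝓡 d') (Induction.incl K) x v + generator ξ (Induction.incl K x))
  have e3 := mfderiv_comp_apply' (I := 𝓡 d') (h := fun y => g • inductionMap he y)
    (g := fun y : M => g • y) (f := inductionMap he) (fun y => rfl)
    (Induction.incl K x) _ rfl (mdifferentiable_smul_left hσ g _) (hΦ _)
    (mfderiv (𝓡 d) (𝓡 d') (Induction.incl K) x v + generator ξ (Induction.incl K x))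
  refine ⟨_, e2.symm.trans (e3.trans ?_)⟩
  refine Eq.trans ?_ hc
  exact congrArg (mfderiv (𝓡 m) (𝓡 m) (fun y : M => g • y) (inductionMap he (Induction.incl K x)))
    (e1.trans hv)

/-- The restriction of an invariant form induces that form. -/
lemma isInducedForm_pullback (hB : IsNormalizedForm k K B)
    (hK : IsSmoothEmbedding (𝓡 k) (𝓡 n) ∞ (Subtype.val : K → G))
    {ωM : DiffForm m M 2} (hM : IsQHamiltonian B m ωM μ) {μN : N → K}
    (hμN : ContMDiff (𝓡 d) (𝓡 k) ∞ μN) (hμi : ∀ x, μ (i x) = μN x) :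
    IsInducedForm K k B d (pullback d m i ωM) μN d' (pullback d' m (inductionMap he) ωM) := by
  have hΦ : MDifferentiable (𝓡 d') (𝓡 m) (inductionMap he) :=
    (contMDiff_inductionMap he hs hσ hi).mdifferentiable (by simp)
  have hμd : MDifferentiable (𝓡 m) (𝓡 n) μ := hM.smooth_moment.mdifferentiable (by simp)
  have hdl := dlog_restrict hK hμd (hμN.mdifferentiable (by simp))
    (hi.mdifferentiable (by simp)) hμi
  refine ⟨fun g => pullback_invariant (inductionMap_smul he g) hΦ
    (mdifferentiable_smul_left (Induction.contMDiff_smul hq hs) g)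
    (mdifferentiable_smul_left hM.contMDiff_smul g) (hM.invariant g), fun x v w ξ hξ ζ hζ => ?_⟩
  rw [pullback_apply₂]
  refine (form_congr_point ωM (one_smul G (i x) : inductionMap he (Induction.incl K x) = i x)
    _).trans ?_
  have e0 : ωM (i x) ![mfderiv (𝓡 d) (𝓡 m) i x v + generator ξ (i x),
      mfderiv (𝓡 d) (𝓡 m) i x w + generator ζ (i x)] =
      pullback d m i ωM x ![v, w] + (1 / 2) * (B (Ad n (μN x : G) ξ) ζ - B ξ (Ad n (μN x : G) ζ)) := by
    -- On vectors tangent to `N` the logarithmic derivative of `μ` is in `𝔨`, so the contraction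
    -- axiom makes them orthogonal to generators from `𝔭`.
    have hcross : ∀ (v : TangentSpace (𝓡 d) x) (ζ : GroupLieAlgebra (𝓡 n) G),
        ζ ∈ lieOrth k K B → ωM (i x) ![generator ζ (i x), mfderiv (𝓡 d) (𝓡 m) i x v] = 0 :=
      fun v ζ hζ => by
        rw [hM.contraction, hdl, hμi, IsNormalizedForm.Ad_lieIncl hK, ← map_add,
          hB.apply_kp (lieIncl_mem _) hζ, mul_zero]
    -- The contraction axiom fixes the form on two generators as `(1/2) ⟨Ad⁻¹ ζ - Ad ζ, ξ⟩`, which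
    -- invariance turns into the prescribed expression.
    have hgen : ωM (i x) ![generator ξ (i x), generator ζ (i x)] =
        (1 / 2) * (B (Ad n (μN x : G) ξ) ζ - B ξ (Ad n (μN x : G) ζ)) := by
      have e1 : B (Ad n (μN x : G)⁻¹ ζ) ξ = B (Ad n (μN x : G) ξ) ζ := by
        rw [← hB.ad_invariant (μN x : G), Ad_apply_Ad_inv, hB.symm]
      rw [hM.contraction, dlog_generator hM.contMDiff_smul hμd hM.equivariant, hμi, map_sub,
        Ad_apply_Ad_inv, sub_add_sub_cancel, map_sub, LinearMap.sub_apply, e1, hB.symm ξ]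
    rw [alt_add_left, alt_add_right, alt_add_right, alt_swap _ (mfderiv (𝓡 d) (𝓡 m) i x v)
      (generator ζ (i x)), hcross v ζ hζ, hcross w ξ hξ, hgen, pullback_apply₂]
    ring
  refine Eq.trans ?_ e0
  refine congrArg (show EuclideanSpace ℝ (Fin m) [⋀^Fin 2]→L[ℝ] ℝ from ωM (i x)) ?_
  funext j; fin_cases j
  · exact mfderiv_inductionMap_incl he hs hq hσ hi x v ξ
  · exact mfderiv_inductionMap_incl he hs hq hσ hi x w ζ

end InductionMap

open Manifold

/-! ### Reconstruction of a q-Hamiltonian manifold from its cross-section -/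

section

variable {n : ℕ} {G : Type*} [TopologicalSpace G] [T2Space G]
  [ChartedSpace (EuclideanSpace ℝ (Fin n)) G] [Group G] [LieGroup (𝓡 n) ∞ G]
  [ConnectedSpace G] [LieAlgebra.IsSemisimple ℝ (GroupLieAlgebra (𝓡 n) G)]
  {K : Subgroup G} (hmax : Maximal (fun H : Subgroup G => IsCompact (H : Set G)) K)
  {k : ℕ} [ChartedSpace (EuclideanSpace ℝ (Fin k)) K] [LieGroup (𝓡 k) ∞ K]
  (hK : IsSmoothEmbedding (𝓡 k) (𝓡 n) ∞ (Subtype.val : K → G))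
  [ChartedSpace (EuclideanSpace ℝ (Fin (n - k))) (G ⧸ K)] [IsManifold (𝓡 (n - k)) ∞ (G ⧸ K)]
  (hGK : IsSubmersion (𝓡 n) (𝓡 (n - k)) ∞ (QuotientGroup.mk : G → G ⧸ K))
  {B : LinearMap.BilinForm ℝ (GroupLieAlgebra (𝓡 n) G)} (hB : IsNormalizedForm k K B)

include hmax hK hGK hB

/-- A q-Hamiltonian manifold over the strongly stable elements is induced from its
cross-section. -/
theorem exists_induction_diffeomorph_crossSection {m : ℕ} {M : Type*} [TopologicalSpace M]
    [ChartedSpace (EuclideanSpace ℝ (Fin m)) M] [IsManifold (𝓡 m) ∞ M] [MulAction G M]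
    (ωM : DiffForm m M 2) (μ : M → G) (hM : IsQHamiltonian B m ωM μ)
    (hD : ∀ x, μ x ∈ stronglyStable G)
    (hreg : IsRegularValue m (n - k) (fun x : M => (QuotientGroup.mk (μ x) : G ⧸ K))
      (QuotientGroup.mk 1)) :
    ∃ (_ : ChartedSpace (EuclideanSpace ℝ (Fin (m - (n - k))))
            (crossSection K μ hM.equivariant))
      (_ : IsManifold (𝓡 (m - (n - k))) ∞ (crossSection K μ hM.equivariant)),
      Manifold.IsSmoothEmbedding (𝓡 (m - (n - k))) (𝓡 m) ∞
        (Subtype.val : crossSection K μ hM.equivariant → M) ∧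
      IsQHamiltonian (restrictForm k K B) (m - (n - k))
        (pullback (m - (n - k)) m (Subtype.val : crossSection K μ hM.equivariant → M) ωM)
        (crossMoment K μ hM.equivariant) ∧
      ∃ (_ : ChartedSpace (EuclideanSpace ℝ (Fin (m - (n - k) + (n - k))))
              (Induction K (crossSection K μ hM.equivariant)))
        (_ : IsManifold (𝓡 (m - (n - k) + (n - k))) ∞
              (Induction K (crossSection K μ hM.equivariant))),
        Manifold.IsSubmersion ((𝓡 n).prod (𝓡 (m - (n - k)))) (𝓡 (m - (n - k) + (n - k))) ∞
          (Induction.mk K : G × crossSection K μ hM.equivariant → _) ∧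
        ∃ Φ : Diffeomorph (𝓡 (m - (n - k) + (n - k))) (𝓡 m)
            (Induction K (crossSection K μ hM.equivariant)) M ∞,
          (∀ (g : G) (x : crossSection K μ hM.equivariant),
            Φ (Induction.mk K (g, x)) = g • (x : M)) ∧
          (∀ (g : G) (y : Induction K (crossSection K μ hM.equivariant)),
            Φ (g • y) = g • Φ y) ∧
          IsInducedForm K k B (m - (n - k))
            (pullback (m - (n - k)) m (Subtype.val : crossSection K μ hM.equivariant → M) ωM)
            (crossMoment K μ hM.equivariant) (m - (n - k) + (n - k))
            (pullback (m - (n - k) + (n - k)) m Φ ωM) ∧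
          ∃ hN : ∀ (c : K) (x : crossSection K μ hM.equivariant),
              crossMoment K μ hM.equivariant (c • x) =
                c * crossMoment K μ hM.equivariant x * c⁻¹,
            ∀ y, μ (Φ y) = inducedMoment K (crossMoment K μ hM.equivariant) hN y := by
  have hkn := le_dim hK
  -- A regular value that is attained forces `n - k ≤ m`, so the truncated subtraction is exact.
  -- Strong stability moves every point of `M` to one over `K`, which extends this to all points.
  have hdim : ∀ x : M, μ x ∈ K → m = n - k + (m - (n - k)) := fun x hx => by
    let T : EuclideanSpace ℝ (Fin m) →ₗ[ℝ] EuclideanSpace ℝ (Fin (n - k)) :=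
      (mfderiv (𝓡 m) (𝓡 (n - k)) (fun x : M => (QuotientGroup.mk (μ x) : G ⧸ K)) x).toLinearMap
    have h1 := LinearMap.finrank_le_finrank_of_surjective (f := T) (hreg x ((quotient_mk_eq_one_iff _).2 hx))
    rw [finrank_euclideanSpace_fin, finrank_euclideanSpace_fin] at h1
    omega
  have hdimM : ∀ y : M, m = n - k + (m - (n - k)) := fun y => by
    obtain ⟨h, hh⟩ := hB.exists_conj_mem hK hmax (hD y)
    exact hdim (h⁻¹ • y) (by rw [hM.equivariant, inv_inv]; exact hh)
  have hμd : MDifferentiable (𝓡 m) (𝓡 n) μ := hM.smooth_moment.mdifferentiable (by simp)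
  obtain ⟨cs, man, hi⟩ := exists_chartedSpace_crossSection hGK hM.smooth_moment hM.equivariant hreg
    (d := m - (n - k)) fun z => hdim z.1 z.2
  have hic : ContMDiff (𝓡 (m - (n - k))) (𝓡 m) ∞
    (Subtype.val : crossSection K μ hM.equivariant → M) := hi.isImmersion.contMDiff
  have he : ∀ (c : K) (x : crossSection K μ hM.equivariant), ((c • x : _) : M) = (c : G) • (x : M) :=
    fun c x => rfl
  have hσN : ContMDiff ((𝓡 k).prod (𝓡 (m - (n - k)))) (𝓡 (m - (n - k))) ∞
      (fun p : K × crossSection K μ hM.equivariant => p.1 • p.2) := by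
    refine contMDiff_of_comp_isSmoothEmbedding hi ?_
    exact hM.contMDiff_smul.comp (((IsNormalizedForm.contMDiff_subtype hK).comp
      contMDiff_fst).prodMk (hic.comp contMDiff_snd))
  have hμN : ContMDiff (𝓡 (m - (n - k))) (𝓡 k) ∞ (crossMoment K μ hM.equivariant) :=
    contMDiff_of_comp_isSmoothEmbedding hK (hM.smooth_moment.comp hic)
  have hN : ∀ (c : K) (x : crossSection K μ hM.equivariant),
      crossMoment K μ hM.equivariant (c • x) = c * crossMoment K μ hM.equivariant x * c⁻¹ :=
    fun c x => Subtype.ext (hM.equivariant (c : G) x.1)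
  have htan := fun x : crossSection K μ hM.equivariant => exists_mfderiv_eq_of_dlog_mem hK hGK
    hM.smooth_moment hi (fun x => x.2) hreg (hdim x.1 x.2) x
  have hsplit : ∀ (x : crossSection K μ hM.equivariant) (b : TangentSpace (𝓡 m) (x : M)),
      ∃ (ξ : GroupLieAlgebra (𝓡 n) G) (v : TangentSpace (𝓡 (m - (n - k))) x),
        mfderiv (𝓡 (m - (n - k))) (𝓡 m) Subtype.val x v + generator ξ (x : M) = b := fun x b => by
    obtain ⟨ζ, hζ, hb⟩ := exists_dlog_sub_generator_mem hB hK hM.contMDiff_smul hμd hM.equivariant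
        (hD x) x.2 b
    obtain ⟨v, hv⟩ := htan x _ hb
    exact ⟨ζ, v, by rw [hv, sub_add_cancel]⟩
  refine ⟨cs, man, hi, ?_, ?_⟩
  · exact isQHamiltonian_restrict hB hK hM hD hσN hic he
      (fun x => mfderiv_injective_of_isImmersionAt (hi.isImmersion.isImmersionAt x)) htan hμN
      (fun _ => rfl) hN
  · obtain ⟨csI, manI, hq, hs⟩ := Induction.exists_chartedSpace (N := crossSection K μ hM.equivariant)
      hK hGK hσN (d' := m - (n - k) + (n - k)) rfl
    have hbij : Function.Bijective (inductionMap he) :=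
      inductionMap_bijective he hB hK hmax hM.equivariant hD Subtype.val_injective
        (fun x => ⟨fun ⟨z, hz⟩ => hz ▸ z.2, fun hx => ⟨⟨x, hx⟩, rfl⟩⟩)
    have hΦ := contMDiff_inductionMap he hs hM.contMDiff_smul hic
    -- A surjective differential between spaces of equal dimension is bijective; a bijective local
    -- diffeomorphism is then a diffeomorphism.
    have hloc : IsLocalDiffeomorph (𝓡 (m - (n - k) + (n - k))) (𝓡 m) ∞ (inductionMap he) :=
      fun y => by
      refine isLocalDiffeomorphAt_of_bijective hΦ ?_
      have hsur := mfderiv_inductionMap_surjective he hs hq hM.contMDiff_smul hic hsplit y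
      have hfin : Module.finrank ℝ (EuclideanSpace ℝ (Fin (m - (n - k) + (n - k)))) =
          Module.finrank ℝ (EuclideanSpace ℝ (Fin m)) := by
        rw [finrank_euclideanSpace_fin, finrank_euclideanSpace_fin]
        have := hdimM (inductionMap he y)
        omega
      let T : EuclideanSpace ℝ (Fin (m - (n - k) + (n - k))) →ₗ[ℝ] EuclideanSpace ℝ (Fin m) :=
        (mfderiv (𝓡 (m - (n - k) + (n - k))) (𝓡 m) (inductionMap he) y).toLinearMap
      exact ⟨(LinearMap.injective_iff_surjective_of_finrank_eq_finrank (f := T) hfin).2 hsur, hsur⟩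
    refine ⟨csI, manI, Induction.isSubmersion_mk hq hs (k := k) (by omega),
      hloc.diffeomorphOfBijective hbij, fun g x => rfl, inductionMap_smul he,
      isInducedForm_pullback he hs hq hM.contMDiff_smul hic hB hK hM hμN (fun _ => rfl),
      hN, fun y => ?_⟩
    obtain ⟨⟨g, x⟩, rfl⟩ := Induction.mk_surjective y
    exact hM.equivariant g x

end

open Manifold

/-! ### Existence of the induced form -/

section Wedge

variable {V : Type*} [NormedAddCommGroup V] [NormedSpace ℝ V]

/-- The alternating form `b(u, v) - b(v, u)`. -/
def antisymmetrization (b : V →L[ℝ] V →L[ℝ] ℝ) : V [⋀^Fin 2]→L[ℝ] ℝ :=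
  ContinuousAlternatingMap.alternatizeUncurryFin
    (((ContinuousAlternatingMap.ofSubsingletonLIE (𝕜 := ℝ) (E := V) (F := ℝ)
      (0 : Fin 1)).toContinuousLinearEquiv.toContinuousLinearMap) ∘L b)

lemma antisymmetrization_apply (b : V →L[ℝ] V →L[ℝ] ℝ) (u v : V) :
    antisymmetrization b ![u, v] = b u v - b v u := by
  rw [antisymmetrization, ContinuousAlternatingMap.alternatizeUncurryFin_apply, Fin.sum_univ_two]
  have e0 : (0 : Fin 2).removeNth ![u, v] = ![v] := by funext i; fin_cases i; rfl
  have e1 : (1 : Fin 2).removeNth ![u, v] = ![u] := by funext i; fin_cases i; rfl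
  rw [e0, e1]
  change (-1 : ℤ) ^ 0 • b u v + (-1 : ℤ) ^ 1 • b v u = _
  simp [sub_eq_add_neg]

end Wedge

section Generator

variable {n : ℕ} {G : Type*} [TopologicalSpace G] [ChartedSpace (EuclideanSpace ℝ (Fin n)) G]
  [Group G] [LieGroup (𝓡 n) ∞ G]
  {m : ℕ} {M : Type*} [TopologicalSpace M] [ChartedSpace (EuclideanSpace ℝ (Fin m)) M] [IsManifold (𝓡 m) ∞ M]
  [MulAction G M]

lemma invariant_apply {α : DiffForm m M 2} (h : ∀ g : G, pullback m m (fun x : M => g • x) α = α)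
    (g : G) (x : M) (u v : TangentSpace (𝓡 m) x) :
    α (g • x) ![mfderiv (𝓡 m) (𝓡 m) (fun y : M => g • y) x u,
      mfderiv (𝓡 m) (𝓡 m) (fun y : M => g • y) x v] = α x ![u, v] := by
  rw [← pullback_apply₂ (fun y : M => g • y) α x u v, h]

end Generator

namespace Induction

variable {n : ℕ} {G : Type*} [TopologicalSpace G] [ChartedSpace (EuclideanSpace ℝ (Fin n)) G]
  [Group G] [LieGroup (𝓡 n) ∞ G]
  {k : ℕ} {K : Subgroup G} [ChartedSpace (EuclideanSpace ℝ (Fin k)) K] [LieGroup (𝓡 k) ∞ K]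
  {B : LinearMap.BilinForm ℝ (GroupLieAlgebra (𝓡 n) G)}
  {d : ℕ} {N : Type*} [TopologicalSpace N] [ChartedSpace (EuclideanSpace ℝ (Fin d)) N]
  [IsManifold (𝓡 d) ∞ N] [MulAction K N]
  {d' : ℕ} [ChartedSpace (EuclideanSpace ℝ (Fin d')) (Induction K N)]
  [IsManifold (𝓡 d') ∞ (Induction K N)]
  (hB : IsNormalizedForm k K B)
  (hK : IsSmoothEmbedding (𝓡 k) (𝓡 n) ∞ (Subtype.val : K → G))
  {ωN : DiffForm d N 2} {μ : N → K}
  (hq : ContMDiff ((𝓡 n).prod (𝓡 d)) (𝓡 d') ∞ (Induction.mk K : G × N → Induction K N))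
  (hs : ∀ p : G × N, ∃ s : Induction K N → G × N,
        ContMDiffAt (𝓡 d') ((𝓡 n).prod (𝓡 d)) ∞ s (Induction.mk K p) ∧
        s (Induction.mk K p) = p ∧ ∀ᶠ y in 𝓝 (Induction.mk K p), Induction.mk K (s y) = y)

variable (n d d' K) in
/-- The tangent vector `d(incl) v + X_ξ` at `[1, x]`. -/
def tangentE (x : N) (v : EuclideanSpace ℝ (Fin d)) (ξ : EuclideanSpace ℝ (Fin n)) :
    EuclideanSpace ℝ (Fin d') :=
  (show TangentSpace (𝓡 d') (incl K x) from
    mfderiv (𝓡 d) (𝓡 d') (incl K) x v + generator (G := G) ξ (incl K x))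

section

include hq hs

lemma mfderiv_smul_tangentE
    (hσN : ContMDiff ((𝓡 k).prod (𝓡 d)) (𝓡 d) ∞ (fun p : K × N => p.1 • p.2))
    (c : K) (x : N) (v : EuclideanSpace ℝ (Fin d)) (ξ : EuclideanSpace ℝ (Fin n)) :
    (mfderiv (𝓡 d') (𝓡 d') (fun y : Induction K N => (c : G) • y) (incl K x)
      (tangentE n K d d' x v ξ) : EuclideanSpace ℝ (Fin d')) =
      tangentE n K d d' (c • x) (mfderiv (𝓡 d) (𝓡 d) (fun y : N => c • y) x v) (AdE n (c : G) ξ) := by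
  have hσ := contMDiff_smul hq hs
  have hincl : MDifferentiable (𝓡 d) (𝓡 d') (incl K : N → Induction K N) :=
    (contMDiff_incl hq).mdifferentiable (by simp)
  have e1 := mfderiv_comp_apply' (I := 𝓡 d) (h := fun z : N => incl K (c • z)) (g := incl K)
    (f := fun y : N => c • y) (fun z => rfl) x _ rfl (hincl _) (mdifferentiable_smul_left hσN c x) v
  have e2 := mfderiv_comp_apply' (I := 𝓡 d) (h := fun z : N => incl K (c • z))
    (g := fun y : Induction K N => (c : G) • y) (f := incl K) (fun z => mk_one_smul c z) x _ rfl
    (mdifferentiable_smul_left hσ (c : G) _) (hincl x) v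
  have e3 := mfderiv_smul_generator hσ (c : G) ξ (incl K x)
  have e4 : genE n d' G (AdE n (c : G) ξ) ((c : G) • incl K x) =
    genE n d' G (AdE n (c : G) ξ) (incl K (c • x)) := congrArg _ (mk_one_smul c x).symm
  have key : ∀ (T : EuclideanSpace ℝ (Fin d') →L[ℝ] EuclideanSpace ℝ (Fin d'))
      (a b a' b' b'' a'' : EuclideanSpace ℝ (Fin d')), a'' = a' → a'' = T a → T b = b' → b' = b'' →
      T (a + b) = a' + b'' := by
    rintro T a b _ _ _ _ rfl rfl rfl rfl
    exact map_add T a b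
  exact key (mfderiv (𝓡 d') (𝓡 d') (fun y : Induction K N => (c : G) • y) (incl K x)) _ _ _ _ _ _
    e1 e2 e3 e4

include hB hK

/-- In the decomposition `T_x N ⊕ 𝔭` the two components depend linearly on the vector; the induced
form is written with these projections. -/
lemma exists_split
    (hσN : ContMDiff ((𝓡 k).prod (𝓡 d)) (𝓡 d) ∞ (fun p : K × N => p.1 • p.2))
    (hd : n + d = d' + k) (x : N) :
    ∃ (P : EuclideanSpace ℝ (Fin d') →L[ℝ] EuclideanSpace ℝ (Fin d))
      (Z : EuclideanSpace ℝ (Fin d') →L[ℝ] EuclideanSpace ℝ (Fin n)),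
      ∀ (v : EuclideanSpace ℝ (Fin d)) (ζ : GroupLieAlgebra (𝓡 n) G), ζ ∈ lieOrth k K B →
        P (tangentE n K d d' x v ζ) = v ∧ Z (tangentE n K d d' x v ζ) = ζ := by
  let D : EuclideanSpace ℝ (Fin d) →ₗ[ℝ] EuclideanSpace ℝ (Fin d') :=
    (mfderiv (𝓡 d) (𝓡 d') (incl K) x).toLinearMap
  let X : GroupLieAlgebra (𝓡 n) G →ₗ[ℝ] EuclideanSpace ℝ (Fin d') :=
    (mfderiv (𝓡 n) (𝓡 d') (fun g : G => g • incl K x) 1 :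
      GroupLieAlgebra (𝓡 n) G →L[ℝ] TangentSpace (𝓡 d') ((1 : G) • incl K x)).toLinearMap
  let T : (EuclideanSpace ℝ (Fin d) × lieOrth k K B) →ₗ[ℝ] EuclideanSpace ℝ (Fin d') :=
    D.coprod (X.comp (lieOrth k K B).subtype)
  have hT : Function.Bijective T := by
    refine ⟨?_, fun w => ?_⟩
    · rw [injective_iff_map_eq_zero]
      rintro ⟨v, ζ, hζ⟩ h
      obtain ⟨h1, h2⟩ := eq_zero_of_decomposition hB hK hσN hq hs hd x hζ (v := v) h
      exact Prod.ext h2 (Subtype.ext h1)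
    · obtain ⟨ζ, hζ, v, hv⟩ := exists_decomposition hB hK hσN hq hs x w
      exact ⟨(v, ⟨ζ, hζ⟩), hv⟩
  let S := (LinearEquiv.ofBijective T hT).symm
  have hS : ∀ v ζ (hζ : ζ ∈ lieOrth k K B), S (tangentE n K d d' x v ζ) = (v, ⟨ζ, hζ⟩) :=
    fun v ζ hζ => (LinearEquiv.symm_apply_eq _).2 rfl
  let Z : EuclideanSpace ℝ (Fin d') →ₗ[ℝ] EuclideanSpace ℝ (Fin n) :=
    (lieOrth k K B).subtype ∘ₗ LinearMap.snd ℝ _ _ ∘ₗ S.toLinearMap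
  refine ⟨LinearMap.toContinuousLinearMap (LinearMap.fst ℝ _ _ ∘ₗ S.toLinearMap),
    LinearMap.toContinuousLinearMap Z, fun v ζ hζ => ⟨?_, ?_⟩⟩
  · exact congrArg Prod.fst (hS v ζ hζ)
  · exact congrArg (fun p => ((p.2 : lieOrth k K B) : GroupLieAlgebra (𝓡 n) G)) (hS v ζ hζ)

/-- Existence of the induced form. -/
theorem exists_isInducedForm (hN : IsQHamiltonian (restrictForm k K B) d ωN μ)
    (hd : n + d = d' + k) :
    ∃ Ω : DiffForm d' (Induction K N) 2, IsInducedForm K k B d ωN μ d' Ω := by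
  have hσN := hN.contMDiff_smul
  have hσ := contMDiff_smul hq hs
  choose P Z hPZ using exists_split hB hK hq hs hσN hd
  let b : G → EuclideanSpace ℝ (Fin n) →L[ℝ] EuclideanSpace ℝ (Fin n) →L[ℝ] ℝ := fun a =>
    LinearMap.toContinuousLinearMap (LinearMap.toContinuousLinearMap.toLinearMap ∘ₗ
      (show EuclideanSpace ℝ (Fin n) →ₗ[ℝ] EuclideanSpace ℝ (Fin n) →ₗ[ℝ] ℝ from B) ∘ₗ
        (AdE n a).toLinearMap)
  have hb : ∀ a u v, b a u v = B (Ad n a u) v := fun _ _ _ => rfl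
  -- A tangent vector at `[g, x]` is translated back to `[1, x]` by `g⁻¹` and split there; `F` is
  -- the form that results from a given representative.
  let A : G → Induction K N → EuclideanSpace ℝ (Fin d') →L[ℝ] EuclideanSpace ℝ (Fin d') :=
    fun g y => mfderiv (𝓡 d') (𝓡 d') (fun y : Induction K N => g⁻¹ • y) y
  let ω₁ : ∀ x : N, EuclideanSpace ℝ (Fin d) [⋀^Fin 2]→L[ℝ] ℝ := fun x => ωN x
  let F : G × N → Induction K N → EuclideanSpace ℝ (Fin d') [⋀^Fin 2]→L[ℝ] ℝ := fun p y =>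
    (ω₁ p.2).compContinuousLinearMap (P p.2 ∘L A p.1 y) +
      (1 / 2 : ℝ) • antisymmetrization
        ((b (μ p.2)).bilinearComp (Z p.2 ∘L A p.1 y) (Z p.2 ∘L A p.1 y))
  have hF : ∀ p y w w', F p y ![w, w'] = ω₁ p.2 ![P p.2 (A p.1 y w), P p.2 (A p.1 y w')] +
      (1 / 2) * (B (Ad n (μ p.2 : G) (Z p.2 (A p.1 y w))) (Z p.2 (A p.1 y w')) -
        B (Ad n (μ p.2 : G) (Z p.2 (A p.1 y w'))) (Z p.2 (A p.1 y w))) := fun p y w w' => by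
    change ω₁ p.2 (fun j => (P p.2 ∘L A p.1 y)
      ((![w, w'] : Fin 2 → EuclideanSpace ℝ (Fin d')) j)) + (1 / 2 : ℝ) • antisymmetrization
        ((b (μ p.2)).bilinearComp (Z p.2 ∘L A p.1 y) (Z p.2 ∘L A p.1 y)) ![w, w'] = _
    rw [antisymmetrization_apply]
    have e0 : (fun j => (P p.2 ∘L A p.1 y) ((![w, w'] : Fin 2 → EuclideanSpace ℝ (Fin d')) j)) =
        ![P p.2 (A p.1 y w), P p.2 (A p.1 y w')] := by
      funext j; fin_cases j <;> rfl
    rw [e0]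
    rfl
  let out : Induction K N → G × N := Function.surjInv mk_surjective
  have hout : ∀ y, Induction.mk K (out y) = y := Function.surjInv_eq mk_surjective
  let Ω : DiffForm d' (Induction K N) 2 := fun y => F (out y) y
  let L : G → N → EuclideanSpace ℝ (Fin d') →L[ℝ] EuclideanSpace ℝ (Fin d') := fun g x =>
    mfderiv (𝓡 d') (𝓡 d') (fun y : Induction K N => g • y) (incl K x)
  -- the value of the form does not depend on the representative
  have hΩ : ∀ (g : G) (x : N) (v v' : EuclideanSpace ℝ (Fin d)) (ζ ζ' : GroupLieAlgebra (𝓡 n) G),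
      ζ ∈ lieOrth k K B → ζ' ∈ lieOrth k K B →
      (show EuclideanSpace ℝ (Fin d') [⋀^Fin 2]→L[ℝ] ℝ from Ω (g • incl K x))
        ![L g x (tangentE n K d d' x v ζ), L g x (tangentE n K d d' x v' ζ')] =
      ω₁ x ![v, v'] + (1 / 2) * (B (Ad n (μ x : G) ζ) ζ' - B (Ad n (μ x : G) ζ') ζ) := by
    intro g x v v' ζ ζ' hζ hζ'
    -- The chosen representative is `(g c⁻¹, c • x)` for some `c ∈ K`. The discrepancy `c` has no
    -- effect, by invariance of `ωN` and `B` and equivariance of `μ`.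
    obtain ⟨c, hc⟩ := mk_eq_mk_iff.1 ((mk_eq_smul_incl (g, x)).trans (hout (g • incl K x)).symm)
    have hA : ∀ (v : EuclideanSpace ℝ (Fin d)) (ζ : GroupLieAlgebra (𝓡 n) G),
        A (g * (c : G)⁻¹) (g • incl K x) (L g x (tangentE n K d d' x v ζ)) =
        tangentE n K d d' (c • x) (mfderiv (𝓡 d) (𝓡 d) (fun y : N => c • y) x v)
          (AdE n (c : G) ζ) := fun v ζ => by
      have e1 := mfderiv_comp_apply' (I := 𝓡 d') (h := fun y : Induction K N => (c : G) • y)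
        (g := fun y : Induction K N => (g * (c : G)⁻¹)⁻¹ • y) (f := fun y => g • y)
        (fun y => by rw [smul_smul]; congr 1; group) (incl K x) _ rfl
        (mdifferentiable_smul_left hσ _ _) (mdifferentiable_smul_left hσ g _)
        (tangentE n K d d' x v ζ)
      exact e1.symm.trans (mfderiv_smul_tangentE hq hs hσN c x v ζ)
    have hPc : ∀ (v : EuclideanSpace ℝ (Fin d)) (ζ : GroupLieAlgebra (𝓡 n) G),
        ζ ∈ lieOrth k K B → P (c • x) (A (g * (c : G)⁻¹) (g • incl K x)
          (L g x (tangentE n K d d' x v ζ))) = mfderiv (𝓡 d) (𝓡 d) (fun y : N => c • y) x v ∧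
        Z (c • x) (A (g * (c : G)⁻¹) (g • incl K x) (L g x (tangentE n K d d' x v ζ))) =
          AdE n (c : G) ζ := fun v ζ hζ => by
      rw [hA]
      exact hPZ (c • x) _ _ (hB.Ad_mem_lieOrth hK c.2 hζ)
    have h1 : (show EuclideanSpace ℝ (Fin d') [⋀^Fin 2]→L[ℝ] ℝ from Ω (g • incl K x)) =
        F (g * (c : G)⁻¹, c • x) (g • incl K x) := congrArg (fun p => F p (g • incl K x)) hc
    rw [h1, hF]
    have h2 : ∀ z z' : GroupLieAlgebra (𝓡 n) G,
        B (Ad n (μ (c • x) : G) (AdE n (c : G) z)) (AdE n (c : G) z') = B (Ad n (μ x : G) z) z' :=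
      fun z z' => by
      have e : (μ (c • x) : G) = c * μ x * (c : G)⁻¹ := by
        rw [hN.equivariant]; rfl
      change B (Ad n (μ (c • x) : G) (Ad n (c : G) z)) (Ad n (c : G) z') = _
      rw [← Ad_mul_apply, e, inv_mul_cancel_right, Ad_mul_apply, hB.ad_invariant]
    have h3 : ω₁ (c • x) ![mfderiv (𝓡 d) (𝓡 d) (fun y : N => c • y) x v,
        mfderiv (𝓡 d) (𝓡 d) (fun y : N => c • y) x v'] = ω₁ x ![v, v'] :=
      invariant_apply hN.invariant c x v v'
    simp only [(hPc v ζ hζ).1, (hPc v ζ hζ).2, (hPc v' ζ' hζ').1, (hPc v' ζ' hζ').2]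
    rw [h2, h2]
    exact congrArg (· + _) h3
  refine ⟨Ω, fun h => ?_, fun x v w ξ hξ ζ hζ => ?_⟩
  · funext y
    obtain ⟨g, x, rfl⟩ := exists_eq_smul_incl y
    ext u
    obtain ⟨c0, hc0⟩ := mfderiv_smul_surjective hσ g (incl K x) (u 0)
    obtain ⟨c1, hc1⟩ := mfderiv_smul_surjective hσ g (incl K x) (u 1)
    obtain ⟨ζ0, hζ0, v0, hv0⟩ := exists_decomposition hB hK hσN hq hs x c0
    obtain ⟨ζ1, hζ1, v1, hv1⟩ := exists_decomposition hB hK hσN hq hs x c1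
    have hu : u = ![u 0, u 1] := by funext j; fin_cases j <;> rfl
    rw [hu]
    refine (pullback_apply₂ (fun y : Induction K N => h • y) Ω (g • incl K x) (u 0) (u 1)).trans ?_
    have hL : ∀ w : EuclideanSpace ℝ (Fin d'), (mfderiv (𝓡 d') (𝓡 d')
        (fun y : Induction K N => h • y) (g • incl K x) (L g x w) : EuclideanSpace ℝ (Fin d')) =
        L (h * g) x w := fun w =>
      (mfderiv_comp_apply' (I := 𝓡 d') (h := fun y : Induction K N => (h * g) • y)
        (g := fun y : Induction K N => h • y) (f := fun y => g • y) (fun y => mul_smul h g y)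
        (incl K x) _ rfl (mdifferentiable_smul_left hσ _ _) (mdifferentiable_smul_left hσ g _)
        w).symm
    have e1 := hΩ (h * g) x v0 v1 ζ0 ζ1 hζ0 hζ1
    have e2 := hΩ g x v0 v1 ζ0 ζ1 hζ0 hζ1
    refine Eq.trans ?_ (e1.trans (e2.symm.trans ?_))
    · refine (form_congr_point Ω (mul_smul h g (incl K x)).symm _).trans ?_
      refine congrArg (show EuclideanSpace ℝ (Fin d') [⋀^Fin 2]→L[ℝ] ℝ from
        Ω ((h * g) • incl K x)) ?_
      funext j; fin_cases j
      · rw [← hc0, ← hv0]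
        exact hL _
      · rw [← hc1, ← hv1]
        exact hL _
    · refine congrArg (show EuclideanSpace ℝ (Fin d') [⋀^Fin 2]→L[ℝ] ℝ from
        Ω (g • incl K x)) ?_
      funext j; fin_cases j
      · exact (congrArg (L g x) hv0).trans hc0
      · exact (congrArg (L g x) hv1).trans hc1
  · have e1 := hΩ 1 x v w ξ ζ hξ hζ
    have hL : ∀ w, L 1 x w = w := fun w => by
      have e : (fun y : Induction K N => (1 : G) • y) = id := by funext y; exact one_smul G y
      change mfderiv (𝓡 d') (𝓡 d') (fun y : Induction K N => (1 : G) • y) (incl K x) w = w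
      rw [e, mfderiv_id]
      rfl
    rw [hL, hL, hB.symm (Ad n (μ x : G) ζ)] at e1
    exact (form_congr_point Ω (one_smul G (incl K x)).symm _).trans e1

end

end Induction

open Manifold

/-! ### Smoothness of the induced form -/

section Bilinear

variable {n : ℕ} {G : Type*} [TopologicalSpace G] [ChartedSpace (EuclideanSpace ℝ (Fin n)) G]
  [Group G]

/-- A bilinear form on the Lie algebra as a continuous bilinear map. -/
def bilinE (B : LinearMap.BilinForm ℝ (GroupLieAlgebra (𝓡 n) G)) :
    EuclideanSpace ℝ (Fin n) →L[ℝ] EuclideanSpace ℝ (Fin n) →L[ℝ] ℝ :=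
  LinearMap.toContinuousLinearMap (LinearMap.toContinuousLinearMap.toLinearMap ∘ₗ
    (show EuclideanSpace ℝ (Fin n) →ₗ[ℝ] EuclideanSpace ℝ (Fin n) →ₗ[ℝ] ℝ from B))

variable {k : ℕ} {K : Subgroup G} [ChartedSpace (EuclideanSpace ℝ (Fin k)) K]
  {B : LinearMap.BilinForm ℝ (GroupLieAlgebra (𝓡 n) G)}

/-- Chosen linearly, so that the `𝔨`- and `𝔭`-components of a smooth family of vectors are again
smooth. -/
lemma IsNormalizedForm.exists_linear_split [LieGroup (𝓡 n) ∞ G] (hB : IsNormalizedForm k K B) :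
    ∃ (κ : EuclideanSpace ℝ (Fin n) →L[ℝ] EuclideanSpace ℝ (Fin k))
      (ζ : EuclideanSpace ℝ (Fin n) →L[ℝ] EuclideanSpace ℝ (Fin n)),
      ∀ ξ : EuclideanSpace ℝ (Fin n), (ξ : EuclideanSpace ℝ (Fin n)) =
          (show EuclideanSpace ℝ (Fin n) from lieIncl n k K (κ ξ)) + ζ ξ ∧
        (show GroupLieAlgebra (𝓡 n) G from ζ ξ) ∈ lieOrth k K B := by
  let J : EuclideanSpace ℝ (Fin k) →ₗ[ℝ] GroupLieAlgebra (𝓡 n) G := (lieIncl n k K).toLinearMap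
  let T : (EuclideanSpace ℝ (Fin k) × lieOrth k K B) →ₗ[ℝ] GroupLieAlgebra (𝓡 n) G :=
    J.coprod (lieOrth k K B).subtype
  have hT : LinearMap.range T = ⊤ := by
    rw [LinearMap.range_eq_top]
    intro ξ
    obtain ⟨u, ⟨κ, rfl⟩, ζ, hζ, rfl⟩ := hB.exists_add ξ
    exact ⟨(κ, ⟨ζ, hζ⟩), rfl⟩
  obtain ⟨S, hS⟩ := T.exists_rightInverse_of_surjective hT
  let Z : EuclideanSpace ℝ (Fin n) →ₗ[ℝ] EuclideanSpace ℝ (Fin n) :=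
    (lieOrth k K B).subtype ∘ₗ LinearMap.snd ℝ _ _ ∘ₗ S
  let Q : EuclideanSpace ℝ (Fin n) →ₗ[ℝ] EuclideanSpace ℝ (Fin k) := LinearMap.fst ℝ _ _ ∘ₗ S
  refine ⟨LinearMap.toContinuousLinearMap Q, LinearMap.toContinuousLinearMap Z, fun ξ => ⟨?_, ?_⟩⟩
  · exact (LinearMap.congr_fun hS ξ).symm
  · exact (S ξ).2.2

end Bilinear

section Expand

variable {n : ℕ} {G : Type*} [TopologicalSpace G] [ChartedSpace (EuclideanSpace ℝ (Fin n)) G]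
  [Group G] [LieGroup (𝓡 n) ∞ G] {B : LinearMap.BilinForm ℝ (GroupLieAlgebra (𝓡 n) G)}
  {m : ℕ} {M : Type*} [TopologicalSpace M] [ChartedSpace (EuclideanSpace ℝ (Fin m)) M]
  [MulAction G M] {μ : M → G}

/-- The contraction axiom trades generators among the arguments for expressions in `μ`, whose smooth
dependence on parameters is known. -/
lemma IsQHamiltonian.apply_add_generator {ωM : DiffForm m M 2} (hM : IsQHamiltonian B m ωM μ)
    (x : M) (v v' : TangentSpace (𝓡 m) x) (ξ ξ' : GroupLieAlgebra (𝓡 n) G) :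
    ωM x ![v + generator ξ x, v' + generator ξ' x] = ωM x ![v, v'] +
      (1 / 2) * B (dlog n m μ x v' + Ad n (μ x) (dlog n m μ x v')) ξ -
      (1 / 2) * B (dlog n m μ x v + Ad n (μ x) (dlog n m μ x v)) ξ' +
      (1 / 2) * B (Ad n (μ x)⁻¹ ξ' - Ad n (μ x) ξ') ξ := by
  have e1 := hM.contraction ξ x (generator ξ' x)
  rw [dlog_generator hM.contMDiff_smul (hM.smooth_moment.mdifferentiable (by simp))
    hM.equivariant, map_sub, Ad_apply_Ad_inv] at e1
  have e2 : Ad n (μ x)⁻¹ ξ' - ξ' + (ξ' - Ad n (μ x) ξ') = Ad n (μ x)⁻¹ ξ' - Ad n (μ x) ξ' := by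
    abel
  rw [e2] at e1
  rw [alt_add_left, alt_add_right, alt_add_right, e1, hM.contraction,
    alt_swap (ωM x) v (generator ξ' x), hM.contraction]
  ring

end Expand

namespace Induction

variable {n : ℕ} {G : Type*} [TopologicalSpace G] [ChartedSpace (EuclideanSpace ℝ (Fin n)) G]
  [Group G] [LieGroup (𝓡 n) ∞ G]
  {k : ℕ} {K : Subgroup G} [ChartedSpace (EuclideanSpace ℝ (Fin k)) K] [LieGroup (𝓡 k) ∞ K]
  {B : LinearMap.BilinForm ℝ (GroupLieAlgebra (𝓡 n) G)}
  {d : ℕ} {N : Type*} [TopologicalSpace N] [ChartedSpace (EuclideanSpace ℝ (Fin d)) N]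
  [IsManifold (𝓡 d) ∞ N] [MulAction K N]
  {d' : ℕ} [ChartedSpace (EuclideanSpace ℝ (Fin d')) (Induction K N)]
  [IsManifold (𝓡 d') ∞ (Induction K N)]
  (hB : IsNormalizedForm k K B)
  (hK : IsSmoothEmbedding (𝓡 k) (𝓡 n) ∞ (Subtype.val : K → G))
  {ωN : DiffForm d N 2} {μ : N → K} {Ω : DiffForm d' (Induction K N) 2}
  (hq : ContMDiff ((𝓡 n).prod (𝓡 d)) (𝓡 d') ∞ (Induction.mk K : G × N → Induction K N))
  (hs : ∀ p : G × N, ∃ s : Induction K N → G × N,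
        ContMDiffAt (𝓡 d') ((𝓡 n).prod (𝓡 d)) ∞ s (Induction.mk K p) ∧
        s (Induction.mk K p) = p ∧ ∀ᶠ y in 𝓝 (Induction.mk K p), Induction.mk K (s y) = y)

include hK hq hs

lemma tangentE_add (hσN : ContMDiff ((𝓡 k).prod (𝓡 d)) (𝓡 d) ∞ (fun p : K × N => p.1 • p.2))
    (x : N) (v : EuclideanSpace ℝ (Fin d)) (κ : EuclideanSpace ℝ (Fin k))
    (ζ : EuclideanSpace ℝ (Fin n)) :
    tangentE n K d d' x v ((show EuclideanSpace ℝ (Fin n) from lieIncl n k K κ) + ζ) =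
      tangentE n K d d' x (v + genE k d K κ x) ζ := by
  have key : ∀ (D : EuclideanSpace ℝ (Fin d) →L[ℝ] EuclideanSpace ℝ (Fin d'))
      (v g : EuclideanSpace ℝ (Fin d)) (b c e : EuclideanSpace ℝ (Fin d')), D g = b → e = b + c →
      D v + e = D (v + g) + c := by
    rintro D v g _ c _ rfl rfl
    rw [map_add, add_assoc]
  exact key (mfderiv (𝓡 d) (𝓡 d') (incl K) x) v (genE k d K κ x) _ _ _
    (mfderiv_incl_generator hK hσN hq hs κ x)
    (generator_add (contMDiff_smul hq hs) (lieIncl n k K κ) ζ (incl K x))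

/-- The induced form on arbitrary tangent vectors. -/
lemma apply_tangentE (hN : IsQHamiltonian (restrictForm k K B) d ωN μ)
    (hΩ : IsInducedForm K k B d ωN μ d' Ω) (g : G) (x : N) (v v' : EuclideanSpace ℝ (Fin d))
    (κ κ' : EuclideanSpace ℝ (Fin k)) (ζ ζ' : EuclideanSpace ℝ (Fin n))
    (hζ : (show GroupLieAlgebra (𝓡 n) G from ζ) ∈ lieOrth k K B)
    (hζ' : (show GroupLieAlgebra (𝓡 n) G from ζ') ∈ lieOrth k K B) :
    Ω (g • incl K x)
      ![mfderiv (𝓡 d') (𝓡 d') (fun y : Induction K N => g • y) (incl K x)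
          (tangentE n K d d' x v ((show EuclideanSpace ℝ (Fin n) from lieIncl n k K κ) + ζ)),
        mfderiv (𝓡 d') (𝓡 d') (fun y : Induction K N => g • y) (incl K x)
          (tangentE n K d d' x v' ((show EuclideanSpace ℝ (Fin n) from lieIncl n k K κ') + ζ'))] =
      ωN x ![v + genE k d K κ x, v' + genE k d K κ' x] +
        (1 / 2) * (B (Ad n (μ x : G) ζ) ζ' - B ζ (Ad n (μ x : G) ζ')) := by
  refine (invariant_apply hΩ.invariant g (incl K x) _ _).trans ?_
  rw [tangentE_add hK hq hs hN.contMDiff_smul, tangentE_add hK hq hs hN.contMDiff_smul]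
  exact hΩ.apply_eq x _ _ ζ hζ ζ' hζ'

include hB

/-- The induced form is smooth. -/
theorem isSmoothForm (hN : IsQHamiltonian (restrictForm k K B) d ωN μ)
    (hΩ : IsInducedForm K k B d ωN μ d' Ω) : IsSmoothForm Ω := by
  refine (isSmoothForm_iff _).2 fun y₀ => ?_
  have hσ := contMDiff_smul hq hs
  have hincl : MDifferentiable (𝓡 d) (𝓡 d') (incl K : N → Induction K N) :=
    (contMDiff_incl hq).mdifferentiable (by simp)
  have hμ : MDifferentiable (𝓡 d) (𝓡 k) μ := hN.smooth_moment.mdifferentiable (by simp)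
  obtain ⟨κ, ζ, hsplit⟩ := hB.exists_linear_split
  obtain ⟨p, rfl⟩ := mk_surjective y₀
  obtain ⟨s, hs1, -, hs3⟩ := hs p
  let φ := extChartAt (𝓡 d') (Induction.mk K p)
  let t₀ := φ (Induction.mk K p)
  have hφ0 : φ.symm t₀ = Induction.mk K p := extChartAt_to_inv _
  have hφ : ContMDiffAt (𝓡 d') (𝓡 d') ∞ φ.symm t₀ :=
    (contMDiffOn_extChartAt_symm (Induction.mk K p)).contMDiffAt
      ((isOpen_extChartAt_target _).mem_nhds (mem_extChartAt_target _))
  have hφc : Tendsto φ.symm (𝓝 t₀) (𝓝 (Induction.mk K p)) := by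
    have := hφ.continuousAt
    rwa [ContinuousAt, hφ0] at this
  let c' : Induction K N → N := fun y => (s y).2
  let A : EuclideanSpace ℝ (Fin d') → G := fun t => (s (φ.symm t)).1
  let c : EuclideanSpace ℝ (Fin d') → N := fun t => c' (φ.symm t)
  have hc' : ContMDiffAt (𝓡 d') (𝓡 d) ∞ c' (Induction.mk K p) :=
    ContMDiffAt.comp _ (g := Prod.snd) contMDiffAt_snd hs1
  have hc'0 : ContMDiffAt (𝓡 d') (𝓡 d) ∞ c' (φ.symm t₀) := by rw [hφ0]; exact hc'
  have hA' : ContMDiffAt (𝓡 d') (𝓡 n) ∞ (fun y => (s y).1) (φ.symm t₀) := by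
    rw [hφ0]
    exact ContMDiffAt.comp _ (g := Prod.fst) contMDiffAt_fst hs1
  have hA : ContMDiffAt 𝓘(ℝ, EuclideanSpace ℝ (Fin d')) (𝓡 n) ∞ A t₀ :=
    ContMDiffAt.comp t₀ (g := fun y => (s y).1) hA' hφ
  have hc : ContMDiffAt (𝓡 d') (𝓡 d) ∞ c t₀ := ContMDiffAt.comp t₀ (g := c') hc'0 hφ
  have hm : ContMDiffAt 𝓘(ℝ, EuclideanSpace ℝ (Fin d')) (𝓡 k) ∞ (fun t => μ (c t)) t₀ :=
    ContMDiffAt.comp t₀ (g := μ) hN.smooth_moment.contMDiffAt hc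
  have hmG : ContMDiffAt 𝓘(ℝ, EuclideanSpace ℝ (Fin d')) (𝓡 n) ∞ (fun t => (μ (c t) : G)) t₀ :=
    ContMDiffAt.comp t₀ (g := (Subtype.val : K → G))
      (IsNormalizedForm.contMDiff_subtype hK).contMDiffAt hm
  have hα : SmoothFormAt (pullback d' d c' ωN) (Induction.mk K p) :=
    SmoothFormAt.pullback ((isSmoothForm_iff _).1 hN.smooth_form _) hc'
  let L := logD n A
  let δ := logD k (fun t => μ (c t))
  have hL : ContDiffAt ℝ ∞ L t₀ := contDiffAt_logD hA
  have hδ : ContDiffAt ℝ ∞ δ t₀ := contDiffAt_logD hm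
  have hAdm : ContDiffAt ℝ ∞ (fun t => AdE k (μ (c t))) t₀ := contDiffAt_AdE hm
  have hAdi : ContDiffAt ℝ ∞ (fun t => AdE k (μ (c t))⁻¹) t₀ := contDiffAt_AdE hm.inv
  have hAdG : ContDiffAt ℝ ∞ (fun t => AdE n (μ (c t) : G)) t₀ := contDiffAt_AdE hmG
  let bK := bilinE (restrictForm k K B)
  let bG := bilinE B
  refine contDiffAt_alternating fun u => ?_
  -- A local section writes the point with coordinate `t` as `A(t) • [1, c(t)]`. The Leibniz rule
  -- then gives the tangent vectors, `κ` and `ζ` split `A^* θ^L`, and invariance moves the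
  -- evaluation to `[1, c(t)]`; `F` is the resulting coefficient.
  let F : EuclideanSpace ℝ (Fin d') → ℝ := fun t =>
    (chartForm (pullback d' d c' ωN) (Induction.mk K p) t u +
      (1 / 2) * bK (δ t (u 1) + AdE k (μ (c t)) (δ t (u 1))) (κ (L t (u 0))) -
      (1 / 2) * bK (δ t (u 0) + AdE k (μ (c t)) (δ t (u 0))) (κ (L t (u 1))) +
      (1 / 2) * bK (AdE k (μ (c t))⁻¹ (κ (L t (u 1))) - AdE k (μ (c t)) (κ (L t (u 1))))
        (κ (L t (u 0)))) +
      (1 / 2) * (bG (AdE n (μ (c t) : G) (ζ (L t (u 0)))) (ζ (L t (u 1))) -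
        bG (ζ (L t (u 0))) (AdE n (μ (c t) : G) (ζ (L t (u 1)))))
  have hF : ContDiffAt ℝ ∞ F t₀ := by
    have h1 : ∀ w, ContDiffAt ℝ ∞ (fun t => κ (L t w)) t₀ := fun w =>
      contDiffAt_const.clm_apply (hL.clm_apply contDiffAt_const)
    have h2 : ∀ w, ContDiffAt ℝ ∞ (fun t => ζ (L t w)) t₀ := fun w =>
      contDiffAt_const.clm_apply (hL.clm_apply contDiffAt_const)
    have h3 : ∀ w, ContDiffAt ℝ ∞ (fun t => δ t w + AdE k (μ (c t)) (δ t w)) t₀ := fun w =>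
      (hδ.clm_apply contDiffAt_const).add (hAdm.clm_apply (hδ.clm_apply contDiffAt_const))
    have h4 : ∀ {f g : EuclideanSpace ℝ (Fin d') → EuclideanSpace ℝ (Fin k)},
        ContDiffAt ℝ ∞ f t₀ → ContDiffAt ℝ ∞ g t₀ → ContDiffAt ℝ ∞ (fun t => bK (f t) (g t)) t₀ :=
      fun hf hg => (contDiffAt_const.clm_apply hf).clm_apply hg
    have h5 : ∀ {f g : EuclideanSpace ℝ (Fin d') → EuclideanSpace ℝ (Fin n)},
        ContDiffAt ℝ ∞ f t₀ → ContDiffAt ℝ ∞ g t₀ → ContDiffAt ℝ ∞ (fun t => bG (f t) (g t)) t₀ :=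
      fun hf hg => (contDiffAt_const.clm_apply hf).clm_apply hg
    have h6 : ContDiffAt ℝ ∞ (fun t => chartForm (pullback d' d c' ωN) (Induction.mk K p) t u) t₀ :=
      contDiffAt_alternating_apply (c := fun i _ => u i) hα (fun _ => contDiffAt_const)
    exact (((h6.add (contDiffAt_const.mul (h4 (h3 _) (h1 _)))).sub
      (contDiffAt_const.mul (h4 (h3 _) (h1 _)))).add (contDiffAt_const.mul
        (h4 ((hAdi.clm_apply (h1 _)).sub (hAdm.clm_apply (h1 _))) (h1 _)))).add
      (contDiffAt_const.mul ((h5 (hAdG.clm_apply (h2 _)) (h2 _)).sub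
        (h5 (h2 _) (hAdG.clm_apply (h2 _)))))
  refine hF.congr_of_eventuallyEq ?_
  filter_upwards [eventually_mdifferentiableAt hA, eventually_mdifferentiableAt hc,
    hφc.eventually (eventually_mdifferentiableAt hc'), eventually_mdifferentiableAt hφ,
    (hφc.eventually hs3).eventually_nhds] with t htA htc htc' htφ hts
  have hloc : φ.symm =ᶠ[𝓝 t] fun t => A t • incl K (c t) := by
    filter_upwards [hts] with r hr
    exact hr.symm.trans (mk_eq_smul_incl _)
  have hpt : φ.symm t = A t • incl K (c t) := hloc.self_of_nhds
  let dc : EuclideanSpace ℝ (Fin d') → EuclideanSpace ℝ (Fin d) := fun w =>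
    mfderiv (𝓡 d') (𝓡 d) c t w
  have hd : ∀ w : EuclideanSpace ℝ (Fin d'), (mfderiv (𝓡 d') (𝓡 d') φ.symm t w :
      EuclideanSpace ℝ (Fin d')) =
      mfderiv (𝓡 d') (𝓡 d') (fun y : Induction K N => A t • y) (incl K (c t))
        (tangentE n K d d' (c t) (dc w)
          ((show EuclideanSpace ℝ (Fin n) from lieIncl n k K (κ (L t w))) + ζ (L t w))) := by
    intro w
    have e0 : MDifferentiableAt (𝓡 d') (𝓡 d') (fun t => incl K (c t)) t :=
      MDifferentiableAt.comp t (g := incl K) (hincl _) htc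
    have e1 := mfderiv_smul_apply hσ htA e0 w
    have e2 := mfderiv_comp_apply' (I := 𝓡 d') (h := fun t => incl K (c t)) (g := incl K) (f := c)
      (fun _ => rfl) t _ rfl (hincl _) htc w
    rw [← (hsplit (L t w)).1]
    have key : ∀ (T : EuclideanSpace ℝ (Fin d') →L[ℝ] EuclideanSpace ℝ (Fin d'))
        (a b b' w : EuclideanSpace ℝ (Fin d')), b = b' → w = T (a + b) → w = T (b' + a) := by
      rintro T a b _ _ rfl rfl
      rw [add_comm]
    refine (congrArg (fun T : EuclideanSpace ℝ (Fin d') →L[ℝ] EuclideanSpace ℝ (Fin d') => T w)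
      hloc.mfderiv_eq).trans ?_
    exact key (mfderiv (𝓡 d') (𝓡 d') (fun y : Induction K N => A t • y) (incl K (c t))) _ _ _ _
      e2 e1
  have hδt : ∀ w : EuclideanSpace ℝ (Fin d'),
      (dlog k d μ (c t) (dc w) : EuclideanSpace ℝ (Fin k)) = δ t w := fun w =>
    (congrArg (thetaL (n := k) (μ (c t))) (mfderiv_comp_apply' (I := 𝓡 d')
      (h := fun t => μ (c t)) (g := μ) (f := c) (fun _ => rfl) t _ rfl (hμ _) htc w)).symm
  have h1 := apply_tangentE hK hq hs hN hΩ (A t) (c t) (dc (u 0)) (dc (u 1)) (κ (L t (u 0)))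
    (κ (L t (u 1))) (ζ (L t (u 0))) (ζ (L t (u 1))) (hsplit _).2 (hsplit _).2
  have h2 := hN.apply_add_generator (c t) (dc (u 0)) (dc (u 1)) (κ (L t (u 0))) (κ (L t (u 1)))
  rw [hδt, hδt] at h2
  have h4 : chartForm (pullback d' d c' ωN) (Induction.mk K p) t u =
      ωN (c t) ![dc (u 0), dc (u 1)] := by
    have e1 : ∀ w : EuclideanSpace ℝ (Fin d'), (mfderiv (𝓡 d') (𝓡 d) c' (φ.symm t)
        (mfderiv (𝓡 d') (𝓡 d') φ.symm t w) : EuclideanSpace ℝ (Fin d)) = dc w := fun w =>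
      (mfderiv_comp_apply' (I := 𝓡 d') (h := c) (g := c') (f := φ.symm) (fun _ => rfl) t _ rfl
        htc' htφ w).symm
    refine congrArg (ωN (c t)) ?_
    funext j; fin_cases j
    · exact e1 (u 0)
    · exact e1 (u 1)
  refine (form_congr_point Ω hpt _).trans (Eq.trans ?_ (h1.trans ?_))
  · refine congrArg (show EuclideanSpace ℝ (Fin d') [⋀^Fin 2]→L[ℝ] ℝ from
      Ω (A t • incl K (c t))) ?_
    funext j; fin_cases j
    · exact hd (u 0)
    · exact hd (u 1)
  refine congrArg (· + _) (h2.trans ?_)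
  rw [← h4]
  rfl

end Induction

open Manifold

/-! ### The exterior derivative on triples that contain a generator -/

section Calculus

lemma fderiv_clm_comp_apply {V E F : Type*} [NormedAddCommGroup V] [NormedSpace ℝ V]
    [NormedAddCommGroup E] [NormedSpace ℝ E] [NormedAddCommGroup F] [NormedSpace ℝ F]
    (ℓ : E →L[ℝ] F) {D : V → V →L[ℝ] E} {t : V} (hD : DifferentiableAt ℝ D t) (u w : V) :
    fderiv ℝ (fun r => ℓ (D r w)) t u = ℓ (fderiv ℝ D t u w) := by
  have h := ℓ.hasFDerivAt.comp t (hD.hasFDerivAt.clm_apply (hasFDerivAt_const w t))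
  have h1 : fderiv ℝ (fun r => ℓ (D r w)) t = _ := h.fderiv
  rw [h1]
  simp

/-- An alternating trilinear map is determined by its values with first argument in `X` and by its
values on `D`, if `D + X` is everything. -/
lemma eq_zero_of_alternating {E : Type*} [AddCommGroup E] {T : E → E → E → ℝ} {D X : Set E}
    (hadd : ∀ a b v w, T (a + b) v w = T a v w + T b v w)
    (h12 : ∀ u v w, T u v w = -T v u w) (h23 : ∀ u v w, T u v w = -T u w v)
    (hX : ∀ x ∈ X, ∀ v w, T x v w = 0) (hD : ∀ a ∈ D, ∀ b ∈ D, ∀ c ∈ D, T a b c = 0)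
    (hDX : ∀ u, ∃ a ∈ D, ∃ x ∈ X, a + x = u) (u v w : E) : T u v w = 0 := by
  have hadd2 : ∀ u a b w, T u (a + b) w = T u a w + T u b w := fun u a b w => by
    rw [h12, hadd, h12 a, h12 b]; ring
  have hadd3 : ∀ u v a b, T u v (a + b) = T u v a + T u v b := fun u v a b => by
    rw [h23, hadd2, h23 u a, h23 u b]; ring
  have hX2 : ∀ u, ∀ x ∈ X, ∀ w, T u x w = 0 := fun u x hx w => by rw [h12, hX x hx, neg_zero]
  have hX3 : ∀ u v, ∀ x ∈ X, T u v x = 0 := fun u v x hx => by rw [h23, hX2 u x hx, neg_zero]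
  obtain ⟨a, ha, x, hx, rfl⟩ := hDX u
  obtain ⟨b, hb, y, hy, rfl⟩ := hDX v
  obtain ⟨c, hc, z, hz, rfl⟩ := hDX w
  rw [hadd, hX x hx, hadd2, hX2 _ y hy, hadd3, hX3 _ _ z hz, hD a ha b hb c hc]
  simp

lemma alt_three {V : Type*} [AddCommGroup V] [Module ℝ V] [TopologicalSpace V]
    (α : V [⋀^Fin 3]→L[ℝ] ℝ) :
    (∀ a b v w, α ![a + b, v, w] = α ![a, v, w] + α ![b, v, w]) ∧
    (∀ u v w, α ![u, v, w] = -α ![v, u, w]) ∧ ∀ u v w, α ![u, v, w] = -α ![u, w, v] := by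
  refine ⟨fun a b v w => α.vecCons_add (n := 2) ![v, w] a b, fun u v w => ?_, fun u v w => ?_⟩
  · have h := α.map_swap ![v, u, w] (i := 0) (j := 1) (by decide)
    have e : (![v, u, w] ∘ Equiv.swap (0 : Fin 3) 1 : Fin 3 → V) = ![u, v, w] := by
      funext i; fin_cases i <;> rfl
    rwa [e] at h
  · have h := α.map_swap ![u, w, v] (i := 1) (j := 2) (by decide)
    have e : (![u, w, v] ∘ Equiv.swap (1 : Fin 3) 2 : Fin 3 → V) = ![u, v, w] := by
      funext i; fin_cases i <;> rfl
    rwa [e] at h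

end Calculus

section Contraction

variable {n : ℕ} {G : Type*} [TopologicalSpace G] [T2Space G]
  [ChartedSpace (EuclideanSpace ℝ (Fin n)) G] [Group G] [LieGroup (𝓡 n) ∞ G]
  {k : ℕ} {K : Subgroup G} [ChartedSpace (EuclideanSpace ℝ (Fin k)) K]
  {B : LinearMap.BilinForm ℝ (GroupLieAlgebra (𝓡 n) G)} (hB : IsNormalizedForm k K B)
  {m : ℕ} {M : Type*} [TopologicalSpace M] [ChartedSpace (EuclideanSpace ℝ (Fin m)) M]
  [IsManifold (𝓡 m) ∞ M] [MulAction G M] {Ω : DiffForm m M 2} {μ : M → G}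
  (hσ : ContMDiff ((𝓡 n).prod (𝓡 m)) (𝓡 m) ∞ (fun p : G × M => p.1 • p.2))
  (hΩ : IsSmoothForm Ω) (hinv : ∀ g : G, pullback m m (fun x : M => g • x) Ω = Ω)
  (hμ : ContMDiff (𝓡 m) (𝓡 n) ∞ μ) (he : ∀ (g : G) (x : M), μ (g • x) = g * μ x * g⁻¹)
  (hcon : ∀ (ξ : GroupLieAlgebra (𝓡 n) G) (x : M) (v : TangentSpace (𝓡 m) x),
    Ω x ![generator ξ x, v] = (1 / 2) * B (dlog n m μ x v + Ad n (μ x) (dlog n m μ x v)) ξ)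

include hB

/-- The Cartan form, pulled back along `μ`, is alternating and additive. -/
lemma apply_lie_alternating (x y z : GroupLieAlgebra (𝓡 n) G) :
    B x ⁅y, z⁆ = -B y ⁅x, z⁆ ∧ B x ⁅y, z⁆ = -B x ⁅z, y⁆ := by
  constructor
  · have h1 := hB.apply_lie x y z
    have h2 := hB.apply_lie y x z
    have h3 : B ⁅x, y⁆ z = -B ⁅y, x⁆ z := by
      rw [← lie_skew x y, map_neg, LinearMap.neg_apply]
    linarith
  · rw [← lie_skew, map_neg]

include hσ hΩ hinv hμ he hcon

/-- The equation `dΩ = - μ^* η` on triples that contain a generator. -/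
theorem extDerivForm_generator_eq (ξ : GroupLieAlgebra (𝓡 n) G) (x : M)
    (b c : TangentSpace (𝓡 m) x) :
    extDerivForm Ω x ![generator ξ x, b, c] =
      -(1 / 2 * B (dlog n m μ x (generator ξ x)) ⁅dlog n m μ x b, dlog n m μ x c⁆) := by
  let φ := extChartAt (𝓡 m) x
  let t₀ : EuclideanSpace ℝ (Fin m) := φ x
  have hφ0 : φ.symm t₀ = x := extChartAt_to_inv x
  have hφ : ContMDiffAt (𝓡 m) (𝓡 m) ∞ φ.symm t₀ :=
    (contMDiffOn_extChartAt_symm x).contMDiffAt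
      ((isOpen_extChartAt_target _).mem_nhds (mem_extChartAt_target _))
  let A : EuclideanSpace ℝ (Fin m) → G := fun t => μ (φ.symm t)
  have hA : ContMDiffAt 𝓘(ℝ, EuclideanSpace ℝ (Fin m)) (𝓡 n) ∞ A t₀ :=
    ContMDiffAt.comp t₀ (g := μ) hμ.contMDiffAt hφ
  let δ := logD n A
  let δ' := logD n (fun t => (A t)⁻¹)
  have hδ : DifferentiableAt ℝ δ t₀ := (contDiffAt_logD hA).differentiableAt (by simp)
  have hδ' : DifferentiableAt ℝ δ' t₀ := (contDiffAt_logD hA.inv).differentiableAt (by simp)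
  have hμd : MDifferentiable (𝓡 m) (𝓡 n) μ := hμ.mdifferentiable (by simp)
  let ℓ : EuclideanSpace ℝ (Fin n) →L[ℝ] ℝ := (1 / 2 : ℝ) • (bilinE B).flip ξ
  have hℓ : ∀ z : GroupLieAlgebra (𝓡 n) G, ℓ z = (1 / 2) * B z ξ := fun _ => rfl
  -- `δ' = -Ad (A) δ` is the logarithmic derivative of `A⁻¹`, so the contraction `(1/2) ⟨δ + Ad (A)
  -- δ, ξ⟩` becomes `(1/2) ⟨δ - δ', ξ⟩`, to which the Maurer–Cartan equations for `A` and `A⁻¹`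
  -- apply.
  let β : EuclideanSpace ℝ (Fin m) → EuclideanSpace ℝ (Fin m) → ℝ := fun t w =>
    ℓ ((δ t - δ' t) w)
  have hβ : ∀ᶠ t in 𝓝 (extChartAt (𝓡 m) x x), ∀ w : EuclideanSpace ℝ (Fin m),
      Ω ((extChartAt (𝓡 m) x).symm t) ![generator ξ ((extChartAt (𝓡 m) x).symm t),
        mfderiv (𝓡 m) (𝓡 m) (extChartAt (𝓡 m) x).symm t w] = β t w := by
    filter_upwards [eventually_mdifferentiableAt hA, eventually_mdifferentiableAt hφ]
      with t htA htφ w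
    have e1 : (dlog n m μ (φ.symm t) (mfderiv (𝓡 m) (𝓡 m) φ.symm t w) :
        EuclideanSpace ℝ (Fin n)) = δ t w :=
      (congrArg (thetaL (n := n) (μ (φ.symm t))) (mfderiv_comp_apply' (I := 𝓡 m)
        (h := A) (g := μ) (f := φ.symm) (fun _ => rfl) t _ rfl (hμd _) htφ w)).symm
    have e2 : δ' t w = -AdE n (A t) (δ t w) := logD_inv htA w
    have e3 := hcon ξ (φ.symm t) (mfderiv (𝓡 m) (𝓡 m) φ.symm t w)
    rw [e1] at e3
    refine e3.trans ?_
    change _ = ℓ (δ t w - δ' t w)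
    rw [e2, sub_neg_eq_add]
    rfl
  have hδ0 : ∀ w : TangentSpace (𝓡 m) x, δ t₀ (mfderiv (𝓡 m) (𝓡 m) φ x w) = dlog n m μ x w := by
    intro w
    have h1 := mfderiv_extChartAt_symm_comp (mem_extChartAt_source (I := 𝓡 m) x) w
    have h2 : ∀ x' : M, x' = x → ∀ w : EuclideanSpace ℝ (Fin m),
      (dlog n m μ x' w : EuclideanSpace ℝ (Fin n)) = dlog n m μ x w := by rintro _ rfl w; rfl
    have e1 := (congrArg (thetaL (n := n) (μ (φ.symm t₀))) (mfderiv_comp_apply' (I := 𝓡 m)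
        (h := A) (g := μ) (f := φ.symm) (fun _ => rfl) t₀ _ rfl (hμd _)
        (hφ.mdifferentiableAt (by simp)) (mfderiv (𝓡 m) (𝓡 m) φ x w)))
    refine e1.trans ?_
    refine Eq.trans ?_ (h2 _ hφ0 w)
    exact congrArg (dlog n m μ (φ.symm t₀)) h1
  rw [extDerivForm_generator hσ hΩ hinv ξ x hβ b c]
  have hfd : ∀ u w : EuclideanSpace ℝ (Fin m), fderiv ℝ (fun t => β t w) t₀ u =
      ℓ (fderiv ℝ δ t₀ u w - fderiv ℝ δ' t₀ u w) := fun u w => by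
    refine (fderiv_clm_comp_apply ℓ (hδ.sub hδ') u w).trans ?_
    rw [fderiv_sub hδ hδ']
    rfl
  set b' : EuclideanSpace ℝ (Fin m) := mfderiv (𝓡 m) (𝓡 m) φ x b with hb'
  set c' : EuclideanSpace ℝ (Fin m) := mfderiv (𝓡 m) (𝓡 m) φ x c with hc'
  change -(fderiv ℝ (fun t => β t c') t₀ b' - fderiv ℝ (fun t => β t b') t₀ c') = _
  rw [hfd, hfd, ← map_sub]
  have m1 := maurerCartan hA b' c'
  have m2 := maurerCartan hA.inv b' c'
  have i1 : ∀ w, logD n (fun t => (A t)⁻¹) t₀ w = -AdE n (A t₀) (δ t₀ w) := fun w =>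
    logD_inv (hA.mdifferentiableAt (by simp)) w
  change fderiv ℝ δ' t₀ b' c' - fderiv ℝ δ' t₀ c' b' = -lieBr G (logD n (fun t => (A t)⁻¹) t₀ b')
    (logD n (fun t => (A t)⁻¹) t₀ c') at m2
  rw [i1, i1, lieBr_neg_left, lieBr_neg_right, neg_neg, ← AdE_lieBr] at m2
  -- The two equations combine to `(Ad μ - 1) [δ b, δ c]`; invariance moves the operator to `ξ`,
  -- where `Ad μ⁻¹ ξ - ξ` is `dlog` of the generator.
  have e1 : fderiv ℝ δ t₀ b' c' - fderiv ℝ δ' t₀ b' c' -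
      (fderiv ℝ δ t₀ c' b' - fderiv ℝ δ' t₀ c' b') =
      AdE n (A t₀) (lieBr G (δ t₀ b') (δ t₀ c')) - lieBr G (δ t₀ b') (δ t₀ c') := by
    have : fderiv ℝ δ t₀ b' c' - fderiv ℝ δ' t₀ b' c' -
      (fderiv ℝ δ t₀ c' b' - fderiv ℝ δ' t₀ c' b') =
      (fderiv ℝ δ t₀ b' c' - fderiv ℝ δ t₀ c' b') -
        (fderiv ℝ δ' t₀ b' c' - fderiv ℝ δ' t₀ c' b') := by abel
    rw [this, m1, m2]
    abel
  rw [e1]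
  have hb0 : δ t₀ b' = dlog n m μ x b := hδ0 b
  have hc0 : δ t₀ c' = dlog n m μ x c := hδ0 c
  have hA0 : A t₀ = μ x := congrArg μ hφ0
  rw [hA0, hb0, hc0, dlog_generator hσ hμd he]
  change -ℓ (Ad n (μ x) ⁅dlog n m μ x b, dlog n m μ x c⁆ - ⁅dlog n m μ x b, dlog n m μ x c⁆) = _
  refine (congrArg Neg.neg (hℓ _)).trans ?_
  rw [hB.symm _ ξ]
  have h5 : ∀ z : GroupLieAlgebra (𝓡 n) G,
      B ξ (Ad n (μ x) z - z) = B (Ad n (μ x)⁻¹ ξ - ξ) z := fun z => by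
    rw [map_sub, map_sub, LinearMap.sub_apply, ← hB.ad_invariant (μ x) (Ad n (μ x)⁻¹ ξ),
      Ad_apply_Ad_inv]
  rw [h5]

end Contraction

open Manifold

/-! ### The induction is q-Hamiltonian -/

namespace Induction

variable {n : ℕ} {G : Type*} [TopologicalSpace G] [T2Space G]
  [ChartedSpace (EuclideanSpace ℝ (Fin n)) G] [Group G] [LieGroup (𝓡 n) ∞ G]
  {k : ℕ} {K : Subgroup G} [ChartedSpace (EuclideanSpace ℝ (Fin k)) K] [LieGroup (𝓡 k) ∞ K]
  {B : LinearMap.BilinForm ℝ (GroupLieAlgebra (𝓡 n) G)}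
  {d : ℕ} {N : Type*} [TopologicalSpace N] [ChartedSpace (EuclideanSpace ℝ (Fin d)) N]
  [IsManifold (𝓡 d) ∞ N] [MulAction K N]
  {d' : ℕ} [ChartedSpace (EuclideanSpace ℝ (Fin d')) (Induction K N)]
  [IsManifold (𝓡 d') ∞ (Induction K N)]
  (hB : IsNormalizedForm k K B)
  (hK : IsSmoothEmbedding (𝓡 k) (𝓡 n) ∞ (Subtype.val : K → G))
  {ωN : DiffForm d N 2} {μ : N → K} {Ω : DiffForm d' (Induction K N) 2}
  (hq : ContMDiff ((𝓡 n).prod (𝓡 d)) (𝓡 d') ∞ (Induction.mk K : G × N → Induction K N))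
  (hs : ∀ p : G × N, ∃ s : Induction K N → G × N,
        ContMDiffAt (𝓡 d') ((𝓡 n).prod (𝓡 d)) ∞ s (Induction.mk K p) ∧
        s (Induction.mk K p) = p ∧ ∀ᶠ y in 𝓝 (Induction.mk K p), Induction.mk K (s y) = y)
  (hN : IsQHamiltonian (restrictForm k K B) d ωN μ)
  (hΩ : IsInducedForm K k B d ωN μ d' Ω)

section Moment

variable (hμe : ∀ (c : K) (x : N), μ (c • x) = c * μ x * c⁻¹)

omit [T2Space G] in
lemma inducedMoment_smul (g : G) (y : Induction K N) :
    inducedMoment K μ hμe (g • y) = g * inducedMoment K μ hμe y * g⁻¹ := by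
  obtain ⟨p, rfl⟩ := mk_surjective y
  change g * p.1 * (μ p.2 : G) * (g * p.1)⁻¹ = g * (p.1 * (μ p.2 : G) * p.1⁻¹) * g⁻¹
  group

omit [T2Space G] in
lemma inducedMoment_incl (x : N) : inducedMoment K μ hμe (incl K x) = μ x := by
  change (1 : G) * (μ x : G) * 1⁻¹ = μ x
  simp

include hK hs in
omit [T2Space G] in
lemma contMDiff_inducedMoment (hμ : ContMDiff (𝓡 d) (𝓡 k) ∞ μ) :
    ContMDiff (𝓡 d') (𝓡 n) ∞ (inducedMoment K μ hμe) := by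
  refine contMDiff_of_comp_mk hs ?_
  have h1 : ContMDiff ((𝓡 n).prod (𝓡 d)) (𝓡 n) ∞ (fun p : G × N => (μ p.2 : G)) :=
    (IsNormalizedForm.contMDiff_subtype hK).comp (hμ.comp contMDiff_snd)
  exact (contMDiff_fst.mul h1).mul contMDiff_fst.inv

end Moment

-- The defining formula with `ξ = ζ = 0`.
include hΩ in
omit [T2Space G] [LieGroup (𝓡 k) ∞ K] [IsManifold (𝓡 d') ∞ (Induction K N)] in
lemma pullback_incl : pullback d d' (incl K) Ω = ωN := by
  funext z
  ext r
  have hr : r = ![r 0, r 1] := by funext j; fin_cases j <;> rfl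
  rw [hr, pullback_apply₂]
  have e3 := hΩ.apply_eq z (r 0) (r 1) 0 (zero_mem _) 0 (zero_mem _)
  have e4 : generator (n := n) (m := d') (0 : GroupLieAlgebra (𝓡 n) G) (incl K z) = 0 :=
    map_zero (mfderiv (𝓡 n) (𝓡 d') (fun g : G => g • incl K z) 1)
  rw [map_zero, map_zero, LinearMap.zero_apply, sub_zero, mul_zero, add_zero] at e3
  rw [e4, add_zero, add_zero] at e3
  exact e3

include hB hK hq hs hN hΩ

lemma mfderiv_incl_add_generator (x : N) (v : TangentSpace (𝓡 d) x)
    (κ : GroupLieAlgebra (𝓡 k) K) (ζ : GroupLieAlgebra (𝓡 n) G) :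
    mfderiv (𝓡 d) (𝓡 d') (incl K) x v + generator (lieIncl n k K κ + ζ) (incl K x) =
      mfderiv (𝓡 d) (𝓡 d') (incl K) x (v + generator κ x) + generator ζ (incl K x) :=
  tangentE_add hK hq hs hN.contMDiff_smul x v κ ζ

lemma dlog_incl_add_generator (x : N) (v : TangentSpace (𝓡 d) x) (ζ : GroupLieAlgebra (𝓡 n) G) :
    dlog n d' (inducedMoment K μ hN.equivariant) (incl K x)
      (mfderiv (𝓡 d) (𝓡 d') (incl K) x v + generator ζ (incl K x)) =
    lieIncl n k K (dlog k d μ x v) + (Ad n (μ x : G)⁻¹ ζ - ζ) := by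
  have hσ := contMDiff_smul hq hs
  have hM : MDifferentiable (𝓡 d') (𝓡 n) (inducedMoment K μ hN.equivariant) :=
    (contMDiff_inducedMoment hK hs hN.equivariant hN.smooth_moment).mdifferentiable (by simp)
  rw [map_add, dlog_generator hσ hM (inducedMoment_smul hN.equivariant),
    inducedMoment_incl hN.equivariant,
    dlog_restrict hK hM (hN.smooth_moment.mdifferentiable (by simp))
      ((contMDiff_incl hq).mdifferentiable (by simp)) (inducedMoment_incl hN.equivariant)]

/-- After splitting `ξ` and the tangent vector, the `𝔨`-part is the contraction axiom of `N`, the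
`𝔭`-part is the defining formula, and the mixed terms vanish by orthogonality. -/
lemma contraction_incl (ξ : GroupLieAlgebra (𝓡 n) G) (x : N)
    (w : TangentSpace (𝓡 d') (incl K x)) :
    Ω (incl K x) ![generator ξ (incl K x), w] =
      (1 / 2) * B (dlog n d' (inducedMoment K μ hN.equivariant) (incl K x) w +
        Ad n (μ x : G) (dlog n d' (inducedMoment K μ hN.equivariant) (incl K x) w)) ξ := by
  obtain ⟨u, ⟨κ, rfl⟩, ζ', hζ', rfl⟩ := hB.exists_add ξ
  obtain ⟨ζ, hζ, v, rfl⟩ := exists_decomposition hB hK hN.contMDiff_smul hq hs x w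
  have e1 := mfderiv_incl_add_generator hB hK hq hs hN hΩ x 0 κ ζ'
  rw [map_zero, zero_add, zero_add] at e1
  have e2 := hΩ.apply_eq x (generator κ x) v ζ' hζ' ζ hζ
  have e3 : Ω (incl K x) ![generator (lieIncl n k K κ + ζ') (incl K x),
      mfderiv (𝓡 d) (𝓡 d') (incl K) x v + generator ζ (incl K x)] = _ :=
    (congrArg (fun z => Ω (incl K x) ![z,
      mfderiv (𝓡 d) (𝓡 d') (incl K) x v + generator ζ (incl K x)]) e1).trans e2
  refine e3.trans ?_
  rw [dlog_incl_add_generator hB hK hq hs hN hΩ, hN.contraction]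
  have hp : ∀ a ∈ K, ∀ ζ ∈ lieOrth k K B, Ad n a ζ ∈ lieOrth k K B := fun a ha ζ h =>
    hB.Ad_mem_lieOrth hK ha h
  have a1 := IsNormalizedForm.Ad_lieIncl hK (μ x) (dlog k d μ x v)
  have a2 : lieIncl n k K (dlog k d μ x v) + (Ad n (μ x : G)⁻¹ ζ - ζ) +
      Ad n (μ x : G) (lieIncl n k K (dlog k d μ x v) + (Ad n (μ x : G)⁻¹ ζ - ζ)) =
      lieIncl n k K (dlog k d μ x v + Ad k (μ x) (dlog k d μ x v)) +
        (Ad n (μ x : G)⁻¹ ζ - Ad n (μ x : G) ζ) := by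
    rw [map_add, map_add, map_sub, Ad_apply_Ad_inv, a1]
    abel
  have hm : Ad n (μ x : G)⁻¹ ζ - Ad n (μ x : G) ζ ∈ lieOrth k K B :=
    sub_mem (hp _ (inv_mem (μ x).2) _ hζ) (hp _ (μ x).2 _ hζ)
  have a3 : ∀ p ∈ lieSub n k K, ∀ q ∈ lieSub n k K, ∀ z ∈ lieOrth k K B,
      B (p + z) (q + ζ') = B p q + B z ζ' := fun p hp q hq z hz => by
    have h : B (p + z) = B p + B z := map_add B p z
    rw [h, map_add, LinearMap.add_apply, LinearMap.add_apply, hB.apply_kp hp hζ',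
      hB.apply_pk hz hq]
    ring
  have a4 := a3 _ (lieIncl_mem (n := n) (dlog k d μ x v + Ad k (μ x) (dlog k d μ x v))) _
    (lieIncl_mem κ) _ hm
  rw [map_sub B, LinearMap.sub_apply, ← hB.ad_invariant (μ x : G) (Ad n (μ x : G)⁻¹ ζ) ζ',
    Ad_apply_Ad_inv, hB.symm ζ, hB.symm (Ad n (μ x : G) ζ)] at a4
  rw [a2]
  refine Eq.trans ?_ (congrArg (1 / 2 * ·) a4).symm
  rw [← mul_add]
  rfl

/-- Invariance of both sides reduces to the points `[1, x]`. -/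
lemma contraction (ξ : GroupLieAlgebra (𝓡 n) G) (y : Induction K N)
    (w : TangentSpace (𝓡 d') y) :
    Ω y ![generator ξ y, w] =
      (1 / 2) * B (dlog n d' (inducedMoment K μ hN.equivariant) y w +
        Ad n (inducedMoment K μ hN.equivariant y)
          (dlog n d' (inducedMoment K μ hN.equivariant) y w)) ξ := by
  obtain ⟨g, x, rfl⟩ := exists_eq_smul_incl y
  have hσ := contMDiff_smul hq hs
  have hM : MDifferentiable (𝓡 d') (𝓡 n) (inducedMoment K μ hN.equivariant) :=
    (contMDiff_inducedMoment hK hs hN.equivariant hN.smooth_moment).mdifferentiable (by simp)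
  obtain ⟨w, rfl⟩ := mfderiv_smul_surjective hσ g (incl K x) w
  have e1 := mfderiv_smul_generator hσ g (Ad n g⁻¹ ξ) (incl K x)
  rw [Ad_apply_Ad_inv] at e1
  have e2 := invariant_apply hΩ.invariant g (incl K x) (generator (Ad n g⁻¹ ξ) (incl K x)) w
  have e3 := contraction_incl hB hK hq hs hN hΩ (Ad n g⁻¹ ξ) x w
  have e4 : Ω (g • incl K x) ![generator ξ (g • incl K x),
      mfderiv (𝓡 d') (𝓡 d') (fun y : Induction K N => g • y) (incl K x) w] = _ :=
    (congrArg (fun z => Ω (g • incl K x) ![z,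
      mfderiv (𝓡 d') (𝓡 d') (fun y : Induction K N => g • y) (incl K x) w]) e1.symm).trans e2
  refine e4.trans (e3.trans ?_)
  rw [dlog_smul hσ hM (inducedMoment_smul hN.equivariant), inducedMoment_smul,
    inducedMoment_incl, ← Ad_mul_apply, inv_mul_cancel_right, Ad_mul_apply, ← map_add,
    ← hB.ad_invariant g _ (Ad n g⁻¹ ξ), Ad_apply_Ad_inv]

variable [ConnectedSpace G] [LieAlgebra.IsSemisimple ℝ (GroupLieAlgebra (𝓡 n) G)]

/-- Pairing with `𝔭` alone gives `Ad ζ = Ad⁻¹ ζ`, so `Ad ζ + ζ ∈ 𝔭` is fixed by `Ad μ(x)` and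
vanishes by strong stability. Pairing with `T_x N` alone reduces the other component to the kernel
axiom of `N`. -/
lemma exists_generator_of_kernel_incl {x : N} (hx : (μ x : G) ∈ stronglyStable G)
    {w : TangentSpace (𝓡 d') (incl K x)} (hw : ∀ w', Ω (incl K x) ![w, w'] = 0) :
    ∃ ξ : GroupLieAlgebra (𝓡 n) G, Ad n (μ x : G) ξ + ξ = 0 ∧ generator ξ (incl K x) = w := by
  obtain ⟨ζ, hζ, u, rfl⟩ := exists_decomposition hB hK hN.contMDiff_smul hq hs x w
  have hp : ∀ a ∈ K, ∀ ζ ∈ lieOrth k K B, Ad n a ζ ∈ lieOrth k K B := fun a ha ζ h =>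
    hB.Ad_mem_lieOrth hK ha h
  have hT : ∀ (u' : TangentSpace (𝓡 d) x), ∀ ζ' ∈ lieOrth k K B,
      ωN x ![u, u'] + (1 / 2) * B (Ad n (μ x : G) ζ - Ad n (μ x : G)⁻¹ ζ) ζ' = 0 := by
    intro u' ζ' hζ'
    have e1 := hΩ.apply_eq x u u' ζ hζ ζ' hζ'
    rw [map_sub, LinearMap.sub_apply, ← hB.ad_invariant (μ x : G) (Ad n (μ x : G)⁻¹ ζ) ζ',
      Ad_apply_Ad_inv]
    exact e1.symm.trans (hw _)
  have h1 : Ad n (μ x : G) ζ - Ad n (μ x : G)⁻¹ ζ = 0 := by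
    have hm : Ad n (μ x : G) ζ - Ad n (μ x : G)⁻¹ ζ ∈ lieOrth k K B :=
      sub_mem (hp _ (μ x).2 _ hζ) (hp _ (inv_mem (μ x).2) _ hζ)
    -- Testing against the vector itself is enough, as `B` is definite on `𝔭`.
    by_contra h0
    have e1 := hT 0 _ hm
    have e2 : ωN x ![u, 0] = 0 := (ωN x).map_coord_zero 1 rfl
    rw [e2] at e1
    have := hB.neg _ hm h0
    linarith
  have h2 : Ad n (μ x : G) ζ + ζ = 0 := by
    refine hB.eq_zero_of_Ad_eq hK hx (add_mem (hp _ (μ x).2 _ hζ) hζ) ?_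
    rw [map_add]
    nth_rewrite 1 [sub_eq_zero.1 h1]
    rw [Ad_apply_Ad_inv, add_comm]
  obtain ⟨κ, hκ, hκu⟩ := (hN.ker_eq x u).1 fun u' => by
    have e1 := hT u' 0 (zero_mem _)
    rwa [map_zero, mul_zero, add_zero] at e1
  refine ⟨lieIncl n k K κ + ζ, ?_, ?_⟩
  · rw [map_add, IsNormalizedForm.Ad_lieIncl hK, add_add_add_comm, h2, ← map_add, hκ, map_zero,
      add_zero]
  · have e1 := mfderiv_incl_add_generator hB hK hq hs hN hΩ x 0 κ ζ
    rw [map_zero, zero_add, zero_add, hκu] at e1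
    exact e1

/-- Both sides are alternating and trilinear, and `T_x N` together with the generators spans. On
triples that contain a generator equality is Cartan's formula; on triples from `T_x N` it is the
axiom for `N`, by naturality of `d`. -/
lemma extDerivForm_incl (hsm : IsSmoothForm Ω) (x : N) (u v w : TangentSpace (𝓡 d') (incl K x)) :
    extDerivForm Ω (incl K x) ![u, v, w] =
      -(1 / 2 * B (dlog n d' (inducedMoment K μ hN.equivariant) (incl K x) u)
        ⁅dlog n d' (inducedMoment K μ hN.equivariant) (incl K x) v,
          dlog n d' (inducedMoment K μ hN.equivariant) (incl K x) w⁆) := by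
  have hσ := contMDiff_smul hq hs
  have hM := contMDiff_inducedMoment (d' := d') hK hs hN.equivariant hN.smooth_moment
  have hincl := contMDiff_incl hq
  let θ := dlog n d' (inducedMoment K μ hN.equivariant) (incl K x)
  let τ := extDerivForm Ω (incl K x)
  let D : Set (TangentSpace (𝓡 d') (incl K x)) := Set.range (mfderiv (𝓡 d) (𝓡 d') (incl K) x)
  let X : Set (TangentSpace (𝓡 d') (incl K x)) :=
    Set.range fun ξ : GroupLieAlgebra (𝓡 n) G => generator ξ (incl K x)
  have key := eq_zero_of_alternating (D := D) (X := X)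
    (T := fun u v w => τ ![u, v, w] + 1 / 2 * B (θ u) ⁅θ v, θ w⁆) ?_ ?_ ?_ ?_ ?_ ?_ u v w
  · exact eq_neg_of_add_eq_zero_left key
  · intro a b v w
    rw [(alt_three τ).1, map_add, map_add, LinearMap.add_apply]
    ring
  · intro u v w
    rw [(alt_three τ).2.1, (apply_lie_alternating hB _ _ _).1]
    ring
  · intro u v w
    rw [(alt_three τ).2.2, (apply_lie_alternating hB _ _ _).2]
    ring
  · rintro _ ⟨ξ, rfl⟩ v w
    have := extDerivForm_generator_eq hB hσ hsm hΩ.invariant hM (inducedMoment_smul hN.equivariant)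
      (contraction hB hK hq hs hN hΩ) ξ (incl K x) v w
    exact add_eq_zero_iff_eq_neg.2 this
  · rintro _ ⟨a, rfl⟩ _ ⟨b, rfl⟩ _ ⟨c, rfl⟩
    have e1 := extDerivForm_pullback ((isSmoothForm_iff _).1 hsm _) (hincl x) ![a, b, c]
    have e0 : (fun j => (mfderiv (𝓡 d) (𝓡 d') (incl K) x
        ((![a, b, c] : Fin 3 → TangentSpace (𝓡 d) x) j))) =
        ![mfderiv (𝓡 d) (𝓡 d') (incl K) x a, mfderiv (𝓡 d) (𝓡 d') (incl K) x b,
          mfderiv (𝓡 d) (𝓡 d') (incl K) x c] := by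
      funext j; fin_cases j <;> rfl
    rw [e0, pullback_incl hΩ, hN.extDeriv_eq, cartanForm_restrictForm_eq hK hB] at e1
    have hdl := dlog_restrict hK (hM.mdifferentiable (by simp))
      (hN.smooth_moment.mdifferentiable (by simp)) (hincl.mdifferentiable (by simp))
      (inducedMoment_incl hN.equivariant) x
    change τ ![_, _, _] + 1 / 2 * B (θ _) ⁅θ _, θ _⁆ = 0
    rw [hdl, hdl, hdl]
    refine add_eq_zero_iff_eq_neg.2 (e1.symm.trans rfl)
  · intro u
    obtain ⟨ζ, hζ, v, h⟩ := exists_decomposition hB hK hN.contMDiff_smul hq hs x u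
    exact ⟨_, ⟨v, rfl⟩, _, ⟨ζ, rfl⟩, h⟩

/-- The induction of a q-Hamiltonian `K`-manifold is a q-Hamiltonian `G`-manifold. -/
theorem isQHamiltonian (hD : ∀ x, (μ x : G) ∈ stronglyStable G) :
    IsQHamiltonian B d' Ω (inducedMoment K μ hN.equivariant) := by
  have hσ := contMDiff_smul hq hs
  have hM := contMDiff_inducedMoment (d' := d') hK hs hN.equivariant hN.smooth_moment
  have hMd : MDifferentiable (𝓡 d') (𝓡 n) (inducedMoment K μ hN.equivariant) :=
    hM.mdifferentiable (by simp)
  have hsm := isSmoothForm hB hK hq hs hN hΩ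
  have hcon := contraction hB hK hq hs hN hΩ
  refine ⟨hσ, hsm, hM, hΩ.invariant, inducedMoment_smul hN.equivariant, fun y u v w => ?_,
    fun ξ y v => ?_, fun y v => ⟨fun h => ?_, ?_⟩⟩
  · obtain ⟨g, x, rfl⟩ := exists_eq_smul_incl y
    obtain ⟨u, rfl⟩ := mfderiv_smul_surjective hσ g (incl K x) u
    obtain ⟨v, rfl⟩ := mfderiv_smul_surjective hσ g (incl K x) v
    obtain ⟨w, rfl⟩ := mfderiv_smul_surjective hσ g (incl K x) w
    have e1 := extDerivForm_pullback (f := fun y : Induction K N => g • y)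
      ((isSmoothForm_iff _).1 hsm _) (contMDiff_smul_left hσ g (incl K x)) ![u, v, w]
    rw [hΩ.invariant, extDerivForm_incl hB hK hq hs hN hΩ hsm] at e1
    have e0 : (fun j => (mfderiv (𝓡 d') (𝓡 d') (fun y : Induction K N => g • y) (incl K x)
        ((![u, v, w] : Fin 3 → TangentSpace (𝓡 d') (incl K x)) j))) =
        ![mfderiv (𝓡 d') (𝓡 d') (fun y : Induction K N => g • y) (incl K x) u,
          mfderiv (𝓡 d') (𝓡 d') (fun y : Induction K N => g • y) (incl K x) v,
          mfderiv (𝓡 d') (𝓡 d') (fun y : Induction K N => g • y) (incl K x) w] := by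
      funext j; fin_cases j <;> rfl
    rw [e0] at e1
    rw [cartanForm_eq hB]
    refine e1.symm.trans (congrArg Neg.neg (congrArg (1 / 2 * ·) ?_))
    have hdl := dlog_smul hσ hMd (inducedMoment_smul hN.equivariant) g (incl K x)
    change _ = B (dlog n d' (inducedMoment K μ hN.equivariant) (g • incl K x) _)
      ⁅dlog n d' (inducedMoment K μ hN.equivariant) (g • incl K x) _,
        dlog n d' (inducedMoment K μ hN.equivariant) (g • incl K x) _⁆
    rw [hdl, hdl, hdl]
    have hl : ∀ a b : GroupLieAlgebra (𝓡 n) G, Ad n g ⁅a, b⁆ = ⁅Ad n g a, Ad n g b⁆ :=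
      AdE_lieBr g
    rw [← hl, hB.ad_invariant]
  · rw [thetaR_apply]
    exact hcon ξ y v
  · obtain ⟨g, x, rfl⟩ := exists_eq_smul_incl y
    obtain ⟨v, rfl⟩ := mfderiv_smul_surjective hσ g (incl K x) v
    obtain ⟨ξ, h1, rfl⟩ := exists_generator_of_kernel_incl hB hK hq hs hN hΩ (hD x) (w := v)
      fun w' => (invariant_apply hΩ.invariant g (incl K x) v w').symm.trans (h _)
    refine ⟨Ad n g ξ, ?_, (mfderiv_smul_generator hσ g ξ (incl K x)).symm⟩
    rw [inducedMoment_smul, inducedMoment_incl, ← Ad_mul_apply, inv_mul_cancel_right,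
      Ad_mul_apply, ← map_add, h1, map_zero]
  · rintro ⟨ξ, hξ, rfl⟩ w
    -- If `Ad ξ = -ξ`, invariance gives `⟨Ad z, ξ⟩ = -⟨z, ξ⟩`, so the two terms of the contraction
    -- cancel.
    rw [hcon, map_add, LinearMap.add_apply]
    have e1 := hB.ad_invariant (inducedMoment K μ hN.equivariant y)
      (dlog n d' (inducedMoment K μ hN.equivariant) y w) ξ
    rw [eq_neg_of_add_eq_zero_left hξ, map_neg] at e1
    linarith

end Induction

open Manifold

/-! ### The cross-section of the induction -/

section StronglyStable

variable {G : Type*} [TopologicalSpace G] [Group G] [IsTopologicalGroup G]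

lemma conj_mem_stronglyStable {a : G} (ha : a ∈ stronglyStable G) (g : G) :
    g * a * g⁻¹ ∈ stronglyStable G := by
  have h : (Subgroup.centralizer {g * a * g⁻¹} : Set G) =
      (fun c => g * c * g⁻¹) '' (Subgroup.centralizer {a} : Set G) := by
    ext c
    simp only [SetLike.mem_coe, Subgroup.mem_centralizer_singleton_iff, mem_image]
    constructor
    · intro hc
      refine ⟨g⁻¹ * c * g, ?_, by group⟩
      calc _ = g⁻¹ * (c * (g * a * g⁻¹)) * g := by group
        _ = _ := by rw [hc]; group
    · rintro ⟨c, hc, rfl⟩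
      calc _ = g * (c * a) * g⁻¹ := by group
        _ = _ := by rw [hc]; group
  change IsCompact (Subgroup.centralizer {g * a * g⁻¹} : Set G)
  rw [h]
  exact IsCompact.image ha (by fun_prop)

end StronglyStable

variable {n : ℕ} {G : Type*} [TopologicalSpace G] [T2Space G]
  [ChartedSpace (EuclideanSpace ℝ (Fin n)) G] [Group G] [LieGroup (𝓡 n) ∞ G]
  [ConnectedSpace G] [LieAlgebra.IsSemisimple ℝ (GroupLieAlgebra (𝓡 n) G)]
  {K : Subgroup G} {k : ℕ} [ChartedSpace (EuclideanSpace ℝ (Fin k)) K] [LieGroup (𝓡 k) ∞ K]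
  (hK : IsSmoothEmbedding (𝓡 k) (𝓡 n) ∞ (Subtype.val : K → G))
  [ChartedSpace (EuclideanSpace ℝ (Fin (n - k))) (G ⧸ K)] [IsManifold (𝓡 (n - k)) ∞ (G ⧸ K)]
  (hGK : IsSubmersion (𝓡 n) (𝓡 (n - k)) ∞ (QuotientGroup.mk : G → G ⧸ K))
  {B : LinearMap.BilinForm ℝ (GroupLieAlgebra (𝓡 n) G)} (hB : IsNormalizedForm k K B)

include hK hGK hB

/-- Generators in `𝔭` move the moment map transversally to `K`. -/
lemma mfderiv_quotient_moment_surjective {m : ℕ} {M : Type*} [TopologicalSpace M]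
    [ChartedSpace (EuclideanSpace ℝ (Fin m)) M] [IsManifold (𝓡 m) ∞ M] [MulAction G M] {μ : M → G}
    (hσ : ContMDiff ((𝓡 n).prod (𝓡 m)) (𝓡 m) ∞ (fun p : G × M => p.1 • p.2))
    (hμ : ContMDiff (𝓡 m) (𝓡 n) ∞ μ) (he : ∀ (g : G) (x : M), μ (g • x) = g * μ x * g⁻¹)
    {x : M} (hx : μ x ∈ stronglyStable G) (hxK : μ x ∈ K) : Function.Surjective
      (mfderiv (𝓡 m) (𝓡 (n - k)) (fun x : M => (QuotientGroup.mk (μ x) : G ⧸ K)) x) := by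
  intro b
  obtain ⟨u, hu⟩ := mfderiv_surjective_of_isSubmersionAt (hGK.isSubmersionAt (μ x)) b
  obtain ⟨p, hp, z, hz, hpz⟩ := hB.exists_add (thetaL (μ x) u)
  -- The differential of `G → G ⧸ K` sees only the `𝔭`-component, and every element of `𝔭` is `dlog`
  -- of a generator.
  obtain ⟨ζ, hζ, hζz⟩ := hB.exists_Ad_inv_sub hK hx hxK hz
  refine ⟨generator ζ x, (mfderiv_quotient_comp hGK hμ x _).trans (Eq.trans ?_ hu)⟩
  have h1 := (mfderiv_quotient_eq_zero_iff hK hGK (μ x)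
    (u - mfderiv (𝓡 m) (𝓡 n) μ x (generator ζ x))).2 (by
      have h2 := dlog_generator hσ (hμ.mdifferentiable (by simp)) he ζ x
      rw [map_sub]
      change thetaL (μ x) u - dlog n m μ x (generator ζ x) ∈ _
      rwa [h2, hζz, ← hpz, add_sub_cancel_right])
  rw [map_sub] at h1
  exact (sub_eq_zero.1 h1).symm

/-- The induction of a q-Hamiltonian `K`-manifold, and its cross-section. -/
theorem exists_diffeomorph_crossSection_induction [SecondCountableTopology G]
    (hmax : Maximal (fun H : Subgroup G => IsCompact (H : Set G)) K)
    {d : ℕ} {N : Type*} [TopologicalSpace N] [T2Space N] [SecondCountableTopology N]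
    [ChartedSpace (EuclideanSpace ℝ (Fin d)) N] [IsManifold (𝓡 d) ∞ N]
    [MulAction K N] (ωN : DiffForm d N 2) (μ : N → K)
    (hN : IsQHamiltonian (restrictForm k K B) d ωN μ)
    (hD : ∀ x, (μ x : G) ∈ stronglyStable G) :
    T2Space (Induction K N) ∧ SecondCountableTopology (Induction K N) ∧
    ProperSMul G (Induction K N) ∧
    (∀ y, inducedMoment K μ hN.equivariant y ∈ stronglyStable G) ∧
    ∃ (_ : ChartedSpace (EuclideanSpace ℝ (Fin (d + (n - k)))) (Induction K N))
      (_ : IsManifold (𝓡 (d + (n - k))) ∞ (Induction K N)),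
      Manifold.IsSubmersion ((𝓡 n).prod (𝓡 d)) (𝓡 (d + (n - k))) ∞
        (Induction.mk K : G × N → Induction K N) ∧
      IsRegularValue (d + (n - k)) (n - k) (fun y : Induction K N =>
        (QuotientGroup.mk (inducedMoment K μ hN.equivariant y) : G ⧸ K))
        (QuotientGroup.mk 1) ∧
      ∃ Ω : DiffForm (d + (n - k)) (Induction K N) 2,
        IsInducedForm K k B d ωN μ (d + (n - k)) Ω ∧
        ∃ hI : IsQHamiltonian B (d + (n - k)) Ω (inducedMoment K μ hN.equivariant),
          ∃ (_ : ChartedSpace (EuclideanSpace ℝ (Fin d))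
                  (crossSection K (inducedMoment K μ hN.equivariant) hI.equivariant))
            (_ : IsManifold (𝓡 d) ∞
                  (crossSection K (inducedMoment K μ hN.equivariant) hI.equivariant)),
            Manifold.IsSmoothEmbedding (𝓡 d) (𝓡 (d + (n - k))) ∞
              (Subtype.val :
                crossSection K (inducedMoment K μ hN.equivariant) hI.equivariant → _) ∧
            ∃ Ψ : Diffeomorph (𝓡 d) (𝓡 d) N
                (crossSection K (inducedMoment K μ hN.equivariant) hI.equivariant) ∞,
              (∀ x : N, (Ψ x : Induction K N) = Induction.mk K (1, x)) ∧
              (∀ (c : K) (x : N), Ψ (c • x) = c • Ψ x) ∧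
              pullback d d Ψ (pullback d (d + (n - k)) (Subtype.val :
                crossSection K (inducedMoment K μ hN.equivariant) hI.equivariant → _) Ω)
                = ωN ∧
              ∀ x, crossMoment K (inducedMoment K μ hN.equivariant) hI.equivariant (Ψ x)
                = μ x := by
  have : IsTopologicalGroup G := topologicalGroup_of_lieGroup (𝓡 n) ∞
  have : ContinuousSMul K N := ⟨hN.contMDiff_smul.continuous⟩
  have : CompactSpace K := isCompact_iff_compactSpace.1 hmax.1
  have hkn := le_dim hK
  -- The cross-section contains only points `[1, x]`: if `g μ(x) g⁻¹ ∈ K` then `g ∈ K`, and `g` can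
  -- be absorbed into `x`.
  have hmem : ∀ y, inducedMoment K μ hN.equivariant y ∈ K → ∃ x, Induction.incl K x = y := by
    intro y hy
    obtain ⟨g, x, rfl⟩ := Induction.exists_eq_smul_incl y
    rw [Induction.inducedMoment_smul, Induction.inducedMoment_incl] at hy
    have hg := hB.mem_of_conj_mem hK hmax (hD x) (μ x).2 hy
    exact ⟨(⟨g, hg⟩ : K) • x, Induction.mk_one_smul ⟨g, hg⟩ x⟩
  refine ⟨Induction.t2Space, Induction.secondCountableTopology, Induction.properSMul,
    fun y => ?_, ?_⟩
  · obtain ⟨g, x, rfl⟩ := Induction.exists_eq_smul_incl y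
    rw [Induction.inducedMoment_smul, Induction.inducedMoment_incl]
    exact conj_mem_stronglyStable (hD x) g
  obtain ⟨cs, man, hq, hs⟩ := Induction.exists_chartedSpace hK hGK hN.contMDiff_smul
    (d' := d + (n - k)) rfl
  obtain ⟨Ω, hΩ⟩ := Induction.exists_isInducedForm (d' := d + (n - k)) hB hK hq hs hN (by omega)
  have hI := Induction.isQHamiltonian hB hK hq hs hN hΩ hD
  have hreg : IsRegularValue (d + (n - k)) (n - k) (fun y : Induction K N =>
      (QuotientGroup.mk (inducedMoment K μ hN.equivariant y) : G ⧸ K)) (QuotientGroup.mk 1) := by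
    intro y hy
    obtain ⟨x, rfl⟩ := hmem y ((quotient_mk_eq_one_iff _).1 hy)
    have hx := Induction.inducedMoment_incl hN.equivariant x
    exact mfderiv_quotient_moment_surjective hK hGK hB hI.contMDiff_smul hI.smooth_moment
      hI.equivariant (by rw [hx]; exact hD x) (by rw [hx]; exact (μ x).2)
  obtain ⟨csS, manS, hi⟩ := exists_chartedSpace_crossSection hGK hI.smooth_moment hI.equivariant
    hreg (d := d) fun _ => by omega
  let Ψ : N → crossSection K (inducedMoment K μ hN.equivariant) hI.equivariant := fun x =>
    ⟨Induction.incl K x, by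
      change inducedMoment K μ hN.equivariant (Induction.incl K x) ∈ K
      rw [Induction.inducedMoment_incl]
      exact (μ x).2⟩
  have hincl := Induction.contMDiff_incl hq
  have hΨ : ContMDiff (𝓡 d) (𝓡 d) ∞ Ψ := contMDiff_of_comp_isSmoothEmbedding hi hincl
  have hval : MDifferentiable (𝓡 d) (𝓡 (d + (n - k))) (Subtype.val :
      crossSection K (inducedMoment K μ hN.equivariant) hI.equivariant → Induction K N) :=
    hi.isImmersion.contMDiff.mdifferentiable (by simp)
  have hΨd : MDifferentiable (𝓡 d) (𝓡 d) Ψ := hΨ.mdifferentiable (by simp)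
  have hbij : Function.Bijective Ψ := by
    refine ⟨fun x x' h => ?_, fun y => ?_⟩
    · obtain ⟨c, hc⟩ := Induction.mk_eq_mk_iff.1 (congrArg Subtype.val h)
      have h1 : (1 : G) = 1 * (c : G)⁻¹ := congrArg Prod.fst hc
      have h2 : x' = c • x := congrArg Prod.snd hc
      rw [one_mul, eq_comm, inv_eq_one] at h1
      have h3 : c = 1 := Subtype.ext h1
      rw [h2, h3, one_smul]
    · obtain ⟨x, hx⟩ := hmem y.1 y.2
      exact ⟨x, Subtype.ext hx⟩
  have hloc : IsLocalDiffeomorph (𝓡 d) (𝓡 d) ∞ Ψ := fun x => by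
    refine isLocalDiffeomorphAt_of_bijective hΨ ?_
    let T : EuclideanSpace ℝ (Fin d) →ₗ[ℝ] EuclideanSpace ℝ (Fin d) :=
      (mfderiv (𝓡 d) (𝓡 d) Ψ x).toLinearMap
    -- Followed by the inclusion, `Ψ` is `x ↦ [1, x]`, whose differential is injective by uniqueness
    -- in the decomposition of the tangent space.
    have hinj : Function.Injective T := by
      rw [injective_iff_map_eq_zero]
      intro v hv
      have e1 := mfderiv_comp_apply' (I := 𝓡 d) (h := Induction.incl K) (g := Subtype.val) (f := Ψ)
        (fun _ => rfl) x _ rfl (hval _) (hΨd x) v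
      have e2 : (mfderiv (𝓡 d) (𝓡 (d + (n - k))) (Induction.incl K) x v :
          EuclideanSpace ℝ (Fin (d + (n - k)))) = 0 :=
        e1.trans ((congrArg (mfderiv (𝓡 d) (𝓡 (d + (n - k))) Subtype.val (Ψ x)) hv).trans
          (map_zero (mfderiv (𝓡 d) (𝓡 (d + (n - k))) Subtype.val (Ψ x))))
      refine (Induction.eq_zero_of_decomposition hB hK hN.contMDiff_smul hq hs (by omega) x
        (zero_mem (lieOrth k K B)) (v := v) ?_).2
      have e4 : generator (n := n) (m := d + (n - k)) (0 : GroupLieAlgebra (𝓡 n) G)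
          (Induction.incl K x) = 0 :=
        map_zero (mfderiv (𝓡 n) (𝓡 (d + (n - k))) (fun g : G => g • Induction.incl K x) 1)
      rw [e4, add_zero]
      exact e2
    have hsur : Function.Surjective T := LinearMap.injective_iff_surjective.1 hinj
    exact ⟨hinj, hsur⟩
  refine ⟨cs, man, Induction.isSubmersion_mk hq hs (k := k) (by omega), hreg, Ω, hΩ, hI, csS, manS,
    hi, hloc.diffeomorphOfBijective hbij, fun x => rfl, fun c x => ?_, ?_, fun x => ?_⟩
  · exact Subtype.ext (Induction.mk_one_smul c x)
  · exact (pullback_comp hval hΨd Ω).symm.trans (Induction.pullback_incl hΩ)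
  · exact Subtype.ext (Induction.inducedMoment_incl hN.equivariant x)

end QHam

end

open QHam in
theorem propositionB6
    -- a connected semisimple Lie group `G`
    {n : ℕ} {G : Type*} [TopologicalSpace G] [T2Space G] [SecondCountableTopology G]
    [ChartedSpace (EuclideanSpace ℝ (Fin n)) G] [Group G] [LieGroup (𝓡 n) ∞ G]
    [ConnectedSpace G] [LieAlgebra.IsSemisimple ℝ (GroupLieAlgebra (𝓡 n) G)]
    -- a maximal compact subgroup `K`, with its structure of embedded Lie subgroup
    (K : Subgroup G) (hmax : Maximal (fun H : Subgroup G => IsCompact (H : Set G)) K)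
    {k : ℕ} [ChartedSpace (EuclideanSpace ℝ (Fin k)) K] [LieGroup (𝓡 k) ∞ K]
    (hK : Manifold.IsSmoothEmbedding (𝓡 k) (𝓡 n) ∞ (Subtype.val : K → G))
    -- the homogeneous space `G ⧸ K`, with the smooth structure for which `G → G ⧸ K` is a
    -- submersion
    [ChartedSpace (EuclideanSpace ℝ (Fin (n - k))) (G ⧸ K)] [IsManifold (𝓡 (n - k)) ∞ (G ⧸ K)]
    (hGK : Manifold.IsSubmersion (𝓡 n) (𝓡 (n - k)) ∞ (QuotientGroup.mk : G → G ⧸ K))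
    -- `G` and `K` have the same rank
    (hrank : LieAlgebra.rank ℝ (GroupLieAlgebra (𝓡 n) G) =
      LieAlgebra.rank ℝ (GroupLieAlgebra (𝓡 k) K))
    -- the normalized invariant form on the Lie algebra of `G`
    (B : LinearMap.BilinForm ℝ (GroupLieAlgebra (𝓡 n) G)) (hB : IsNormalizedForm k K B) :
    -- the cross-section of a q-Hamiltonian `G`-manifold `M` is a q-Hamiltonian `K`-manifold `N`,
    -- and `M` is the induction of `N`
    (∀ {m : ℕ} {M : Type*} [TopologicalSpace M] [T2Space M] [SecondCountableTopology M]
        [ChartedSpace (EuclideanSpace ℝ (Fin m)) M] [IsManifold (𝓡 m) ∞ M]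
        [MulAction G M] [ProperSMul G M] (ωM : DiffForm m M 2) (μ : M → G)
        (hM : IsQHamiltonian B m ωM μ),
        (∀ x, μ x ∈ stronglyStable G) →
        IsRegularValue m (n - k) (fun x : M => (QuotientGroup.mk (μ x) : G ⧸ K)) (QuotientGroup.mk 1) →
        ∃ (_ : ChartedSpace (EuclideanSpace ℝ (Fin (m - (n - k))))
                (crossSection K μ hM.equivariant))
          (_ : IsManifold (𝓡 (m - (n - k))) ∞ (crossSection K μ hM.equivariant)),
          Manifold.IsSmoothEmbedding (𝓡 (m - (n - k))) (𝓡 m) ∞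
            (Subtype.val : crossSection K μ hM.equivariant → M) ∧
          IsQHamiltonian (restrictForm k K B) (m - (n - k))
            (pullback (m - (n - k)) m (Subtype.val : crossSection K μ hM.equivariant → M) ωM)
            (crossMoment K μ hM.equivariant) ∧
          ∃ (_ : ChartedSpace (EuclideanSpace ℝ (Fin (m - (n - k) + (n - k))))
                  (Induction K (crossSection K μ hM.equivariant)))
            (_ : IsManifold (𝓡 (m - (n - k) + (n - k))) ∞
                  (Induction K (crossSection K μ hM.equivariant))),
            Manifold.IsSubmersion ((𝓡 n).prod (𝓡 (m - (n - k)))) (𝓡 (m - (n - k) + (n - k))) ∞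
              (Induction.mk K : G × crossSection K μ hM.equivariant → _) ∧
            ∃ Φ : Diffeomorph (𝓡 (m - (n - k) + (n - k))) (𝓡 m)
                (Induction K (crossSection K μ hM.equivariant)) M ∞,
              (∀ (g : G) (x : crossSection K μ hM.equivariant),
                Φ (Induction.mk K (g, x)) = g • (x : M)) ∧
              (∀ (g : G) (y : Induction K (crossSection K μ hM.equivariant)),
                Φ (g • y) = g • Φ y) ∧
              IsInducedForm K k B (m - (n - k))
                (pullback (m - (n - k)) m (Subtype.val : crossSection K μ hM.equivariant → M) ωM)
                (crossMoment K μ hM.equivariant) (m - (n - k) + (n - k)) (pullback (m - (n - k) + (n - k)) m Φ ωM) ∧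
              ∃ hN : ∀ (c : K) (x : crossSection K μ hM.equivariant),
                  crossMoment K μ hM.equivariant (c • x) =
                    c * crossMoment K μ hM.equivariant x * c⁻¹,
                ∀ y, μ (Φ y) = inducedMoment K (crossMoment K μ hM.equivariant) hN y) ∧
    -- the induction of a q-Hamiltonian `K`-manifold `N` is a q-Hamiltonian `G`-manifold as above,
    -- and its cross-section is `N`
    (∀ {d : ℕ} {N : Type*} [TopologicalSpace N] [T2Space N] [SecondCountableTopology N]
        [ChartedSpace (EuclideanSpace ℝ (Fin d)) N] [IsManifold (𝓡 d) ∞ N]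
        [MulAction K N] (ωN : DiffForm d N 2) (μ : N → K)
        (hN : IsQHamiltonian (restrictForm k K B) d ωN μ),
        (∀ x, (μ x : G) ∈ stronglyStable G) →
        T2Space (Induction K N) ∧ SecondCountableTopology (Induction K N) ∧
        ProperSMul G (Induction K N) ∧
        (∀ y, inducedMoment K μ hN.equivariant y ∈ stronglyStable G) ∧
        ∃ (_ : ChartedSpace (EuclideanSpace ℝ (Fin (d + (n - k)))) (Induction K N))
          (_ : IsManifold (𝓡 (d + (n - k))) ∞ (Induction K N)),
          Manifold.IsSubmersion ((𝓡 n).prod (𝓡 d)) (𝓡 (d + (n - k))) ∞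
            (Induction.mk K : G × N → Induction K N) ∧
          IsRegularValue (d + (n - k)) (n - k) (fun y : Induction K N =>
            (QuotientGroup.mk (inducedMoment K μ hN.equivariant y) : G ⧸ K))
            (QuotientGroup.mk 1) ∧
          ∃ Ω : DiffForm (d + (n - k)) (Induction K N) 2,
            IsInducedForm K k B d ωN μ (d + (n - k)) Ω ∧
            ∃ hI : IsQHamiltonian B (d + (n - k)) Ω (inducedMoment K μ hN.equivariant),
              ∃ (_ : ChartedSpace (EuclideanSpace ℝ (Fin d))
                      (crossSection K (inducedMoment K μ hN.equivariant) hI.equivariant))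
                (_ : IsManifold (𝓡 d) ∞
                      (crossSection K (inducedMoment K μ hN.equivariant) hI.equivariant)),
                Manifold.IsSmoothEmbedding (𝓡 d) (𝓡 (d + (n - k))) ∞
                  (Subtype.val :
                    crossSection K (inducedMoment K μ hN.equivariant) hI.equivariant → _) ∧
                ∃ Ψ : Diffeomorph (𝓡 d) (𝓡 d) N
                    (crossSection K (inducedMoment K μ hN.equivariant) hI.equivariant) ∞,
                  (∀ x : N, (Ψ x : Induction K N) = Induction.mk K (1, x)) ∧
                  (∀ (c : K) (x : N), Ψ (c • x) = c • Ψ x) ∧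
                  pullback d d Ψ (pullback d (d + (n - k)) (Subtype.val :
                    crossSection K (inducedMoment K μ hN.equivariant) hI.equivariant → _) Ω)
                    = ωN ∧
                  ∀ x, crossMoment K (inducedMoment K μ hN.equivariant) hI.equivariant (Ψ x)
                    = μ x) := by
  exact ⟨fun ωM μ hM hD hreg =>
      exists_induction_diffeomorph_crossSection hmax hK hGK hB ωM μ hM hD hreg,
    fun ωN μ hN hD =>
      exists_diffeomorph_crossSection_induction hK hGK hB hmax ωN μ hN hD⟩
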